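/- **Rank-1 extensions of the Frobenius manifolds $M^{cKP}$ and $M^{Toda}$.** *Rational case.* Let $m\ge 0$, let $n_0,\dots,n_m\ge 1$ be integers, and let $M=M^{cKP}$ be the space of rational functions $$\lambda(z)=\tfrac1{n_0}z^{n_0}+a_{0,n_0-2}z^{n_0-2}+\dots+a_{0,0}+\sum_{i=1}^m\sum_{j=1}^{n_i}a_{i,j}(z-a_{i,0})^{-j},$$ with $a_{i,n_i}\neq0$ and the $a_{i,0}$ distinct, with coordinates $a_{i,j}$. Put $\varrho(z)=1$ and $z(s)=s$; the finite poles are $\varphi_j=a_{j,0}$. *Trigonometric case.* Let $m\ge1$, $n_0,\dots,n_m\ge1$, and let $M=M^{Toda}$ be the space of functions, with $z=e^{\varphi}$, $$\lambda=\tfrac1{n_0}z^{n_0}+a_{0,n_0-1}z^{n_0-1}+\dots+a_{0,0}+\sum_{i=1}^m\sum_{j=1}^{n_i}a_{i,j}(z-a_{i,0})^{-j},$$ with $a_{1,0}=0$, $a_{i,n_i}\ne0$ and the $a_{i,0}$ distinct. Put $\varrho(z)=z$ and $z(s)=e^s$; again $\varphi_j=a_{j,0}$. In both cases $'$ denotes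 $d/dz$, tangent vectors act on $\lambda$ at fixed $z$, and $$\eta(X,Y)=\sum_{\lambda'(p)=0}\operatorname{Res}_{z=p}\frac{X\lambda\,Y\lambda}{\varrho^2\lambda'}dz,\qquad c(X,Y,Z)=\sum_{\lambda'(p)=0}\operatorname{Res}_{z=p}\frac{X\lambda\,Y\lambda\,Z\lambda}{\varrho^2\lambda'}dz,\qquad \eta(X\circ Y,Z)=c(X,Y,Z),$$ the sums being over the points $p\in\mathbb C$ that are not poles of $\lambda$. With $w_i=(n_i\lambda)^{1/n_i}$ near the pole $a_{i,0}$ and near $\infty$ for $i=0$ (with $w_0\sim z$), the coordinates $t^\alpha\in\mathbf t$ are as follows. For $M^{cKP}$ they are $t_{0,j}$ $(1\le j\le n_0-1)$ and $t_{i,j}$ $(1\le i\le m,\ 0\le j\le n_i)$, read off from $z=w_0-t_{0,1}w_0^{-1}-t_{0,2}w_0^{-2}-\cdots$ at $\infty$ and $z=t_{i,0}+t_{i,1}w_i^{-1}+\cdots$ at $a_{i,0}$. For $M^{Toda}$ they are indexed in the same way and read off from $\varphi=\log w_0-t_{0,1}w_0^{-1}-\cdots$ at $z=\infty$, $\varphi=-\log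 w_1+t_{1,0}+t_{1,1}w_1^{-1}+\cdots$ at $z=0$, and $\varphi=t_{i,0}+t_{i,1}w_i^{-1}+\cdots$ at $z=a_{i,0}$, $i\ge2$. Write $\partial_\alpha=\partial/\partial t^\alpha$. For tangent vectors $X,Y$ let $$H(X,Y)(z)=\Big(\frac{X\lambda\,Y\lambda}{\varrho\lambda'}\Big)_{\infty,\ge0}(z)+\sum_{j=1}^m\Big(\frac{X\lambda\,Y\lambda}{\varrho\lambda'}\Big)_{\varphi_j,\le-1}(z),$$ where $(f)_{\infty,\ge0}$ and $(f)_{p,\le-1}$ denote the parts of the Laurent expansions of $f$ at $\infty$ and at $p$ with nonnegative powers of $z$ and with negative powers of $z-p$, respectively. Then, in both cases: 1. Around every point of $M$ the functions $\mathbf t$ (for any choice of the roots and logarithms) are local holomorphic coordinates, and in them $\eta_{\alpha\beta}=\eta(\partial_\alpha,\partial_\beta)$ is a constant nondegenerate matrix. Let $c_{\alpha\beta}^\delta$ be defined by $\partial_\alpha\circ\partial_\beta=\sum_\delta c_{\alpha\beta}^\delta\partial_\delta$. 2. On every convex open set, in the coordinates $(\mathbf t,s)$, of points of a flat chart of $M$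 times $\mathbb C$ with $z(s)$ not a pole of $\lambda$, there is a holomorphic function $\Omega(\mathbf t,s)$ with $$\partial_s\partial_\alpha\Omega=\partial_\alpha\lambda(z),\qquad \partial_s^2\Omega=\varrho(z)\lambda'(z),\qquad \partial_\alpha\partial_\beta\Omega=H(\partial_\alpha,\partial_\beta)(z),\qquad z=z(s).$$ (Globally $\Omega$ is multivalued, but its second derivatives are single-valued.) 3. Every such $\Omega$, on any open set of such points, solves the open WDVV equations of $M$: for all $\alpha,\beta,\gamma$, $$c_{\alpha\beta}^{\delta}\partial_\delta\partial_\gamma\Omega+\partial_\alpha\partial_\beta\Omega\,\partial_\gamma\partial_s\Omega=c_{\beta\gamma}^{\delta}\partial_\delta\partial_\alpha\Omega+\partial_\beta\partial_\gamma\Omega\,\partial_\alpha\partial_s\Omega,\qquad c_{\alpha\beta}^{\delta}\partial_\delta\partial_s\Omega+\partial_\alpha\partial_\beta\Omega\,\partial_s^2\Omega=\partial_\alpha\partial_s\Omega\,\partial_\beta\partial_s\Omega.$$ 4. There is a flat F-manifold structure on $\{(\lambda,s)\in M\times\mathbb C:\ z(s)\text{ is not a pole of }\lambda\}$, i.e.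 a holomorphic flat torsion-free connection $\nabla$ and a holomorphic commutative associative product $\star$ on the tangent spaces, with a unit field $e$ satisfying $\nabla e=0$ and, locally, a vector potential $\Psi$ with $X\star Y=[X,[Y,\Psi]]$ for all flat $X,Y$. Its flat coordinates are $\mathbf t\cup\{s\}$, and $$(X,0)\star(Y,0)=(X\circ Y,\ H(X,Y)(z)\,\partial_s),\qquad (X,0)\star(0,\partial_s)=(0,\ X\lambda(z)\,\partial_s),\qquad (0,\partial_s)\star(0,\partial_s)=(0,\ \varrho(z)\lambda'(z)\,\partial_s),$$ with $z=z(s)$; in particular $(\partial_\alpha,0)\star(\partial_\beta,0)=(\partial_\alpha\circ\partial_\beta,\ \partial_\alpha\partial_\beta\Omega\,\partial_s)$. -/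

import Mathlib

open Filter Topology Set

noncomputable section

/-! ### Laurent coefficients, residues and truncations -/

/-- The coefficient of `(z - p) ^ k` in the Laurent expansion of `f` at `p`, as the contour integral
over small circles around `p` (these integrals do not depend on small `r` when `f` is meromorphic). -/
def laurentCoeff (f : ℂ → ℂ) (p : ℂ) (k : ℤ) : ℂ :=
  limUnder (𝓝[>] (0 : ℝ)) fun r =>
    (2 * Real.pi * Complex.I)⁻¹ * ∮ z in C(p, r), (z - p) ^ (-k - 1) * f z

/-- The coefficient of `z ^ k` in the Laurent expansion of `f` at `∞`. -/
def laurentCoeffInfty (f : ℂ → ℂ) (k : ℤ) : ℂ :=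
  limUnder (atTop : Filter ℝ) fun R =>
    (2 * Real.pi * Complex.I)⁻¹ * ∮ z in C(0, R), z ^ (-k - 1) * f z

/-- `Res_{z = p} f dz`. -/
def residue (f : ℂ → ℂ) (p : ℂ) : ℂ := laurentCoeff f p (-1)

/-- `(f)_{p, ≤ -1}`: the principal part of `f` at the point `p`, as a function of `s`. -/
def principalPart (f : ℂ → ℂ) (p s : ℂ) : ℂ :=
  ∑' k : ℕ, laurentCoeff f p (-((k : ℤ) + 1)) * (s - p) ^ (-((k : ℤ) + 1))

/-- `(f)_{∞, ≥ 0}`: the part of the expansion of `f` at `∞` with nonnegative powers. -/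
def inftyPart (f : ℂ → ℂ) (s : ℂ) : ℂ :=
  ∑' k : ℕ, laurentCoeffInfty f (k : ℤ) * s ^ k

/-- Second derivative `∂_x ∂_y g` at `p` along constant vectors `x`, `y`. -/
def secondDeriv {E F : Type*} [NormedAddCommGroup E] [NormedSpace ℂ E]
    [NormedAddCommGroup F] [NormedSpace ℂ F] (g : E → F) (p x y : E) : F :=
  fderiv ℂ (fun q => fderiv ℂ g q y) p x

/-! ### Flat F-manifolds -/

/-- `X` is flat on `V` for the connection `∇_x Y = D_x Y + Γ (x, Y)`. -/
def IsFlatField {E : Type*} [NormedAddCommGroup E] [NormedSpace ℂ E]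
    (Γ : E → E →L[ℂ] E →L[ℂ] E) (V : Set E) (X : E → E) : Prop :=
  AnalyticOnNhd ℂ X V ∧ ∀ p ∈ V, ∀ v, fderiv ℂ X p v + Γ p v (X p) = 0

/-- A flat F-manifold structure on an open subset `D` of a complex vector space.  The connection is
`∇_x Y = D_x Y + conn (x, Y)`.  As usual the vector potential is a locally defined vector field. -/
structure FlatFManifold {E : Type*} [NormedAddCommGroup E] [NormedSpace ℂ E] (D : Set E) where
  conn : E → E →L[ℂ] E →L[ℂ] E
  mul : E → E →L[ℂ] E →L[ℂ] E
  unit : E → E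
  isOpen : IsOpen D
  conn_analytic : AnalyticOnNhd ℂ conn D
  mul_analytic : AnalyticOnNhd ℂ mul D
  unit_analytic : AnalyticOnNhd ℂ unit D
  torsion_free : ∀ p ∈ D, ∀ x y, conn p x y = conn p y x
  curvature_zero : ∀ p ∈ D, ∀ x y z,
    fderiv ℂ conn p x y z - fderiv ℂ conn p y x z
      + conn p x (conn p y z) - conn p y (conn p x z) = 0
  mul_comm : ∀ p ∈ D, ∀ x y, mul p x y = mul p y x
  mul_assoc : ∀ p ∈ D, ∀ x y z, mul p (mul p x y) z = mul p x (mul p y z)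
  unit_mul : ∀ p ∈ D, ∀ x, mul p (unit p) x = x
  unit_flat : IsFlatField conn D unit
  vector_potential : ∀ p ∈ D, ∃ U : Set E, IsOpen U ∧ p ∈ U ∧ U ⊆ D ∧ ∃ Ψ : E → E,
    AnalyticOnNhd ℂ Ψ U ∧ ∀ V ⊆ U, IsOpen V → ∀ X Y : E → E,
      IsFlatField conn V X → IsFlatField conn V Y → ∀ q ∈ V,
        mul q (X q) (Y q) =
          VectorField.lieBracket ℂ X (VectorField.lieBracket ℂ Y Ψ) q

/-! ### Spaces of superpotentials -/

/-- Bookkeeping for a space of superpotentials: `κ` indexes the coordinates `a` given by the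
coefficients, `ι` indexes the flat coordinates `t`. -/
structure LGModel (κ ι : Type) where
  /-- the space `M`, in the coefficient coordinates -/
  carrier : Set (κ → ℂ)
  /-- the superpotential `λ_a (z)` -/
  lam : (κ → ℂ) → ℂ → ℂ
  /-- the finite poles of `λ_a` -/
  poles : (κ → ℂ) → Finset ℂ
  /-- the primary differential is `dz / rho z` -/
  rho : ℂ → ℂ
  /-- the value of `z` at the coordinate `s` of the extra factor `ℂ` -/
  zOf : ℂ → ℂ
  /-- `t` is the system of values of the flat coordinates at `a` (for some choice of the roots
  and logarithms that occur in them) -/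
  IsFlatCoord : (κ → ℂ) → (ι → ℂ) → Prop

namespace LGModel

variable {κ ι : Type} [Fintype κ] [Fintype ι] [DecidableEq ι]

/-- `∂_X λ (z)`, the derivative at fixed `z` in the direction of the tangent vector `X`. -/
def dlam (L : LGModel κ ι) (a X : κ → ℂ) (z : ℂ) : ℂ :=
  fderiv ℂ (fun a' => L.lam a' z) a X

/-- The finite points with `dλ = 0`, `|λ| < ∞`. -/
def crit (L : LGModel κ ι) (a : κ → ℂ) : Set ℂ :=
  {z | z ∉ L.poles a ∧ deriv (L.lam a) z = 0}

/-- The metric `η`. -/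
def metric (L : LGModel κ ι) (a X Y : κ → ℂ) : ℂ :=
  ∑ᶠ p ∈ L.crit a, residue
    (fun z => L.dlam a X z * L.dlam a Y z / (L.rho z ^ 2 * deriv (L.lam a) z)) p

/-- The `(0,3)`-tensor `c`. -/
def cubic (L : LGModel κ ι) (a X Y Z : κ → ℂ) : ℂ :=
  ∑ᶠ p ∈ L.crit a, residue
    (fun z => L.dlam a X z * L.dlam a Y z * L.dlam a Z z /
      (L.rho z ^ 2 * deriv (L.lam a) z)) p

/-- `Z = X ∘ Y`, that is `η (Z, W) = c (X, Y, W)` for all `W`. -/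
def IsProd (L : LGModel κ ι) (a X Y Z : κ → ℂ) : Prop :=
  ∀ W, L.metric a Z W = L.cubic a X Y W

/-- `(f)_{∞, ≥ 0} + ∑_j (f)_{p_j, ≤ -1}` at `z`, where `f = ∂_X λ ∂_Y λ / (rho λ')` and the `p_j` are
the finite poles of `λ`. -/
def hess (L : LGModel κ ι) (a X Y : κ → ℂ) (z : ℂ) : ℂ :=
  inftyPart (fun w => L.dlam a X w * L.dlam a Y w / (L.rho w * deriv (L.lam a) w)) z +
    ∑ p ∈ L.poles a, principalPart
      (fun w => L.dlam a X w * L.dlam a Y w / (L.rho w * deriv (L.lam a) w)) p z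

/-- A flat chart of `M`, written as a local parametrisation `t ↦ a t` by the flat coordinates. -/
def IsFlatChart (L : LGModel κ ι) (W : Set (ι → ℂ)) (a : (ι → ℂ) → κ → ℂ) : Prop :=
  IsOpen W ∧ AnalyticOnNhd ℂ a W ∧ ∀ t ∈ W, a t ∈ L.carrier ∧ L.IsFlatCoord (a t) t

/-- The coordinate vector field `∂_α = ∂ / ∂ t^α` of a flat chart. -/
def frame (a : (ι → ℂ) → κ → ℂ) (t : ι → ℂ) (α : ι) : κ → ℂ :=
  fderiv ℂ a t (Pi.single α 1)

/-- `η_{αβ}` in a flat chart. -/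
def gram (L : LGModel κ ι) (a : (ι → ℂ) → κ → ℂ) (t : ι → ℂ) : Matrix ι ι ℂ :=
  Matrix.of fun α β => L.metric (a t) (frame a t α) (frame a t β)

/-- `c_{αβ}^δ = η^{δε} c_{εαβ}` in a flat chart. -/
def structConst (L : LGModel κ ι) (a : (ι → ℂ) → κ → ℂ) (t : ι → ℂ) (α β δ : ι) : ℂ :=
  ∑ ε, (L.gram a t)⁻¹ δ ε * L.cubic (a t) (frame a t ε) (frame a t α) (frame a t β)

/-- The part of `M × ℂ` where `λ` is finite, in the coordinates `(a, s)`. -/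
def extDomain (L : LGModel κ ι) : Set ((κ → ℂ) × ℂ) :=
  {q | q.1 ∈ L.carrier ∧ L.zOf q.2 ∉ L.poles q.1}

/-- The part of `W × ℂ` where `λ` is finite, in the coordinates `(t, s)` of a flat chart. -/
def chartDomain (L : LGModel κ ι) (W : Set (ι → ℂ)) (a : (ι → ℂ) → κ → ℂ) :
    Set ((ι → ℂ) × ℂ) :=
  {q | q.1 ∈ W ∧ L.zOf q.2 ∉ L.poles (a q.1)}

/-- The vector `∂_α` in the coordinates `(t, s)`. -/
def dt (α : ι) : (ι → ℂ) × ℂ := (Pi.single α 1, 0)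

/-- The vector `∂_s` in the coordinates `(t, s)`. -/
def ds : (ι → ℂ) × ℂ := (0, 1)

/-- `Ω` has on `U` the prescribed second derivatives: with `z = zOf s`,
`∂_s ∂_α Ω = ∂_α λ (z)`, `∂_s² Ω = rho (z) λ' (z)`, and `∂_α ∂_β Ω` is given by `hess`. -/
def IsOpenPotential (L : LGModel κ ι) (a : (ι → ℂ) → κ → ℂ) (U : Set ((ι → ℂ) × ℂ))
    (Ω : (ι → ℂ) × ℂ → ℂ) : Prop :=
  AnalyticOnNhd ℂ Ω U ∧ ∀ q ∈ U,
    (∀ α, secondDeriv Ω q ds (dt α) = L.dlam (a q.1) (frame a q.1 α) (L.zOf q.2)) ∧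
    secondDeriv Ω q ds ds = L.rho (L.zOf q.2) * deriv (L.lam (a q.1)) (L.zOf q.2) ∧
    ∀ α β, secondDeriv Ω q (dt α) (dt β) =
      L.hess (a q.1) (frame a q.1 α) (frame a q.1 β) (L.zOf q.2)

/-- The open WDVV equations of `M` for a function `Ω (t, s)` on `U`. -/
def OpenWDVV (L : LGModel κ ι) (a : (ι → ℂ) → κ → ℂ) (U : Set ((ι → ℂ) × ℂ))
    (Ω : (ι → ℂ) × ℂ → ℂ) : Prop :=
  ∀ q ∈ U,
    (∀ α β γ,
      ∑ δ, L.structConst a q.1 α β δ * secondDeriv Ω q (dt δ) (dt γ)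
          + secondDeriv Ω q (dt α) (dt β) * secondDeriv Ω q (dt γ) ds =
        ∑ δ, L.structConst a q.1 β γ δ * secondDeriv Ω q (dt δ) (dt α)
          + secondDeriv Ω q (dt β) (dt γ) * secondDeriv Ω q (dt α) ds) ∧
    ∀ α β,
      ∑ δ, L.structConst a q.1 α β δ * secondDeriv Ω q (dt δ) ds
          + secondDeriv Ω q (dt α) (dt β) * secondDeriv Ω q ds ds =
        secondDeriv Ω q (dt α) ds * secondDeriv Ω q (dt β) ds

/-- The natural rank-1 extension of the Frobenius manifold `M` of superpotentials. -/
structure HasRankOneExtension (L : LGModel κ ι) : Prop where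
  /-- Flat charts are local biholomorphisms that cover `M`, and in all of them `η_{αβ}` is the same
  constant nondegenerate matrix. -/
  flat_cover : ∀ a₀ ∈ L.carrier, ∃ W a, L.IsFlatChart W a ∧ ∃ t₀ ∈ W, a t₀ = a₀
  flat_local_iso : ∀ W a, L.IsFlatChart W a → ∀ t ∈ W, Function.Bijective (fderiv ℂ a t)
  flat_metric : ∃ η₀ : Matrix ι ι ℂ, η₀.det ≠ 0 ∧
    ∀ W a, L.IsFlatChart W a → ∀ t ∈ W, L.gram a t = η₀
  /-- `Ω` exists on every convex open part of a flat chart. -/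
  potential_exists : ∀ W a, L.IsFlatChart W a → ∀ U ⊆ L.chartDomain W a,
    IsOpen U → Convex ℝ U → ∃ Ω, L.IsOpenPotential a U Ω
  /-- Every such `Ω`, on any open set, solves the open WDVV equations of `M`. -/
  potential_solves : ∀ W a, L.IsFlatChart W a → ∀ U ⊆ L.chartDomain W a,
    IsOpen U → ∀ Ω, L.IsOpenPotential a U Ω → L.OpenWDVV a U Ω
  /-- There is a flat F-manifold structure on `M × ℂ` (off the poles of `λ`) with flat coordinates
  `t`, `s` and with the multiplication
  `(X, 0) ⋆ (Y, 0) = (X ∘ Y, H (X, Y) ∂_s)`, `(X, 0) ⋆ (0, ∂_s) = (0, ∂_X λ ∂_s)`,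
  `(0, ∂_s) ⋆ (0, ∂_s) = (0, rho λ' ∂_s)`, where `H (∂_α, ∂_β) = ∂_α ∂_β Ω`. -/
  flat_F_manifold : ∃ S : FlatFManifold L.extDomain,
    (∀ W a, L.IsFlatChart W a → ∀ q ∈ L.chartDomain W a, ∀ x y : (ι → ℂ) × ℂ,
      secondDeriv (fun r : (ι → ℂ) × ℂ => (a r.1, r.2)) q x y
        + S.conn (a q.1, q.2) (fderiv ℂ (fun r : (ι → ℂ) × ℂ => (a r.1, r.2)) q x)
            (fderiv ℂ (fun r : (ι → ℂ) × ℂ => (a r.1, r.2)) q y) = 0) ∧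
    ∀ a s, (a, s) ∈ L.extDomain →
      (∀ X Y, ∃ Z, L.IsProd a X Y Z ∧
        S.mul (a, s) (X, 0) (Y, 0) = (Z, L.hess a X Y (L.zOf s))) ∧
      (∀ X, S.mul (a, s) (X, 0) (0, 1) = (0, L.dlam a X (L.zOf s))) ∧
      S.mul (a, s) (0, 1) (0, 1) = (0, L.rho (L.zOf s) * deriv (L.lam a) (L.zOf s))

end LGModel

/-! ### Rational superpotentials -/

/-- `Sum.inl j` is the index of `a_{0,j}` (or of `t_{0,j+1}`), `Sum.inr ⟨i, j⟩` that of `a_{i+1,j}`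
(or of `t_{i+1,j}`), `0 ≤ j ≤ n_{i+1}`. -/
abbrev CKPIdx (n₀ : ℕ) {m : ℕ} (n : Fin m → ℕ) : Type :=
  Fin (n₀ - 1) ⊕ ((i : Fin m) × Fin (n i + 1))

def cKPLam (n₀ : ℕ) {m : ℕ} (n : Fin m → ℕ) (a : CKPIdx n₀ n → ℂ) (z : ℂ) : ℂ :=
  z ^ n₀ / n₀ + ∑ j : Fin (n₀ - 1), a (Sum.inl j) * z ^ (j : ℕ)
    + ∑ i, ∑ j : Fin (n i), a (Sum.inr ⟨i, j.succ⟩) / (z - a (Sum.inr ⟨i, 0⟩)) ^ ((j : ℕ) + 1)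

/-- The flat coordinates are read off from the expansions
`z = w₀ - t_{0,1} w₀⁻¹ - t_{0,2} w₀⁻² - ⋯` at `∞`, where `w₀ = (n₀ λ)^{1/n₀} = z + ⋯`, and
`z = t_{i,0} + t_{i,1} w_i⁻¹ + ⋯` at `a_{i,0}`, where `w_i = (n_i λ)^{1/n_i}`; here `u = w_i⁻¹`. -/
def cKPIsFlatCoord (n₀ : ℕ) {m : ℕ} (n : Fin m → ℕ) (a t : CKPIdx n₀ n → ℂ) : Prop :=
  (∃ w : ℂ → ℂ,
    (∀ᶠ z in Bornology.cobounded ℂ, w z ^ n₀ = n₀ * cKPLam n₀ n a z) ∧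
    Tendsto (fun z => w z / z) (Bornology.cobounded ℂ) (𝓝 1) ∧
    (fun z => z - (w z - ∑ j : Fin (n₀ - 1), t (Sum.inl j) / w z ^ ((j : ℕ) + 1)))
      =O[Bornology.cobounded ℂ] fun z => (z ^ n₀)⁻¹) ∧
  ∀ i, ∃ u : ℂ → ℂ, AnalyticAt ℂ u (a (Sum.inr ⟨i, 0⟩)) ∧
    (∀ᶠ z in 𝓝[≠] (a (Sum.inr ⟨i, 0⟩)), u z ^ n i * (n i * cKPLam n₀ n a z) = 1) ∧
    (fun z => z - ∑ j : Fin (n i + 1), t (Sum.inr ⟨i, j⟩) * u z ^ (j : ℕ))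
      =O[𝓝[≠] (a (Sum.inr ⟨i, 0⟩))] fun z => (z - a (Sum.inr ⟨i, 0⟩)) ^ (n i + 1)

/-- The space `M^{cKP}` with poles of orders `n₀` at `∞` and `n i` at the points `a_{i+1,0}`. -/
def cKP (n₀ : ℕ) {m : ℕ} (n : Fin m → ℕ) : LGModel (CKPIdx n₀ n) (CKPIdx n₀ n) where
  carrier := {a | (Function.Injective fun i : Fin m => a (Sum.inr ⟨i, 0⟩)) ∧
    ∀ i, a (Sum.inr ⟨i, Fin.last (n i)⟩) ≠ 0}
  lam := cKPLam n₀ n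
  poles := fun a => Finset.univ.image fun i : Fin m => a (Sum.inr ⟨i, 0⟩)
  rho := fun _ => 1
  zOf := fun s => s
  IsFlatCoord := cKPIsFlatCoord n₀ n

/-! ### Trigonometric superpotentials -/

/-- `Sum.inl j` is the index of `a_{0,j}`, `Sum.inr (Sum.inl j)` that of `a_{1,j+1}`, and
`Sum.inr (Sum.inr ⟨i, j⟩)` that of `a_{i+2,j}`, `0 ≤ j ≤ n_{i+2}`. -/
abbrev TodaIdx (n₀ n₁ : ℕ) {k : ℕ} (n : Fin k → ℕ) : Type :=
  Fin n₀ ⊕ Fin n₁ ⊕ ((i : Fin k) × Fin (n i + 1))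

/-- `Sum.inl j` is the index of `t_{0,j+1}`, `Sum.inr (Sum.inl j)` that of `t_{1,j}`, and
`Sum.inr (Sum.inr ⟨i, j⟩)` that of `t_{i+2,j}`. -/
abbrev TodaFlatIdx (n₀ n₁ : ℕ) {k : ℕ} (n : Fin k → ℕ) : Type :=
  Fin (n₀ - 1) ⊕ Fin (n₁ + 1) ⊕ ((i : Fin k) × Fin (n i + 1))

/-- The superpotential as a function of `z = exp φ`. -/
def todaLam (n₀ n₁ : ℕ) {k : ℕ} (n : Fin k → ℕ) (a : TodaIdx n₀ n₁ n → ℂ) (z : ℂ) : ℂ :=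
  z ^ n₀ / n₀ + ∑ j : Fin n₀, a (Sum.inl j) * z ^ (j : ℕ)
    + ∑ j : Fin n₁, a (Sum.inr (Sum.inl j)) / z ^ ((j : ℕ) + 1)
    + ∑ i, ∑ j : Fin (n i), a (Sum.inr (Sum.inr ⟨i, j.succ⟩)) /
        (z - a (Sum.inr (Sum.inr ⟨i, 0⟩))) ^ ((j : ℕ) + 1)

/-- The flat coordinates are read off from the expansions of `φ = log z`:
`φ = log w₀ - t_{0,1} w₀⁻¹ - ⋯` at `∞` (here `g = φ - log w₀`),
`φ = - log w₁ + t_{1,0} + t_{1,1} w₁⁻¹ + ⋯` at `z = 0` (here `g = φ + log w₁`, `u = w₁⁻¹`), and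
`φ = t_{i,0} + t_{i,1} w_i⁻¹ + ⋯` at `a_{i,0}`, `i ≥ 2` (here `u = w_i⁻¹`),
where `w_i = (n_i λ)^{1/n_i}`. -/
def todaIsFlatCoord (n₀ n₁ : ℕ) {k : ℕ} (n : Fin k → ℕ) (a : TodaIdx n₀ n₁ n → ℂ)
    (t : TodaFlatIdx n₀ n₁ n → ℂ) : Prop :=
  (∃ w g : ℂ → ℂ,
    (∀ᶠ z in Bornology.cobounded ℂ, w z ^ n₀ = n₀ * todaLam n₀ n₁ n a z) ∧
    Tendsto (fun z => w z / z) (Bornology.cobounded ℂ) (𝓝 1) ∧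
    (∀ᶠ z in Bornology.cobounded ℂ, z = w z * Complex.exp (g z)) ∧
    (fun z => g z + ∑ j : Fin (n₀ - 1), t (Sum.inl j) / w z ^ ((j : ℕ) + 1))
      =O[Bornology.cobounded ℂ] fun z => (z ^ n₀)⁻¹) ∧
  (∃ u g : ℂ → ℂ, AnalyticAt ℂ u 0 ∧ AnalyticAt ℂ g 0 ∧
    (∀ᶠ z in 𝓝[≠] (0 : ℂ), u z ^ n₁ * (n₁ * todaLam n₀ n₁ n a z) = 1) ∧
    (∀ᶠ z in 𝓝[≠] (0 : ℂ), z = u z * Complex.exp (g z)) ∧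
    (fun z => g z - ∑ j : Fin (n₁ + 1), t (Sum.inr (Sum.inl j)) * u z ^ (j : ℕ))
      =O[𝓝[≠] (0 : ℂ)] fun z => z ^ (n₁ + 1)) ∧
  ∀ i, ∃ u φ : ℂ → ℂ, AnalyticAt ℂ u (a (Sum.inr (Sum.inr ⟨i, 0⟩))) ∧
    AnalyticAt ℂ φ (a (Sum.inr (Sum.inr ⟨i, 0⟩))) ∧
    (∀ᶠ z in 𝓝[≠] (a (Sum.inr (Sum.inr ⟨i, 0⟩))),
      u z ^ n i * (n i * todaLam n₀ n₁ n a z) = 1) ∧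
    (∀ᶠ z in 𝓝[≠] (a (Sum.inr (Sum.inr ⟨i, 0⟩))), Complex.exp (φ z) = z) ∧
    (fun z => φ z - ∑ j : Fin (n i + 1), t (Sum.inr (Sum.inr ⟨i, j⟩)) * u z ^ (j : ℕ))
      =O[𝓝[≠] (a (Sum.inr (Sum.inr ⟨i, 0⟩)))]
        fun z => (z - a (Sum.inr (Sum.inr ⟨i, 0⟩))) ^ (n i + 1)

/-- The space `M^{Toda}` with poles of orders `n₀` at `z = ∞`, `n₁` at `z = 0`, and `n i` at the
points `z = a_{i+2,0} ≠ 0`.  The primary differential is `dφ = dz / z`, and `z = exp s`. -/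
def toda (n₀ n₁ : ℕ) {k : ℕ} (n : Fin k → ℕ) :
    LGModel (TodaIdx n₀ n₁ n) (TodaFlatIdx n₀ n₁ n) where
  carrier := {a | (Function.Injective fun i : Fin k => a (Sum.inr (Sum.inr ⟨i, 0⟩))) ∧
    (∀ i, a (Sum.inr (Sum.inr ⟨i, 0⟩)) ≠ 0) ∧
    (∀ j : Fin n₁, (j : ℕ) + 1 = n₁ → a (Sum.inr (Sum.inl j)) ≠ 0) ∧
    ∀ i, a (Sum.inr (Sum.inr ⟨i, Fin.last (n i)⟩)) ≠ 0}
  lam := todaLam n₀ n₁ n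
  poles := fun a => insert 0 (Finset.univ.image fun i : Fin k => a (Sum.inr (Sum.inr ⟨i, 0⟩)))
  rho := fun z => z
  zOf := Complex.exp
  IsFlatCoord := todaIsFlatCoord n₀ n₁ n

end

/-!
The superpotential `λ` is encoded by germs `Y` of holomorphic maps at `u = 0`, one for each pole:
the expansion of `z` (of `1 / z` at infinity) in the local parameter `u = w⁻¹`. The flat coordinates
are the coefficients of `z` or of `log z` in these expansions, so that along a flat coordinate only
one germ moves, and it moves by `u ^ k` times a function of `Y`. Comparing expansions at the poles
shows that the polar part of `λ` is `-[u ^ n] log (1 - (Y - Y 0) X)` with `X = 1 / (z - Y 0)`, or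
`X = z` at infinity (`logPoly`), that the flat coordinates determine `λ`, and that all admissible
values occur; this is done for `HasPole` and yields `CKP.poleSystem` and `Toda.poleSystem`. It
follows that `∂_α λ` and `ρ λ'` are `ρ` times combinations of Taylor coefficients in `u` of the
kernels `1 / (z - Y)` and `Y / (1 - z Y)` (`PoleSystem.dlamExt_eq`).

The behaviour of these coefficients near the poles gives the principal parts of `∂_α λ ∂_β λ / λ'`.
They are again coefficients of kernels, which computes `H` (`IsPoleGerms.sum_principalPart`), and by
the residue theorem the metric is a constant pairing of the coordinates at each pole
(`IsPoleGerms.sum_residue_crit`). A function that is holomorphic off the poles and whose quotient by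
`λ'` is bounded at the finite poles and tends to zero at infinity is a combination of the
`∂_α λ / ρ`, since both spaces have the same dimension (`IsPoleGerms.exists_flatCombo_eq`). Applied
to `∂_X λ ∂_Y λ / ρ - λ' H (X, Y)` this yields the division identity
`∂_X λ ∂_Y λ = ∂_{X ∘ Y} λ + ρ λ' H (X, Y)` (`IsPoleGerms.exists_division`).

The division identity says that for the extended product on `M × ℂ` the differential of `λ (z (s))`,
as a function of the tangent vector, is multiplicative at every `z` (`dlamExt_mulExt`). As no
nonzero tangent vector of `M` is killed by it for all `z`, the product is associative and has a
unit. The open WDVV equations are the component of associativity along `∂_s` and the division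
identity (`openWDVV`). The tensor of the extended product is closed in the flat coordinates
(`mHat_closed`): the components along `∂_s` by the symmetries of the derivatives of `H` and `dλ`,
the others because `dλ` detects them, by differentiating its multiplicativity and the associativity.
On convex sets the Poincaré lemma provides `Ω` (`exists_hessian_potential`), and locally it turns
the closed product into a vector potential (`exists_flatFManifold`).
-/

set_option linter.unusedSectionVars false

noncomputable section

section

/-! ### Primitives of closed analytic forms -/

/-- A function with an analytic differential is analytic: its power series is the term-by-term
primitive of the power series of the differential, as one sees on complex lines through `x`. -/
theorem analyticAt_of_hasFDerivAt {E F : Type*} [NormedAddCommGroup E] [NormedSpace ℂ E]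
    [NormedAddCommGroup F] [NormedSpace ℂ F] [CompleteSpace F] {f : E → F} {ω : E → E →L[ℂ] F}
    {x : E} (hω : AnalyticAt ℂ ω x) (h : ∀ᶠ y in 𝓝 x, HasFDerivAt f (ω y) y) :
    AnalyticAt ℂ f x := by
  obtain ⟨p, r, hp⟩ := hω
  obtain ⟨ε, hε, hball⟩ := EMetric.mem_nhds_iff.1 h
  obtain ⟨r', hr'0, hr'⟩ := ENNReal.lt_iff_exists_nnreal_btwn.1 (lt_min hp.r_pos hε)
  have hsum := p.summable_norm_mul_pow ((hr'.trans_le (min_le_left _ _)).trans_le hp.r_le)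
  replace hp := hp.mono hr'0 (hr'.le.trans (min_le_left _ _))
  let q : FormalMultilinearSeries ℂ E F := fun n => match n with
    | 0 => ContinuousMultilinearMap.uncurry0 ℂ E (f x)
    | n + 1 => ((n + 1 : ℕ) : ℂ)⁻¹ • (p n).uncurryRight
  refine ⟨q, r', q.le_radius_of_summable ?_, hr'0, fun {y} hy => ?_⟩
  · rw [← summable_nat_add_iff 1]
    refine .of_nonneg_of_le (fun n => by positivity) (fun n => ?_) (hsum.mul_right (r' : ℝ))
    rw [pow_succ, ← mul_assoc]
    gcongr
    rw [norm_smul, ContinuousMultilinearMap.uncurryRight_norm, norm_inv, Complex.norm_natCast]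
    exact mul_le_of_le_one_left (norm_nonneg (p n)) (Nat.cast_inv_le_one _)
  · -- the expansion of `f` along the complex line through `x` in the direction `y`
    have hmem : ∀ {s : ℂ}, ‖s‖ * ‖y‖ < r' → s • y ∈ Metric.eball (0 : E) r' := fun {s} hs => by
      rwa [mem_eball_zero_iff, ← ofReal_norm, norm_smul, ENNReal.ofReal_lt_coe_iff (by positivity)]
    have hd : ∀ {s : ℂ}, ‖s‖ * ‖y‖ < r' →
        HasDerivAt (fun s : ℂ => f (x + s • y)) (ω (x + s • y) y) s := fun {s} hs => by
      refine HasFDerivAt.comp_hasDerivAt (l := f) s (hball ?_)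
        (by simpa using ((hasDerivAt_id s).smul_const y).const_add x)
      rw [Metric.mem_eball, edist_eq_enorm_sub, add_sub_cancel_left]
      exact (mem_eball_zero_iff.1 (hmem hs)).trans (hr'.trans_le (min_le_right _ _))
    have hser : ∀ {s : ℂ}, ‖s‖ * ‖y‖ < r' →
        HasSum (fun n => s ^ n • p n (fun _ => y) y) (ω (x + s • y) y) := fun {s} hs => by
      simpa [Function.comp_def, (p _).map_smul_univ] using
        (ContinuousLinearMap.apply ℂ F y).hasSum (hp.hasSum (hmem hs))
    have hy' : ‖y‖ < r' := by simpa [← ofReal_norm, ENNReal.ofReal_lt_coe_iff] using hy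
    obtain ⟨R, hR, hRy⟩ := ((continuous_id.mul_const ‖y‖).tendsto (1 : ℝ)
      |>.eventually_lt_const (by simpa using hy')).exists_gt
    have hRs : ∀ s ∈ Metric.ball (0 : ℂ) R, ‖s‖ * ‖y‖ < r' := fun s hs =>
      (mul_le_mul_of_nonneg_right (mem_ball_zero_iff.1 hs).le (norm_nonneg y)).trans_lt hRy
    have hR0 : Metric.ball (0 : ℂ) R ∈ 𝓝 0 :=
      Metric.ball_mem_nhds _ (zero_lt_one.trans hR)
    have hps : HasFPowerSeriesAt (fun s : ℂ => ω (x + s • y) y)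
        (fun n => ContinuousMultilinearMap.mkPiRing ℂ (Fin n) (p n (fun _ => y) y)) 0 := by
      refine hasFPowerSeriesAt_iff.2 ?_
      filter_upwards [hR0] with s hs
      simpa [FormalMultilinearSeries.coeff] using hser (hRs s hs)
    have hcoeff : ∀ n, iteratedDeriv (n + 1) (fun s : ℂ => f (x + s • y)) 0 =
        n.factorial • p n (fun _ => y) y := fun n => by
      obtain ⟨ρ, hρ⟩ := hps
      rw [iteratedDeriv_succ', EventuallyEq.iteratedDeriv_eq n
        (eventually_of_mem hR0 fun s hs => (hd (hRs s hs)).deriv), iteratedDeriv_eq_iteratedFDeriv,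
        ← hρ.factorial_smul 1 n]
      simp
    have key := Complex.hasSum_taylorSeries_on_ball (f := fun s : ℂ => f (x + s • y)) (c := 0)
      (r := R) (fun s hs => (hd (hRs s hs)).differentiableAt.differentiableWithinAt) (z := 1)
      (by simpa using hR)
    rw [one_smul] at key
    convert key using 2 with n
    rcases n with _ | n
    · simp [q]
    · rw [hcoeff, sub_zero, one_pow, one_smul, Nat.factorial_succ, ← Nat.cast_smul_eq_nsmul ℂ,
        smul_smul, Nat.cast_mul, mul_inv, inv_mul_cancel_right₀ (mod_cast n.factorial_ne_zero)]
      rfl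

/-- A closed analytic `1`-form on a convex open set has an analytic primitive. -/
theorem exists_primitive_of_closed {E F : Type*} [NormedAddCommGroup E] [NormedSpace ℂ E]
    [NormedAddCommGroup F] [NormedSpace ℂ F] [CompleteSpace F] {ω : E → E →L[ℂ] F} {U : Set E}
    (hU : IsOpen U) (hc : Convex ℝ U) (hω : AnalyticOnNhd ℂ ω U)
    (hs : ∀ p ∈ U, ∀ x y, fderiv ℂ ω p x y = fderiv ℂ ω p y x) :
    ∃ f : E → F, AnalyticOnNhd ℂ f U ∧ ∀ p ∈ U, HasFDerivAt f (ω p) p := by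
  obtain ⟨f, hf⟩ := hc.exists_forall_hasFDerivAt_of_fderiv_symmetric (𝕜 := ℂ) (ω := ω) hU
    (fun p hp => ((hω p hp).differentiableAt.restrictScalars ℝ).differentiableWithinAt)
    (fun p hp x y => by
      rw [(hω p hp).differentiableAt.fderiv_restrictScalars ℝ]
      exact hs p hp x y)
  exact ⟨f, fun p hp => analyticAt_of_hasFDerivAt (hω p hp)
    (eventually_of_mem (hU.mem_nhds hp) hf), hf⟩

/-- A totally symmetric first derivative is exactly what is needed for a symmetric bilinear form
depending on a point of a convex open set to be a Hessian. -/
theorem exists_hessian_potential {E F : Type*} [NormedAddCommGroup E] [NormedSpace ℂ E]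
    [NormedAddCommGroup F] [NormedSpace ℂ F] [CompleteSpace F] {m : E → E →L[ℂ] E →L[ℂ] F}
    {U : Set E} (hU : IsOpen U) (hc : Convex ℝ U) (hm : AnalyticOnNhd ℂ m U)
    (hsymm : ∀ p ∈ U, ∀ x y, m p x y = m p y x)
    (hclosed : ∀ p ∈ U, ∀ x y z, fderiv ℂ m p x y z = fderiv ℂ m p y x z) :
    ∃ (f : E → F) (g : E → E →L[ℂ] F), AnalyticOnNhd ℂ f U ∧ (∀ p ∈ U, HasFDerivAt f (g p) p) ∧
      ∀ p ∈ U, HasFDerivAt g (m p) p := by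
  obtain ⟨g, hga, hg⟩ := exists_primitive_of_closed hU hc hm
    (fun p hp x y => ContinuousLinearMap.ext fun z => hclosed p hp x y z)
  obtain ⟨f, hfa, hf⟩ := exists_primitive_of_closed hU hc hga
    (fun p hp x y => by rw [(hg p hp).fderiv]; exact hsymm p hp x y)
  exact ⟨f, g, hfa, hf, hg⟩

theorem secondDeriv_eq_of_hasFDerivAt {E F : Type*} [NormedAddCommGroup E] [NormedSpace ℂ E]
    [NormedAddCommGroup F] [NormedSpace ℂ F] {f : E → F} {g : E → E →L[ℂ] F}
    {m : E →L[ℂ] E →L[ℂ] F} {p : E} (hf : ∀ᶠ q in 𝓝 p, HasFDerivAt f (g q) q)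
    (hg : HasFDerivAt g m p) (x y : E) : secondDeriv f p x y = m x y := by
  have h1 : (fun q => fderiv ℂ f q y) =ᶠ[𝓝 p] fun q => g q y :=
    hf.mono fun q hq => by simp only [hq.fderiv]
  rw [secondDeriv, h1.fderiv_eq]
  have := hg.clm_apply (hasFDerivAt_const y p)
  rw [this.fderiv]
  simp

end

section

/-! ### Flat F-manifolds from a parametrisation by flat coordinates -/
section CLM
variable {E V W G' : Type*} [NormedAddCommGroup E] [NormedSpace ℂ E]
  [NormedAddCommGroup V] [NormedSpace ℂ V] [NormedAddCommGroup W] [NormedSpace ℂ W]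

theorem AnalyticAt.clm_apply_apply {c : E → V →L[ℂ] W} {u : E → V} {x : E}
    (hc : AnalyticAt ℂ c x) (hu : AnalyticAt ℂ u x) : AnalyticAt ℂ (fun y => c y (u y)) x :=
  ((ContinuousLinearMap.id ℂ (V →L[ℂ] W)).analyticAt_bilinear (c x, u x)).comp₂ hc hu

/-- On a finite-dimensional space analyticity of a family of linear maps is pointwise. -/
theorem analyticAt_clm_of_forall_apply [FiniteDimensional ℂ V] {c : E → V →L[ℂ] W} {x : E}
    (h : ∀ v, AnalyticAt ℂ (fun y => c y v) x) : AnalyticAt ℂ c x := by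
  let b := Module.finBasis ℂ V
  have : c = fun y => ∑ i, (ContinuousLinearMap.smulRightL ℂ V W
      (LinearMap.toContinuousLinearMap (b.coord i))) (c y (b i)) := by
    funext y
    apply ContinuousLinearMap.ext
    intro v
    have h1 : c y v = c y (∑ i, b.repr v i • b i) := by rw [b.sum_repr v]
    rw [h1, map_sum]
    simp
  rw [this]
  refine Finset.analyticAt_fun_sum _ fun i _ => ?_
  exact AnalyticAt.comp (ContinuousLinearMap.analyticAt _ _) (h (b i))

/-- The derivative of `q ↦ c q v` for a family `c` of continuous linear maps. -/
theorem fderiv_apply_const {c : E → V →L[ℂ] W} {x : E} (hc : DifferentiableAt ℂ c x) (v : V)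
    (w : E) : fderiv ℂ (fun y => c y v) x w = fderiv ℂ c x w v := by
  rw [(hc.hasFDerivAt.clm_apply (hasFDerivAt_const v x)).fderiv]
  simp

theorem analyticAt_clm₂_of_forall_apply [FiniteDimensional ℂ V] {c : E → V →L[ℂ] V →L[ℂ] W} {x : E}
    (h : ∀ v w, AnalyticAt ℂ (fun y => c y v w) x) : AnalyticAt ℂ c x :=
  analyticAt_clm_of_forall_apply fun v => analyticAt_clm_of_forall_apply fun w => h v w

end CLM

section Flat

variable {E F : Type*} [NormedAddCommGroup E] [NormedSpace ℂ E] [FiniteDimensional ℂ E]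
  [CompleteSpace E] [NormedAddCommGroup F] [NormedSpace ℂ F] [FiniteDimensional ℂ F]
  [CompleteSpace F]

/-- `T` is a local inverse at `p` of the parametrisation `A : G → E`. -/
structure IsLocalFlatCoord (A : F → E) (G : Set F) (T : E → F) (p : E) : Prop where
  analyticAt : AnalyticAt ℂ T p
  mem : T p ∈ G
  eq : ∀ᶠ q in 𝓝 p, A (T q) = q

theorem exists_isLocalFlatCoord {A : F → E} {G : Set F}
    (hA : AnalyticOnNhd ℂ A G) (hb : ∀ t ∈ G, Function.Bijective (fderiv ℂ A t)) {t : F}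
    (ht : t ∈ G) : ∃ T, IsLocalFlatCoord A G T (A t) ∧ T (A t) = t := by
  let e : F ≃L[ℂ] E := ContinuousLinearEquiv.ofBijective (fderiv ℂ A t)
    (LinearMap.ker_eq_bot.2 (hb t ht).1) (LinearMap.range_eq_top.2 (hb t ht).2)
  have he : (e : F →L[ℂ] E) = fderiv ℂ A t := ContinuousLinearEquiv.coe_ofBijective _ _ _
  have hs : HasStrictFDerivAt A (e : F →L[ℂ] E) t := by
    rw [he]; exact (hA t ht).hasStrictFDerivAt
  let φ := hs.toOpenPartialHomeomorph A
  have hφ : (φ : F → E) = A := hs.toOpenPartialHomeomorph_coe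
  have hmem : t ∈ φ.source := hs.mem_toOpenPartialHomeomorph_source
  have hφt : φ.symm (A t) = t := by rw [← hφ]; exact φ.left_inv hmem
  obtain ⟨p, hp⟩ := hA t ht
  have hp' : HasFPowerSeriesAt φ p t := by rw [hφ]; exact hp
  refine ⟨φ.symm, ⟨?_, by rwa [hφt], ?_⟩, hφt⟩
  · rw [← hφ]
    refine (φ.hasFPowerSeriesAt_symm (i := e) hmem hp' ?_).analyticAt
    have h1 : HasFDerivAt A ((continuousMultilinearCurryFin1 ℂ F E) (p 1)) t := hp.hasFDerivAt
    have h2 := h1.unique hs.hasFDerivAt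
    rw [← h2]; simp
  · rw [← hφ]
    exact φ.eventually_right_inverse (φ.map_source hmem)

variable {A : F → E} {G : Set F}

theorem IsLocalFlatCoord.eventually {T : E → F} {p : E} (hG : IsOpen G)
    (h : IsLocalFlatCoord A G T p) : ∀ᶠ q in 𝓝 p, IsLocalFlatCoord A G T q := by
  filter_upwards [h.analyticAt.eventually_analyticAt, h.eq.eventually_nhds,
    h.analyticAt.continuousAt.eventually_mem (hG.mem_nhds h.mem)] with q h1 h2 h3
  exact ⟨h1, h3, h2⟩

theorem IsLocalFlatCoord.apply_eq {T : E → F} {p : E} (h : IsLocalFlatCoord A G T p) :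
    A (T p) = p := h.eq.self_of_nhds

theorem IsLocalFlatCoord.hasFDerivAt_comp {W : Type*} [NormedAddCommGroup W] [NormedSpace ℂ W]
    {T : E → F} {p : E} (h : IsLocalFlatCoord A G T p) {g : F → W} {g' : F →L[ℂ] W}
    (hg : HasFDerivAt g g' (T p)) : HasFDerivAt (fun q => g (T q)) (g'.comp (fderiv ℂ T p)) p :=
  hg.comp p h.analyticAt.differentiableAt.hasFDerivAt

theorem IsLocalFlatCoord.analyticAt_comp {W : Type*} [NormedAddCommGroup W] [NormedSpace ℂ W]
    {T : E → F} {p : E} (h : IsLocalFlatCoord A G T p) {g : F → W} (hg : AnalyticOnNhd ℂ g G) :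
    AnalyticAt ℂ (fun q => g (T q)) p :=
  (hg _ h.mem).comp h.analyticAt

theorem IsLocalFlatCoord.fderiv_comp {T : E → F} {p : E} (hA : AnalyticOnNhd ℂ A G)
    (h : IsLocalFlatCoord A G T p) (X : E) : fderiv ℂ A (T p) (fderiv ℂ T p X) = X :=
  DFunLike.congr_fun ((h.hasFDerivAt_comp (hA _ h.mem).differentiableAt.hasFDerivAt).unique
    ((hasFDerivAt_id p).congr_of_eventuallyEq h.eq)) X

theorem IsLocalFlatCoord.fderiv_comp' {T : E → F} {p : E} (hA : AnalyticOnNhd ℂ A G)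
    (hb : ∀ t ∈ G, Function.Bijective (fderiv ℂ A t))
    (h : IsLocalFlatCoord A G T p) (x : F) : fderiv ℂ T p (fderiv ℂ A (T p) x) = x :=
  (hb _ h.mem).1 (h.fderiv_comp hA _)

/-- The connection for which the components of `T` are flat coordinates: `DT⁻¹ D²T`. -/
def flatConn (A : F → E) (T : E → F) (p : E) : E →L[ℂ] E →L[ℂ] E :=
  (ContinuousLinearMap.compL ℂ E F E (fderiv ℂ A (T p))).comp (fderiv ℂ (fderiv ℂ T) p)

@[simp] theorem flatConn_apply (A : F → E) (T : E → F) (p X Y : E) :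
    flatConn A T p X Y = fderiv ℂ A (T p) (fderiv ℂ (fderiv ℂ T) p X Y) := rfl

theorem AnalyticAt.sndFDeriv_symm {T : E → F} {p : E} (h : AnalyticAt ℂ T p) (X Y : E) :
    fderiv ℂ (fderiv ℂ T) p X Y = fderiv ℂ (fderiv ℂ T) p Y X :=
  h.contDiffAt.isSymmSndFDerivAt_of_omega X Y

theorem flatConn_symm {T : E → F} {p : E} (h : IsLocalFlatCoord A G T p) (X Y : E) :
    flatConn A T p X Y = flatConn A T p Y X := by
  rw [flatConn_apply, h.analyticAt.sndFDeriv_symm X Y, flatConn_apply]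

/-- A metric which is constant in flat coordinates determines the flat connection. -/
theorem flatConn_unique (hG : IsOpen G) (hA : AnalyticOnNhd ℂ A G)
    (hbij : ∀ t ∈ G, Function.Bijective (fderiv ℂ A t)) {b : E → E → E → ℂ}
    {β : F →L[ℂ] F →L[ℂ] ℂ} (hβ : ∀ x y, β x y = β y x)
    (hnd : ∀ x, (∀ y, β x y = 0) → x = 0)
    (hb : ∀ t ∈ G, ∀ x y, b (A t) (fderiv ℂ A t x) (fderiv ℂ A t y) = β x y)
    {T₁ T₂ : E → F} {p : E} (h₁ : IsLocalFlatCoord A G T₁ p) (h₂ : IsLocalFlatCoord A G T₂ p) :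
    flatConn A T₁ p = flatConn A T₂ p := by
  have hbT : ∀ {T : E → F} {q : E}, IsLocalFlatCoord A G T q → ∀ X Y,
      b q X Y = β (fderiv ℂ T q X) (fderiv ℂ T q Y) := fun {T q} h X Y => by
    rw [← hb _ h.mem, h.fderiv_comp hA, h.fderiv_comp hA, h.apply_eq]
  have hd : ∀ {T : E → F}, IsLocalFlatCoord A G T p → ∀ X Y Z,
      fderiv ℂ (fun q => b q X Y) p Z =
        b p (flatConn A T p Z X) Y + b p X (flatConn A T p Z Y) := fun {T} h X Y Z => by
    have hT := fun X : E => h.analyticAt.fderiv.differentiableAt.hasFDerivAt.clm_apply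
      (hasFDerivAt_const X p)
    have h1 : (fun q => b q X Y) =ᶠ[𝓝 p] _ := (h.eventually hG).mono fun q hq => hbT hq X Y
    rw [h1.fderiv_eq,
      (β.hasFDerivAt_of_bilinear (hT X) (hT Y)).fderiv, hbT h, hbT h, flatConn_apply,
      flatConn_apply, h.fderiv_comp' hA hbij, h.fderiv_comp' hA hbij]
    simp [add_comm]
  set Δ := flatConn A T₁ p - flatConn A T₂ p with hΔ
  have hanti : ∀ X Y Z, b p (Δ Z X) Y = - b p (Δ Z Y) X := fun X Y Z => by
    have e1 := hd h₁ X Y Z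
    rw [hd h₂ X Y Z] at e1
    simp only [hbT h₁, hΔ, sub_apply, map_sub] at e1 ⊢
    rw [hβ (fderiv ℂ T₁ p X), hβ (fderiv ℂ T₁ p X)] at e1
    linear_combination -e1
  have hΔs : ∀ X Y, Δ X Y = Δ Y X := fun X Y => by
    rw [hΔ, sub_apply, sub_apply, sub_apply, sub_apply, flatConn_symm h₁, flatConn_symm h₂]
  -- a trilinear form symmetric in two arguments and skew in another two vanishes
  have hzero : ∀ X Y Z, b p (Δ Z X) Y = 0 := fun X Y Z => by
    have e1 := hanti X Y Z
    have e2 := hanti Y Z X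
    have e3 := hanti Z X Y
    rw [hΔs Z Y] at e1
    rw [hΔs X Z] at e2
    rw [hΔs Y X] at e3
    linear_combination (e1 - e3 + e2) / 2
  ext Z X
  have h0 : fderiv ℂ T₁ p (Δ Z X) = 0 := hnd _ fun y => by
    have := hzero X (fderiv ℂ A (T₁ p) y) Z
    rwa [hbT h₁, h₁.fderiv_comp' hA hbij] at this
  rw [← sub_eq_zero, ← sub_apply, ← sub_apply, ← h₁.fderiv_comp hA ((_ - _ : E →L[ℂ] E →L[ℂ] E) Z X),
    h0, map_zero]

/-- The multiplication `m` of flat coordinates, transported to the ambient coordinates. -/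
def flatMul (A : F → E) (m : F → F →L[ℂ] F →L[ℂ] F) (T : E → F) (p : E) : E →L[ℂ] E →L[ℂ] E :=
  (ContinuousLinearMap.compL ℂ E F E (fderiv ℂ A (T p))).comp
    (((m (T p)).comp (fderiv ℂ T p)).flip.comp (fderiv ℂ T p)).flip

@[simp] theorem flatMul_apply (A : F → E) (m : F → F →L[ℂ] F →L[ℂ] F) (T : E → F) (p X Y : E) :
    flatMul A m T p X Y = fderiv ℂ A (T p) (m (T p) (fderiv ℂ T p X) (fderiv ℂ T p Y)) := rfl

theorem analyticAt_flatConn (hA : AnalyticOnNhd ℂ A G) {T : E → F} {p : E}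
    (h : IsLocalFlatCoord A G T p) : AnalyticAt ℂ (flatConn A T) p :=
  analyticAt_clm₂_of_forall_apply fun _ _ => (h.analyticAt_comp hA.fderiv).clm_apply_apply
    ((h.analyticAt.fderiv.fderiv.clm_apply_apply analyticAt_const).clm_apply_apply analyticAt_const)

theorem analyticAt_flatMul (hA : AnalyticOnNhd ℂ A G) {m : F → F →L[ℂ] F →L[ℂ] F}
    (hm : AnalyticOnNhd ℂ m G) {T : E → F} {p : E}
    (h : IsLocalFlatCoord A G T p) : AnalyticAt ℂ (flatMul A m T) p :=
  have h3 := fun X : E => h.analyticAt.fderiv.clm_apply_apply (analyticAt_const (v := X))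
  analyticAt_clm₂_of_forall_apply fun X Y => (h.analyticAt_comp hA.fderiv).clm_apply_apply
    (((h.analyticAt_comp hm).clm_apply_apply (h3 X)).clm_apply_apply (h3 Y))

/-- Differentiating `DA (T q) (DT q W) = W`. -/
theorem IsLocalFlatCoord.sndFDeriv_eq (hG : IsOpen G) (hA : AnalyticOnNhd ℂ A G) {T : E → F} {p : E}
    (h : IsLocalFlatCoord A G T p) (X W : E) :
    fderiv ℂ (fderiv ℂ A) (T p) (fderiv ℂ T p X) (fderiv ℂ T p W) = -flatConn A T p X W := by
  have h1 := (h.hasFDerivAt_comp (hA.fderiv _ h.mem).differentiableAt.hasFDerivAt).clm_apply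
    (h.analyticAt.fderiv.differentiableAt.hasFDerivAt.clm_apply (hasFDerivAt_const W p))
  have h2 : HasFDerivAt (fun q => fderiv ℂ A (T q) (fderiv ℂ T q W)) (0 : E →L[ℂ] E) p :=
    (hasFDerivAt_const W p).congr_of_eventuallyEq
      ((h.eventually hG).mono fun q hq => hq.fderiv_comp hA W)
  have h3 := DFunLike.congr_fun (h1.unique h2) X
  simp only [ContinuousLinearMap.comp_zero, zero_add, ContinuousLinearMap.comp_apply,
    ContinuousLinearMap.flip_apply, add_apply, zero_apply] at h3
  rw [eq_neg_iff_add_eq_zero, add_comm]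
  exact h3

/-- The curvature of `flatConn` vanishes. -/
theorem flatConn_curvature (hG : IsOpen G) (hA : AnalyticOnNhd ℂ A G)
    (hbij : ∀ t ∈ G, Function.Bijective (fderiv ℂ A t)) {T : E → F} {p : E}
    (h : IsLocalFlatCoord A G T p) (X Y Z : E) :
    fderiv ℂ (flatConn A T) p X Y Z - fderiv ℂ (flatConn A T) p Y X Z
      + flatConn A T p X (flatConn A T p Y Z) - flatConn A T p Y (flatConn A T p X Z) = 0 := by
  have hT := h.analyticAt
  have hΓ : ∀ X Y Z, fderiv ℂ (flatConn A T) p X Y Z =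
      fderiv ℂ A (T p) (fderiv ℂ (fderiv ℂ (fderiv ℂ T)) p X Y Z) -
        flatConn A T p X (flatConn A T p Y Z) := fun X Y Z => by
    have h1 := (analyticAt_flatConn hA h).differentiableAt.hasFDerivAt
    have h2 := (h1.clm_apply (hasFDerivAt_const Y p)).clm_apply (hasFDerivAt_const Z p)
    have h3 := (h.hasFDerivAt_comp (hA.fderiv _ h.mem).differentiableAt.hasFDerivAt).clm_apply
      ((hT.fderiv.fderiv.differentiableAt.hasFDerivAt.clm_apply (hasFDerivAt_const Y p)).clm_apply
        (hasFDerivAt_const Z p))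
    have h4 := DFunLike.congr_fun (h2.unique h3) X
    have h5 := h.sndFDeriv_eq hG hA X (fderiv ℂ A (T p) (fderiv ℂ (fderiv ℂ T) p Y Z))
    rw [h.fderiv_comp' hA hbij, ← flatConn_apply] at h5
    rw [sub_eq_add_neg, ← h5]
    simpa using h4
  rw [hΓ, hΓ, hT.fderiv.sndFDeriv_symm X Y]
  abel

/-- In flat coordinates a flat field has constant components. -/
theorem IsLocalFlatCoord.hasFDerivAt_component (hA : AnalyticOnNhd ℂ A G)
    (hbij : ∀ t ∈ G, Function.Bijective (fderiv ℂ A t)) {T : E → F} {p : E}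
    (h : IsLocalFlatCoord A G T p) {X : E → E} (hX : DifferentiableAt ℂ X p) :
    HasFDerivAt (fun q => fderiv ℂ T q (X q))
      ((fderiv ℂ T p).comp (fderiv ℂ X p + (flatConn A T p).flip (X p))) p := by
  refine (h.analyticAt.fderiv.differentiableAt.hasFDerivAt.clm_apply hX.hasFDerivAt).congr_fderiv ?_
  ext v
  simp [h.fderiv_comp' hA hbij]

/-- The components of a Lie bracket in flat coordinates. -/
theorem IsLocalFlatCoord.fderiv_lieBracket (hA : AnalyticOnNhd ℂ A G)
    (hbij : ∀ t ∈ G, Function.Bijective (fderiv ℂ A t)) {T : E → F} {p : E}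
    (h : IsLocalFlatCoord A G T p) {X Y : E → E} (hX : DifferentiableAt ℂ X p)
    (hY : DifferentiableAt ℂ Y p) : fderiv ℂ T p (VectorField.lieBracket ℂ X Y p) =
      fderiv ℂ (fun q => fderiv ℂ T q (Y q)) p (X p) -
        fderiv ℂ (fun q => fderiv ℂ T q (X q)) p (Y p) := by
  rw [(h.hasFDerivAt_component hA hbij hX).fderiv, (h.hasFDerivAt_component hA hbij hY).fderiv]
  simp only [VectorField.lieBracket, ContinuousLinearMap.comp_apply, add_apply,
    ContinuousLinearMap.flip_apply, ← map_sub]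
  rw [flatConn_symm h]
  congr 1
  abel

/-- A chart `A` whose coordinate fields have constant inner products, together with a
commutative, associative, unital multiplication with constant unit and closed structure tensor,
gives a flat F-manifold. -/
theorem exists_flatFManifold (hG : IsOpen G) (hA : AnalyticOnNhd ℂ A G)
    (hbij : ∀ t ∈ G, Function.Bijective (fderiv ℂ A t)) (hopen : IsOpen (A '' G))
    {b : E → E → E → ℂ} {β : F →L[ℂ] F →L[ℂ] ℂ} (hβ : ∀ x y, β x y = β y x)
    (hnd : ∀ x, (∀ y, β x y = 0) → x = 0)
    (hb : ∀ t ∈ G, ∀ x y, b (A t) (fderiv ℂ A t x) (fderiv ℂ A t y) = β x y)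
    {m : F → F →L[ℂ] F →L[ℂ] F} (hm : AnalyticOnNhd ℂ m G)
    (hcomm : ∀ t ∈ G, ∀ x y, m t x y = m t y x)
    (hassoc : ∀ t ∈ G, ∀ x y z, m t (m t x y) z = m t x (m t y z))
    (hclosed : ∀ t ∈ G, ∀ x y z, fderiv ℂ m t x y z = fderiv ℂ m t y x z)
    {e : F} (he : ∀ t ∈ G, ∀ x, m t e x = x)
    (hwd : ∀ t ∈ G, ∀ t' ∈ G, A t = A t' → ∀ x y x' y', fderiv ℂ A t x = fderiv ℂ A t' x' →
      fderiv ℂ A t y = fderiv ℂ A t' y' → fderiv ℂ A t (m t x y) = fderiv ℂ A t' (m t' x' y')) :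
    ∃ S : FlatFManifold (A '' G),
      (∀ t ∈ G, ∀ x y, secondDeriv A t x y +
        S.conn (A t) (fderiv ℂ A t x) (fderiv ℂ A t y) = 0) ∧
      ∀ t ∈ G, ∀ x y, S.mul (A t) (fderiv ℂ A t x) (fderiv ℂ A t y) = fderiv ℂ A t (m t x y) := by
  classical
  -- `A` need not be injective, so a local inverse `T p` is chosen at each point; connection and
  -- product do not depend on the choice, by `flatConn_unique` and `hwd`
  have hex : ∀ p ∈ A '' G, ∃ T, IsLocalFlatCoord A G T p := by
    rintro _ ⟨t, ht, rfl⟩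
    exact (exists_isLocalFlatCoord hA hbij ht).imp fun _ h => h.1
  choose! T hT using hex
  have hmem : ∀ {T' : E → F} {p : E}, IsLocalFlatCoord A G T' p → p ∈ A '' G := fun h =>
    ⟨_, h.mem, h.apply_eq⟩
  have hconn : ∀ {T' : E → F} {p : E}, IsLocalFlatCoord A G T' p →
      flatConn A (T p) p = flatConn A T' p := fun h =>
    flatConn_unique hG hA hbij hβ hnd hb (hT _ (hmem h)) h
  have hmul : ∀ {T' : E → F} {p : E}, IsLocalFlatCoord A G T' p →
      flatMul A m (T p) p = flatMul A m T' p := fun {T' p} h => by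
    have hp := hT p (hmem h)
    ext X Y
    exact hwd _ hp.mem _ h.mem (hp.apply_eq.trans h.apply_eq.symm) _ _ _ _
      ((hp.fderiv_comp hA X).trans (h.fderiv_comp hA X).symm)
      ((hp.fderiv_comp hA Y).trans (h.fderiv_comp hA Y).symm)
  have hunit : ∀ {T' : E → F} {p : E}, IsLocalFlatCoord A G T' p → ∀ X,
      flatMul A m T' p (fderiv ℂ A (T' p) e) X = X := fun h X => by
    rw [flatMul_apply, h.fderiv_comp' hA hbij, he _ h.mem, h.fderiv_comp hA]
  have hmc : ∀ {T' : E → F} {p : E}, IsLocalFlatCoord A G T' p → ∀ X Y,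
      flatMul A m T' p X Y = flatMul A m T' p Y X := fun h X Y => by
    rw [flatMul_apply, hcomm _ h.mem, flatMul_apply]
  have hue : ∀ {T' : E → F} {p : E}, IsLocalFlatCoord A G T' p →
      fderiv ℂ A (T p p) e = fderiv ℂ A (T' p) e := fun {T' p} h => by
    rw [← hunit h (fderiv ℂ A (T p p) e), hmc h, ← hmul h, hunit (hT _ (hmem h))]
  have hconn_ev : ∀ p ∈ A '' G, (fun q => flatConn A (T q) q) =ᶠ[𝓝 p] flatConn A (T p) :=
    fun p hp => ((hT p hp).eventually hG).mono fun q hq => hconn hq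
  have hmul_ev : ∀ p ∈ A '' G, (fun q => flatMul A m (T q) q) =ᶠ[𝓝 p] flatMul A m (T p) :=
    fun p hp => ((hT p hp).eventually hG).mono fun q hq => hmul hq
  have hunit_ev : ∀ p ∈ A '' G,
      (fun q => fderiv ℂ A (T q q) e) =ᶠ[𝓝 p] fun q => fderiv ℂ A (T p q) e :=
    fun p hp => ((hT p hp).eventually hG).mono fun q hq => hue hq
  have hunit_an : ∀ p ∈ A '' G, AnalyticAt ℂ (fun q => fderiv ℂ A (T p q) e) p := fun p hp =>
    ((hT p hp).analyticAt_comp hA.fderiv).clm_apply_apply analyticAt_const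
  refine ⟨{
    conn := fun q => flatConn A (T q) q
    mul := fun q => flatMul A m (T q) q
    unit := fun q => fderiv ℂ A (T q q) e
    isOpen := hopen
    conn_analytic := fun p hp => (analyticAt_flatConn hA (hT p hp)).congr (hconn_ev p hp).symm
    mul_analytic := fun p hp => (analyticAt_flatMul hA hm (hT p hp)).congr (hmul_ev p hp).symm
    unit_analytic := fun p hp => (hunit_an p hp).congr (hunit_ev p hp).symm
    torsion_free := fun p hp X Y => flatConn_symm (hT p hp) X Y
    curvature_zero := fun p hp X Y Z => by
      rw [(hconn_ev p hp).fderiv_eq]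
      exact flatConn_curvature hG hA hbij (hT p hp) X Y Z
    mul_comm := fun p hp X Y => hmc (hT p hp) X Y
    mul_assoc := fun p hp X Y Z => by
      simp only [flatMul_apply, (hT p hp).fderiv_comp' hA hbij]
      rw [hassoc _ (hT p hp).mem]
    unit_mul := fun p hp X => hunit (hT p hp) X
    unit_flat := ⟨fun p hp => (hunit_an p hp).congr (hunit_ev p hp).symm, fun p hp v => ?_⟩
    vector_potential := fun p hp => ?_ }, fun t ht x y => ?_, fun t ht x y => ?_⟩
  · rw [(hunit_ev p hp).fderiv_eq]
    have h := hT p hp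
    have h1 : HasFDerivAt (fun q => fderiv ℂ (T p) q (fderiv ℂ A (T p q) e)) (0 : E →L[ℂ] F) p :=
      (hasFDerivAt_const e p).congr_of_eventuallyEq
        ((h.eventually hG).mono fun q hq => hq.fderiv_comp' hA hbij e)
    have h2 := congrArg (fun L : E →L[ℂ] F => fderiv ℂ A (T p p) (L v))
      ((h.hasFDerivAt_component hA hbij (hunit_an p hp).differentiableAt).unique h1)
    simp only [ContinuousLinearMap.comp_apply, h.fderiv_comp hA, zero_apply, map_zero,
      add_apply, ContinuousLinearMap.flip_apply] at h2
    exact h2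
  · have h := hT p hp
    -- a Hessian potential `Ψ'` in flat coordinates on a ball around `T p`
    obtain ⟨ε, hε, hball⟩ := Metric.isOpen_iff.1 hG _ h.mem
    obtain ⟨Ψ', g, hΨa, hΨ, hg⟩ := exists_hessian_potential (m := m) Metric.isOpen_ball
      (convex_ball (T p p) ε) (fun t ht => hm t (hball ht)) (fun t ht => hcomm t (hball ht))
      (fun t ht => hclosed t (hball ht))
    obtain ⟨U, hU, hUo, hpU⟩ := eventually_nhds_iff.1 ((h.eventually hG).and
      (h.analyticAt.continuousAt.eventually_mem (Metric.isOpen_ball.mem_nhds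
        (Metric.mem_ball_self hε))))
    set Ψ : E → E := fun q => fderiv ℂ A (T p q) (Ψ' (T p q)) with hΨdef
    have hΨan : AnalyticOnNhd ℂ Ψ U := fun q hq =>
      ((hU q hq).1.analyticAt_comp hA.fderiv).clm_apply_apply
        ((hΨa _ (hU q hq).2).comp (hU q hq).1.analyticAt)
    refine ⟨U, hUo, hpU, fun q hq => hmem (hU q hq).1, Ψ, hΨan,
      fun V hVU hV X Y hX hY q hq => ?_⟩
    have hloc : ∀ q ∈ V, IsLocalFlatCoord A G (T p) q := fun q hq => (hU q (hVU hq)).1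
    have hflat : ∀ {Z : E → E}, IsFlatField (fun q => flatConn A (T q) q) V Z → ∀ q ∈ V,
        HasFDerivAt (fun r => fderiv ℂ (T p) r (Z r)) (0 : E →L[ℂ] F) q := fun {Z} hZ q hq => by
      refine ((hloc q hq).hasFDerivAt_component hA hbij
        (hZ.1 q hq).differentiableAt).congr_fderiv ?_
      ext v
      have := hZ.2 q hq v
      simp only [hconn (hloc q hq)] at this
      simp only [ContinuousLinearMap.comp_apply, add_apply,
        ContinuousLinearMap.flip_apply, this, map_zero, zero_apply]
    have hΨcomp : ∀ q ∈ V, HasFDerivAt (fun r => fderiv ℂ (T p) r (Ψ r))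
        ((g (T p q)).comp (fderiv ℂ (T p) q)) q := fun q hq =>
      ((hloc q hq).hasFDerivAt_comp (hΨ _ (hU q (hVU hq)).2)).congr_of_eventuallyEq
        (((hloc q hq).eventually hG).mono fun r hr => hr.fderiv_comp' hA hbij _)
    have hZan : AnalyticAt ℂ (VectorField.lieBracket ℂ Y Ψ) q :=
      ((hΨan q (hVU hq)).fderiv.clm_apply_apply (hY.1 q hq)).sub
        ((hY.1 q hq).fderiv.clm_apply_apply (hΨan q (hVU hq)))
    -- the components of `[Y, Ψ]` are the derivative of those of `Ψ`
    have hZ : (fun r => fderiv ℂ (T p) r (VectorField.lieBracket ℂ Y Ψ r)) =ᶠ[𝓝 q]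
        fun r => g (T p r) (fderiv ℂ (T p) r (Y r)) := by
      filter_upwards [hV.mem_nhds hq] with r hr
      rw [(hloc r hr).fderiv_lieBracket hA hbij (hY.1 r hr).differentiableAt
        (hΨan r (hVU hr)).differentiableAt, (hflat hY r hr).fderiv, (hΨcomp r hr).fderiv]
      simp
    have hfin := (hloc q hq).fderiv_lieBracket hA hbij (hX.1 q hq).differentiableAt
      hZan.differentiableAt
    rw [(hflat hX q hq).fderiv, hZ.fderiv_eq, (((hloc q hq).hasFDerivAt_comp
      (hg _ (hU q (hVU hq)).2)).clm_apply (hflat hY q hq)).fderiv] at hfin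
    simp only [ContinuousLinearMap.comp_zero, zero_add, ContinuousLinearMap.flip_apply,
      ContinuousLinearMap.comp_apply, zero_apply, sub_zero] at hfin
    rw [hmul (hloc q hq), flatMul_apply, ← hfin, (hloc q hq).fderiv_comp hA]
  · obtain ⟨T', hT', hT't⟩ := exists_isLocalFlatCoord hA hbij ht
    have h1 := hT'.sndFDeriv_eq hG hA (fderiv ℂ A t x) (fderiv ℂ A t y)
    have h2 : ∀ w, fderiv ℂ T' (A t) (fderiv ℂ A t w) = w := fun w => by
      simpa only [hT't] using hT'.fderiv_comp' hA hbij w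
    rw [h2, h2, hT't] at h1
    rw [secondDeriv, fderiv_apply_const (hA t ht).fderiv.differentiableAt, h1]
    exact neg_add_eq_zero.2 (by rw [← hconn hT'])
  · have hp := hT _ (mem_image_of_mem A ht)
    exact hwd _ hp.mem t ht hp.apply_eq _ _ x y (hp.fderiv_comp hA _) (hp.fderiv_comp hA _)

end Flat

end

section

/-! ### Linear algebra of the coordinate space -/
section LinearAlgebra

variable {ι : Type} [Fintype ι] [DecidableEq ι]

theorem pi_eq_sum_smul_single (x : ι → ℂ) : x = ∑ α, x α • (Pi.single α (1 : ℂ) : ι → ℂ) := by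
  ext j
  simp [Finset.sum_apply, Pi.single_apply]

theorem map_eq_sum_single {V : Type*} [AddCommGroup V] [Module ℂ V]
    {Φ : Type*} [FunLike Φ (ι → ℂ) V] [LinearMapClass Φ ℂ (ι → ℂ) V] (f : Φ) (x : ι → ℂ) :
    f x = ∑ α, x α • f (Pi.single α (1 : ℂ)) := by
  conv_lhs => rw [pi_eq_sum_smul_single x]
  simp [map_sum, map_smul]

/-- A finite family of functions without linear relations is separated by as many points. -/
theorem exists_eval_matrix_det_ne_zero {Z : Type*} (S : Set Z) (f : ι → Z → ℂ)
    (h : ∀ x : ι → ℂ, (∀ z ∈ S, ∑ α, x α * f α z = 0) → x = 0) :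
    ∃ z : ι → Z, (∀ i, z i ∈ S) ∧ (Matrix.of fun i α => f α (z i)).det ≠ 0 := by
  set V : Set (ι → ℂ) := (fun z α => f α z) '' S with hV
  have hspan : Submodule.span ℂ V = ⊤ := by
    by_contra hne
    obtain ⟨φ, hφ0, hφ⟩ := Submodule.exists_le_ker_of_lt_top _ (lt_top_iff_ne_top.2 hne)
    apply hφ0
    have hx := h (fun α => φ (Pi.single α 1)) (fun z hz => by
      have h1 : φ (fun α => f α z) = 0 :=
        hφ (Submodule.subset_span ⟨z, hz, rfl⟩)
      rw [map_eq_sum_single φ] at h1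
      rw [← h1]
      exact Finset.sum_congr rfl fun α _ => by rw [smul_eq_mul, mul_comm])
    ext α
    simpa using congrFun hx α
  obtain ⟨b, hbV, hbs, hbl⟩ := exists_linearIndependent ℂ V
  rw [hspan] at hbs
  let B : Module.Basis b ℂ (ι → ℂ) := Module.Basis.mk hbl (by rw [Subtype.range_coe, hbs])
  have hBf : Finite b := B.finite_index_of_rank_lt_aleph0 (by
    rw [rank_fun']; exact Cardinal.natCast_lt_aleph0)
  have : Fintype b := Fintype.ofFinite b
  have hcard : Fintype.card ι = Fintype.card b := by
    have := Module.finrank_eq_card_basis B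
    rw [Module.finrank_fintype_fun_eq_card] at this
    exact this
  let e : ι ≃ b := Fintype.equivOfCardEq hcard
  choose z hzS hz using fun i => hbV (e i).2
  refine ⟨z, hzS, ?_⟩
  have hrow : (Matrix.of fun i α => f α (z i)).row = fun i => ((e i : b) : ι → ℂ) := by
    funext i
    exact hz i
  have hli : LinearIndependent ℂ (Matrix.of fun i α => f α (z i)).row := by
    rw [hrow]
    exact hbl.comp e e.injective
  rw [Matrix.linearIndependent_rows_iff_isUnit, Matrix.isUnit_iff_isUnit_det] at hli
  exact hli.ne_zero

theorem analyticAt_det {E : Type*} [NormedAddCommGroup E] [NormedSpace ℂ E]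
    {M : E → Matrix ι ι ℂ} {x : E} (h : ∀ i j, AnalyticAt ℂ (fun y => M y i j) x) :
    AnalyticAt ℂ (fun y => (M y).det) x := by
  simp only [Matrix.det_apply]
  refine Finset.analyticAt_fun_sum _ fun σ _ => ?_
  have : AnalyticAt ℂ (fun y => ∏ i, M y (σ i) i) x :=
    Finset.analyticAt_fun_prod _ fun i _ => h _ _
  exact this.const_smul

/-- Solutions of linear systems with analytic coefficients are analytic (Cramer's rule). -/
theorem analyticAt_of_mulVec_eq {E : Type*} [NormedAddCommGroup E] [NormedSpace ℂ E]
    {M : E → Matrix ι ι ℂ} {v r : E → ι → ℂ} {x : E}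
    (hM : ∀ i j, AnalyticAt ℂ (fun y => M y i j) x) (hr : ∀ i, AnalyticAt ℂ (fun y => r y i) x)
    (hdet : (M x).det ≠ 0) (h : ∀ᶠ y in 𝓝 x, (M y).mulVec (v y) = r y) (i : ι) :
    AnalyticAt ℂ (fun y => v y i) x := by
  have h1 : AnalyticAt ℂ (fun y => ((M y).updateCol i (r y)).det / (M y).det) x := by
    refine (analyticAt_det fun j k => ?_).div (analyticAt_det hM) hdet
    by_cases hk : k = i
    · subst hk; simpa using hr j
    · simpa [Matrix.updateCol_ne hk] using hM j k
  refine h1.congr ?_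
  filter_upwards [h, (analyticAt_det hM).continuousAt.eventually_ne hdet] with y hy hy0
  have h2 := Matrix.cramer_eq_adjugate_mulVec (M y) (r y)
  rw [← hy, Matrix.mulVec_mulVec, Matrix.adjugate_mul, Matrix.smul_mulVec, Matrix.one_mulVec] at h2
  have h3 := congrFun h2 i
  rw [Matrix.cramer_apply] at h3
  rw [← hy, h3]
  simp [hy0]

/-- The bilinear form with the matrix `B`. -/
def bil (B : ι → ι → ℂ) : LinearMap.BilinForm ℂ (ι → ℂ) := Matrix.toBilin' (Matrix.of B)

theorem bil_apply (B : ι → ι → ℂ) (x y : ι → ℂ) : bil B x y = ∑ α, ∑ β, x α * y β * B α β := by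
  simp [bil, Matrix.toBilin'_apply, mul_right_comm]

@[simp] theorem bil_single (B : ι → ι → ℂ) (α β : ι) :
    bil B (Pi.single α 1) (Pi.single β 1) = B α β := by
  simp [bil]

theorem bil_comm {B : ι → ι → ℂ} (h : ∀ α β, B α β = B β α) (x y : ι → ℂ) :
    bil B x y = bil B y x := by
  rw [bil_apply, bil_apply, Finset.sum_comm]
  refine Finset.sum_congr rfl fun α _ => Finset.sum_congr rfl fun β _ => ?_
  rw [h β α, mul_comm (x β)]

theorem bilinear_eq_bil {E : Type*} [NormedAddCommGroup E] [NormedSpace ℂ E]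
    (b : E →L[ℂ] E →L[ℂ] ℂ) (f : (ι → ℂ) →L[ℂ] E) (x y : ι → ℂ) :
    b (f x) (f y) = bil (fun α β => b (f (Pi.single α 1)) (f (Pi.single β 1))) x y := by
  rw [bil_apply, map_eq_sum_single f x, map_eq_sum_single f y]
  simp only [map_sum, map_smul, sum_apply, smul_apply,
    smul_eq_mul, Finset.mul_sum, mul_assoc]
  rw [Finset.sum_comm]
  simp only [mul_left_comm]

theorem analyticAt_bil {E : Type*} [NormedAddCommGroup E] [NormedSpace ℂ E] {B : E → ι → ι → ℂ}
    {p : E} (h : ∀ α β, AnalyticAt ℂ (fun q => B q α β) p) (x y : ι → ℂ) :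
    AnalyticAt ℂ (fun q => bil (B q) x y) p := by
  simp only [bil_apply]
  exact Finset.analyticAt_fun_sum _ fun α _ => Finset.analyticAt_fun_sum _ fun β _ =>
    analyticAt_const.mul (h α β)

theorem fderiv_bil {E : Type*} [NormedAddCommGroup E] [NormedSpace ℂ E] {B : E → ι → ι → ℂ}
    {p : E} (h : ∀ α β, DifferentiableAt ℂ (fun q => B q α β) p) (x y : ι → ℂ) (v : E) :
    fderiv ℂ (fun q => bil (B q) x y) p v =
      bil (fun α β => fderiv ℂ (fun q => B q α β) p v) x y := by
  simp only [bil_apply]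
  rw [(HasFDerivAt.fun_sum fun α _ => HasFDerivAt.fun_sum fun β _ =>
    (h α β).hasFDerivAt.const_mul (x α * y β)).fderiv]
  simp

end LinearAlgebra

section Partial

variable {E F : Type*} [NormedAddCommGroup E] [NormedSpace ℂ E] [NormedAddCommGroup F]
  [NormedSpace ℂ F] {f : E × ℂ → F} {q : E × ℂ} (hf : DifferentiableAt ℂ f q)
include hf

theorem fderiv_apply_fst (w : E) :
    fderiv ℂ f q (w, 0) = fderiv ℂ (fun t => f (t, q.2)) q.1 w :=
  (DFunLike.congr_fun (HasFDerivAt.comp (f := fun t => (t, q.2)) (g := f) q.1 hf.hasFDerivAt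
    (hasFDerivAt_prodMk_left q.1 q.2)).fderiv w).symm

theorem fderiv_apply_snd : fderiv ℂ f q (0, 1) = deriv (fun s => f (q.1, s)) q.2 :=
  (hf.hasFDerivAt.comp_hasDerivAt q.2 ((hasDerivAt_const q.2 q.1).prodMk
    (hasDerivAt_id q.2))).deriv.symm

end Partial

/-! ### Families of superpotentials with flat coordinates -/
namespace LGModel

variable {κ ι : Type} [Fintype κ] [Fintype ι] [DecidableEq ι]

/-- The superpotential as a function of flat coordinates `t` and of `z`. -/
def lamFlat (L : LGModel κ ι) (A : (ι → ℂ) → κ → ℂ) (q : (ι → ℂ) × ℂ) : ℂ := L.lam (A q.1) q.2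

/-- The differential of the superpotential at `(t, z)` as a linear form in `(x, c)`, where the
tangent vector `c ∂_s` acts by `c ρ (z) ∂_z`. -/
def dlamExt (L : LGModel κ ι) (A : (ι → ℂ) → κ → ℂ) (t : ι → ℂ) (z : ℂ) : ((ι → ℂ) × ℂ) →L[ℂ] ℂ :=
  (fderiv ℂ (lamFlat L A) (t, z)).comp
    ((ContinuousLinearMap.fst ℂ _ _).prod (L.rho z • ContinuousLinearMap.snd ℂ _ _))

theorem dlamExt_eq_sum (L : LGModel κ ι) (A : (ι → ℂ) → κ → ℂ) (t : ι → ℂ) (z : ℂ)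
    (x : (ι → ℂ) × ℂ) : dlamExt L A t z x =
      ∑ α, x.1 α * dlamExt L A t z (dt α) + x.2 * dlamExt L A t z ds := by
  have h3 : x = ContinuousLinearMap.inl ℂ (ι → ℂ) ℂ x.1 + x.2 • ds := by ext <;> simp [ds]
  conv_lhs => rw [h3]
  rw [map_add, map_smul, map_eq_sum_single (ContinuousLinearMap.inl ℂ (ι → ℂ) ℂ) x.1, map_sum]
  simp only [map_smul, smul_eq_mul]
  rfl

/-- A parametrisation `A` of `M` by the values of the flat coordinates, defined on `G`. -/
structure FlatParam (L : LGModel κ ι) (A : (ι → ℂ) → κ → ℂ) (G : Set (ι → ℂ)) : Prop where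
  isOpen : IsOpen G
  analytic : AnalyticOnNhd ℂ A G
  of_flatCoord : ∀ a ∈ L.carrier, ∀ t, L.IsFlatCoord a t → t ∈ G ∧ A t = a
  flatCoord : ∀ t ∈ G, A t ∈ L.carrier ∧ L.IsFlatCoord (A t) t
  surj : ∀ a ∈ L.carrier, ∃ t ∈ G, A t = a
  card_eq : Fintype.card ι = Fintype.card κ
  isOpen_extDomain : IsOpen L.extDomain
  rho_analytic : ∀ z, AnalyticAt ℂ L.rho z
  zOf_analytic : ∀ s, AnalyticAt ℂ L.zOf s
  zOf_deriv : ∀ s, HasDerivAt L.zOf (L.rho (L.zOf s)) s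
  zOf_surj : ∀ a ∈ L.carrier, ∀ z ∉ L.poles a, ∃ s, L.zOf s = z
  lam_analytic : ∀ a ∈ L.carrier, ∀ z ∉ L.poles a,
    AnalyticAt ℂ (fun q : (κ → ℂ) × ℂ => L.lam q.1 q.2) (a, z)

namespace FlatParam

variable {L : LGModel κ ι} {A : (ι → ℂ) → κ → ℂ} {G : Set (ι → ℂ)} (D : L.FlatParam A G)
  {t : ι → ℂ} (ht : t ∈ G) {z : ℂ} (hz : z ∉ L.poles (A t))
include D ht

theorem isOpen_chartDomain : IsOpen (L.chartDomain G A) := by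
  refine isOpen_iff_eventually.2 fun q ⟨hq, hz⟩ => ?_
  have hc : ContinuousAt (fun r : (ι → ℂ) × ℂ => ((A r.1, r.2) : (κ → ℂ) × ℂ)) q :=
    (ContinuousAt.comp (f := Prod.fst) (D.analytic _ hq).continuousAt continuousAt_fst).prodMk
      continuousAt_snd
  filter_upwards [hc.eventually_mem (D.isOpen_extDomain.mem_nhds (x := (A q.1, q.2))
    ⟨(D.flatCoord _ hq).1, hz⟩), continuousAt_fst.eventually_mem (D.isOpen.mem_nhds hq)] with r h1 h2
  exact ⟨h2, h1.2⟩

include hz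

theorem eventually_mem : ∀ᶠ u in 𝓝 t, u ∈ G ∧ z ∉ L.poles (A u) := by
  obtain ⟨s, rfl⟩ := D.zOf_surj _ (D.flatCoord t ht).1 z hz
  exact (Continuous.prodMk_left s).continuousAt.eventually_mem
    ((D.isOpen_chartDomain ht).mem_nhds (x := (t, s)) ⟨ht, hz⟩)

theorem lamFlat_analytic : AnalyticAt ℂ (lamFlat L A) (t, z) :=
  AnalyticAt.comp (g := fun q : (κ → ℂ) × ℂ => L.lam q.1 q.2)
    (f := fun r : (ι → ℂ) × ℂ => (A r.1, r.2)) (D.lam_analytic _ (D.flatCoord _ ht).1 _ hz)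
    ((AnalyticAt.comp (f := Prod.fst) (D.analytic _ ht) analyticAt_fst).prod analyticAt_snd)

theorem dlamExt_analytic (x : (ι → ℂ) × ℂ) :
    AnalyticAt ℂ (fun q : (ι → ℂ) × ℂ => dlamExt L A q.1 q.2 x) (t, z) :=
  (D.lamFlat_analytic ht hz).fderiv.clm_apply_apply (analyticAt_const.prod
    ((AnalyticAt.comp (f := Prod.snd) (D.rho_analytic z) analyticAt_snd).mul analyticAt_const))

theorem dlamExt_apply (x : (ι → ℂ) × ℂ) : dlamExt L A t z x =
    L.dlam (A t) (fderiv ℂ A t x.1) z + x.2 * (L.rho z * deriv (L.lam (A t)) z) := by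
  have h1 := (D.lamFlat_analytic ht hz).differentiableAt
  have h2 : DifferentiableAt ℂ (fun a => L.lam a z) (A t) :=
    (D.lam_analytic _ (D.flatCoord _ ht).1 _ hz).along_fst.differentiableAt
  have h3 : fderiv ℂ (fun t => lamFlat L A (t, z)) t x.1 = L.dlam (A t) (fderiv ℂ A t x.1) z :=
    DFunLike.congr_fun
      (h2.hasFDerivAt.comp t (D.analytic t ht).differentiableAt.hasFDerivAt).fderiv x.1
  have h4 : ((x.1, L.rho z * x.2) : (ι → ℂ) × ℂ) = (x.1, 0) + (L.rho z * x.2) • (0, 1) := by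
    ext <;> simp
  change fderiv ℂ (lamFlat L A) (t, z) (x.1, L.rho z * x.2) = _
  rw [h4, map_add, map_smul, fderiv_apply_fst h1, fderiv_apply_snd h1, h3, smul_eq_mul]
  simp only [lamFlat]
  ring

end FlatParam

/-- The facts about a space of superpotentials from which the rank-1 extension is built.

`A` is the flat parametrisation, defined on `G`, and `H α β t z` is the function `H(∂_α, ∂_β)(z)`.
The key facts are the division identity `∂_X λ ∂_Y λ = ∂_{X ∘ Y} λ + ρ λ' H(X, Y)` with its
uniqueness, the constancy of the metric, and the closedness of `H`. -/
structure FlatData (L : LGModel κ ι) (A : (ι → ℂ) → κ → ℂ) (G : Set (ι → ℂ))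
    (H : ι → ι → (ι → ℂ) → ℂ → ℂ) (η₀ : ι → ι → ℂ) (e : (ι → ℂ) × ℂ) : Prop
    extends FlatParam L A G where
  H_analytic : ∀ α β, ∀ t ∈ G, ∀ z ∉ L.poles (A t),
    AnalyticAt ℂ (fun q : (ι → ℂ) × ℂ => H α β q.1 q.2) (t, z)
  H_symm : ∀ α β t z, H α β t z = H β α t z
  H_closed : ∀ α β γ, ∀ t ∈ G, ∀ z ∉ L.poles (A t),
    fderiv ℂ (fun t => H α β t z) t (Pi.single γ 1) =
      fderiv ℂ (fun t => H γ β t z) t (Pi.single α 1)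
  H_deriv : ∀ α β, ∀ t ∈ G, ∀ z ∉ L.poles (A t), L.rho z * deriv (H α β t) z =
    fderiv ℂ (fun t => dlamExt L A t z (Pi.single α 1, 0)) t (Pi.single β 1)
  hess_eq : ∀ t ∈ G, ∀ x y, ∀ z ∉ L.poles (A t),
    L.hess (A t) (fderiv ℂ A t x) (fderiv ℂ A t y) z = bil (fun α β => H α β t z) x y
  metric_eq : ∀ t ∈ G, ∀ x y, L.metric (A t) (fderiv ℂ A t x) (fderiv ℂ A t y) = bil η₀ x y
  gram_symm : ∀ α β, η₀ α β = η₀ β α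
  det_ne_zero : (Matrix.of η₀).det ≠ 0
  division : ∀ t ∈ G, ∀ x y, ∃ ζ, ∀ z ∉ L.poles (A t),
    dlamExt L A t z (x, 0) * dlamExt L A t z (y, 0) =
      dlamExt L A t z (ζ, bil (fun α β => H α β t z) x y)
  division_unique : ∀ t ∈ G, ∀ x, ∀ h : ℂ → ℂ, (∀ z ∉ L.poles (A t), AnalyticAt ℂ h z) →
    (∀ z ∉ L.poles (A t), dlamExt L A t z (x, h z) = 0) → ∀ z ∉ L.poles (A t), h z = 0
  cubic_eq : ∀ t ∈ G, ∀ x y ζ, ∀ h : ℂ → ℂ, (∀ z ∉ L.poles (A t), AnalyticAt ℂ h z) →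
    (∀ z ∉ L.poles (A t), dlamExt L A t z (x, 0) * dlamExt L A t z (y, 0) =
      dlamExt L A t z (ζ, h z)) →
    ∀ w, L.cubic (A t) (fderiv ℂ A t x) (fderiv ℂ A t y) (fderiv ℂ A t w) =
      L.metric (A t) (fderiv ℂ A t ζ) (fderiv ℂ A t w)
  unit_eq : ∀ t ∈ G, ∀ z ∉ L.poles (A t), dlamExt L A t z e = 1

theorem residue_zero (p : ℂ) : residue (fun _ => 0) p = 0 := by
  rw [residue, laurentCoeff]
  apply Tendsto.limUnder_eq
  simp [circleIntegral]

theorem cubic_rotate (L : LGModel κ ι) (a X Y Z : κ → ℂ) : L.cubic a X Y Z = L.cubic a Y Z X := by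
  simp only [cubic, mul_comm, mul_assoc]

theorem cubic_swap (L : LGModel κ ι) (a X Y Z : κ → ℂ) : L.cubic a X Y Z = L.cubic a X Z Y := by
  simp only [cubic, mul_comm, mul_left_comm, mul_assoc]

theorem structConst_symm (L : LGModel κ ι) (A : (ι → ℂ) → κ → ℂ) (t : ι → ℂ) (α β δ : ι) :
    L.structConst A t α β δ = L.structConst A t β α δ := by
  simp only [structConst]
  exact Finset.sum_congr rfl fun ε _ => by rw [cubic_swap]

/-- The product in flat coordinates. -/
def prodF (L : LGModel κ ι) (A : (ι → ℂ) → κ → ℂ) (t x y : ι → ℂ) (δ : ι) : ℂ :=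
  bil (fun α β => L.structConst A t α β δ) x y

/-- The product on the rank-1 extension at `(t, z)`.  The last component is the bilinear form that
restricts to `H` on vectors `(x, 0)` and pairs any vector with `∂_s` through `dlamExt`. -/
def mulExt (L : LGModel κ ι) (A : (ι → ℂ) → κ → ℂ) (H : ι → ι → (ι → ℂ) → ℂ → ℂ) (t : ι → ℂ) (z : ℂ) :
    ((ι → ℂ) × ℂ) →L[ℂ] ((ι → ℂ) × ℂ) →L[ℂ] ((ι → ℂ) × ℂ) :=
  LinearMap.toContinuousBilinearMap <| LinearMap.mk₂ ℂ
    (fun x y : (ι → ℂ) × ℂ => (prodF L A t x.1 y.1, bil (fun α β => H α β t z) x.1 y.1 +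
      x.2 * dlamExt L A t z y + y.2 * dlamExt L A t z x - x.2 * y.2 * dlamExt L A t z ds))
    (fun x x' y => by
      ext
      · simp [prodF]
      · simp only [Prod.fst_add, Prod.snd_add, map_add, LinearMap.add_apply]; ring)
    (fun c x y => by
      ext
      · simp [prodF]
      · simp only [Prod.smul_fst, Prod.smul_snd, map_smul, LinearMap.smul_apply, smul_eq_mul]; ring)
    (fun x y y' => by
      ext
      · simp [prodF]
      · simp only [Prod.fst_add, Prod.snd_add, map_add]; ring)
    (fun c x y => by
      ext
      · simp [prodF]
      · simp only [Prod.smul_fst, Prod.smul_snd, map_smul, smul_eq_mul]; ring)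

theorem mulExt_apply (L : LGModel κ ι) (A : (ι → ℂ) → κ → ℂ) (H : ι → ι → (ι → ℂ) → ℂ → ℂ)
    (t : ι → ℂ) (z : ℂ) (x y : (ι → ℂ) × ℂ) : mulExt L A H t z x y =
      (prodF L A t x.1 y.1, bil (fun α β => H α β t z) x.1 y.1 + x.2 * dlamExt L A t z y +
        y.2 * dlamExt L A t z x - x.2 * y.2 * dlamExt L A t z ds) := rfl

theorem mulExt_ds (L : LGModel κ ι) (A : (ι → ℂ) → κ → ℂ) (H : ι → ι → (ι → ℂ) → ℂ → ℂ)
    (t : ι → ℂ) (z : ℂ) (x : (ι → ℂ) × ℂ) : mulExt L A H t z x ds = (0, dlamExt L A t z x) := by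
  rw [mulExt_apply]
  refine Prod.ext (funext fun δ => ?_) ?_
  · simp [prodF, ds]
  · simp [ds]

theorem mulExt_dt (L : LGModel κ ι) (A : (ι → ℂ) → κ → ℂ) (H : ι → ι → (ι → ℂ) → ℂ → ℂ)
    (t : ι → ℂ) (z : ℂ) (α β : ι) : mulExt L A H t z (dt α) (dt β) =
      (fun δ => L.structConst A t α β δ, H α β t z) := by
  rw [mulExt_apply]
  refine Prod.ext (funext fun δ => ?_) ?_ <;> simp [prodF, dt]

namespace FlatData

variable {L : LGModel κ ι} {A : (ι → ℂ) → κ → ℂ} {G : Set (ι → ℂ)}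
  {H : ι → ι → (ι → ℂ) → ℂ → ℂ} {η₀ : ι → ι → ℂ} {e : (ι → ℂ) × ℂ} (D : L.FlatData A G H η₀ e)
include D

theorem eq_zero_of_bil {x : ι → ℂ} (h : ∀ y : ι → ℂ, bil η₀ x y = 0) : x = 0 := by
  by_contra hx
  refine D.det_ne_zero (Matrix.exists_vecMul_eq_zero_iff.1 ⟨x, hx, ?_⟩)
  funext β
  simpa [bil_apply, Matrix.vecMul, dotProduct, Pi.single_apply] using h (Pi.single β 1)

variable {t : ι → ℂ} (ht : t ∈ G)
include ht

theorem fderiv_bijective : Function.Bijective (fderiv ℂ A t) := by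
  have hinj : Function.Injective (fderiv ℂ A t) := by
    -- a vector in the kernel is orthogonal to everything for the nondegenerate form `η₀`
    refine (injective_iff_map_eq_zero _).2 fun x hx => D.eq_zero_of_bil fun y => ?_
    rw [← D.metric_eq t ht, hx, ← map_zero (fderiv ℂ A t), D.metric_eq t ht, map_zero,
      LinearMap.zero_apply]
  exact ⟨hinj, (LinearMap.injective_iff_surjective_of_finrank_eq_finrank
    (f := (fderiv ℂ A t : (ι → ℂ) →ₗ[ℂ] (κ → ℂ))) (by simp [D.card_eq])).1 hinj⟩

/-- A family of vectors `(x, h z)` that annihilates the differential of `λ` is zero. -/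
theorem eq_zero_of_dlamExt {x : ι → ℂ} {h : ℂ → ℂ} (hh : ∀ z ∉ L.poles (A t), AnalyticAt ℂ h z)
    (hx : ∀ z ∉ L.poles (A t), dlamExt L A t z (x, h z) = 0) :
    x = 0 ∧ ∀ z ∉ L.poles (A t), h z = 0 := by
  have h1 := D.division_unique t ht x h hh hx
  refine ⟨D.eq_zero_of_bil fun y => ?_, h1⟩
  have h0 : ∀ z, L.dlam (A t) 0 z = 0 := fun z => map_zero _
  rw [← D.metric_eq t ht, ← D.cubic_eq t ht 0 0 x h hh fun z hz => by
    rw [hx z hz, Prod.mk_zero_zero, map_zero, zero_mul]]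
  simp [cubic, h0, residue_zero]

theorem gram_eq : L.gram A t = Matrix.of η₀ := by
  ext α β
  rw [gram, Matrix.of_apply, Matrix.of_apply, frame, frame, D.metric_eq t ht, bil_single]

theorem H_analytic_z (x y : ι → ℂ) {z : ℂ} (hz : z ∉ L.poles (A t)) :
    AnalyticAt ℂ (fun z => bil (fun α β => H α β t z) x y) z :=
  analyticAt_bil (B := fun z α β => H α β t z) (fun α β => (D.H_analytic α β t ht z hz).along_snd) x y

/-- The quotient vector of the division identity has the structure constants as components, since
`cubic_eq` computes its inner products. -/
theorem division_single (α β : ι) {z : ℂ} (hz : z ∉ L.poles (A t)) :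
    dlamExt L A t z (dt α) * dlamExt L A t z (dt β) =
      dlamExt L A t z (fun δ => L.structConst A t α β δ, H α β t z) := by
  obtain ⟨ζ, hζ⟩ := D.division t ht (Pi.single α 1) (Pi.single β 1)
  have hc := D.cubic_eq t ht _ _ _ _ (fun z hz => D.H_analytic_z ht _ _ hz) hζ
  have h1 : ∀ ε, L.cubic (A t) (frame A t ε) (frame A t α) (frame A t β) =
      ∑ μ, ζ μ * η₀ μ ε := fun ε => by
    rw [cubic_rotate]
    refine (hc _).trans ?_
    rw [D.metric_eq t ht, bil_apply]
    simp [Pi.single_apply]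
  have h2 : ζ = fun δ => L.structConst A t α β δ := by
    have h3 : ζ = (Matrix.of η₀)⁻¹.mulVec ((Matrix.of η₀).mulVec ζ) := by
      rw [Matrix.mulVec_mulVec, Matrix.nonsing_inv_mul _ (isUnit_iff_ne_zero.2 D.det_ne_zero),
        Matrix.one_mulVec]
    rw [h3]
    funext δ
    simp only [structConst, h1, D.gram_eq ht, Matrix.mulVec, dotProduct, mul_comm (ζ _)]
    simp only [D.gram_symm, Matrix.of_apply]
  rw [← h2]
  simpa [dt] using hζ z hz

/-- The differential of the superpotential is multiplicative for the product of the extension. -/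
theorem dlamExt_mulExt {z : ℂ} (hz : z ∉ L.poles (A t)) (x y : (ι → ℂ) × ℂ) :
    dlamExt L A t z (mulExt L A H t z x y) = dlamExt L A t z x * dlamExt L A t z y := by
  have h1 : ∀ x y : ι → ℂ, (prodF L A t x y, bil (fun α β => H α β t z) x y) =
      ∑ α, ∑ β, (x α * y β) • ((fun δ => L.structConst A t α β δ, H α β t z) : (ι → ℂ) × ℂ) :=
    fun x y => by
      ext <;> simp [prodF, bil_apply, Prod.fst_sum, Prod.snd_sum]
  have h4 : ∀ (x y : ι → ℂ) (c : ℂ), dlamExt L A t z (prodF L A t x y,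
      bil (fun α β => H α β t z) x y + c) = (∑ α, x α * dlamExt L A t z (dt α)) *
        (∑ α, y α * dlamExt L A t z (dt α)) + c * dlamExt L A t z ds := fun x y c => by
    have h5 : (prodF L A t x y, bil (fun α β => H α β t z) x y + c) =
      (prodF L A t x y, bil (fun α β => H α β t z) x y) + c • ds := by ext <;> simp [ds]
    rw [h5, map_add, map_smul, h1, smul_eq_mul, Finset.sum_mul_sum]
    simp only [map_sum, map_smul, ← D.division_single ht _ _ hz, smul_eq_mul, mul_mul_mul_comm]
  rw [mulExt_apply, add_sub_assoc, add_assoc, h4, dlamExt_eq_sum L A t z x, dlamExt_eq_sum L A t z y]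
  ring

end FlatData
end LGModel

end

section

namespace LGModel

variable {κ ι : Type} [Fintype κ] [Fintype ι] [DecidableEq ι]
  {L : LGModel κ ι} {A : (ι → ℂ) → κ → ℂ} {G : Set (ι → ℂ)}
  {H : ι → ι → (ι → ℂ) → ℂ → ℂ} {η₀ : ι → ι → ℂ} {e : (ι → ℂ) × ℂ}

/-! ### The product on the extension -/
theorem eq_add_smul_ds (x : (ι → ℂ) × ℂ) : x = (x.1, 0) + x.2 • ds := by ext <;> simp [ds]

/-- The product on the rank-1 extension, in the coordinates `(t, s)`. -/
def mHat (L : LGModel κ ι) (A : (ι → ℂ) → κ → ℂ) (H : ι → ι → (ι → ℂ) → ℂ → ℂ)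
    (q : (ι → ℂ) × ℂ) : ((ι → ℂ) × ℂ) →L[ℂ] ((ι → ℂ) × ℂ) →L[ℂ] ((ι → ℂ) × ℂ) :=
  mulExt L A H q.1 (L.zOf q.2)

/-- The differential of the superpotential as a function of `(t, s)`. -/
def dlamHat (L : LGModel κ ι) (A : (ι → ℂ) → κ → ℂ) (q : (ι → ℂ) × ℂ) :
    ((ι → ℂ) × ℂ) →L[ℂ] ℂ :=
  dlamExt L A q.1 (L.zOf q.2)

theorem FlatParam.analyticAt_comp_zOf (D : L.FlatParam A G) {V : Type*} [NormedAddCommGroup V]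
    [NormedSpace ℂ V] {f : (ι → ℂ) × ℂ → V} {q : (ι → ℂ) × ℂ}
    (hf : AnalyticAt ℂ f (q.1, L.zOf q.2)) :
    AnalyticAt ℂ (fun r : (ι → ℂ) × ℂ => f (r.1, L.zOf r.2)) q :=
  AnalyticAt.comp (g := f) (f := fun r : (ι → ℂ) × ℂ => (r.1, L.zOf r.2)) hf
    (analyticAt_fst.prod (AnalyticAt.comp (f := Prod.snd) (D.zOf_analytic _) analyticAt_snd))

theorem FlatParam.hasFDerivAt_lamHat (D : L.FlatParam A G) {q : (ι → ℂ) × ℂ}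
    (hq : q ∈ L.chartDomain G A) :
    HasFDerivAt (fun r => lamFlat L A (r.1, L.zOf r.2)) (dlamHat L A q) q := by
  have h : HasFDerivAt (fun r : (ι → ℂ) × ℂ => (r.1, L.zOf r.2)) _ q :=
    hasFDerivAt_fst.prodMk (HasFDerivAt.comp (f := Prod.snd) q (D.zOf_deriv q.2).hasFDerivAt
      hasFDerivAt_snd)
  refine ((D.lamFlat_analytic hq.1 hq.2).differentiableAt.hasFDerivAt.comp q h).congr_fderiv ?_
  ext x
  · simp [dlamHat, dlamExt]
  · simp [dlamHat, dlamExt]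

theorem FlatParam.analyticAt_dlamHat (D : L.FlatParam A G) {q : (ι → ℂ) × ℂ}
    (hq : q ∈ L.chartDomain G A) : AnalyticAt ℂ (dlamHat L A) q :=
  (D.analyticAt_comp_zOf (D.lamFlat_analytic hq.1 hq.2)).fderiv.congr <| by
    filter_upwards [(D.isOpen_chartDomain hq.1).mem_nhds hq] with r hr
      using (D.hasFDerivAt_lamHat hr).fderiv

/-- `dlamHat` is an exact one-form. -/
theorem FlatParam.fderiv_dlamHat_symm (D : L.FlatParam A G) {q : (ι → ℂ) × ℂ}
    (hq : q ∈ L.chartDomain G A) (x y : (ι → ℂ) × ℂ) :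
    fderiv ℂ (dlamHat L A) q x y = fderiv ℂ (dlamHat L A) q y x := by
  have h : fderiv ℂ (fun r => lamFlat L A (r.1, L.zOf r.2)) =ᶠ[𝓝 q] dlamHat L A := by
    filter_upwards [(D.isOpen_chartDomain hq.1).mem_nhds hq] with r hr
      using (D.hasFDerivAt_lamHat hr).fderiv
  rw [← h.fderiv_eq, (D.analyticAt_comp_zOf (D.lamFlat_analytic hq.1 hq.2)).sndFDeriv_symm]

namespace FlatData

variable (D : L.FlatData A G H η₀ e)
include D

section Point

variable {t : ι → ℂ} (ht : t ∈ G)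
include ht

/-- The division identity at enough points `z i` is a linear system for the structure constants
with analytic coefficients. -/
theorem structConst_analytic (α β δ : ι) :
    AnalyticAt ℂ (fun t => L.structConst A t α β δ) t := by
  obtain ⟨z, hz, hdet⟩ := exists_eval_matrix_det_ne_zero {z | z ∉ L.poles (A t)}
    (fun δ z => dlamExt L A t z (dt δ)) (fun x hx =>
      (D.eq_zero_of_dlamExt ht (h := fun _ => 0) (fun _ _ => analyticAt_const) fun z hz => by
        rw [dlamExt_eq_sum, hx z hz, zero_mul, zero_add]).1)
  have hl : ∀ i x, AnalyticAt ℂ (fun u => dlamExt L A u (z i) x) t := fun i x =>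
    (D.dlamExt_analytic ht (hz i) x).along_fst
  refine analyticAt_of_mulVec_eq (M := fun u => Matrix.of fun i δ => dlamExt L A u (z i) (dt δ))
    (v := fun u δ => L.structConst A u α β δ) (r := fun u i => dlamExt L A u (z i) (dt α) *
      dlamExt L A u (z i) (dt β) - H α β u (z i) * dlamExt L A u (z i) ds)
    (fun i δ => hl i _) (fun i => ((hl i _).mul (hl i _)).sub
      ((D.H_analytic α β t ht _ (hz i)).along_fst.mul (hl i _))) hdet ?_ δ
  filter_upwards [eventually_all.2 fun i => D.eventually_mem ht (hz i)] with u hu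
  funext i
  rw [D.division_single (hu i).1 α β (hu i).2, dlamExt_eq_sum L A u (z i) (_, _)]
  simp [Matrix.mulVec, dotProduct, mul_comm]

theorem analyticAt_mulExt {z : ℂ} (hz : z ∉ L.poles (A t)) :
    AnalyticAt ℂ (fun q : (ι → ℂ) × ℂ => mulExt L A H q.1 q.2) (t, z) :=
  analyticAt_clm₂_of_forall_apply fun x y => by
    have hl := fun x => D.dlamExt_analytic ht hz x
    simp only [mulExt_apply]
    refine AnalyticAt.prod (AnalyticAt.pi fun δ => ?_) ((((analyticAt_bil
      (B := fun (q : (ι → ℂ) × ℂ) α β => H α β q.1 q.2)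
      (fun α β => D.H_analytic α β t ht z hz) _ _).add (analyticAt_const.mul (hl _))).add
      (analyticAt_const.mul (hl _))).sub (analyticAt_const.mul (hl _)))
    exact analyticAt_bil (B := fun (q : (ι → ℂ) × ℂ) α β => L.structConst A q.1 α β δ)
      (fun α β => AnalyticAt.comp (f := Prod.fst) (g := fun t => L.structConst A t α β δ)
        (D.structConst_analytic ht α β δ) analyticAt_fst) _ _

/-- The associator is killed by the multiplicative map `dlamExt`, and a vector `(x, h z)` killed by
it for all `z` is zero. -/
theorem mulExt_assoc {z : ℂ} (hz : z ∉ L.poles (A t)) (x y w : (ι → ℂ) × ℂ) :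
    mulExt L A H t z (mulExt L A H t z x y) w = mulExt L A H t z x (mulExt L A H t z y w) := by
  have hm := fun z hz => (D.analyticAt_mulExt ht (z := z) hz).along_snd
  have hc := fun z x => analyticAt_const (𝕜 := ℂ) (v := (x : (ι → ℂ) × ℂ)) (x := (z : ℂ))
  have h := D.eq_zero_of_dlamExt ht
    (x := prodF L A t (prodF L A t x.1 y.1) w.1 - prodF L A t x.1 (prodF L A t y.1 w.1))
    (h := fun z => (mulExt L A H t z (mulExt L A H t z x y) w -
      mulExt L A H t z x (mulExt L A H t z y w)).2)
    (fun z hz => analyticAt_snd.comp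
      ((((hm z hz).clm_apply_apply (((hm z hz).clm_apply_apply (hc z x)).clm_apply_apply
        (hc z y))).clm_apply_apply (hc z w)).sub
      (((hm z hz).clm_apply_apply (hc z x)).clm_apply_apply
        (((hm z hz).clm_apply_apply (hc z y)).clm_apply_apply (hc z w)))))
    fun z hz => by
      change dlamExt L A t z (mulExt L A H t z (mulExt L A H t z x y) w -
        mulExt L A H t z x (mulExt L A H t z y w)) = 0
      simp only [map_sub, D.dlamExt_mulExt ht hz]
      ring
  exact sub_eq_zero.1 (Prod.ext h.1 (h.2 z hz))

theorem mulExt_unit {z : ℂ} (hz : z ∉ L.poles (A t)) (x : (ι → ℂ) × ℂ) :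
    mulExt L A H t z e x = x := by
  have h := D.eq_zero_of_dlamExt ht (x := prodF L A t e.1 x.1 - x.1)
    (h := fun z => (mulExt L A H t z e x - x).2) (fun z hz => analyticAt_snd.comp
      ((((D.analyticAt_mulExt ht hz).along_snd.clm_apply_apply analyticAt_const).clm_apply_apply
        analyticAt_const).sub analyticAt_const)) fun z hz => by
      change dlamExt L A t z (mulExt L A H t z e x - x) = 0
      rw [map_sub, D.dlamExt_mulExt ht hz, D.unit_eq t ht z hz, one_mul, sub_self]
  exact sub_eq_zero.1 (Prod.ext h.1 (h.2 z hz))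

end Point

theorem mulExt_comm (t : ι → ℂ) (z : ℂ) (x y : (ι → ℂ) × ℂ) :
    mulExt L A H t z x y = mulExt L A H t z y x := by
  rw [mulExt_apply, mulExt_apply]
  refine Prod.ext (funext fun δ => bil_comm (fun α β => structConst_symm L A t α β δ) _ _) ?_
  simp only [bil_comm (fun α β => D.H_symm α β t z) x.1]
  ring

variable {q : (ι → ℂ) × ℂ} (hq : q ∈ L.chartDomain G A)
include hq

theorem analyticAt_mHat : AnalyticAt ℂ (mHat L A H) q :=
  D.analyticAt_comp_zOf (D.analyticAt_mulExt hq.1 hq.2)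

theorem differentiableAt_H (α β : ι) :
    DifferentiableAt ℂ (fun r : (ι → ℂ) × ℂ => H α β r.1 (L.zOf r.2)) q :=
  (D.analyticAt_comp_zOf (D.H_analytic α β _ hq.1 _ hq.2)).differentiableAt

theorem fderiv_H_symm (x y w : ι → ℂ) :
    fderiv ℂ (fun r : (ι → ℂ) × ℂ => bil (fun α β => H α β r.1 (L.zOf r.2)) x y) q (w, 0) =
      fderiv ℂ (fun r : (ι → ℂ) × ℂ => bil (fun α β => H α β r.1 (L.zOf r.2)) w y) q (x, 0) := by
  have h1 : ∀ α β w, fderiv ℂ (fun r : (ι → ℂ) × ℂ => H α β r.1 (L.zOf r.2)) q (w, 0) =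
      ∑ γ, w γ * fderiv ℂ (fun t => H α β t (L.zOf q.2)) q.1 (Pi.single γ 1) := fun α β w =>
    (fderiv_apply_fst (D.differentiableAt_H hq α β) w).trans (map_eq_sum_single _ w)
  rw [fderiv_bil (B := fun (r : (ι → ℂ) × ℂ) α β => H α β r.1 (L.zOf r.2))
    (D.differentiableAt_H hq), fderiv_bil (B := fun (r : (ι → ℂ) × ℂ) α β => H α β r.1 (L.zOf r.2))
    (D.differentiableAt_H hq), bil_apply, bil_apply, Finset.sum_comm]
  conv_rhs => rw [Finset.sum_comm]
  simp only [h1, Finset.mul_sum]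
  refine Finset.sum_congr rfl fun β _ => ?_
  rw [Finset.sum_comm]
  refine Finset.sum_congr rfl fun γ _ => Finset.sum_congr rfl fun α _ => ?_
  rw [D.H_closed α β γ _ hq.1 _ hq.2]
  ring

theorem fderiv_H_ds (x y : ι → ℂ) :
    fderiv ℂ (fun r : (ι → ℂ) × ℂ => bil (fun α β => H α β r.1 (L.zOf r.2)) x y) q ds =
      fderiv ℂ (dlamHat L A) q (x, 0) (y, 0) := by
  have hd := (D.analyticAt_dlamHat hq).differentiableAt
  rw [fderiv_bil (B := fun (r : (ι → ℂ) × ℂ) α β => H α β r.1 (L.zOf r.2))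
    (D.differentiableAt_H hq)]
  refine Eq.trans ?_ (bilinear_eq_bil (fderiv ℂ (dlamHat L A) q)
    (ContinuousLinearMap.inl ℂ (ι → ℂ) ℂ) x y).symm
  congr
  funext α β
  have h1 : HasDerivAt (fun s => H α β q.1 (L.zOf s)) _ q.2 :=
    (D.H_analytic α β _ hq.1 _ hq.2).along_snd.differentiableAt.hasDerivAt.comp q.2
      (D.zOf_deriv q.2)
  refine (fderiv_apply_snd (D.differentiableAt_H hq α β)).trans ?_
  rw [h1.deriv, mul_comm, D.H_deriv α β _ hq.1 _ hq.2]
  refine (fderiv_apply_fst (f := fun r => dlamHat L A r (Pi.single α 1, 0))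
    (hd.clm_apply (differentiableAt_const _)) _).symm.trans ?_
  rw [fderiv_apply_const hd, D.fderiv_dlamHat_symm hq]
  rfl

theorem hasFDerivAt_mHat (x y : (ι → ℂ) × ℂ) :
    HasFDerivAt (fun r => mHat L A H r x y)
      (((fderiv ℂ (fun t => prodF L A t x.1 y.1) q.1).comp (ContinuousLinearMap.fst ℂ _ _)).prod
        (fderiv ℂ (fun r : (ι → ℂ) × ℂ => bil (fun α β => H α β r.1 (L.zOf r.2)) x.1 y.1) q +
          x.2 • (fderiv ℂ (dlamHat L A) q).flip y + y.2 • (fderiv ℂ (dlamHat L A) q).flip x -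
          (x.2 * y.2) • (fderiv ℂ (dlamHat L A) q).flip ds)) q := by
  have hd : ∀ x, HasFDerivAt (fun r => dlamHat L A r x) ((fderiv ℂ (dlamHat L A) q).flip x) q :=
    fun x => ((D.analyticAt_dlamHat hq).differentiableAt.hasFDerivAt.clm_apply
      (hasFDerivAt_const x q)).congr_fderiv (by ext <;> simp)
  have hP : DifferentiableAt ℂ (fun t => prodF L A t x.1 y.1) q.1 :=
    (AnalyticAt.pi fun δ => analyticAt_bil (B := fun t α β => L.structConst A t α β δ)
      (fun α β => D.structConst_analytic hq.1 α β δ) _ _).differentiableAt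
  have hB := (analyticAt_bil (B := fun (r : (ι → ℂ) × ℂ) α β => H α β r.1 (L.zOf r.2))
    (fun α β => D.analyticAt_comp_zOf (D.H_analytic α β _ hq.1 _ hq.2)) x.1 y.1).differentiableAt
  exact (HasFDerivAt.comp (f := Prod.fst) q hP.hasFDerivAt hasFDerivAt_fst).prodMk
    (((hB.hasFDerivAt.add ((hd y).const_mul x.2)).add ((hd x).const_mul y.2)).sub
      ((hd ds).const_mul (x.2 * y.2)))

/-- Apart from the derivatives of the structure constants and of `H` along `t`, the derivative of
the product is expressed through the symmetric form `fderiv dlamHat`. -/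
theorem fderiv_mHat (w x y : (ι → ℂ) × ℂ) : fderiv ℂ (mHat L A H) q w x y =
    (fderiv ℂ (fun t => prodF L A t x.1 y.1) q.1 w.1,
      fderiv ℂ (fun r : (ι → ℂ) × ℂ => bil (fun α β => H α β r.1 (L.zOf r.2)) x.1 y.1) q (w.1, 0) +
      (fderiv ℂ (dlamHat L A) q w x * y.2 + fderiv ℂ (dlamHat L A) q w y * x.2 +
        fderiv ℂ (dlamHat L A) q x y * w.2 - fderiv ℂ (dlamHat L A) q w ds * x.2 * y.2 -
        fderiv ℂ (dlamHat L A) q x ds * w.2 * y.2 - fderiv ℂ (dlamHat L A) q y ds * w.2 * x.2 +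
        fderiv ℂ (dlamHat L A) q ds ds * w.2 * x.2 * y.2)) := by
  have hm := (D.analyticAt_mHat hq).differentiableAt
  rw [← fderiv_apply_const hm, ← fderiv_apply_const (hm.clm_apply (differentiableAt_const _)),
    (D.hasFDerivAt_mHat hq x y).fderiv]
  refine Prod.ext rfl ?_
  set b := fderiv ℂ (dlamHat L A) q with hb
  have h1 := congrArg (fderiv ℂ (fun r : (ι → ℂ) × ℂ =>
    bil (fun α β => H α β r.1 (L.zOf r.2)) x.1 y.1) q) (eq_add_smul_ds w)
  rw [map_add, map_smul, D.fderiv_H_ds hq, smul_eq_mul] at h1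
  have h2 : b x y = b (x.1, 0) (y.1, 0) + y.2 * b x ds + x.2 * b y ds - x.2 * y.2 * b ds ds := by
    have hs : b y ds = b (y.1, 0) ds + y.2 * b ds ds := by
      conv_lhs => rw [eq_add_smul_ds y]
      simp
    have hx : b x (y.1, 0) = b (x.1, 0) (y.1, 0) + x.2 * b ds (y.1, 0) := by
      conv_lhs => rw [eq_add_smul_ds x]
      simp
    have hy : b x y = b x (y.1, 0) + y.2 * b x ds := by
      conv_lhs => rw [eq_add_smul_ds y]
      simp
    rw [hy, hx, D.fderiv_dlamHat_symm hq ds, hs]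
    ring
  simp only [ContinuousLinearMap.prod_apply, sub_apply, add_apply, smul_apply,
    ContinuousLinearMap.flip_apply, smul_eq_mul]
  linear_combination h1 - w.2 * h2

/-- Differentiating the associativity of the product along `∂_s`. -/
theorem fderiv_dlamHat_mHat (x y w : (ι → ℂ) × ℂ) :
    fderiv ℂ (dlamHat L A) q (mHat L A H q x y) w + fderiv ℂ (dlamHat L A) q x y * dlamHat L A q w =
      fderiv ℂ (dlamHat L A) q x (mHat L A H q y w) +
        dlamHat L A q x * fderiv ℂ (dlamHat L A) q y w := by
  have hm := (D.analyticAt_mHat hq).differentiableAt.hasFDerivAt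
  have hc := fun x : (ι → ℂ) × ℂ => hasFDerivAt_const (𝕜 := ℂ) x q
  have h := ((hm.clm_apply ((hm.clm_apply (hc x)).clm_apply (hc y))).clm_apply (hc w)).unique
    (((hm.clm_apply (hc x)).clm_apply ((hm.clm_apply (hc y)).clm_apply (hc w))).congr_of_eventuallyEq
      (by filter_upwards [(D.isOpen_chartDomain hq.1).mem_nhds hq] with r hr
          exact D.mulExt_assoc hr.1 hr.2 x y w))
  have hds : ∀ x y, fderiv ℂ (mHat L A H) q ds x y =
      fderiv ℂ (dlamHat L A) q x y • (ds : (ι → ℂ) × ℂ) := fun x y => by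
    rw [D.fderiv_mHat hq, D.fderiv_dlamHat_symm hq ds x, D.fderiv_dlamHat_symm hq ds y]
    refine Prod.ext ?_ ?_
    · simp [ds]
    · simp only [ds, Prod.mk_zero_zero]; simp; ring
  have hs : ∀ x, mHat L A H q x ds = dlamHat L A q x • (ds : (ι → ℂ) × ℂ) := fun x => by
    rw [mHat, mulExt_ds, dlamHat]; simp [ds]
  have hs' : ∀ x, mHat L A H q ds x = dlamHat L A q x • (ds : (ι → ℂ) × ℂ) := fun x =>
    (D.mulExt_comm _ _ _ _).trans (hs x)
  have h2 := congrArg Prod.snd (DFunLike.congr_fun h ds)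
  simp [hds, hs, hs'] at h2
  simp [ds] at h2
  linear_combination h2

/-- The product on the extension is a closed one-form with values in endomorphisms. -/
theorem mHat_closed (w x y : (ι → ℂ) × ℂ) :
    fderiv ℂ (mHat L A H) q w x y = fderiv ℂ (mHat L A H) q x w y := by
  have hsnd : ∀ {q}, q ∈ L.chartDomain G A → (fderiv ℂ (mHat L A H) q w x y).2 =
      (fderiv ℂ (mHat L A H) q x w y).2 := fun {q} hq => by
    rw [D.fderiv_mHat hq, D.fderiv_mHat hq, D.fderiv_H_symm hq, D.fderiv_dlamHat_symm hq w x]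
    ring
  -- the derivative of the identity `dλ (x ⋆ y) = dλ x * dλ y`
  have hℓ : ∀ {q}, q ∈ L.chartDomain G A → ∀ w x, dlamHat L A q (fderiv ℂ (mHat L A H) q w x y) =
      fderiv ℂ (dlamHat L A) q w x * dlamHat L A q y +
        dlamHat L A q x * fderiv ℂ (dlamHat L A) q w y -
        fderiv ℂ (dlamHat L A) q w (mHat L A H q x y) := fun {q} hq w x => by
    have hm := (D.analyticAt_mHat hq).differentiableAt.hasFDerivAt
    have hd := (D.analyticAt_dlamHat hq).differentiableAt.hasFDerivAt
    have hc := fun x : (ι → ℂ) × ℂ => hasFDerivAt_const (𝕜 := ℂ) x q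
    have h := (hd.clm_apply ((hm.clm_apply (hc x)).clm_apply (hc y))).unique
      (((hd.clm_apply (hc x)).mul (hd.clm_apply (hc y))).congr_of_eventuallyEq
        (by filter_upwards [(D.isOpen_chartDomain hq.1).mem_nhds hq] with r hr
            exact D.dlamExt_mulExt hr.1 hr.2 x y))
    have h2 := DFunLike.congr_fun h w
    simp at h2
    linear_combination h2
  -- the difference of the first components does not depend on `s`, so it vanishes once `dλ` kills
  -- it at every `s`
  refine Prod.ext (sub_eq_zero.1 (D.eq_zero_of_dlamExt hq.1 (h := fun _ => 0)
    (fun _ _ => analyticAt_const) fun z hz => ?_).1) (hsnd hq)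
  obtain ⟨s, rfl⟩ := D.zOf_surj _ (D.flatCoord _ hq.1).1 z hz
  have hr : (q.1, s) ∈ L.chartDomain G A := ⟨hq.1, hz⟩
  have h1 : ((fderiv ℂ (mHat L A H) q w x y).1 - (fderiv ℂ (mHat L A H) q x w y).1, (0 : ℂ)) =
      fderiv ℂ (mHat L A H) (q.1, s) w x y - fderiv ℂ (mHat L A H) (q.1, s) x w y := by
    refine Prod.ext ?_ (sub_eq_zero.2 (hsnd hr)).symm
    rw [D.fderiv_mHat hq, D.fderiv_mHat hq, D.fderiv_mHat hr, D.fderiv_mHat hr]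
    rfl
  have h2 := D.fderiv_dlamHat_mHat hr w y x
  have h3 : mHat L A H (q.1, s) x y = mHat L A H (q.1, s) y x := D.mulExt_comm _ _ _ _
  change dlamHat L A (q.1, s) _ = 0
  rw [h1, map_sub, hℓ hr, hℓ hr, D.fderiv_dlamHat_symm hr x w, h3]
  rw [D.fderiv_dlamHat_symm hr (mHat L A H _ w y), D.fderiv_dlamHat_symm hr y x] at h2
  linear_combination h2

end FlatData
end LGModel

end

section

namespace LGModel

variable {κ ι : Type} [Fintype κ] [Fintype ι] [DecidableEq ι]
  {L : LGModel κ ι} {A : (ι → ℂ) → κ → ℂ} {G : Set (ι → ℂ)}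
  {H : ι → ι → (ι → ℂ) → ℂ → ℂ} {η₀ : ι → ι → ℂ} {e : (ι → ℂ) × ℂ}

/-! ### The rank-1 extension -/
/-- The parametrisation of the extension by its flat coordinates `(t, s)`. -/
def paramHat (A : (ι → ℂ) → κ → ℂ) (q : (ι → ℂ) × ℂ) : (κ → ℂ) × ℂ := (A q.1, q.2)

/-- The metric `η ⊕ ds²`, which is constant in the flat coordinates `(t, s)`. -/
def formHat (η₀ : ι → ι → ℂ) : ((ι → ℂ) × ℂ) →L[ℂ] ((ι → ℂ) × ℂ) →L[ℂ] ℂ :=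
  LinearMap.toContinuousBilinearMap ((bil η₀).compl₁₂ (LinearMap.fst ℂ _ ℂ) (LinearMap.fst ℂ _ ℂ) +
    (LinearMap.mul ℂ ℂ).compl₁₂ (LinearMap.snd ℂ _ ℂ) (LinearMap.snd ℂ _ ℂ))

theorem formHat_apply (η₀ : ι → ι → ℂ) (x y : (ι → ℂ) × ℂ) :
    formHat η₀ x y = bil η₀ x.1 y.1 + x.2 * y.2 := rfl

theorem frame_congr {a : (ι → ℂ) → κ → ℂ} {t : ι → ℂ} (h : a =ᶠ[𝓝 t] A) (α : ι) :
    frame a t α = frame A t α := by rw [frame, frame, h.fderiv_eq]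

theorem gram_congr {a : (ι → ℂ) → κ → ℂ} {t : ι → ℂ} (h : a =ᶠ[𝓝 t] A) :
    L.gram a t = L.gram A t := by
  ext α β
  simp only [gram, Matrix.of_apply, frame_congr h, h.eq_of_nhds]

theorem structConst_congr {a : (ι → ℂ) → κ → ℂ} {t : ι → ℂ} (h : a =ᶠ[𝓝 t] A) (α β δ : ι) :
    L.structConst a t α β δ = L.structConst A t α β δ := by
  simp only [structConst, gram_congr h, frame_congr h, h.eq_of_nhds]

namespace FlatParam

variable (D : L.FlatParam A G)
include D

theorem image_paramHat : paramHat A '' L.chartDomain G A = L.extDomain := by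
  ext ⟨a, s⟩
  refine ⟨?_, fun ⟨ha, hs⟩ => ?_⟩
  · rintro ⟨q, hq, h⟩
    exact h ▸ ⟨(D.flatCoord _ hq.1).1, hq.2⟩
  · obtain ⟨t, ht, rfl⟩ := D.surj a ha
    exact ⟨(t, s), ⟨ht, hs⟩, rfl⟩

theorem fderiv_paramHat {q : (ι → ℂ) × ℂ} (hq : q.1 ∈ G) (x : (ι → ℂ) × ℂ) :
    fderiv ℂ (paramHat A) q x = (fderiv ℂ A q.1 x.1, x.2) := by
  have h : HasFDerivAt (paramHat A) _ q := (HasFDerivAt.comp (f := Prod.fst) q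
    (D.analytic _ hq).differentiableAt.hasFDerivAt hasFDerivAt_fst).prodMk hasFDerivAt_snd
  rw [h.fderiv]; rfl

variable {W : Set (ι → ℂ)} {a : (ι → ℂ) → κ → ℂ} (h : L.IsFlatChart W a)
include h

/-- Every flat chart is a local piece of the parametrisation `A`. -/
theorem chart_eq {t : ι → ℂ} (ht : t ∈ W) : t ∈ G ∧ a =ᶠ[𝓝 t] A := by
  have h1 : ∀ t ∈ W, t ∈ G ∧ A t = a t := fun t ht =>
    D.of_flatCoord _ (h.2.2 t ht).1 t (h.2.2 t ht).2
  exact ⟨(h1 t ht).1, by filter_upwards [h.1.mem_nhds ht] with u hu using (h1 u hu).2.symm⟩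

theorem mem_chartDomain {q : (ι → ℂ) × ℂ} (hq : q ∈ L.chartDomain W a) :
    q ∈ L.chartDomain G A ∧ a =ᶠ[𝓝 q.1] A :=
  have h2 := D.chart_eq h hq.1
  ⟨⟨h2.1, h2.2.eq_of_nhds ▸ hq.2⟩, h2.2⟩

end FlatParam

namespace FlatData

variable (D : L.FlatData A G H η₀ e)
include D

theorem exists_flatFManifold_ext :
    ∃ S : FlatFManifold L.extDomain,
      (∀ q ∈ L.chartDomain G A, ∀ x y : (ι → ℂ) × ℂ, secondDeriv (paramHat A) q x y +
        S.conn (paramHat A q) (fderiv ℂ (paramHat A) q x) (fderiv ℂ (paramHat A) q y) = 0) ∧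
      ∀ q ∈ L.chartDomain G A, ∀ x y : (ι → ℂ) × ℂ, S.mul (paramHat A q)
        (fderiv ℂ (paramHat A) q x) (fderiv ℂ (paramHat A) q y) =
          fderiv ℂ (paramHat A) q (mHat L A H q x y) := by
  rw [← D.image_paramHat]
  refine exists_flatFManifold (A := paramHat A) (e := e)
    (isOpen_iff_mem_nhds.2 fun q hq => (D.isOpen_chartDomain hq.1).mem_nhds hq)
    (fun q hq => (AnalyticAt.comp (f := Prod.fst) (D.analytic _ hq.1) analyticAt_fst).prod
      analyticAt_snd)
    (fun q hq => ?_) (by rw [D.image_paramHat]; exact D.isOpen_extDomain)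
    (b := fun p X Y => L.metric p.1 X.1 Y.1 + X.2 * Y.2) (β := formHat η₀)
    (fun x y => by rw [formHat_apply, formHat_apply, bil_comm D.gram_symm, mul_comm x.2])
    (fun x hx => Prod.ext (D.eq_zero_of_bil fun y => ?_) ?_) (fun q hq x y => ?_)
    (fun q hq => D.analyticAt_mHat hq) (fun q _ => D.mulExt_comm _ _)
    (fun q hq => D.mulExt_assoc hq.1 hq.2) (fun q hq => D.mHat_closed hq)
    (fun q hq => D.mulExt_unit hq.1 hq.2) (fun q hq q' hq' hA x y x' y' hx hy => ?_)
  · have : (fderiv ℂ (paramHat A) q : (ι → ℂ) × ℂ → (κ → ℂ) × ℂ) =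
        Prod.map (fderiv ℂ A q.1) id := by
      funext x; rw [D.fderiv_paramHat hq.1]; rfl
    rw [this]
    exact (D.fderiv_bijective hq.1).prodMap Function.bijective_id
  · simpa [formHat_apply] using hx (y, 0)
  · simpa [formHat_apply] using hx (0, 1)
  · rw [D.fderiv_paramHat hq.1, D.fderiv_paramHat hq.1, formHat_apply]
    simp only [paramHat]
    rw [D.metric_eq _ hq.1]
  · obtain ⟨h1, h2⟩ : A q.1 = A q'.1 ∧ q.2 = q'.2 := Prod.ext_iff.1 hA
    rw [D.fderiv_paramHat hq.1, D.fderiv_paramHat hq'.1, Prod.mk.injEq] at hx hy ⊢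
    -- two parameters of the same point: the two products have the same image under the
    -- multiplicative map `dlamExt`, which depends on the point only
    obtain ⟨v, hv⟩ := (D.fderiv_bijective hq.1).2 (fderiv ℂ A q'.1 (mHat L A H q' x' y').1)
    have hℓ : ∀ z ∉ L.poles (A q.1), ∀ w w' : (ι → ℂ) × ℂ, fderiv ℂ A q.1 w.1 =
        fderiv ℂ A q'.1 w'.1 → w.2 = w'.2 → dlamExt L A q.1 z w = dlamExt L A q'.1 z w' :=
      fun z hz w w' h3 h4 => by
        rw [D.dlamExt_apply hq.1 hz, D.dlamExt_apply hq'.1 (h1 ▸ hz), h1, h3, h4]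
    have hm := fun {t} (ht : t ∈ G) {z} (hz : z ∉ L.poles (A t)) (x y : (ι → ℂ) × ℂ) =>
      AnalyticAt.comp (g := Prod.snd) (analyticAt_snd (𝕜 := ℂ))
        (((D.analyticAt_mulExt ht hz).along_snd.clm_apply_apply
          (analyticAt_const (v := x))).clm_apply_apply (analyticAt_const (v := y)))
    have h3 := D.eq_zero_of_dlamExt hq.1 (x := (mHat L A H q x y).1 - v)
      (h := fun z => (mulExt L A H q.1 z x y).2 - (mulExt L A H q'.1 z x' y').2)
      (fun z hz => (hm hq.1 hz x y).sub (hm hq'.1 (h1 ▸ hz) x' y')) fun z hz => by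
        change dlamExt L A q.1 z (mulExt L A H q.1 z x y - (v, (mulExt L A H q'.1 z x' y').2)) = 0
        rw [map_sub, D.dlamExt_mulExt hq.1 hz, hℓ z hz (v, _) (mulExt L A H q'.1 z x' y') hv rfl,
          D.dlamExt_mulExt hq'.1 (h1 ▸ hz), hℓ z hz x x' hx.1 hx.2, hℓ z hz y y' hy.1 hy.2, sub_self]
    refine ⟨by rw [sub_eq_zero.1 h3.1, hv], (sub_eq_zero.1 (h3.2 _ hq.2)).trans ?_⟩
    rw [h2]
    rfl

/-- The product is a Hessian by `mHat_closed`; the last component of its vector potential is the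
required function. -/
theorem exists_isOpenPotential {W : Set (ι → ℂ)} {a : (ι → ℂ) → κ → ℂ}
    (h : L.IsFlatChart W a) {U : Set ((ι → ℂ) × ℂ)} (hU : U ⊆ L.chartDomain W a) (ho : IsOpen U)
    (hc : Convex ℝ U) : ∃ Ω, L.IsOpenPotential a U Ω := by
  have hU' : ∀ q ∈ U, q ∈ L.chartDomain G A := fun q hq => (D.mem_chartDomain h (hU hq)).1
  obtain ⟨f, g, hfa, hf, hg⟩ := exists_hessian_potential ho hc (m := mHat L A H)
    (fun q hq => D.analyticAt_mHat (hU' q hq)) (fun q _ => D.mulExt_comm _ _)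
    (fun q hq => D.mHat_closed (hU' q hq))
  have hsd : ∀ q ∈ U, ∀ x y, secondDeriv (fun q => (f q).2) q x y = (mHat L A H q x y).2 :=
    fun q hq x y => by
    have h1 : ∀ᶠ r in 𝓝 q, HasFDerivAt (fun q => (f q).2)
        ((ContinuousLinearMap.snd ℂ _ _).comp (g r)) r := by
      filter_upwards [ho.mem_nhds hq] with r hr using (hf r hr).snd
    have h2 : HasFDerivAt (fun r => (ContinuousLinearMap.snd ℂ (ι → ℂ) ℂ).comp (g r)) _ q :=
      (hasFDerivAt_const _ q).clm_comp (hg q hq)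
    rw [secondDeriv_eq_of_hasFDerivAt h1 h2]
    simp
  refine ⟨fun q => (f q).2, fun q hq => (analyticAt_snd).comp (hfa q hq), fun q hq => ?_⟩
  obtain ⟨hqG, hev⟩ := D.mem_chartDomain h (hU hq)
  have hae := hev.eq_of_nhds
  simp only [hsd q hq, mHat, D.mulExt_comm _ _ ds, mulExt_ds, mulExt_dt, hae,
    D.dlamExt_apply hqG.1 hqG.2, frame, hev.fderiv_eq, D.hess_eq _ hqG.1 _ _ _ hqG.2, bil_single]
  simp [dt, ds, dlam]

/-- The first family of equations is the last component of
`(∂_α ⋆ ∂_β) ⋆ ∂_γ = ∂_α ⋆ (∂_β ⋆ ∂_γ)`, the second one is the division identity. -/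
theorem openWDVV {W : Set (ι → ℂ)} {a : (ι → ℂ) → κ → ℂ} (h : L.IsFlatChart W a)
    {U : Set ((ι → ℂ) × ℂ)} (hU : U ⊆ L.chartDomain W a) {Ω : (ι → ℂ) × ℂ → ℂ}
    (hΩ : L.IsOpenPotential a U Ω) : L.OpenWDVV a U Ω := by
  intro q hq
  obtain ⟨hqG, hev⟩ := D.mem_chartDomain h (hU hq)
  have hae := hev.eq_of_nhds
  obtain ⟨h1, h2, h3⟩ := hΩ.2 q hq
  have hd : ∀ x, dlamHat L A q x = _ := D.dlamExt_apply hqG.1 hqG.2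
  have h4 : ∀ α, secondDeriv Ω q (dt α) ds = dlamHat L A q (dt α) := fun α => by
    have hs := (hΩ.1 q hq).sndFDeriv_symm (dt α) ds
    rw [← fderiv_apply_const (hΩ.1 q hq).fderiv.differentiableAt,
      ← fderiv_apply_const (hΩ.1 q hq).fderiv.differentiableAt] at hs
    refine hs.trans ((h1 α).trans ?_)
    rw [frame_congr hev, hae, hd]
    simp [dt, frame]
  have h5 : ∀ α β, secondDeriv Ω q (dt α) (dt β) = H α β q.1 (L.zOf q.2) := fun α β => by
    rw [h3, frame_congr hev, frame_congr hev, hae, frame, frame, D.hess_eq _ hqG.1 _ _ _ hqG.2,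
      bil_single]
  have h6 : secondDeriv Ω q ds ds = dlamHat L A q ds := by
    rw [h2, hae, hd]
    simp [ds, dlam]
  have h7 : ∀ (x : (ι → ℂ) × ℂ) γ, (mulExt L A H q.1 (L.zOf q.2) x (dt γ)).2 =
      ∑ δ, x.1 δ * H δ γ q.1 (L.zOf q.2) + x.2 * dlamHat L A q (dt γ) := fun x γ => by
    rw [mulExt_apply, dlamHat]
    simp [bil_apply, Pi.single_apply, dt]
  simp only [h4, h5, h6, structConst_congr hev]
  refine ⟨fun α β γ => ?_, fun α β => ?_⟩
  · have h8 := congrArg Prod.snd ((D.mulExt_assoc hqG.1 hqG.2 (dt α) (dt β)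
      (dt γ)).trans (D.mulExt_comm _ _ _ _))
    rw [mulExt_dt, mulExt_dt, h7, h7] at h8
    exact h8
  · exact (dlamExt_eq_sum L A q.1 (L.zOf q.2) (_, _)).symm.trans
      (D.division_single hqG.1 α β hqG.2).symm

/-- The rank-1 extension of a space of superpotentials for which the basic facts are known. -/
theorem hasRankOneExtension : L.HasRankOneExtension where
  flat_cover a₀ ha := by
    obtain ⟨t, ht, rfl⟩ := D.surj a₀ ha
    exact ⟨G, A, ⟨D.isOpen, D.analytic, D.flatCoord⟩, t, ht, rfl⟩
  flat_local_iso W a h t ht := by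
    obtain ⟨h1, h2⟩ := D.chart_eq h ht
    rw [h2.fderiv_eq]
    exact D.fderiv_bijective h1
  flat_metric := ⟨Matrix.of η₀, D.det_ne_zero, fun W a h t ht => by
    obtain ⟨h1, h2⟩ := D.chart_eq h ht
    rw [gram_congr h2, D.gram_eq h1]⟩
  potential_exists W a h U hU ho hc := D.exists_isOpenPotential h hU ho hc
  potential_solves W a h U hU _ Ω hΩ := D.openWDVV h hU hΩ
  flat_F_manifold := by
    obtain ⟨S, hS1, hS2⟩ := D.exists_flatFManifold_ext
    refine ⟨S, fun W a h q hq x y => ?_, fun a s has => ?_⟩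
    · obtain ⟨hqG, hev⟩ := D.mem_chartDomain h hq
      have hq2 : (fun r : (ι → ℂ) × ℂ => (a r.1, r.2)) =ᶠ[𝓝 q] paramHat A := by
        filter_upwards [continuousAt_fst.eventually hev] with r hr
        rw [hr]; rfl
      have h1 : (fun r => fderiv ℂ (fun r : (ι → ℂ) × ℂ => (a r.1, r.2)) r y) =ᶠ[𝓝 q]
          fun r => fderiv ℂ (paramHat A) r y := by
        filter_upwards [hq2.fderiv (𝕜 := ℂ)] with r hr
        rw [hr]
      rw [secondDeriv, h1.fderiv_eq, hq2.fderiv_eq, hev.eq_of_nhds]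
      exact hS1 q hqG x y
    · obtain ⟨t, ht, rfl⟩ := D.surj a has.1
      have hq : (t, s) ∈ L.chartDomain G A := ⟨ht, has.2⟩
      have h1 : ∀ x y : (ι → ℂ) × ℂ, S.mul (A t, s) (fderiv ℂ A t x.1, x.2)
          (fderiv ℂ A t y.1, y.2) = (fderiv ℂ A t (mHat L A H (t, s) x y).1,
            (mHat L A H (t, s) x y).2) := fun x y => by
        have := hS2 (t, s) hq x y
        rwa [D.fderiv_paramHat ht, D.fderiv_paramHat ht, D.fderiv_paramHat ht] at this
      have h2 : ∀ x : (ι → ℂ) × ℂ, S.mul (A t, s) (fderiv ℂ A t x.1, x.2) (0, 1) =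
          (0, dlamExt L A t (L.zOf s) x) := fun x => by
        have := h1 x ds
        rw [mHat, mulExt_ds] at this
        simpa [ds] using this
      have h3 : ∀ X, ∃ x, fderiv ℂ A t x = X := (D.fderiv_bijective ht).2
      refine ⟨fun X Y => ?_, fun X => ?_, ?_⟩
      · obtain ⟨x, rfl⟩ := h3 X
        obtain ⟨y, rfl⟩ := h3 Y
        refine ⟨fderiv ℂ A t (prodF L A t x y), fun W => ?_, (h1 (x, 0) (y, 0)).trans ?_⟩
        · obtain ⟨w, rfl⟩ := h3 W
          refine (D.cubic_eq t ht x y _ (fun z => bil (fun α β => H α β t z) x y)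
            (fun z hz => D.H_analytic_z ht x y hz) (fun z hz => ?_) w).symm
          rw [← D.dlamExt_mulExt ht hz, mulExt_apply]
          simp
        · rw [D.hess_eq t ht x y _ has.2, mHat, mulExt_apply]
          simp
      · obtain ⟨x, rfl⟩ := h3 X
        rw [h2 (x, 0), D.dlamExt_apply ht has.2]
        simp
      · have := h2 ds
        rw [D.dlamExt_apply ht has.2] at this
        simpa [ds, dlam] using this

end FlatData
end LGModel

end

section

open Asymptotics Metric

/-! ### Taylor coefficients -/

/-- The coefficient of `u ^ m` in the Taylor expansion of `f` at `0`. -/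
def taylorCoeff (m : ℕ) (f : ℂ → ℂ) : ℂ := iteratedDeriv m f 0 / m.factorial

section Taylor

variable {f g : ℂ → ℂ}

theorem taylorCoeff_congr (h : f =ᶠ[𝓝 0] g) (m : ℕ) : taylorCoeff m f = taylorCoeff m g := by
  rw [taylorCoeff, taylorCoeff, (h.iteratedDeriv m).eq_of_nhds]

theorem taylorCoeff_zero (f : ℂ → ℂ) : taylorCoeff 0 f = f 0 := by simp [taylorCoeff]

theorem taylorCoeff_succ (m : ℕ) (f : ℂ → ℂ) :
    taylorCoeff (m + 1) f = taylorCoeff m (deriv f) / (m + 1) := by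
  rw [taylorCoeff, taylorCoeff, iteratedDeriv_succ', Nat.factorial_succ]
  push_cast
  rw [div_div, mul_comm (m.factorial : ℂ)]

theorem taylorCoeff_add (hf : AnalyticAt ℂ f 0) (hg : AnalyticAt ℂ g 0) (m : ℕ) :
    taylorCoeff m (fun u => f u + g u) = taylorCoeff m f + taylorCoeff m g := by
  rw [taylorCoeff, iteratedDeriv_fun_add hf.contDiffAt hg.contDiffAt, add_div]
  rfl

theorem taylorCoeff_const_mul (c : ℂ) (f : ℂ → ℂ) (m : ℕ) :
    taylorCoeff m (fun u => c * f u) = c * taylorCoeff m f := by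
  rw [taylorCoeff, iteratedDeriv_const_mul_field, mul_div_assoc]
  rfl

theorem taylorCoeff_neg (f : ℂ → ℂ) (m : ℕ) :
    taylorCoeff m (fun u => -f u) = -taylorCoeff m f := by
  have := taylorCoeff_const_mul (-1) f m
  simpa using this

theorem taylorCoeff_sub (hf : AnalyticAt ℂ f 0) (hg : AnalyticAt ℂ g 0) (m : ℕ) :
    taylorCoeff m (fun u => f u - g u) = taylorCoeff m f - taylorCoeff m g := by
  have := taylorCoeff_add hf hg.neg m
  simp only [sub_eq_add_neg]
  rw [← taylorCoeff_neg]
  exact this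

theorem taylorCoeff_fun_zero (m : ℕ) : taylorCoeff m (fun _ => 0) = 0 := by
  have := taylorCoeff_const_mul 0 (fun _ => 0) m
  simpa using this

theorem taylorCoeff_sum {α : Type*} (s : Finset α) {f : α → ℂ → ℂ}
    (hf : ∀ i ∈ s, AnalyticAt ℂ (f i) 0) (m : ℕ) :
    taylorCoeff m (fun u => ∑ i ∈ s, f i u) = ∑ i ∈ s, taylorCoeff m (f i) := by
  classical
  induction s using Finset.induction_on with
  | empty => simpa using taylorCoeff_fun_zero m
  | insert a s ha ih =>
    simp only [Finset.sum_insert ha]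
    rw [taylorCoeff_add (hf a (by simp)) (Finset.analyticAt_fun_sum _ fun i hi =>
      hf i (by simp [hi])), ih fun i hi => hf i (by simp [hi])]

theorem taylorCoeff_eq_zero_of_isBigO (hf : AnalyticAt ℂ f 0) {m : ℕ}
    (h : f =O[𝓝 0] fun u => u ^ (m + 1)) : taylorCoeff m f = 0 := by
  obtain ⟨C, hC⟩ := h.bound
  have key : ∀ᶠ r : ℝ in 𝓝[>] 0, ‖taylorCoeff m f‖ ≤ C * r := by
    obtain ⟨ε, hε, hball⟩ := Metric.eventually_nhds_iff.1 (hC.and hf.eventually_analyticAt)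
    filter_upwards [Ioo_mem_nhdsGT hε] with r hr
    have hmem : ∀ u ∈ closedBall (0 : ℂ) r, dist u 0 < ε := fun u hu =>
      lt_of_le_of_lt hu hr.2
    have hd : DiffContOnCl ℂ f (ball 0 r) := by
      apply DifferentiableOn.diffContOnCl
      rw [closure_ball _ hr.1.ne']
      exact fun u hu => (hball (hmem u hu)).2.differentiableAt.differentiableWithinAt
    have := Complex.norm_iteratedDeriv_le_of_forall_mem_sphere_norm_le m hr.1 hd
      (C := C * r ^ (m + 1)) (fun u hu => by
        have h1 := (hball (hmem u (sphere_subset_closedBall hu))).1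
        have h2 : ‖u‖ = r := by simpa using hu
        simpa [h2] using h1)
    rw [taylorCoeff, norm_div, Complex.norm_natCast]
    have hfac : (0 : ℝ) < m.factorial := by positivity
    rw [div_le_iff₀ hfac]
    refine this.trans (le_of_eq ?_)
    have := hr.1.ne'
    field_simp
    ring
  have hlim : Tendsto (fun r : ℝ => C * r) (𝓝[>] 0) (𝓝 0) := by
    have : Tendsto (fun r : ℝ => C * r) (𝓝 0) (𝓝 (C * 0)) := tendsto_id.const_mul C
    simpa using this.mono_left nhdsWithin_le_nhds
  have := ge_of_tendsto hlim key
  exact norm_le_zero_iff.1 this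

theorem taylorCoeff_pow (j m : ℕ) :
    taylorCoeff m (fun u => u ^ j) = if m = j then 1 else 0 := by
  induction m generalizing j with
  | zero =>
    rw [taylorCoeff_zero]
    rcases j with _ | j <;> simp
  | succ m ih =>
    rw [taylorCoeff_succ]
    have : deriv (fun u : ℂ => u ^ j) = fun u => (j : ℂ) * u ^ (j - 1) := by
      funext u; simp
    rw [this, taylorCoeff_const_mul, ih]
    rcases j with _ | j
    · simp
    · have h0 : ((m : ℂ) + 1) ≠ 0 := Nat.cast_add_one_ne_zero m
      by_cases h : m = j
      · subst h; simp [h0]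
      · simp [h]

theorem isBigO_sub_taylor (hf : AnalyticAt ℂ f 0) (m : ℕ) :
    (fun u => f u - ∑ j ∈ Finset.range m, taylorCoeff j f * u ^ j) =O[𝓝 0] fun u => u ^ m := by
  have h := hf.hasFPowerSeriesAt.isBigO_sub_partialSum_pow m
  refine (IsBigO.congr' h (Eventually.of_forall fun u => ?_) .rfl).trans ?_
  · simp only [zero_add, FormalMultilinearSeries.partialSum]
    congr 1
    refine Finset.sum_congr rfl fun j _ => ?_
    rw [FormalMultilinearSeries.ofScalars_apply_eq, smul_eq_mul, taylorCoeff]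
  · exact IsBigO.of_bound 1 (Eventually.of_forall fun u => by simp)

theorem isBigO_pow_pow {j m : ℕ} (h : j ≤ m) :
    (fun u : ℂ => u ^ m) =O[𝓝 0] fun u => u ^ j := by
  obtain ⟨k, rfl⟩ := Nat.exists_eq_add_of_le h
  have hk : (fun u : ℂ => u ^ k) =O[𝓝 0] fun _ => (1 : ℂ) :=
    ((continuous_pow k).tendsto (0 : ℂ)).isBigO_one ℂ
  simpa [pow_add] using (isBigO_refl (fun u : ℂ => u ^ j) (𝓝 0)).mul hk

theorem taylorCoeff_eq_of_isBigO (hf : AnalyticAt ℂ f 0) {c : ℕ → ℂ} {N : ℕ}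
    (h : (fun u => f u - ∑ j ∈ Finset.range N, c j * u ^ j) =O[𝓝 0] fun u => u ^ N) {j : ℕ}
    (hj : j < N) : taylorCoeff j f = c j := by
  have hp : ∀ i, AnalyticAt ℂ (fun u : ℂ => u ^ i) 0 := fun i => analyticAt_id.pow i
  have hs : AnalyticAt ℂ (fun u => ∑ i ∈ Finset.range N, c i * u ^ i) 0 :=
    Finset.analyticAt_fun_sum _ fun i _ => analyticAt_const.mul (hp i)
  have h1 := taylorCoeff_eq_zero_of_isBigO (m := j) (hf.sub hs) (h.trans (isBigO_pow_pow hj))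
  have h2 := taylorCoeff_sub hf hs j
  rw [show (fun u => f u - ∑ i ∈ Finset.range N, c i * u ^ i) =
    f - fun u => ∑ i ∈ Finset.range N, c i * u ^ i from rfl, h1,
    taylorCoeff_sum _ fun i _ => analyticAt_const.fun_mul (hp i)] at h2
  simp only [taylorCoeff_const_mul, taylorCoeff_pow] at h2
  rw [eq_comm, sub_eq_zero] at h2
  rw [h2]
  simp [hj]

theorem taylorCoeff_pow_mul (hf : AnalyticAt ℂ f 0) (k m : ℕ) :
    taylorCoeff m (fun u => u ^ k * f u) = if k ≤ m then taylorCoeff (m - k) f else 0 := by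
  have hp : ∀ i, AnalyticAt ℂ (fun u : ℂ => u ^ i) 0 := fun i => analyticAt_id.pow i
  have h := isBigO_sub_taylor hf (m + 1)
  have h1 : (fun u => u ^ k * f u - ∑ j ∈ Finset.range (m + 1 + k),
      (if k ≤ j then taylorCoeff (j - k) f else 0) * u ^ j) =O[𝓝 0] fun u => u ^ (m + 1 + k) := by
    have h2 := (isBigO_refl (fun u : ℂ => u ^ k) (𝓝 0)).mul h
    refine h2.congr (fun u => ?_) (fun u => by rw [← pow_add, add_comm])
    rw [mul_sub, Finset.range_eq_Ico (m + 1 + k),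
      ← Finset.sum_Ico_consecutive (fun j => (if k ≤ j then taylorCoeff (j - k) f else 0) * u ^ j)
      (Nat.zero_le k) (Nat.le_add_left k (m + 1)), Finset.mul_sum]
    congr 1
    rw [Finset.sum_eq_zero (s := Finset.Ico 0 k), zero_add, Finset.sum_Ico_eq_sum_range,
      Nat.add_sub_cancel]
    · refine Finset.sum_congr rfl fun j _ => ?_
      rw [if_pos (Nat.le_add_right k j), Nat.add_sub_cancel_left, pow_add]
      ring
    · intro j hj
      rw [if_neg (by simp at hj; omega), zero_mul]
  exact taylorCoeff_eq_of_isBigO ((hp k).mul hf) h1 (by omega)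

/-- Taylor coefficients of a function that depends analytically on a parameter. -/
theorem analyticAt_taylorCoeff_and_fderiv {E : Type*} [NormedAddCommGroup E] [NormedSpace ℂ E]
    {F : E → ℂ → ℂ} {x : E} (hF : AnalyticAt ℂ (fun q : E × ℂ => F q.1 q.2) (x, 0)) (m : ℕ) :
    AnalyticAt ℂ (fun y => taylorCoeff m (F y)) x ∧
    ∀ v, fderiv ℂ (fun y => taylorCoeff m (F y)) x v =
      taylorCoeff m (fun u => fderiv ℂ (fun y => F y u) x v) := by
  induction m generalizing F with
  | zero =>
    simp only [taylorCoeff_zero]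
    exact ⟨AnalyticAt.comp (g := fun q : E × ℂ => F q.1 q.2) (f := fun y => (y, 0)) hF
      (analyticAt_id.prod analyticAt_const), fun v => by simp⟩
  | succ m ih =>
    have hslice : ∀ {q : E × ℂ}, AnalyticAt ℂ (fun q : E × ℂ => F q.1 q.2) q →
        HasDerivAt (F q.1) (fderiv ℂ (fun q : E × ℂ => F q.1 q.2) q (0, 1)) q.2 ∧
        ∀ v, fderiv ℂ (fun y => F y q.2) q.1 v =
          fderiv ℂ (fun q : E × ℂ => F q.1 q.2) q (v, 0) := by
      intro q hq
      have h := hq.differentiableAt.hasFDerivAt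
      refine ⟨HasFDerivAt.comp_hasDerivAt (f := fun u : ℂ => (q.1, u)) q.2 h
        ((hasDerivAt_const q.2 q.1).prodMk (hasDerivAt_id q.2)), fun v => ?_⟩
      have h2 : HasFDerivAt (fun y => F y q.2) _ q.1 :=
        HasFDerivAt.comp (f := fun y : E => (y, q.2)) q.1 h
          ((hasFDerivAt_id _).prodMk (hasFDerivAt_const _ _))
      rw [h2.fderiv]; simp
    set F1 : E → ℂ → ℂ := fun y u => fderiv ℂ (fun q : E × ℂ => F q.1 q.2) (y, u) (0, 1) with hF1
    have hF1a : AnalyticAt ℂ (fun q : E × ℂ => F1 q.1 q.2) (x, 0) :=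
      hF.fderiv.clm_apply_apply analyticAt_const
    obtain ⟨ih1, ih2⟩ := ih hF1a
    have hev := hF.eventually_analyticAt
    have hderiv : ∀ᶠ y in 𝓝 x, deriv (F y) =ᶠ[𝓝 0] F1 y := by
      have := hev.curry_nhds
      filter_upwards [this] with y hy
      filter_upwards [hy] with u hu using (hslice hu).1.deriv
    have heq : (fun y => taylorCoeff (m + 1) (F y)) =ᶠ[𝓝 x]
        fun y => taylorCoeff m (F1 y) / (m + 1) := by
      filter_upwards [hderiv] with y hy
      rw [taylorCoeff_succ, taylorCoeff_congr hy]
    refine ⟨(ih1.div_const).congr heq.symm, fun v => ?_⟩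
    rw [heq.fderiv_eq, taylorCoeff_succ]
    have h3 : fderiv ℂ (fun y => taylorCoeff m (F1 y) / (m + 1)) x v =
        fderiv ℂ (fun y => taylorCoeff m (F1 y)) x v / (m + 1) := by
      simp only [div_eq_mul_inv]
      rw [fderiv_mul_const ih1.differentiableAt]
      simp [mul_comm]
    rw [h3, ih2]
    congr 1
    refine taylorCoeff_congr ?_ m
    have hev0 : ∀ᶠ u in 𝓝 (0 : ℂ), AnalyticAt ℂ (fun q : E × ℂ => F q.1 q.2) (x, u) :=
      (Continuous.tendsto (by fun_prop : Continuous fun u : ℂ => (x, u)) 0).eventually hev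
    filter_upwards [hev0, hev0.eventually_nhds] with u hu hu2
    have hA : ∀ w : E × ℂ, HasFDerivAt (fun q => fderiv ℂ (fun q : E × ℂ => F q.1 q.2) q w)
        ((fderiv ℂ (fderiv ℂ (fun q : E × ℂ => F q.1 q.2)) (x, u)).flip w) (x, u) := by
      intro w
      have := hu.fderiv.differentiableAt.hasFDerivAt.clm_apply (hasFDerivAt_const w (x, u))
      refine this.congr_fderiv ?_
      ext y <;> simp
    have h4 : fderiv ℂ (fun y => F1 y u) x v =
        fderiv ℂ (fderiv ℂ (fun q : E × ℂ => F q.1 q.2)) (x, u) (v, 0) (0, 1) := by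
      have : HasFDerivAt (fun y => F1 y u) _ x :=
        HasFDerivAt.comp (f := fun y : E => (y, u)) x (hA (0, 1))
          ((hasFDerivAt_id _).prodMk (hasFDerivAt_const _ _))
      rw [this.fderiv]; simp
    have h5 : deriv (fun u => fderiv ℂ (fun y => F y u) x v) u =
        fderiv ℂ (fderiv ℂ (fun q : E × ℂ => F q.1 q.2)) (x, u) (0, 1) (v, 0) := by
      have h6 : (fun u => fderiv ℂ (fun y => F y u) x v) =ᶠ[𝓝 u]
          fun u => fderiv ℂ (fun q : E × ℂ => F q.1 q.2) (x, u) (v, 0) := by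
        filter_upwards [hu2] with u' hu' using (hslice hu').2 v
      rw [h6.deriv_eq]
      have := HasFDerivAt.comp_hasDerivAt (f := fun u : ℂ => (x, u)) u (hA (v, 0))
        ((hasDerivAt_const u x).prodMk (hasDerivAt_id u))
      have h7 := this.deriv
      simpa [Function.comp_def] using h7
    rw [h4, h5, hu.contDiffAt.isSymmSndFDerivAt_of_omega]

/-- `[u ^ m] B / (1 - c X)` when `X` vanishes at `0`. -/
theorem taylorCoeff_div_one_sub {B X : ℂ → ℂ} (hB : AnalyticAt ℂ B 0) (hX : AnalyticAt ℂ X 0)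
    (hX0 : X 0 = 0) (c : ℂ) (m : ℕ) :
    taylorCoeff m (fun u => B u / (1 - c * X u)) =
      ∑ j ∈ Finset.range (m + 1), taylorCoeff m (fun u => B u * X u ^ j) * c ^ j := by
  have hne : ∀ᶠ u in 𝓝 (0 : ℂ), 1 - c * X u ≠ 0 := by
    have : ContinuousAt (fun u => 1 - c * X u) 0 :=
      continuousAt_const.sub (continuousAt_const.mul hX.continuousAt)
    exact this.eventually_ne (by simp [hX0])
  have hden : AnalyticAt ℂ (fun u => 1 - c * X u) 0 := analyticAt_const.sub (analyticAt_const.mul hX)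
  have ht : ∀ j, AnalyticAt ℂ (fun u => B u * X u ^ j) 0 := fun j => hB.mul (hX.pow j)
  have hquot : AnalyticAt ℂ (fun u => B u / (1 - c * X u)) 0 := hB.div hden (by simp [hX0])
  have hXO : X =O[𝓝 0] fun u => u := by
    have := hX.differentiableAt.isBigO_sub
    simpa [hX0] using this
  have hrem : taylorCoeff m (fun u => (B u / (1 - c * X u)) * (c * X u) ^ (m + 1)) = 0 := by
    refine taylorCoeff_eq_zero_of_isBigO (hquot.fun_mul ((analyticAt_const.fun_mul hX).fun_pow _)) ?_
    have h1 : (fun u => B u / (1 - c * X u)) =O[𝓝 0] fun _ => (1 : ℂ) :=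
      hquot.continuousAt.tendsto.isBigO_one ℂ
    have h2 : (fun u => (c * X u) ^ (m + 1)) =O[𝓝 0] fun u => u ^ (m + 1) :=
      (hXO.const_mul_left c).pow _
    simpa using h1.mul h2
  have h3 : (fun u => B u / (1 - c * X u)) =ᶠ[𝓝 0] fun u =>
      (∑ j ∈ Finset.range (m + 1), c ^ j * (B u * X u ^ j)) +
        (B u / (1 - c * X u)) * (c * X u) ^ (m + 1) := by
    filter_upwards [hne] with u hu
    have hg := geom_sum_mul_neg (c * X u) (m + 1)
    rw [div_eq_iff hu, add_mul]
    have : ∑ j ∈ Finset.range (m + 1), c ^ j * (B u * X u ^ j) =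
        B u * ∑ j ∈ Finset.range (m + 1), (c * X u) ^ j := by
      rw [Finset.mul_sum]
      exact Finset.sum_congr rfl fun j _ => by rw [mul_pow]; ring
    rw [this, mul_assoc, hg]
    field_simp
    ring
  rw [taylorCoeff_congr h3, taylorCoeff_add (Finset.analyticAt_fun_sum _ fun j _ =>
    analyticAt_const.fun_mul (ht j)) (hquot.fun_mul ((analyticAt_const.fun_mul hX).fun_pow _)), hrem,
    add_zero, taylorCoeff_sum _ fun j _ => analyticAt_const.fun_mul (ht j)]
  exact Finset.sum_congr rfl fun j _ => by rw [taylorCoeff_const_mul, mul_comm]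

/-- `[u ^ m] B / (z - Y)`, as a polynomial in `1 / (z - Y 0)`. -/
theorem taylorCoeff_div_sub {B Y : ℂ → ℂ} (hB : AnalyticAt ℂ B 0) (hY : AnalyticAt ℂ Y 0)
    {z : ℂ} (hz : z ≠ Y 0) (m : ℕ) :
    taylorCoeff m (fun u => B u / (z - Y u)) =
      ∑ j ∈ Finset.range (m + 1), taylorCoeff m (fun u => B u * (Y u - Y 0) ^ j) *
        ((z - Y 0)⁻¹) ^ (j + 1) := by
  have hz' : z - Y 0 ≠ 0 := sub_ne_zero.2 hz
  have h1 : (fun u => B u / (z - Y u)) = fun u =>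
      (z - Y 0)⁻¹ * (B u / (1 - (z - Y 0)⁻¹ * (Y u - Y 0))) := by
    funext u
    have : z - Y u = (z - Y 0) * (1 - (z - Y 0)⁻¹ * (Y u - Y 0)) := by field_simp; ring
    rw [this, div_mul_eq_div_div_swap, div_eq_inv_mul (B u / _)]
  rw [h1, taylorCoeff_const_mul, taylorCoeff_div_one_sub hB (hY.fun_sub analyticAt_const) (by simp),
    Finset.mul_sum]
  exact Finset.sum_congr rfl fun j _ => by rw [pow_succ]; ring

theorem taylorCoeff_inv_sub {w : ℂ} (hw : w ≠ 0) (m : ℕ) :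
    taylorCoeff m (fun u => (w - u)⁻¹) = (w ^ (m + 1))⁻¹ := by
  have := taylorCoeff_div_sub (B := fun _ => 1) (Y := fun u => u) analyticAt_const analyticAt_id
    hw m
  simp only [one_div, sub_zero, one_mul, taylorCoeff_pow] at this
  rw [this]
  simp

/-- `[u ^ n] log (1 - c X)` when `X` vanishes at `0`. -/
theorem taylorCoeff_log_one_sub {X : ℂ → ℂ} (hX : AnalyticAt ℂ X 0) (hX0 : X 0 = 0) (c : ℂ)
    (n : ℕ) : taylorCoeff n (fun u => Complex.log (1 - c * X u)) =
      -∑ j ∈ Finset.range (n + 1), taylorCoeff n (fun u => X u ^ j) / j * c ^ j := by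
  have hXO : X =O[𝓝 0] fun u => u := by
    have := hX.differentiableAt.isBigO_sub
    simpa [hX0] using this
  have hlog : AnalyticAt ℂ (fun u => Complex.log (1 - c * X u)) 0 :=
    (analyticAt_const.sub (analyticAt_const.mul hX)).clog (by simp [hX0])
  have hp : ∀ j, AnalyticAt ℂ (fun u => X u ^ j) 0 := fun j => hX.pow j
  have hs : AnalyticAt ℂ (fun u => ∑ j ∈ Finset.range (n + 1), (-(c ^ j / j)) * X u ^ j) 0 :=
    Finset.analyticAt_fun_sum _ fun j _ => analyticAt_const.mul (hp j)
  have hlim : Tendsto (fun u => -(c * X u)) (𝓝 0) (𝓝 0) := by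
    have := (analyticAt_const.fun_mul hX : AnalyticAt ℂ (fun u => c * X u) 0).fun_neg.continuousAt.tendsto
    simpa [hX0] using this
  have h1 := (Complex.log_sub_logTaylor_isBigO n).comp_tendsto hlim
  have h2 : (fun u => Complex.log (1 - c * X u) -
      ∑ j ∈ Finset.range (n + 1), (-(c ^ j / j)) * X u ^ j) =O[𝓝 0] fun u => u ^ (n + 1) := by
    refine (h1.congr_left fun u => ?_).trans ?_
    · simp only [Function.comp, Complex.logTaylor, ← sub_eq_add_neg]
      congr 1
      refine Finset.sum_congr rfl fun j _ => ?_
      rw [neg_pow (c * X u), mul_pow c, pow_succ]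
      have : (-1 : ℂ) ^ j * (-1) ^ j = 1 := by rw [← mul_pow]; simp
      linear_combination -(c ^ j * X u ^ j / j) * this
    · exact ((hXO.const_mul_left c).neg_left).pow _
  have h3 := taylorCoeff_eq_zero_of_isBigO (m := n) (hlog.sub hs) h2
  have h4 := taylorCoeff_sub hlog hs n
  rw [show (fun u => Complex.log (1 - c * X u) -
      ∑ j ∈ Finset.range (n + 1), (-(c ^ j / j)) * X u ^ j) =
      (fun u => Complex.log (1 - c * X u)) -
      fun u => ∑ j ∈ Finset.range (n + 1), (-(c ^ j / j)) * X u ^ j from rfl, h3,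
    taylorCoeff_sum _ fun j _ => analyticAt_const.fun_mul (hp j), eq_comm, sub_eq_zero] at h4
  rw [h4, ← Finset.sum_neg_distrib]
  exact Finset.sum_congr rfl fun j _ => by rw [taylorCoeff_const_mul]; ring

end Taylor

theorem exists_localInverse {Y : ℂ → ℂ} (hY : AnalyticAt ℂ Y 0) (hY' : deriv Y 0 ≠ 0) :
    ∃ v : ℂ → ℂ, AnalyticAt ℂ v (Y 0) ∧ v (Y 0) = 0 ∧ (∀ᶠ y in 𝓝 (Y 0), Y (v y) = y) ∧
      (∀ᶠ u in 𝓝 0, v (Y u) = u) := by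
  refine ⟨hY.hasStrictDerivAt.localInverse _ _ _ hY', hY.analyticAt_localInverse hY', ?_, ?_, ?_⟩
  · exact HasStrictFDerivAt.localInverse_apply_image ..
  · exact HasStrictDerivAt.eventually_right_inverse ..
  · exact HasStrictDerivAt.eventually_left_inverse ..

/-- The behaviour of `[u ^ m] B / (Y w - Y)` as `w → 0`: up to a bounded function it is the residue
term at `u = w`. The difference is the Taylor coefficient of a divided difference, which is bounded
by Cauchy's estimate. -/
theorem isBigO_taylorCoeff_div_sub {Y B : ℂ → ℂ} (hY : AnalyticAt ℂ Y 0) (hY' : deriv Y 0 ≠ 0)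
    (hB : AnalyticAt ℂ B 0) (m : ℕ) :
    (fun w => taylorCoeff m (fun u => B u / (Y w - Y u)) - B w / (w ^ (m + 1) * deriv Y w))
      =O[𝓝[≠] 0] fun _ => (1 : ℂ) := by
  set c : ℝ := ‖deriv Y 0‖ / 2 with hc
  have hY'n : 0 < ‖deriv Y 0‖ := norm_pos_iff.2 hY'
  have hc0 : 0 < c := half_pos hY'n
  set MB : ℝ := ‖B 0‖ + 1 with hMB
  have hMB0 : 0 < MB := by positivity
  have e1 : ∀ᶠ u in 𝓝 (0 : ℂ), ‖B u‖ < MB :=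
    hB.continuousAt.norm.eventually_lt continuousAt_const (by simp [hMB])
  have e2 : ∀ᶠ u in 𝓝 (0 : ℂ), c < ‖deriv Y u‖ :=
    continuousAt_const.eventually_lt hY.deriv.continuousAt.norm (by simp [hc]; exact hY')
  have e3 : ∀ᶠ p : ℂ × ℂ in 𝓝 (0, 0), c * ‖p.1 - p.2‖ ≤ ‖Y p.1 - Y p.2‖ := by
    have h1 := hY.hasStrictDerivAt.isLittleO.def hc0
    filter_upwards [h1] with p hp
    have h2 : ‖(p.1 - p.2) • deriv Y 0‖ = 2 * c * ‖p.1 - p.2‖ := by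
      rw [norm_smul, hc]; ring
    have h3 := norm_sub_norm_le ((p.1 - p.2) • deriv Y 0) (Y p.1 - Y p.2)
    rw [h2, norm_sub_rev (_ • _)] at h3
    have h4 : ‖Y p.1 - Y p.2 - (p.1 - p.2) • deriv Y 0‖ ≤ c * ‖p.1 - p.2‖ := by simpa using hp
    linarith
  obtain ⟨R₁, hR₁, hb1⟩ := Metric.eventually_nhds_iff.1
    ((e1.and e2).and (hY.eventually_analyticAt.and hB.eventually_analyticAt))
  obtain ⟨R₂, hR₂, hb2⟩ := Metric.eventually_nhds_iff.1 e3
  set R := min R₁ R₂ with hR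
  have hR0 : 0 < R := lt_min hR₁ hR₂
  have hb1' : ∀ u ∈ ball (0 : ℂ) R, (‖B u‖ < MB ∧ c < ‖deriv Y u‖) ∧
      (AnalyticAt ℂ Y u ∧ AnalyticAt ℂ B u) := fun u hu => hb1 (lt_of_lt_of_le hu (min_le_left _ _))
  have hb2' : ∀ u ∈ ball (0 : ℂ) R, ∀ w ∈ ball (0 : ℂ) R,
      c * ‖u - w‖ ≤ ‖Y u - Y w‖ := by
    intro u hu w hw
    refine hb2 (y := (u, w)) ?_
    rw [Prod.dist_eq]
    exact max_lt (lt_of_lt_of_le hu (min_le_right _ _)) (lt_of_lt_of_le hw (min_le_right _ _))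
  set r := R / 2 with hr
  have hr0 : 0 < r := half_pos hR0
  have hrR : r < R := half_lt_self hR0
  refine IsBigO.of_bound ((2 * (MB / c) / (r / 2)) / r ^ m) ?_
  rw [eventually_nhdsWithin_iff]
  filter_upwards [ball_mem_nhds (0 : ℂ) (half_pos hr0)] with w hw hw0
  have hw0 : w ≠ 0 := hw0
  have hwn : ‖w‖ < r / 2 := by simpa using hw
  have hwR : w ∈ ball (0 : ℂ) R := by simp; linarith
  set D := dslope Y w with hD
  have hDne : ∀ u ∈ ball (0 : ℂ) R, D u ≠ 0 := by
    intro u hu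
    by_cases huw : u = w
    · rw [hD, huw, dslope_same]
      exact norm_pos_iff.1 (hc0.trans (hb1' w hwR).1.2)
    · rw [hD, dslope_of_ne _ huw, slope_def_field]
      have h1 := hb2' u hu w hwR
      have h2 : 0 < ‖u - w‖ := norm_pos_iff.2 (sub_ne_zero.2 huw)
      exact div_ne_zero (norm_pos_iff.1 (lt_of_lt_of_le (mul_pos hc0 h2) h1)) (sub_ne_zero.2 huw)
  have hball : ball (0 : ℂ) R ∈ 𝓝 w := isOpen_ball.mem_nhds hwR
  have hDd : DifferentiableOn ℂ D (ball 0 R) := (Complex.differentiableOn_dslope hball).2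
    fun u hu => (hb1' u hu).2.1.differentiableAt.differentiableWithinAt
  set g : ℂ → ℂ := fun u => B u / D u with hg
  have hgd : DifferentiableOn ℂ g (ball 0 R) := DifferentiableOn.div
    (fun u hu => (hb1' u hu).2.2.differentiableAt.differentiableWithinAt) hDd hDne
  set h := dslope g w with hh
  have hhd : DifferentiableOn ℂ h (ball 0 R) := (Complex.differentiableOn_dslope hball).2 hgd
  have hgw : g w = B w / deriv Y w := by rw [hg]; simp [hD]
  have hfun : (fun u => B u / (Y w - Y u)) =ᶠ[𝓝 0] fun u => g w * (w - u)⁻¹ - h u := by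
    have : ∀ᶠ u in 𝓝 (0 : ℂ), u ≠ w := continuousAt_id.eventually_ne hw0.symm
    filter_upwards [this, ball_mem_nhds (0 : ℂ) hR0] with u huw huR
    have hu1 : u - w ≠ 0 := sub_ne_zero.2 huw
    have hu1' : w - u ≠ 0 := sub_ne_zero.2 (Ne.symm huw)
    have hDu : D u = (Y u - Y w) / (u - w) := by
      rw [hD, dslope_of_ne _ huw, slope_def_field]
    have hD0 := hDne u huR
    rw [hDu] at hD0
    have hYu : Y u - Y w ≠ 0 := fun h0 => hD0 (by rw [h0, zero_div])
    have hYu' : Y w - Y u ≠ 0 := fun h0 => hYu (by rw [← neg_sub, h0, neg_zero])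
    have hhu : h u = (g u - g w) / (u - w) := by
      rw [hh, dslope_of_ne _ huw, slope_def_field]
    have hgu : g u = B u * (u - w) / (Y u - Y w) := by
      rw [hg]; simp only [hDu]; field_simp
    rw [hhu, hgu]
    rw [show w - u = -(u - w) by ring, show Y w - Y u = -(Y u - Y w) by ring]
    field_simp
    ring
  have hhan : AnalyticAt ℂ h 0 := hhd.analyticAt (ball_mem_nhds _ hR0)
  have hinv : AnalyticAt ℂ (fun u : ℂ => (w - u)⁻¹) 0 :=
    (analyticAt_const.sub analyticAt_id).inv (by simpa using hw0)
  have htc : taylorCoeff m (fun u => B u / (Y w - Y u)) - B w / (w ^ (m + 1) * deriv Y w) =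
      -taylorCoeff m h := by
    rw [taylorCoeff_congr hfun, taylorCoeff_sub (analyticAt_const.fun_mul hinv) hhan,
      taylorCoeff_const_mul, taylorCoeff_inv_sub hw0, hgw]
    have : deriv Y w ≠ 0 := norm_pos_iff.1 (hc0.trans (hb1' w hwR).1.2)
    field_simp
    ring
  have hdc : DiffContOnCl ℂ h (ball 0 r) := by
    apply DifferentiableOn.diffContOnCl
    rw [closure_ball _ hr0.ne']
    exact hhd.mono (closedBall_subset_ball hrR)
  have hgbound : ∀ u ∈ sphere (0 : ℂ) r, ‖g u‖ ≤ MB / c ∧ r / 2 ≤ ‖u - w‖ := by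
    intro u hu
    have hun : ‖u‖ = r := by simpa using hu
    have huR : u ∈ ball (0 : ℂ) R := by simp [hun, hrR]
    have h1 : r / 2 ≤ ‖u - w‖ := by
      have := norm_sub_norm_le u w
      linarith
    have huw : u ≠ w := by
      intro h0; rw [h0, sub_self, norm_zero] at h1; linarith
    refine ⟨?_, h1⟩
    rw [hg]
    simp only [hD, dslope_of_ne _ huw, slope_def_field, norm_div]
    have h2 := hb2' u huR w hwR
    have h3 : 0 < ‖u - w‖ := by linarith
    gcongr
    · exact (hb1' u huR).1.1.le
    · rw [le_div_iff₀ h3]; exact h2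
  have hgwb : ‖g w‖ ≤ MB / c := by
    rw [hgw, norm_div]
    gcongr
    · exact (hb1' w hwR).1.1.le
    · exact (hb1' w hwR).1.2.le
  have hbound := Complex.norm_iteratedDeriv_le_of_forall_mem_sphere_norm_le m hr0 hdc
    (C := 2 * (MB / c) / (r / 2)) (fun u hu => by
      obtain ⟨h1, h2⟩ := hgbound u hu
      have huw : u ≠ w := by
        intro h0; rw [h0, sub_self, norm_zero] at h2; linarith
      rw [hh, dslope_of_ne _ huw, slope_def_field, norm_div]
      gcongr
      calc ‖g u - g w‖ ≤ ‖g u‖ + ‖g w‖ := norm_sub_le _ _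
        _ ≤ 2 * (MB / c) := by linarith)
  rw [htc, norm_neg, taylorCoeff, norm_div, Complex.norm_natCast]
  have hfac : (0 : ℝ) < m.factorial := by positivity
  rw [div_le_iff₀ hfac]
  refine hbound.trans (le_of_eq ?_)
  rw [norm_one]
  ring

end

section

open Polynomial Bornology Asymptotics Metric

/-! ### Laurent coefficients of functions with a finite polar part -/

section Residues

theorem eventually_cobounded_iff {P : ℂ → Prop} :
    (∀ᶠ z in cobounded ℂ, P z) ↔ ∃ R : ℝ, ∀ z, R ≤ ‖z‖ → P z := by
  rw [hasBasis_cobounded_norm.eventually_iff]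
  simp

theorem eventually_punctured_iff {P : ℂ → Prop} {p : ℂ} :
    (∀ᶠ z in 𝓝[≠] p, P z) ↔ ∃ ε > 0, ∀ z, z ≠ p → ‖z - p‖ < ε → P z := by
  rw [eventually_nhdsWithin_iff, Metric.eventually_nhds_iff]
  simp only [dist_eq_norm, mem_compl_iff, mem_singleton_iff]
  exact ⟨fun ⟨ε, h, H⟩ => ⟨ε, h, fun z h1 h2 => H h2 h1⟩,
    fun ⟨ε, h, H⟩ => ⟨ε, h, fun z h1 h2 => H z h2 h1⟩⟩

theorem ne_of_mem_sphere' {p z : ℂ} {r : ℝ} (hr : 0 < r) (hz : z ∈ sphere p r) : z ≠ p := by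
  rintro rfl
  simp at hz
  exact hr.ne hz

theorem circleIntegrable_zpow_mul {p : ℂ} {r : ℝ} (hr : 0 < r) (m : ℤ) {f : ℂ → ℂ}
    (hf : ContinuousOn f (sphere p r)) :
    CircleIntegrable (fun z => (z - p) ^ m * f z) p r := by
  apply ContinuousOn.circleIntegrable hr.le
  refine ContinuousOn.mul (fun z hz => ?_) hf
  have : z - p ≠ 0 := sub_ne_zero.2 (ne_of_mem_sphere' hr hz)
  exact ((continuousAt_id.sub continuousAt_const).zpow₀ m (Or.inl this)).continuousWithinAt

theorem circleIntegral_zpow (p : ℂ) {r : ℝ} (hr : 0 < r) (m : ℤ) :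
    (∮ z in C(p, r), (z - p) ^ m) = if m = -1 then 2 * Real.pi * Complex.I else 0 := by
  split_ifs with h
  · subst h
    simp only [zpow_neg_one]
    exact circleIntegral.integral_sub_center_inv p hr.ne'
  · exact circleIntegral.integral_sub_zpow_of_ne h p p r

theorem circleIntegral_zpow_mul_sum (p : ℂ) {r : ℝ} (hr : 0 < r) (m : ℤ) (s : Finset ℕ)
    (c : ℕ → ℂ) (e : ℕ → ℤ) :
    (∮ z in C(p, r), (z - p) ^ m * ∑ j ∈ s, c j * (z - p) ^ e j) =
      ∑ j ∈ s, c j * (if m + e j = -1 then 2 * Real.pi * Complex.I else 0) := by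
  have h1 : (∮ z in C(p, r), (z - p) ^ m * ∑ j ∈ s, c j * (z - p) ^ e j) =
      ∮ z in C(p, r), ∑ j ∈ s, c j * (z - p) ^ (m + e j) := by
    refine circleIntegral.integral_congr hr.le fun z hz => ?_
    have : z - p ≠ 0 := sub_ne_zero.2 (ne_of_mem_sphere' hr hz)
    simp only [Finset.mul_sum]
    exact Finset.sum_congr rfl fun j _ => by rw [zpow_add₀ this]; ring
  rw [h1, circleIntegral.integral_fun_sum]
  · refine Finset.sum_congr rfl fun j _ => ?_
    rw [circleIntegral.integral_const_mul, circleIntegral_zpow p hr]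
  · intro j _
    have := circleIntegrable_zpow_mul hr (m + e j) (p := p) (f := fun _ => c j) continuousOn_const
    simpa [mul_comm] using this

theorem norm_two_pi_I_inv_mul_le {c : ℂ} {C : ℝ} (h : ‖c‖ ≤ 2 * Real.pi * C) :
    ‖(2 * Real.pi * Complex.I)⁻¹ * c‖ ≤ C := by
  rw [norm_mul, norm_inv]
  have h1 : ‖(2 * Real.pi * Complex.I : ℂ)‖ = 2 * Real.pi := by
    simp [abs_of_pos Real.pi_pos]
  rw [h1, inv_mul_le_iff₀ Real.two_pi_pos]
  exact h

/-- Laurent coefficients of negative index are read off from the polar part. -/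
theorem laurentCoeff_eq {f : ℂ → ℂ} {p : ℂ} {Q : ℂ[X]} (hf : ∀ᶠ z in 𝓝[≠] p, ContinuousAt f z)
    (h : (fun z => f z - Q.eval (z - p)⁻¹) =O[𝓝[≠] p] fun _ => (1 : ℂ)) (k : ℕ) :
    laurentCoeff f p (-((k : ℤ) + 1)) = Q.coeff (k + 1) := by
  obtain ⟨C, hC⟩ := h.bound
  obtain ⟨ε, hε, H⟩ := eventually_punctured_iff.1 (hf.and hC)
  rw [laurentCoeff]
  apply Tendsto.limUnder_eq
  rw [tendsto_iff_norm_sub_tendsto_zero]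
  have hlim : Tendsto (fun r : ℝ => C * r) (𝓝[>] 0) (𝓝 0) := by
    have : Tendsto (fun r : ℝ => C * r) (𝓝 0) (𝓝 (C * 0)) := tendsto_id.const_mul C
    simpa using this.mono_left nhdsWithin_le_nhds
  refine squeeze_zero' (Eventually.of_forall fun _ => norm_nonneg _) ?_ hlim
  filter_upwards [Ioo_mem_nhdsGT (lt_min hε one_pos)] with r hr
  have hr0 : 0 < r := hr.1
  have hsph : ∀ z ∈ sphere p r, z ≠ p ∧ ‖z - p‖ = r ∧ ContinuousAt f z ∧
      ‖f z - Q.eval (z - p)⁻¹‖ ≤ C := by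
    intro z hz
    have h1 : ‖z - p‖ = r := by simpa [dist_eq_norm] using hz
    have h2 := ne_of_mem_sphere' hr0 hz
    have h3 := H z h2 (by rw [h1]; exact lt_of_lt_of_le hr.2 (min_le_left _ _))
    exact ⟨h2, h1, h3.1, by simpa using h3.2⟩
  have hfc : ContinuousOn f (sphere p r) := fun z hz =>
    (hsph z hz).2.2.1.continuousWithinAt
  have hQc : ContinuousOn (fun z => Q.eval (z - p)⁻¹) (sphere p r) := fun z hz => by
    have : z - p ≠ 0 := sub_ne_zero.2 (hsph z hz).1
    exact (Q.continuous.continuousAt.comp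
      ((continuousAt_id.sub continuousAt_const).inv₀ this)).continuousWithinAt
  have hexp : -(-((k : ℤ) + 1)) - 1 = k := by ring
  rw [hexp]
  have hQ : (∮ z in C(p, r), (z - p) ^ (k : ℤ) * Q.eval (z - p)⁻¹) =
      2 * Real.pi * Complex.I * Q.coeff (k + 1) := by
    have h1 : (∮ z in C(p, r), (z - p) ^ (k : ℤ) * Q.eval (z - p)⁻¹) =
        ∮ z in C(p, r), (z - p) ^ (k : ℤ) *
          ∑ j ∈ Finset.range (Q.natDegree + 1), Q.coeff j * (z - p) ^ (-(j : ℤ)) := by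
      congr 1; funext z
      rw [Polynomial.eval_eq_sum_range]
      simp
    rw [h1, circleIntegral_zpow_mul_sum p hr0]
    have h2 : ∀ j : ℕ, ((k : ℤ) + -(j : ℤ) = -1) ↔ j = k + 1 := by intro j; omega
    simp only [h2, mul_ite, mul_zero, Finset.sum_ite_eq', Finset.mem_range]
    split_ifs with h3
    · ring
    · rw [Polynomial.coeff_eq_zero_of_natDegree_lt (by omega), mul_zero]
  have hsub : (2 * Real.pi * Complex.I)⁻¹ * (∮ z in C(p, r), (z - p) ^ (k : ℤ) * f z) -
      Q.coeff (k + 1) = (2 * Real.pi * Complex.I)⁻¹ *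
        ∮ z in C(p, r), (z - p) ^ (k : ℤ) * (f z - Q.eval (z - p)⁻¹) := by
    simp only [mul_sub]
    rw [circleIntegral.integral_sub (circleIntegrable_zpow_mul hr0 _ hfc)
      (circleIntegrable_zpow_mul hr0 _ hQc), hQ, mul_sub, ← mul_assoc,
      inv_mul_cancel₀ Complex.two_pi_I_ne_zero, one_mul]
  rw [hsub]
  apply norm_two_pi_I_inv_mul_le
  have hC0 : 0 ≤ C := by
    have hz : p + r ∈ sphere p r := by simp [abs_of_pos hr0]
    exact (norm_nonneg _).trans (hsph _ hz).2.2.2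
  have := circleIntegral.norm_integral_le_of_norm_le_const hr0.le
    (f := fun z => (z - p) ^ (k : ℤ) * (f z - Q.eval (z - p)⁻¹)) (C := C) fun z hz => by
      obtain ⟨-, h1, -, h2⟩ := hsph z hz
      rw [norm_mul, norm_zpow, h1, zpow_natCast]
      have h3 : r ^ k ≤ 1 := pow_le_one₀ hr0.le (hr.2.le.trans (min_le_right _ _))
      calc r ^ k * _ ≤ 1 * C := mul_le_mul h3 h2 (norm_nonneg _) zero_le_one
        _ = C := one_mul C
  refine this.trans (le_of_eq (by ring))

/-- Laurent coefficients at infinity are read off from the polynomial part. -/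
theorem laurentCoeffInfty_eq {f : ℂ → ℂ} {Q : ℂ[X]}
    (hf : ∀ᶠ z in cobounded ℂ, ContinuousAt f z)
    (h : Tendsto (fun z => f z - Q.eval z) (cobounded ℂ) (𝓝 0)) (k : ℕ) :
    laurentCoeffInfty f k = Q.coeff k := by
  rw [laurentCoeffInfty]
  apply Tendsto.limUnder_eq
  rw [Metric.tendsto_atTop]
  intro ε hε
  have h1 : ∀ᶠ z in cobounded ℂ, ‖f z - Q.eval z‖ ≤ ε / 2 := by
    have := (tendsto_zero_iff_norm_tendsto_zero.1 h).eventually_le_const (half_pos hε)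
    exact this
  obtain ⟨R₀, H⟩ := eventually_cobounded_iff.1 (hf.and h1)
  refine ⟨max R₀ 1, fun r hr => ?_⟩
  have hr1 : 1 ≤ r := (le_max_right _ _).trans hr
  have hr0 : 0 < r := by linarith
  have hsph : ∀ z ∈ sphere (0 : ℂ) r, ‖z‖ = r ∧ ContinuousAt f z ∧
      ‖f z - Q.eval z‖ ≤ ε / 2 := by
    intro z hz
    have h1 : ‖z‖ = r := by simpa using hz
    exact ⟨h1, H z (by rw [h1]; exact (le_max_left _ _).trans hr)⟩
  have hfc : ContinuousOn f (sphere 0 r) := fun z hz => (hsph z hz).2.1.continuousWithinAt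
  have hQ : (∮ z in C(0, r), z ^ (-(k : ℤ) - 1) * Q.eval z) =
      2 * Real.pi * Complex.I * Q.coeff k := by
    have h1 : (∮ z in C(0, r), z ^ (-(k : ℤ) - 1) * Q.eval z) =
        ∮ z in C(0, r), (z - 0) ^ (-(k : ℤ) - 1) *
          ∑ j ∈ Finset.range (Q.natDegree + 1), Q.coeff j * (z - 0) ^ (j : ℤ) := by
      congr 1; funext z
      rw [Polynomial.eval_eq_sum_range]
      simp
    rw [h1, circleIntegral_zpow_mul_sum 0 hr0]
    have h2 : ∀ j : ℕ, (-(k : ℤ) - 1 + (j : ℤ) = -1) ↔ j = k := by intro j; omega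
    simp only [h2, mul_ite, mul_zero, Finset.sum_ite_eq', Finset.mem_range]
    split_ifs with h3
    · ring
    · rw [Polynomial.coeff_eq_zero_of_natDegree_lt (by omega), mul_zero]
  have hint := fun {f : ℂ → ℂ} (hf : ContinuousOn f (sphere 0 r)) =>
    circleIntegrable_zpow_mul hr0 (-(k : ℤ) - 1) hf
  simp only [sub_zero] at hint
  have hsub : (2 * Real.pi * Complex.I)⁻¹ * (∮ z in C(0, r), z ^ (-(k : ℤ) - 1) * f z) -
      Q.coeff k = (2 * Real.pi * Complex.I)⁻¹ *
        ∮ z in C(0, r), z ^ (-(k : ℤ) - 1) * (f z - Q.eval z) := by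
    simp only [mul_sub]
    rw [circleIntegral.integral_sub (hint hfc) (hint Q.continuous.continuousOn), hQ, mul_sub,
      ← mul_assoc, inv_mul_cancel₀ Complex.two_pi_I_ne_zero, one_mul]
  rw [dist_eq_norm, hsub]
  refine lt_of_le_of_lt (norm_two_pi_I_inv_mul_le (C := ε / 2) ?_) (half_lt_self hε)
  have := circleIntegral.norm_integral_le_of_norm_le_const hr0.le
    (f := fun z => z ^ (-(k : ℤ) - 1) * (f z - Q.eval z)) (C := r⁻¹ * (ε / 2)) fun z hz => by
      obtain ⟨h1, -, h2⟩ := hsph z hz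
      rw [norm_mul, norm_zpow, h1]
      refine mul_le_mul ?_ h2 (norm_nonneg _) (by positivity)
      rw [← zpow_neg_one]
      exact zpow_le_zpow_right₀ hr1 (by omega)
  refine this.trans (le_of_eq ?_)
  field_simp

theorem residue_eq {f : ℂ → ℂ} {p : ℂ} {Q : ℂ[X]} (hf : ∀ᶠ z in 𝓝[≠] p, ContinuousAt f z)
    (h : (fun z => f z - Q.eval (z - p)⁻¹) =O[𝓝[≠] p] fun _ => (1 : ℂ)) :
    residue f p = Q.coeff 1 := by
  rw [residue]
  simpa using laurentCoeff_eq hf h 0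

theorem principalPart_eq {f : ℂ → ℂ} {p : ℂ} {Q : ℂ[X]} (hf : ∀ᶠ z in 𝓝[≠] p, ContinuousAt f z)
    (h : (fun z => f z - Q.eval (z - p)⁻¹) =O[𝓝[≠] p] fun _ => (1 : ℂ)) (hQ : Q.coeff 0 = 0)
    (s : ℂ) : principalPart f p s = Q.eval (s - p)⁻¹ := by
  rw [principalPart, tsum_eq_sum (s := Finset.range Q.natDegree)]
  · rw [Polynomial.eval_eq_sum_range, Finset.sum_range_succ', hQ, zero_mul, add_zero]
    refine Finset.sum_congr rfl fun k _ => ?_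
    rw [laurentCoeff_eq hf h, zpow_neg, inv_pow]
    norm_cast
  · intro k hk
    rw [laurentCoeff_eq hf h, Polynomial.coeff_eq_zero_of_natDegree_lt, zero_mul]
    simp at hk; omega

theorem inftyPart_eq {f : ℂ → ℂ} {Q : ℂ[X]}
    (hf : ∀ᶠ z in cobounded ℂ, ContinuousAt f z)
    (h : Tendsto (fun z => f z - Q.eval z) (cobounded ℂ) (𝓝 0)) (s : ℂ) :
    inftyPart f s = Q.eval s := by
  rw [inftyPart, tsum_eq_sum (s := Finset.range (Q.natDegree + 1))]
  · rw [Polynomial.eval_eq_sum_range]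
    exact Finset.sum_congr rfl fun k _ => by rw [laurentCoeffInfty_eq hf h]
  · intro k hk
    rw [laurentCoeffInfty_eq hf h, Polynomial.coeff_eq_zero_of_natDegree_lt, zero_mul]
    simp at hk; omega

/-- Residues do not change when an analytic function is added. -/
theorem residue_congr_add {f F g : ℂ → ℂ} {p : ℂ} (hf : ∀ᶠ z in 𝓝[≠] p, ContinuousAt f z)
    (hg : AnalyticAt ℂ g p) (h : ∀ᶠ z in 𝓝[≠] p, F z = f z + g z) : residue F p = residue f p := by
  obtain ⟨ε, hε, H⟩ := eventually_punctured_iff.1 (hf.and h)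
  obtain ⟨ε', hε', H'⟩ := Metric.eventually_nhds_iff.1 hg.eventually_analyticAt
  rw [residue, residue, laurentCoeff, laurentCoeff, limUnder, limUnder]
  congr 1
  refine Filter.map_congr ?_
  filter_upwards [Ioo_mem_nhdsGT (lt_min hε hε')] with r hr
  have hr0 : 0 < r := hr.1
  have hsph : ∀ z ∈ sphere p r, ContinuousAt f z ∧ F z = f z + g z := by
    intro z hz
    have h1 : ‖z - p‖ = r := by simpa [dist_eq_norm] using hz
    exact H z (ne_of_mem_sphere' hr0 hz) (by rw [h1]; exact lt_of_lt_of_le hr.2 (min_le_left _ _))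
  have hgan : ∀ z ∈ closedBall p r, AnalyticAt ℂ g z := fun z hz =>
    H' (lt_of_le_of_lt hz (lt_of_lt_of_le hr.2 (min_le_right _ _)))
  have hg0 : (∮ z in C(p, r), g z) = 0 :=
    Complex.circleIntegral_eq_zero_of_differentiable_on_off_countable hr0.le countable_empty
      (fun z hz => (hgan z hz).continuousAt.continuousWithinAt)
      (fun z hz => (hgan z (ball_subset_closedBall hz.1)).differentiableAt)
  congr 1
  norm_num
  rw [circleIntegral.integral_congr hr0.le (fun z hz => (hsph z hz).2),
    circleIntegral.integral_add, hg0, add_zero]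
  · exact ContinuousOn.circleIntegrable hr0.le fun z hz => (hsph z hz).1.continuousWithinAt
  · exact ContinuousOn.circleIntegrable hr0.le fun z hz =>
      (hgan z (sphere_subset_closedBall hz)).continuousAt.continuousWithinAt

/-! ### Functions with finitely many singularities -/

theorem exists_entire_extension {S : Finset ℂ} {h : ℂ → ℂ} (hd : ∀ z ∉ S, DifferentiableAt ℂ h z)
    (hb : ∀ p ∈ S, h =O[𝓝[≠] p] fun _ => (1 : ℂ)) :
    ∃ g : ℂ → ℂ, Differentiable ℂ g ∧ ∀ z ∉ S, g z = h z := by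
  classical
  have hoff : ∀ z ∉ S, ∀ᶠ w in 𝓝 z, w ∉ S := fun z hz =>
    S.finite_toSet.isClosed.isOpen_compl.mem_nhds hz
  refine ⟨fun z => if z ∈ S then limUnder (𝓝[≠] z) h else h z, fun z => ?_, fun z hz => by simp [hz]⟩
  by_cases hz : z ∈ S
  · have h1 : ∀ᶠ w in 𝓝[≠] z, w ∉ S := by
      have : ∀ᶠ w in 𝓝 z, w ∉ S.erase z := by
        refine (S.erase z).finite_toSet.isClosed.isOpen_compl.mem_nhds ?_
        simp
      rw [eventually_nhdsWithin_iff]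
      filter_upwards [this] with w hw hwz hwS
      exact hw (Finset.mem_erase.2 ⟨hwz, hwS⟩)
    obtain ⟨ε, hε, H⟩ := eventually_punctured_iff.1 (h1.and (hb z hz).bound.choose_spec)
    have hball := ball_mem_nhds z hε
    have hmem : ∀ w ∈ ball z ε \ {z}, w ∉ S ∧ ‖h w‖ ≤ _ := fun w hw =>
      H w hw.2 (by simpa [dist_eq_norm] using hw.1)
    have h2 := Complex.differentiableOn_update_limUnder_of_bddAbove hball
      (fun w hw => (hd w (hmem w hw).1).differentiableWithinAt)
      ⟨_, by rintro _ ⟨w, hw, rfl⟩; exact (hmem w hw).2⟩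
    refine (h2.differentiableAt hball).congr_of_eventuallyEq ?_
    filter_upwards [hball] with w hw
    by_cases hwz : w = z
    · subst hwz; simp [hz]
    · rw [Function.update_of_ne hwz, if_neg (hmem w ⟨hw, hwz⟩).1]
  · refine (hd z hz).congr_of_eventuallyEq ?_
    filter_upwards [hoff z hz] with w hw
    rw [if_neg hw]

theorem exists_polynomial_of_entire {g : ℂ → ℂ} (hg : Differentiable ℂ g) (N : ℕ)
    (h : Tendsto (fun z => g z / z ^ N) (cobounded ℂ) (𝓝 0)) :
    ∃ P : ℂ[X], P.degree < N ∧ ∀ z, g z = P.eval z := by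
  induction N generalizing g with
  | zero =>
    refine ⟨0, by simp, fun z => ?_⟩
    have := hg.apply_eq_of_tendsto_cocompact z (c := 0) (by
      rw [← cobounded_eq_cocompact]; simpa using h)
    simpa using this
  | succ N ih =>
    have h1 : Differentiable ℂ (dslope g 0) := by
      rw [← differentiableOn_univ]
      exact (Complex.differentiableOn_dslope univ_mem).2 hg.differentiableOn
    have hne : ∀ᶠ z : ℂ in cobounded ℂ, z ≠ 0 := by
      filter_upwards [eventually_cobounded_le_norm (1 : ℝ)] with z hz h0
      rw [h0, norm_zero] at hz; linarith
    obtain ⟨P, hP, hgP⟩ := ih h1 (by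
      have h2 : Tendsto (fun z : ℂ => g 0 * (z⁻¹) ^ (N + 1)) (cobounded ℂ) (𝓝 0) := by
        have := ((tendsto_inv₀_cobounded (α := ℂ)).pow (N + 1)).const_mul (g 0)
        simpa using this
      have h3 := h.sub h2
      rw [sub_zero] at h3
      refine h3.congr' ?_
      filter_upwards [hne] with z hz
      rw [dslope_of_ne _ hz, slope_def_field, inv_pow]
      field_simp
      ring)
    refine ⟨X * P + C (g 0), ?_, fun z => ?_⟩
    · have h4 : (X * P).degree < ((N + 1 : ℕ) : WithBot ℕ) := by
        rcases eq_or_ne P 0 with rfl | hP0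
        · simp
        · rw [degree_mul, degree_X, degree_eq_natDegree hP0] at *
          have : P.natDegree < N := by exact_mod_cast hP
          norm_cast; omega
      refine lt_of_le_of_lt (degree_add_le _ _) (max_lt h4 (lt_of_le_of_lt degree_C_le ?_))
      norm_cast; omega
    · have := sub_smul_dslope g 0 z
      simp only [eval_add, eval_mul, eval_X, eval_C, ← hgP]
      simp at this
      rw [this]; ring

theorem isBigO_sub_const_cobounded (q : ℂ) :
    (fun z => z - q) =O[cobounded ℂ] fun z => z := by
  refine IsBigO.of_bound (1 + ‖q‖) ?_
  filter_upwards [eventually_cobounded_le_norm (1 : ℝ)] with z hz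
  calc ‖z - q‖ ≤ ‖z‖ + ‖q‖ := norm_sub_le _ _
    _ ≤ (1 + ‖q‖) * ‖z‖ := by nlinarith [norm_nonneg q]

/-- A function with finitely many poles of bounded order and polynomial growth becomes a polynomial
of controlled degree after clearing denominators. -/
theorem exists_polynomial_of_poles {S : Finset ℂ} {h : ℂ → ℂ}
    (hd : ∀ z ∉ S, DifferentiableAt ℂ h z) {d : ℂ → ℕ}
    (hb : ∀ p ∈ S, (fun z => (z - p) ^ d p * h z) =O[𝓝[≠] p] fun _ => (1 : ℂ)) {D : ℕ}
    (hinf : Tendsto (fun z => h z / z ^ D) (cobounded ℂ) (𝓝 0)) :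
    ∃ P : ℂ[X], P.degree < ((∑ p ∈ S, d p) + D : ℕ) ∧
      ∀ z ∉ S, P.eval z = h z * ∏ p ∈ S, (z - p) ^ d p := by
  classical
  have hcont : ∀ T : Finset ℂ, Continuous fun z : ℂ => ∏ p ∈ T, (z - p) ^ d p := fun T =>
    continuous_finsetProd _ fun p _ => (continuous_id.sub continuous_const).pow _
  obtain ⟨g, hg, hgh⟩ := exists_entire_extension (S := S)
    (h := fun z => h z * ∏ p ∈ S, (z - p) ^ d p)
    (fun z hz => (hd z hz).mul (by fun_prop)) (fun p hp => by
      have h1 : (fun z : ℂ => ∏ q ∈ S.erase p, (z - q) ^ d q) =O[𝓝[≠] p] fun _ => (1 : ℂ) :=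
        ((hcont _).continuousAt.tendsto.mono_left nhdsWithin_le_nhds).isBigO_one ℂ
      have h2 := (hb p hp).mul h1
      simp only [mul_one] at h2
      refine h2.congr_left fun z => ?_
      rw [← Finset.mul_prod_erase S _ hp]
      ring)
  have hprod : ∀ T : Finset ℂ, (fun z : ℂ => ∏ p ∈ T, (z - p) ^ d p) =O[cobounded ℂ]
      fun z => z ^ ∑ p ∈ T, d p := by
    intro T
    simp only [← Finset.prod_pow_eq_pow_sum]
    exact IsBigO.finsetProd fun p _ => (isBigO_sub_const_cobounded p).pow _
  have hne : ∀ᶠ z : ℂ in cobounded ℂ, z ≠ 0 ∧ z ∉ S := by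
    have h1 : ∀ᶠ z : ℂ in cobounded ℂ, z ∉ S := by
      have := S.finite_toSet.isBounded
      exact isBounded_def.1 this
    filter_upwards [eventually_cobounded_le_norm (1 : ℝ), h1] with z hz hzS
    refine ⟨fun h0 => ?_, hzS⟩
    rw [h0, norm_zero] at hz; linarith
  obtain ⟨P, hP, hgP⟩ := exists_polynomial_of_entire hg ((∑ p ∈ S, d p) + D) (by
    have h1 : (fun z => (∏ p ∈ S, (z - p) ^ d p) / z ^ ∑ p ∈ S, d p) =O[cobounded ℂ]
        fun _ => (1 : ℂ) := by
      have h2 := (hprod S).mul (isBigO_refl (fun z : ℂ => (z ^ ∑ p ∈ S, d p)⁻¹) _)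
      refine (h2.congr_left fun z => (div_eq_mul_inv _ _).symm).trans ?_
      refine IsBigO.of_bound 1 ?_
      filter_upwards [hne] with z hz
      rw [mul_inv_cancel₀ (pow_ne_zero _ hz.1)]; simp
    have h3 := h1.mul_isLittleO ((isLittleO_one_iff ℂ).2 hinf)
    simp only [mul_one] at h3
    refine ((isLittleO_one_iff ℂ).1 h3).congr' ?_
    filter_upwards [hne] with z hz
    rw [hgh z hz.2, pow_add]
    have := hz.1
    field_simp)
  exact ⟨P, hP, fun z hz => by rw [← hgP, hgh z hz]⟩

/-- Liouville's theorem with removable singularities. -/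
theorem eq_zero_of_bounded_of_tendsto {S : Finset ℂ} {h : ℂ → ℂ}
    (hd : ∀ z ∉ S, DifferentiableAt ℂ h z) (hb : ∀ p ∈ S, h =O[𝓝[≠] p] fun _ => (1 : ℂ))
    (hinf : Tendsto h (cobounded ℂ) (𝓝 0)) : ∀ z ∉ S, h z = 0 := by
  obtain ⟨P, hP, hPh⟩ := exists_polynomial_of_poles hd (d := fun _ => 0) (D := 0)
    (by simpa using hb) (by simpa using hinf)
  intro z hz
  have h0 : P = 0 := by simpa [Nat.WithBot.lt_zero_iff] using hP
  have := hPh z hz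
  simpa [h0] using this.symm

theorem tendsto_sub_inv_cobounded (p : ℂ) :
    Tendsto (fun z => (z - p)⁻¹) (cobounded ℂ) (𝓝 0) := by
  have : Tendsto (fun z => z - p) (cobounded ℂ) (cobounded ℂ) := by
    rw [tendsto_iff_eventually]
    intro P hP
    obtain ⟨R, hR⟩ := eventually_cobounded_iff.1 hP
    refine eventually_cobounded_iff.2 ⟨R + ‖p‖, fun z hz => hR _ ?_⟩
    have := norm_sub_norm_le z p
    linarith
  exact tendsto_inv₀_cobounded.comp this

theorem tendsto_mul_eval_inv (p : ℂ) {Q : ℂ[X]} (hQ : Q.coeff 0 = 0) :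
    Tendsto (fun z => z * Q.eval (z - p)⁻¹) (cobounded ℂ) (𝓝 (Q.coeff 1)) := by
  have h1 := tendsto_sub_inv_cobounded p
  have h2 : Tendsto (fun z => z * (z - p)⁻¹) (cobounded ℂ) (𝓝 1) := by
    have h3 := (h1.const_mul p).const_add 1
    simp only [mul_zero, add_zero] at h3
    refine h3.congr' ?_
    filter_upwards [eventually_cobounded_le_norm (‖p‖ + 1)] with z hz
    have : z - p ≠ 0 := by
      intro h0
      rw [sub_eq_zero.1 h0] at hz
      linarith
    field_simp
    ring
  have h4 : Tendsto (fun z => Q.divX.eval (z - p)⁻¹) (cobounded ℂ) (𝓝 (Q.coeff 1)) := by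
    have := (Q.divX.continuous.tendsto 0).comp h1
    rwa [← Polynomial.coeff_zero_eq_eval_zero, Polynomial.coeff_divX] at this
  have h5 := h2.mul h4
  rw [one_mul] at h5
  refine h5.congr fun z => ?_
  conv_rhs => rw [← Polynomial.divX_mul_X_add Q, hQ]
  simp
  ring

/-- The sum of the residues of a function with finitely many poles is its residue at infinity. -/
theorem sum_residues {S : Finset ℂ} {F : ℂ → ℂ} {Q : ℂ → ℂ[X]} {c : ℂ}
    (hd : ∀ z ∉ S, DifferentiableAt ℂ F z) (hQ0 : ∀ p ∈ S, (Q p).coeff 0 = 0)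
    (hQ : ∀ p ∈ S, (fun z => F z - (Q p).eval (z - p)⁻¹) =O[𝓝[≠] p] fun _ => (1 : ℂ))
    (hinf : Tendsto (fun z => z * F z) (cobounded ℂ) (𝓝 c)) :
    ∑ p ∈ S, (Q p).coeff 1 = c := by
  classical
  have hQd : ∀ p z : ℂ, z ≠ p → DifferentiableAt ℂ (fun z => (Q p).eval (z - p)⁻¹) z := by
    intro p z hz
    exact (Q p).differentiable.differentiableAt.comp z
      ((differentiableAt_id.sub_const p).inv (sub_ne_zero.2 hz))
  have hFinf : Tendsto F (cobounded ℂ) (𝓝 0) := by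
    have := (tendsto_inv₀_cobounded (α := ℂ)).mul hinf
    rw [zero_mul] at this
    refine this.congr' ?_
    filter_upwards [eventually_cobounded_le_norm (1 : ℝ)] with z hz
    have : z ≠ 0 := fun h0 => by rw [h0, norm_zero] at hz; linarith
    field_simp
  have hQinf : ∀ p ∈ S, Tendsto (fun z => (Q p).eval (z - p)⁻¹) (cobounded ℂ) (𝓝 0) := by
    intro p hp
    have := ((Q p).continuous.tendsto 0).comp (tendsto_sub_inv_cobounded p)
    rwa [← Polynomial.coeff_zero_eq_eval_zero, hQ0 p hp] at this
  have hzero := eq_zero_of_bounded_of_tendsto (S := S)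
    (h := fun z => F z - ∑ p ∈ S, (Q p).eval (z - p)⁻¹)
    (fun z hz => (hd z hz).sub (DifferentiableAt.fun_sum fun p hp =>
      hQd p z fun h => hz (h ▸ hp)))
    (fun p hp => by
      have h1 : (fun z => ∑ q ∈ S.erase p, (Q q).eval (z - q)⁻¹) =O[𝓝[≠] p] fun _ => (1 : ℂ) := by
        have : DifferentiableAt ℂ (fun z => ∑ q ∈ S.erase p, (Q q).eval (z - q)⁻¹) p :=
          DifferentiableAt.fun_sum fun q hq => hQd q p (Finset.ne_of_mem_erase hq).symm
        exact (this.continuousAt.tendsto.mono_left nhdsWithin_le_nhds).isBigO_one ℂ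
      refine ((hQ p hp).sub h1).congr_left fun z => ?_
      rw [← Finset.add_sum_erase S _ hp]
      ring)
    (by
      have := hFinf.sub (tendsto_finsetSum S hQinf)
      simpa using this)
  have h2 : Tendsto (fun z => z * F z) (cobounded ℂ) (𝓝 (∑ p ∈ S, (Q p).coeff 1)) := by
    refine (tendsto_finsetSum S fun p hp => tendsto_mul_eval_inv p (hQ0 p hp)).congr' ?_
    have h1 : ∀ᶠ z : ℂ in cobounded ℂ, z ∉ S :=
      isBounded_def.1 S.finite_toSet.isBounded
    filter_upwards [h1] with z hz
    rw [← Finset.mul_sum, ← sub_eq_zero.1 (hzero z hz)]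
  exact tendsto_nhds_unique h2 hinf

theorem exists_polarPart {g : ℂ → ℂ} {p : ℂ} (hg : AnalyticAt ℂ g p) (N : ℕ) :
    ∃ Q : ℂ[X], Q.coeff 0 = 0 ∧
      (fun z => g z / (z - p) ^ N - Q.eval (z - p)⁻¹) =O[𝓝[≠] p] fun _ => (1 : ℂ) := by
  induction N generalizing g with
  | zero =>
    refine ⟨0, by simp, ?_⟩
    simpa using (hg.continuousAt.tendsto.mono_left nhdsWithin_le_nhds).isBigO_one ℂ
  | succ N ih =>
    obtain ⟨q, hq⟩ := hg
    obtain ⟨Q, hQ0, hQ⟩ := ih (g := dslope g p) ⟨_, hq.has_fpower_series_dslope_fslope⟩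
    refine ⟨Q + C (g p) * X ^ (N + 1), by simp [hQ0], ?_⟩
    refine hQ.congr' ?_ .rfl
    filter_upwards [self_mem_nhdsWithin] with z hz
    have hz' : z ≠ p := hz
    rw [dslope_of_ne _ hz', slope_def_field]
    have : z - p ≠ 0 := sub_ne_zero.2 hz'
    simp only [eval_add, eval_mul, eval_C, eval_pow, eval_X, inv_pow]
    field_simp
    ring

end Residues

end

section

open Polynomial Bornology Asymptotics

/-! ### Superpotentials in terms of germs at the poles -/

section Asymptotics

variable {l : Filter ℂ} {v ω ℓ g g₁ g₂ : ℂ → ℂ} {r : ℕ}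

/-- A function asymptotic to a function `ω → ∞` up to bounded terms. -/
theorem asymp_div (hω0 : ∀ᶠ z in l, ω z ≠ 0) (hω : Tendsto (fun z => (ω z)⁻¹) l (𝓝 0))
    (hℓ : (fun z => ℓ z - ω z) =O[l] fun _ => (1 : ℂ)) :
    (∀ᶠ z in l, ℓ z ≠ 0) ∧ (fun z => ω z / ℓ z) =O[l] fun _ => (1 : ℂ) := by
  have h1 : Tendsto (fun z => (ℓ z - ω z) * (ω z)⁻¹) l (𝓝 0) := by
    have := hℓ.mul_isLittleO ((isLittleO_one_iff ℂ).2 hω)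
    simpa [isLittleO_one_iff] using this
  have h2 : Tendsto (fun z => ℓ z / ω z) l (𝓝 1) := by
    have := h1.const_add 1
    rw [add_zero] at this
    refine this.congr' ?_
    filter_upwards [hω0] with z hz
    field_simp
    ring
  refine ⟨?_, ?_⟩
  · filter_upwards [h2.eventually_ne one_ne_zero] with z hz h0
    exact hz (by rw [h0, zero_div])
  · have := (h2.inv₀ one_ne_zero).isBigO_one ℂ
    exact this.congr_left fun z => inv_div _ _

theorem IsBigO.one_pow (hv : v =O[l] fun _ => (1 : ℂ)) (k : ℕ) :
    (fun z => v z ^ k) =O[l] fun _ => (1 : ℂ) := by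
  simpa using hv.pow k

theorem IsBigO.one_mul (h₁ : g₁ =O[l] fun _ => (1 : ℂ)) (h₂ : g₂ =O[l] fun _ => (1 : ℂ)) :
    (fun z => g₁ z * g₂ z) =O[l] fun _ => (1 : ℂ) := by
  simpa using h₁.mul h₂

/-- The quotient of two functions with known leading terms, where `v → 0` is a local parameter and
bounded errors are allowed. At a finite pole `r = 0`; at infinity `r = 1`, because there functions
vanishing at `∞` of first order only are compared after multiplication with `z ^ 2`. -/
theorem isBigO_div_of_asymp (hv : v =O[l] fun _ => (1 : ℂ)) (hv0 : ∀ᶠ z in l, v z ≠ 0)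
    (hω0 : ∀ᶠ z in l, ω z ≠ 0) (hω : Tendsto (fun z => (ω z)⁻¹) l (𝓝 0))
    (hω2 : (fun z => (v z ^ (2 * r) * ω z)⁻¹) =O[l] fun _ => (1 : ℂ))
    (hℓ : (fun z => ℓ z - ω z) =O[l] fun _ => (1 : ℂ)) {δ : ℂ} {k : ℕ} (hk : δ ≠ 0 → r ≤ k)
    (hg : (fun z => v z ^ r * (g z - δ * (v z ^ k * ω z))) =O[l] fun _ => (1 : ℂ)) :
    (fun z => g z / ℓ z) =O[l] fun z => v z ^ r := by
  obtain ⟨hℓ0, hdiv⟩ := asymp_div hω0 hω hℓ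
  have hδ : ∀ z, δ * v z ^ k = δ * (v z ^ r * v z ^ (k - r)) := by
    intro z
    by_cases h : δ = 0
    · simp [h]
    · rw [← pow_add, Nat.add_sub_cancel' (hk h)]
  have h1 : (fun z => (δ * v z ^ (k - r) +
      (v z ^ r * (g z - δ * (v z ^ k * ω z))) * (v z ^ (2 * r) * ω z)⁻¹) * (ω z / ℓ z)) =O[l]
      fun _ => (1 : ℂ) :=
    IsBigO.one_mul (((IsBigO.one_pow hv (k - r)).const_mul_left δ).add (IsBigO.one_mul hg hω2)) hdiv
  have h2 := (isBigO_refl (fun z => v z ^ r) l).mul h1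
  simp only [mul_one] at h2
  refine h2.congr' ?_ .rfl
  filter_upwards [hv0, hω0, hℓ0] with z h3 h4 h5
  have h6 := hδ z
  rw [show 2 * r = r + r by ring, pow_add]
  field_simp
  linear_combination -(ω z) * h6

/-- Under the same conventions, `g₁ g₂ / ℓ` has the product of the leading terms divided by `ω`. -/
theorem isBigO_mul_div_sub_of_asymp (hv : v =O[l] fun _ => (1 : ℂ)) (hv0 : ∀ᶠ z in l, v z ≠ 0)
    (hω0 : ∀ᶠ z in l, ω z ≠ 0) (hω : Tendsto (fun z => (ω z)⁻¹) l (𝓝 0))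
    (hω2 : (fun z => (v z ^ (2 * r) * ω z)⁻¹) =O[l] fun _ => (1 : ℂ))
    (hℓ : (fun z => ℓ z - ω z) =O[l] fun _ => (1 : ℂ)) {δ₁ δ₂ : ℂ} {k₁ k₂ : ℕ}
    (hk₁ : δ₁ ≠ 0 → r ≤ k₁) (hk₂ : δ₂ ≠ 0 → r ≤ k₂)
    (hg₁ : (fun z => v z ^ r * (g₁ z - δ₁ * (v z ^ k₁ * ω z))) =O[l] fun _ => (1 : ℂ))
    (hg₂ : (fun z => v z ^ r * (g₂ z - δ₂ * (v z ^ k₂ * ω z))) =O[l] fun _ => (1 : ℂ)) :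
    (fun z => g₁ z * g₂ z / ℓ z - δ₁ * δ₂ * (v z ^ (k₁ + k₂) * ω z)) =O[l] fun _ => (1 : ℂ) := by
  obtain ⟨hℓ0, hdiv⟩ := asymp_div hω0 hω hℓ
  have hδ : ∀ {δ : ℂ} {k : ℕ}, (δ ≠ 0 → r ≤ k) → ∀ z, δ * v z ^ k =
      δ * (v z ^ r * v z ^ (k - r)) := by
    intro δ k hk z
    by_cases h : δ = 0
    · simp [h]
    · rw [← pow_add, Nat.add_sub_cancel' (hk h)]
  set a := fun z => g₁ z - δ₁ * (v z ^ k₁ * ω z) with ha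
  set b := fun z => g₂ z - δ₂ * (v z ^ k₂ * ω z) with hb
  have h1 : (fun z => (δ₁ * v z ^ (k₁ - r) * (v z ^ r * b z) + δ₂ * v z ^ (k₂ - r) * (v z ^ r * a z)
      + (v z ^ r * a z) * (v z ^ r * b z) * (v z ^ (2 * r) * ω z)⁻¹
      - δ₁ * δ₂ * v z ^ (k₁ + k₂) * (ℓ z - ω z)) * (ω z / ℓ z)) =O[l] fun _ => (1 : ℂ) := by
    refine IsBigO.one_mul ?_ hdiv
    refine IsBigO.sub (IsBigO.add (IsBigO.add ?_ ?_) ?_) ?_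
    · exact IsBigO.one_mul ((IsBigO.one_pow hv _).const_mul_left δ₁) hg₂
    · exact IsBigO.one_mul ((IsBigO.one_pow hv _).const_mul_left δ₂) hg₁
    · exact IsBigO.one_mul (IsBigO.one_mul hg₁ hg₂) hω2
    · exact IsBigO.one_mul ((IsBigO.one_pow hv _).const_mul_left (δ₁ * δ₂)) hℓ
  refine h1.congr' ?_ .rfl
  filter_upwards [hv0, hω0, hℓ0] with z h3 h4 h5
  have h6 := hδ hk₁ z
  have h7 := hδ hk₂ z
  have h8 : g₁ z = a z + δ₁ * (v z ^ k₁ * ω z) := by simp [ha]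
  have h9 : g₂ z = b z + δ₂ * (v z ^ k₂ * ω z) := by simp [hb]
  rw [h8, h9, show 2 * r = r + r by ring, pow_add, pow_add]
  field_simp
  linear_combination -(b z) * ω z * h6 - a z * ω z * h7

end Asymptotics

/-- A germ `Y` with `Y'(0) ≠ 0` has a local inverse `v`; the leading behaviour of the Taylor
coefficients `[u ^ n] B / (y - Y)` is governed by `ω = 1 / (v ^ (n + 1) Y'(v))`. -/
theorem exists_local_parameter {Y : ℂ → ℂ} (hY : AnalyticAt ℂ Y 0) (hY' : deriv Y 0 ≠ 0) (n : ℕ) :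
    ∃ v ω : ℂ → ℂ, Tendsto v (𝓝[≠] (Y 0)) (𝓝[≠] 0) ∧ AnalyticAt ℂ v (Y 0) ∧
      (∀ᶠ y in 𝓝[≠] (Y 0), Y (v y) = y ∧ deriv Y (v y) ≠ 0 ∧
        ω y = (v y ^ (n + 1) * deriv Y (v y))⁻¹) ∧
      v =O[𝓝[≠] (Y 0)] (fun y => y - Y 0) ∧
      (fun y => (y - Y 0) ^ (n + 1) * ω y) =O[𝓝[≠] (Y 0)] (fun _ => (1 : ℂ)) ∧
      (fun y => y - Y 0) =O[𝓝[≠] (Y 0)] v ∧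
      ∀ B : ℂ → ℂ, AnalyticAt ℂ B 0 →
        (fun y => taylorCoeff n (fun u => B u / (y - Y u)) - B (v y) * ω y)
          =O[𝓝[≠] (Y 0)] fun _ => (1 : ℂ) := by
  obtain ⟨v, hv, hv0, hYv, hvY⟩ := exists_localInverse hY hY'
  have hvt : Tendsto v (𝓝[≠] (Y 0)) (𝓝[≠] 0) := by
    rw [tendsto_nhdsWithin_iff]
    refine ⟨?_, ?_⟩
    · have := hv.continuousAt.tendsto
      rw [hv0] at this
      exact this.mono_left nhdsWithin_le_nhds
    · filter_upwards [self_mem_nhdsWithin, nhdsWithin_le_nhds hYv] with y hy hy2 h0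
      have h0' : v y = 0 := h0
      rw [h0'] at hy2
      exact hy hy2.symm
  have hvt' : Tendsto v (𝓝[≠] (Y 0)) (𝓝 0) := hvt.mono_right nhdsWithin_le_nhds
  have hdY : ∀ᶠ y in 𝓝[≠] (Y 0), deriv Y (v y) ≠ 0 :=
    hvt'.eventually (hY.deriv.continuousAt.eventually_ne hY')
  have hzv : (fun y => y - Y 0) =O[𝓝[≠] (Y 0)] v := by
    have h1 : (fun u => Y u - Y 0) =O[𝓝 0] fun u => u := by
      simpa using hY.differentiableAt.isBigO_sub
    refine (h1.comp_tendsto hvt').congr' ?_ .rfl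
    filter_upwards [nhdsWithin_le_nhds hYv] with y hy
    simp [hy]
  refine ⟨v, fun y => (v y ^ (n + 1) * deriv Y (v y))⁻¹, hvt, hv, ?_, ?_, ?_, hzv, ?_⟩
  · filter_upwards [nhdsWithin_le_nhds hYv, hdY] with y h1 h2 using ⟨h1, h2, rfl⟩
  · have := hv.differentiableAt.isBigO_sub.mono (nhdsWithin_le_nhds (s := {Y 0}ᶜ))
    simpa [hv0] using this
  · have h1 : (fun y => (y - Y 0) ^ (n + 1) * (v y ^ (n + 1))⁻¹) =O[𝓝[≠] (Y 0)]
        fun _ => (1 : ℂ) := by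
      have := (hzv.pow (n + 1)).mul
        (isBigO_refl (fun y => (v y ^ (n + 1))⁻¹) (𝓝[≠] (Y 0)))
      refine this.trans (IsBigO.of_bound 1 ?_)
      filter_upwards [(tendsto_nhdsWithin_iff.1 hvt).2] with y hy
      rw [mul_inv_cancel₀ (pow_ne_zero _ hy)]; simp
    have h2 : (fun y => (deriv Y (v y))⁻¹) =O[𝓝[≠] (Y 0)] fun _ => (1 : ℂ) :=
      ((hY.deriv.continuousAt.tendsto.comp hvt').inv₀ hY').isBigO_one ℂ
    refine (IsBigO.one_mul h1 h2).congr_left fun y => ?_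
    simp only [mul_inv]; ring
  · intro B hB
    have := (isBigO_taylorCoeff_div_sub hY hY' hB n).comp_tendsto hvt
    refine this.congr' ?_ .rfl
    filter_upwards [nhdsWithin_le_nhds hYv] with y hy
    simp only [Function.comp, hy, div_eq_mul_inv]

section Germs

variable {I : Type} [Fintype I] [DecidableEq I]

/-- The germs `Y i`, the local coordinates `z` at the finite poles (`some i`) and `1 / z` at
infinity (`none`), as functions of the flat local parameter `u`; `n i` is the order of the pole. -/
structure IsPoleGerms (Y : Option I → ℂ → ℂ) (n : Option I → ℕ) : Prop where
  analytic : ∀ i, AnalyticAt ℂ (Y i) 0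
  deriv_ne : ∀ i, deriv (Y i) 0 ≠ 0
  infty : Y none 0 = 0
  inj : Function.Injective fun i : I => Y (some i) 0
  n_pos : ∀ i, 0 < n i

/-- The kernel `1 / (z - Y)` at a finite pole, and `Y / (1 - z Y)` at infinity. -/
def poleKernel (Y : Option I → ℂ → ℂ) : Option I → ℂ → ℂ → ℂ
  | none, z, u => Y none u / (1 - z * Y none u)
  | some i, z, u => 1 / (z - Y (some i) u)

/-- The coefficients `[u ^ n] (u ^ m K)` of the kernel; the derivatives of the superpotential along
the flat coordinates are `ρ` times these. -/
def poleCoeff (Y : Option I → ℂ → ℂ) (n : Option I → ℕ) (i : Option I) (m : ℕ) (z : ℂ) : ℂ :=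
  taylorCoeff (n i) fun u => u ^ m * poleKernel Y i z u

/-- `z`-derivative of the superpotential. -/
def lamDeriv (Y : Option I → ℂ → ℂ) (n : Option I → ℕ) (z : ℂ) : ℂ :=
  poleCoeff Y n none 0 z - ∑ i, poleCoeff Y n (some i) 0 z

/-- The coefficient at a finite pole as a polynomial in `(z - p)⁻¹`. -/
def polarPoly (Y : Option I → ℂ → ℂ) (n : Option I → ℕ) (i : I) (m : ℕ) : ℂ[X] :=
  ∑ j ∈ Finset.range (n (some i) + 1),
    C (taylorCoeff (n (some i)) fun u => u ^ m * (Y (some i) u - Y (some i) 0) ^ j) * X ^ (j + 1)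

/-- The coefficient at infinity as a polynomial in `z`. -/
def inftyPoly (Y : Option I → ℂ → ℂ) (n : Option I → ℕ) (m : ℕ) : ℂ[X] :=
  ∑ j ∈ Finset.range (n none + 1),
    C (taylorCoeff (n none) fun u => u ^ m * Y none u * Y none u ^ j) * X ^ j

variable {Y : Option I → ℂ → ℂ} {n : Option I → ℕ}

/-- The finite poles. -/
def germPoles (Y : Option I → ℂ → ℂ) : Finset ℂ := Finset.univ.image fun i : I => Y (some i) 0

theorem notMem_germPoles {z : ℂ} : z ∉ germPoles Y ↔ ∀ i : I, z ≠ Y (some i) 0 := by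
  simp [germPoles, eq_comm]

theorem analyticAt_pow_zero (m : ℕ) : AnalyticAt ℂ (fun u : ℂ => u ^ m) 0 := analyticAt_id.pow m

theorem polarPoly_coeff_zero (i : I) (m : ℕ) : (polarPoly Y n i m).coeff 0 = 0 := by
  simp [polarPoly]

theorem polarPoly_coeff_one (i : I) (m : ℕ) :
    (polarPoly Y n i m).coeff 1 = if m = n (some i) then 1 else 0 := by
  simp only [polarPoly, finsetSum_coeff, coeff_C_mul, coeff_X_pow]
  rw [Finset.sum_eq_single 0]
  · simp [taylorCoeff_pow, eq_comm]
  · intro j _ hj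
    rw [if_neg (by omega), mul_zero]
  · simp

namespace IsPoleGerms

variable (hY : IsPoleGerms Y n)
include hY

/-- At a finite pole the pole coefficients are polynomials in `(z - p)⁻¹` without constant term. -/
theorem poleCoeff_some (i : I) (m : ℕ) {z : ℂ} (hz : z ≠ Y (some i) 0) :
    poleCoeff Y n (some i) m z = (polarPoly Y n i m).eval (z - Y (some i) 0)⁻¹ := by
  have := taylorCoeff_div_sub (analyticAt_pow_zero m) (hY.analytic (some i)) hz (n (some i))
  simp only [poleCoeff, poleKernel, mul_one_div]
  rw [this, polarPoly, eval_finsetSum]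
  simp

theorem poleCoeff_none (m : ℕ) (z : ℂ) :
    poleCoeff Y n none m z = (inftyPoly Y n m).eval z := by
  have := taylorCoeff_div_one_sub ((analyticAt_pow_zero m).fun_mul (hY.analytic none))
    (hY.analytic none) hY.infty z (n none)
  simp only [poleCoeff, poleKernel, ← mul_div_assoc]
  rw [this, inftyPoly, eval_finsetSum]
  simp

theorem analyticAt_poleCoeff (i : Option I) (m : ℕ) {z : ℂ} (hz : ∀ j : I, i = some j → z ≠ Y i 0) :
    AnalyticAt ℂ (poleCoeff Y n i m) z := by
  rcases i with _ | i
  · have : poleCoeff Y n none m = fun z => (inftyPoly Y n m).eval z :=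
      funext fun z => hY.poleCoeff_none m z
    rw [this]
    exact (inftyPoly Y n m).differentiable.analyticAt z
  · have hz' := hz i rfl
    have h1 : AnalyticAt ℂ (fun z => (polarPoly Y n i m).eval (z - Y (some i) 0)⁻¹) z :=
      AnalyticAt.comp (g := fun x => (polarPoly Y n i m).eval x)
        ((polarPoly Y n i m).differentiable.analyticAt _)
        ((analyticAt_id.sub analyticAt_const).inv (sub_ne_zero.2 hz'))
    refine h1.congr ?_
    filter_upwards [continuousAt_id.eventually_ne hz'] with w hw
    exact (hY.poleCoeff_some i m hw).symm

theorem analyticAt_lamDeriv {z : ℂ} (hz : z ∉ germPoles Y) : AnalyticAt ℂ (lamDeriv Y n) z := by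
  rw [notMem_germPoles] at hz
  exact (hY.analyticAt_poleCoeff none 0 (by simp)).sub (Finset.analyticAt_fun_sum _ fun i _ =>
    hY.analyticAt_poleCoeff (some i) 0 fun j _ => hz i)

omit hY in
theorem eventually_notMem_germPoles (p : ℂ) : ∀ᶠ z in 𝓝[≠] p, z ∉ germPoles Y := by
  have : ∀ᶠ w in 𝓝 p, w ∉ (germPoles Y).erase p := by
    refine ((germPoles Y).erase p).finite_toSet.isClosed.isOpen_compl.mem_nhds ?_
    simp
  rw [eventually_nhdsWithin_iff]
  filter_upwards [this] with w hw hwz hwS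
  exact hw (Finset.mem_erase.2 ⟨hwz, hwS⟩)

omit hY in
theorem eventually_notMem_germPoles_cobounded :
    ∀ᶠ z in cobounded ℂ, z ∉ germPoles Y ∧ z ≠ 0 := by
  have h1 : ∀ᶠ z : ℂ in cobounded ℂ, z ∉ germPoles Y :=
    isBounded_def.1 (germPoles Y).finite_toSet.isBounded
  filter_upwards [eventually_cobounded_le_norm (1 : ℝ), h1] with z hz hzS
  refine ⟨hzS, fun h0 => ?_⟩
  rw [h0, norm_zero] at hz; linarith

/-- The local picture at a finite pole: `v` is a local parameter, the coefficients of the same pole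
have leading terms `v ^ m * ω`, and those of the other poles are bounded. -/
theorem exists_asymp_some (i : I) : ∃ v ω : ℂ → ℂ,
    v =O[𝓝[≠] (Y (some i) 0)] (fun _ => (1 : ℂ)) ∧ (∀ᶠ z in 𝓝[≠] (Y (some i) 0), v z ≠ 0) ∧
    (∀ᶠ z in 𝓝[≠] (Y (some i) 0), ω z ≠ 0) ∧
    Tendsto (fun z => (ω z)⁻¹) (𝓝[≠] (Y (some i) 0)) (𝓝 0) ∧
    (fun z => (z - Y (some i) 0) ^ (n (some i) + 1) * ω z) =O[𝓝[≠] (Y (some i) 0)]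
      (fun _ => (1 : ℂ)) ∧
    (∀ m, (fun z => poleCoeff Y n (some i) m z - v z ^ m * ω z) =O[𝓝[≠] (Y (some i) 0)]
      fun _ => (1 : ℂ)) ∧
    (∀ j m, j ≠ some i → poleCoeff Y n j m =O[𝓝[≠] (Y (some i) 0)] fun _ => (1 : ℂ)) := by
  obtain ⟨v, ω, h1, h2, h3, h4, h5, h6, h7⟩ := exists_local_parameter (hY.analytic (some i))
    (hY.deriv_ne (some i)) (n (some i))
  have hv : Tendsto v (𝓝[≠] (Y (some i) 0)) (𝓝 0) := h1.mono_right nhdsWithin_le_nhds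
  have hv0 : ∀ᶠ z in 𝓝[≠] (Y (some i) 0), v z ≠ 0 := (tendsto_nhdsWithin_iff.1 h1).2
  refine ⟨v, ω, hv.isBigO_one ℂ, hv0, ?_, ?_, h5, fun m => ?_, fun j m hj => ?_⟩
  · filter_upwards [h3, hv0] with z hz hz0
    rw [hz.2.2]
    exact inv_ne_zero (mul_ne_zero (pow_ne_zero _ hz0) hz.2.1)
  · have : Tendsto (fun z => v z ^ (n (some i) + 1) * deriv (Y (some i)) (v z))
        (𝓝[≠] (Y (some i) 0)) (𝓝 0) := by
      have := (hv.pow (n (some i) + 1)).mul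
        ((hY.analytic (some i)).deriv.continuousAt.tendsto.comp hv)
      simpa using this
    refine this.congr' ?_
    filter_upwards [h3] with z hz
    rw [hz.2.2, inv_inv]
  · have := h7 (fun u => u ^ m) (analyticAt_pow_zero m)
    simpa only [poleCoeff, poleKernel, mul_one_div] using this
  · refine ((hY.analyticAt_poleCoeff j m fun k hk => ?_).continuousAt.tendsto.mono_left
      nhdsWithin_le_nhds).isBigO_one ℂ
    subst hk
    exact fun h => hj (congrArg some (hY.inj h.symm))

/-- The local picture at infinity, where the substitution `z ↦ z⁻¹` turns the kernel
`Y / (1 - z Y)` into the kernel `1 / (z⁻¹ - Y)` of a finite pole. -/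
theorem exists_asymp_none : ∃ v ω : ℂ → ℂ,
    Tendsto v (cobounded ℂ) (𝓝 0) ∧ (∀ᶠ z in cobounded ℂ, v z ≠ 0) ∧
    (∀ᶠ z in cobounded ℂ, ω z ≠ 0) ∧
    Tendsto (fun z => (ω z)⁻¹) (cobounded ℂ) (𝓝 0) ∧
    (fun z => (v z ^ (2 * 1) * ω z)⁻¹) =O[cobounded ℂ] (fun _ => (1 : ℂ)) ∧
    ω =O[cobounded ℂ] (fun z => z ^ (n none + 1)) ∧
    (∀ m, (fun z => z ^ 2 * poleCoeff Y n none m z + z * (if m = n none then 1 else 0) -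
      v z ^ m * ω z) =O[cobounded ℂ] fun _ => (1 : ℂ)) ∧
    (∀ (i : I) m, (fun z => v z ^ 1 * (z ^ 2 * poleCoeff Y n (some i) m z))
      =O[cobounded ℂ] fun _ => (1 : ℂ)) ∧
    (∀ (i : I), (fun z => z ^ 2 * poleCoeff Y n (some i) 0 z)
      =O[cobounded ℂ] fun _ => (1 : ℂ)) := by
  obtain ⟨v, ω, h1, h2, h3, h4, h5, h6, h7⟩ := exists_local_parameter (hY.analytic none)
    (hY.deriv_ne none) (n none)
  rw [hY.infty] at *
  have hinv := tendsto_inv₀_cobounded' (α := ℂ)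
  have hvt := h1.comp hinv
  have hv : Tendsto (fun z => v z⁻¹) (cobounded ℂ) (𝓝 0) :=
    hvt.mono_right nhdsWithin_le_nhds
  have hv0 : ∀ᶠ z in cobounded ℂ, v z⁻¹ ≠ 0 := (tendsto_nhdsWithin_iff.1 hvt).2
  have h3' := hinv.eventually h3
  have hne : ∀ᶠ z : ℂ in cobounded ℂ, z ≠ 0 :=
    (eventually_notMem_germPoles_cobounded (Y := Y)).mono fun z hz => hz.2
  have hd : Tendsto (fun z => deriv (Y none) (v z⁻¹)) (cobounded ℂ)
      (𝓝 (deriv (Y none) 0)) := (hY.analytic none).deriv.continuousAt.tendsto.comp hv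
  have hvz : (fun z => z * v z⁻¹) =O[cobounded ℂ] fun _ => (1 : ℂ) := by
    have := (isBigO_refl (fun z : ℂ => z) (cobounded ℂ)).mul
      (h4.comp_tendsto hinv)
    refine this.trans (IsBigO.of_bound 1 ?_)
    filter_upwards [hne] with z hz
    simp [hz]
  have hpoly : ∀ (i : I) m, (fun z => z * poleCoeff Y n (some i) m z) =O[cobounded ℂ]
      fun _ => (1 : ℂ) := by
    intro i m
    refine ((tendsto_mul_eval_inv (Y (some i) 0)
      (polarPoly_coeff_zero (Y := Y) (n := n) i m)).isBigO_one ℂ).congr' ?_ .rfl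
    filter_upwards [eventually_notMem_germPoles_cobounded (Y := Y)] with z hz
    rw [hY.poleCoeff_some i m (notMem_germPoles.1 hz.1 i)]
  refine ⟨fun z => v z⁻¹, fun z => ω z⁻¹, hv, hv0, ?_, ?_, ?_, ?_, fun m => ?_, fun i m => ?_,
    fun i => ?_⟩
  · filter_upwards [h3', hv0] with z hz hz0
    rw [hz.2.2]
    exact inv_ne_zero (mul_ne_zero (pow_ne_zero _ hz0) hz.2.1)
  · have : Tendsto (fun z => v z⁻¹ ^ (n none + 1) * deriv (Y none) (v z⁻¹))
        (cobounded ℂ) (𝓝 0) := by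
      have := (hv.pow (n none + 1)).mul hd
      simpa using this
    refine this.congr' ?_
    filter_upwards [h3'] with z hz
    rw [hz.2.2, inv_inv]
  · have h8 := IsBigO.one_mul (IsBigO.one_pow (hv.isBigO_one ℂ) (n none - 1)) (hd.isBigO_one ℂ)
    refine h8.congr' ?_ .rfl
    filter_upwards [h3', hv0] with z hz hz0
    rw [hz.2.2, mul_inv, inv_inv, show n none + 1 = 2 * 1 + (n none - 1) by
      have := hY.n_pos none; omega, pow_add]
    field_simp
  · have h8 := (isBigO_refl (fun z : ℂ => z ^ (n none + 1)) (cobounded ℂ)).mul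
      (h5.comp_tendsto hinv)
    simp only [Function.comp, mul_one, sub_zero] at h8
    refine h8.congr' ?_ .rfl
    filter_upwards [hne] with z hz
    rw [inv_pow]
    field_simp
  · have h8 := (h7 (fun u => u ^ m) (analyticAt_pow_zero m)).comp_tendsto hinv
    refine h8.congr' ?_ .rfl
    filter_upwards [hne] with z hz
    simp only [Function.comp]
    congr 1
    have hYa := hY.analytic none
    have hc : ∀ᶠ u in 𝓝 0, Y none u ≠ z⁻¹ := by
      refine hYa.continuousAt.eventually_ne ?_
      rw [hY.infty]; exact (inv_ne_zero hz).symm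
    have h9 : (fun u => u ^ m * poleKernel Y none z u) =ᶠ[𝓝 0]
        fun u => (z⁻¹) ^ 2 * (u ^ m / (z⁻¹ - Y none u)) - z⁻¹ * u ^ m := by
      filter_upwards [hc] with u hu
      have hu1 : z⁻¹ - Y none u ≠ 0 := sub_ne_zero.2 hu.symm
      have hu2 : 1 - z * Y none u = z * (z⁻¹ - Y none u) := by field_simp
      rw [poleKernel, hu2]
      generalize Y none u = y at hu1 ⊢
      obtain ⟨c, hc0, rfl⟩ : ∃ c : ℂ, c ≠ 0 ∧ z = c⁻¹ := ⟨z⁻¹, inv_ne_zero hz, (inv_inv z).symm⟩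
      simp only [inv_inv] at hu1 ⊢
      field_simp
      ring
    have h10 : AnalyticAt ℂ (fun u => u ^ m / (z⁻¹ - Y none u)) 0 :=
      (analyticAt_pow_zero m).div (analyticAt_const.sub hYa) (by
        rw [hY.infty]; simpa using hz)
    rw [poleCoeff, taylorCoeff_congr h9, taylorCoeff_sub (analyticAt_const.fun_mul h10)
      (analyticAt_const.fun_mul (analyticAt_pow_zero m)), taylorCoeff_const_mul,
      taylorCoeff_const_mul, taylorCoeff_pow]
    simp only [eq_comm (a := n none)]
    generalize taylorCoeff (n none) _ = T
    field_simp
    ring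
  · refine (IsBigO.one_mul hvz (hpoly i m)).congr_left fun z => ?_
    ring
  · have hQ : (polarPoly Y n i 0).coeff 1 = 0 := by
      rw [polarPoly_coeff_one, if_neg (hY.n_pos _).ne]
    have h8 := tendsto_mul_eval_inv (Y (some i) 0) (Q := (polarPoly Y n i 0).divX)
      (by rw [coeff_divX]; exact hQ)
    have h9 : Tendsto (fun z => z * (z - Y (some i) 0)⁻¹) (cobounded ℂ) (𝓝 1) := by
      have := tendsto_mul_eval_inv (Y (some i) 0) (Q := X) (by simp)
      simpa using this
    refine (IsBigO.one_mul (h8.isBigO_one ℂ) (h9.isBigO_one ℂ)).congr' ?_ .rfl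
    filter_upwards [eventually_notMem_germPoles_cobounded (Y := Y)] with z hz
    rw [hY.poleCoeff_some i 0 (notMem_germPoles.1 hz.1 i)]
    conv_rhs => rw [← divX_mul_X_add (polarPoly Y n i 0), polarPoly_coeff_zero]
    simp
    ring

end IsPoleGerms

end Germs

end

section

open Polynomial Bornology Asymptotics

variable {I ι : Type} [Fintype I] [DecidableEq I] [Fintype ι] [DecidableEq ι]

/-! ### The second derivatives of the open potential in terms of germs -/
/-- The flat coordinates of index `α` belong to the pole `pole α` and to the power `k α` of the
local parameter; at a pole of order `n` the powers are `0, …, n`, and at infinity `1, …, n - 1`. -/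
structure IsFlatIndex (pole : ι → Option I) (k : ι → ℕ) (n : Option I → ℕ) : Prop where
  infty : ∀ α, pole α = none → 1 ≤ k α ∧ k α < n none
  inj : ∀ α β, pole α = pole β → k α = k β → α = β
  dual : ∀ α, ∃ β, pole β = pole α ∧ k α + k β = n (pole α)
  card : Fintype.card ι = ∑ i, (n (some i) + 1) + (n none - 1)

/-- The sign of the contribution of a pole. -/
def poleSign : Option I → ℂ
  | none => 1
  | some _ => -1

/-- The contribution of a pole to the second derivatives of the open potential. -/
def hessPart (Y : Option I → ℂ → ℂ) (n : Option I → ℕ) (a b : ℂ) (i : Option I) (m : ℕ) (z : ℂ) :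
    ℂ :=
  poleSign i * ((a + b * z) * poleCoeff Y n i m z) + b * (if m = n i then 1 else 0)

/-- The second derivatives of the open potential along the flat coordinates. -/
def hessCoeff (Y : Option I → ℂ → ℂ) (n : Option I → ℕ) (pole : ι → Option I) (k : ι → ℕ) (a b : ℂ)
    (α β : ι) (z : ℂ) : ℂ :=
  if pole α = pole β then hessPart Y n a b (pole α) (k α + k β) z else 0

/-- The contribution of infinity as a polynomial in `z`. -/
def hessInftyPoly (Y : Option I → ℂ → ℂ) (n : Option I → ℕ) (a b : ℂ) (m : ℕ) : ℂ[X] :=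
  (C a + C b * X) * inftyPoly Y n m + C (b * (if m = n none then 1 else 0))

/-- The contribution of a finite pole as a polynomial in `(z - p)⁻¹`. -/
def hessPolarPoly (Y : Option I → ℂ → ℂ) (n : Option I → ℕ) (a b : ℂ) (i : I) (m : ℕ) : ℂ[X] :=
  -(C (a + b * Y (some i) 0) * polarPoly Y n i m + C b * (polarPoly Y n i m).divX)
    + C (b * (if m = n (some i) then 1 else 0))

theorem hessPolarPoly_coeff_zero (Y : Option I → ℂ → ℂ) (n : Option I → ℕ) (a b : ℂ) (i : I)
    (m : ℕ) : (hessPolarPoly Y n a b i m).coeff 0 = 0 := by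
  simp only [hessPolarPoly, coeff_add, coeff_neg, coeff_C_mul, polarPoly_coeff_zero, coeff_divX,
    coeff_C_zero, zero_add, polarPoly_coeff_one]
  ring

/-- The linear combination of the pole coefficients that represents a tangent vector. -/
def flatCombo (Y : Option I → ℂ → ℂ) (n : Option I → ℕ) (pole : ι → Option I) (k : ι → ℕ)
    (x : ι → ℂ) (z : ℂ) : ℂ :=
  ∑ α, x α * poleCoeff Y n (pole α) (k α) z

/-- The difference between `ρ ∂_x λ ∂_y λ / λ'`, up to powers of `ρ`, and its part `H (x, y)`. -/
def hessError (Y : Option I → ℂ → ℂ) (n : Option I → ℕ) (pole : ι → Option I) (k : ι → ℕ) (a b : ℂ)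
    (x y : ι → ℂ) (z : ℂ) : ℂ :=
  (a + b * z) * (flatCombo Y n pole k x z * flatCombo Y n pole k y z / lamDeriv Y n z) -
    ∑ α, ∑ β, x α * y β * hessCoeff Y n pole k a b α β z

variable {Y : Option I → ℂ → ℂ} {n : Option I → ℕ} {pole : ι → Option I} {k : ι → ℕ}

theorem hessError_eq_sum (a b : ℂ) (x y : ι → ℂ) (z : ℂ) :
    hessError Y n pole k a b x y z = ∑ α, ∑ β, x α * y β *
      ((a + b * z) * (poleCoeff Y n (pole α) (k α) z * poleCoeff Y n (pole β) (k β) z /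
        lamDeriv Y n z) - hessCoeff Y n pole k a b α β z) := by
  rw [hessError, flatCombo, flatCombo, Finset.sum_mul_sum]
  simp only [Finset.sum_div, Finset.mul_sum, ← Finset.sum_sub_distrib]
  refine Finset.sum_congr rfl fun α _ => Finset.sum_congr rfl fun β _ => ?_
  ring

namespace IsPoleGerms

variable (hY : IsPoleGerms Y n)
include hY

theorem hessPart_none (a b : ℂ) (m : ℕ) (z : ℂ) :
    hessPart Y n a b none m z = (hessInftyPoly Y n a b m).eval z := by
  simp [hessPart, hessInftyPoly, hY.poleCoeff_none, poleSign]

theorem hessPart_some (a b : ℂ) (i : I) (m : ℕ) {z : ℂ} (hz : z ≠ Y (some i) 0) :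
    hessPart Y n a b (some i) m z = (hessPolarPoly Y n a b i m).eval (z - Y (some i) 0)⁻¹ := by
  have h1 := congrArg (eval (z - Y (some i) 0)⁻¹) (divX_mul_X_add (polarPoly Y n i m))
  have h0 : z - Y (some i) 0 ≠ 0 := sub_ne_zero.2 hz
  simp only [polarPoly_coeff_zero, eval_mul, eval_X, C_0, add_zero] at h1
  simp only [hessPart, hY.poleCoeff_some i m hz, hessPolarPoly, poleSign, eval_add, eval_neg,
    eval_mul, eval_C]
  have h2 : eval (z - Y (some i) 0)⁻¹ (polarPoly Y n i m).divX =
      (z - Y (some i) 0) * eval (z - Y (some i) 0)⁻¹ (polarPoly Y n i m) := by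
    rw [← h1]; field_simp
  rw [h2]
  ring

theorem analyticAt_hessPart (a b : ℂ) (i : Option I) (m : ℕ) {z : ℂ}
    (hz : ∀ j : I, i = some j → z ≠ Y i 0) : AnalyticAt ℂ (hessPart Y n a b i m) z :=
  (analyticAt_const.mul ((analyticAt_const.add (analyticAt_const.mul analyticAt_id)).mul
    (hY.analyticAt_poleCoeff i m hz))).add analyticAt_const

theorem analyticAt_hessCoeff (a b : ℂ) (α β : ι) {z : ℂ} (hz : z ∉ germPoles Y) :
    AnalyticAt ℂ (hessCoeff Y n pole k a b α β) z := by
  rw [notMem_germPoles] at hz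
  by_cases h : pole α = pole β
  · have : hessCoeff Y n pole k a b α β = hessPart Y n a b (pole α) (k α + k β) :=
      funext fun z => if_pos h
    rw [this]
    exact hY.analyticAt_hessPart a b _ _ fun j hj => hj ▸ hz j
  · have : hessCoeff Y n pole k a b α β = fun _ => 0 := funext fun z => if_neg h
    rw [this]
    exact analyticAt_const

theorem analyticAt_flatCombo (x : ι → ℂ) {z : ℂ} (hz : z ∉ germPoles Y) :
    AnalyticAt ℂ (flatCombo Y n pole k x) z := by
  rw [notMem_germPoles] at hz
  exact Finset.analyticAt_fun_sum _ fun α _ => analyticAt_const.mul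
    (hY.analyticAt_poleCoeff _ _ fun j hj => hj ▸ hz j)

/-- The pole orders at a finite pole: `∂_α λ / λ'` is bounded there, and so is the difference
between `ρ ∂_α λ ∂_β λ / λ'` and its polar part. -/
theorem asymp_finite (a b : ℂ) (i : I) :
    (∀ᶠ z in 𝓝[≠] (Y (some i) 0), lamDeriv Y n z ≠ 0) ∧
    (fun z => (z - Y (some i) 0) ^ (n (some i) + 1) * lamDeriv Y n z) =O[𝓝[≠] (Y (some i) 0)]
      (fun _ => (1 : ℂ)) ∧
    (∀ j m, (fun z => poleCoeff Y n j m z / lamDeriv Y n z) =O[𝓝[≠] (Y (some i) 0)]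
      (fun _ => (1 : ℂ))) ∧
    ∀ α β, (fun z => (a + b * z) * (poleCoeff Y n (pole α) (k α) z * poleCoeff Y n (pole β) (k β) z /
        lamDeriv Y n z) - hessCoeff Y n pole k a b α β z) =O[𝓝[≠] (Y (some i) 0)]
      fun _ => (1 : ℂ) := by
  obtain ⟨v, ω, hv, hv0, hω0, hω, hωp, hW, hW'⟩ := hY.exists_asymp_some i
  set p := Y (some i) 0 with hp
  have hbdd : ∀ {f : ℂ → ℂ}, AnalyticAt ℂ f p → f =O[𝓝[≠] p] fun _ => (1 : ℂ) := fun hf =>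
    (hf.continuousAt.tendsto.mono_left nhdsWithin_le_nhds).isBigO_one ℂ
  have hℓ : (fun z => -lamDeriv Y n z - ω z) =O[𝓝[≠] p] fun _ => (1 : ℂ) := by
    have h1 : (fun z => (poleCoeff Y n (some i) 0 z - v z ^ 0 * ω z) +
        (∑ j ∈ Finset.univ.erase i, poleCoeff Y n (some j) 0 z - poleCoeff Y n none 0 z))
        =O[𝓝[≠] p] fun _ => (1 : ℂ) := by
      refine (hW 0).add (IsBigO.sub (IsBigO.fun_sum fun j hj => ?_)
        (hW' none 0 (by simp)))
      exact hW' (some j) 0 fun h => Finset.ne_of_mem_erase hj (Option.some_injective _ h)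
    refine h1.congr_left fun z => ?_
    rw [lamDeriv, ← Finset.add_sum_erase _ _ (Finset.mem_univ i)]
    ring
  have hω2 : (fun z => (v z ^ (2 * 0) * ω z)⁻¹) =O[𝓝[≠] p] fun _ => (1 : ℂ) := by
    simpa using hω.isBigO_one ℂ
  have hg : ∀ j m, (fun z => v z ^ 0 * (poleCoeff Y n j m z - (if j = some i then 1 else 0) *
      (v z ^ m * ω z))) =O[𝓝[≠] p] fun _ => (1 : ℂ) := by
    intro j m
    by_cases h : j = some i
    · subst h; simpa using hW m
    · simpa [h] using hW' j m h
  obtain ⟨hne, hdiv⟩ := asymp_div hω0 hω hℓ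
  refine ⟨hne.mono fun z hz => neg_ne_zero.1 hz, ?_, fun j m => ?_, fun α β => ?_⟩
  · have hz : (fun z => z - p) =O[𝓝[≠] p] fun _ => (1 : ℂ) :=
      hbdd (analyticAt_id.sub analyticAt_const)
    have := (hωp.add (IsBigO.one_mul (IsBigO.one_pow hz (n (some i) + 1)) hℓ)).neg_left
    refine this.congr_left fun z => ?_
    ring
  · have := isBigO_div_of_asymp (r := 0) hv hv0 hω0 hω hω2 hℓ (k := m) (fun _ => Nat.zero_le _)
      (hg j m)
    simp only [pow_zero, div_neg] at this
    simpa using this.neg_left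
  · have h1 := isBigO_mul_div_sub_of_asymp (r := 0) hv hv0 hω0 hω hω2 hℓ (fun _ => Nat.zero_le _)
      (fun _ => Nat.zero_le _) (hg (pole α) (k α)) (hg (pole β) (k β))
    have hρ : (fun z => a + b * z) =O[𝓝[≠] p] fun _ => (1 : ℂ) :=
      hbdd (analyticAt_const.add (analyticAt_const.mul analyticAt_id))
    have h2 := (IsBigO.one_mul hρ h1).neg_left
    by_cases hα : pole α = some i
    · by_cases hβ : pole β = some i
      · have h3 := h2.add ((IsBigO.one_mul hρ (hW (k α + k β))).add
          (isBigO_const_const (-(b * if k α + k β = n (some i) then 1 else 0) : ℂ)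
            one_ne_zero (𝓝[≠] p)))
        refine h3.congr_left fun z => ?_
        simp only [hessCoeff, hα, hβ, if_true, hessPart, poleSign, div_neg]
        ring
      · have h3 : ∀ z, hessCoeff Y n pole k a b α β z = 0 := fun z => by
          rw [hessCoeff, if_neg]
          rw [hα]; exact fun h => hβ h.symm
        refine h2.congr_left fun z => ?_
        simp only [h3, hβ, if_false, div_neg]
        ring
    · have h3 : hessCoeff Y n pole k a b α β =O[𝓝[≠] p] fun _ => (1 : ℂ) := by
        by_cases hαβ : pole α = pole β
        · have h4 := hbdd (hY.analyticAt_hessPart a b (pole α) (k α + k β) (z := p) fun j hj h => by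
            rw [hj, hp] at h
            exact hα (hj.trans (congrArg some (hY.inj h.symm))))
          refine h4.congr_left fun z => ?_
          rw [hessCoeff, if_pos hαβ]
        · refine (isBigO_zero _ _).congr_left fun z => ?_
          rw [hessCoeff, if_neg hαβ]
      refine (h2.sub h3).congr_left fun z => ?_
      simp only [hα, if_false, div_neg]
      ring

/-- The counterpart at infinity, where the quotients and differences tend to zero. -/
theorem asymp_infty (hk : IsFlatIndex pole k n) (a b : ℂ) :
    (∀ᶠ z in cobounded ℂ, lamDeriv Y n z ≠ 0) ∧
    (lamDeriv Y n) =O[cobounded ℂ] (fun z => z ^ (n none - 1)) ∧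
    (∀ α, Tendsto (fun z => poleCoeff Y n (pole α) (k α) z / lamDeriv Y n z)
      (cobounded ℂ) (𝓝 0)) ∧
    ∀ α β, Tendsto (fun z => (a + b * z) * (poleCoeff Y n (pole α) (k α) z *
        poleCoeff Y n (pole β) (k β) z / lamDeriv Y n z) - hessCoeff Y n pole k a b α β z)
      (cobounded ℂ) (𝓝 0) := by
  obtain ⟨v, ω, hv, hv0, hω0, hω, hω2, hωz, hW, hW1, hW2⟩ := hY.exists_asymp_none
  have hn := hY.n_pos none
  have hv1 := hv.isBigO_one ℂ
  have hne : ∀ᶠ z : ℂ in cobounded ℂ, z ≠ 0 :=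
    (eventually_notMem_germPoles_cobounded (Y := Y)).mono fun z hz => hz.2
  have hzinv : Tendsto (fun z : ℂ => z⁻¹) (cobounded ℂ) (𝓝 0) := tendsto_inv₀_cobounded
  have hℓ : (fun z => z ^ 2 * lamDeriv Y n z - ω z) =O[cobounded ℂ]
      fun _ => (1 : ℂ) := by
    have h1 := (hW 0).sub (IsBigO.fun_sum (s := Finset.univ) fun i _ => hW2 i)
    refine h1.congr_left fun z => ?_
    rw [if_neg hn.ne, lamDeriv, mul_sub, Finset.mul_sum]
    ring
  have hg : ∀ α, (fun z => v z ^ 1 * (z ^ 2 * poleCoeff Y n (pole α) (k α) z -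
      (if pole α = none then 1 else 0) * (v z ^ k α * ω z))) =O[cobounded ℂ]
      fun _ => (1 : ℂ) := by
    intro α
    rcases h : pole α with _ | i
    · have h1 := IsBigO.one_mul (IsBigO.one_pow hv1 1) (hW (k α))
      refine h1.congr_left fun z => ?_
      rw [if_neg (hk.infty α h).2.ne]
      simp
    · simpa using hW1 i (k α)
  have hr : ∀ α, (if pole α = none then (1 : ℂ) else 0) ≠ 0 → 1 ≤ k α := by
    intro α hα
    by_cases h : pole α = none
    · exact (hk.infty α h).1
    · simp [h] at hα
  obtain ⟨hne', -⟩ := asymp_div hω0 hω hℓ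
  refine ⟨hne'.mono fun z hz => right_ne_zero_of_mul hz, ?_, fun α => ?_, fun α β => ?_⟩
  · have h1 : (fun z => z ^ 2 * lamDeriv Y n z) =O[cobounded ℂ]
        fun z => z ^ (n none + 1) := by
      have h2 : (fun _ : ℂ => (1 : ℂ)) =O[cobounded ℂ] fun z => z ^ (n none + 1) := by
        refine IsBigO.of_bound 1 ?_
        filter_upwards [eventually_cobounded_le_norm (1 : ℝ)] with z hz
        simpa using one_le_pow₀ hz
      refine ((hℓ.trans h2).add hωz).congr_left fun z => ?_
      ring
    have h3 := (isBigO_refl (fun z : ℂ => (z ^ 2)⁻¹) (cobounded ℂ)).mul h1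
    refine h3.congr' ?_ ?_
    · filter_upwards [hne] with z hz
      field_simp
    · filter_upwards [hne] with z hz
      rw [show n none + 1 = 2 + (n none - 1) by omega, pow_add]
      field_simp
  · have h1 := isBigO_div_of_asymp (r := 1) hv1 hv0 hω0 hω hω2 hℓ (hr α) (hg α)
    have h2 : Tendsto (fun z => v z ^ 1) (cobounded ℂ) (𝓝 0) := by simpa using hv
    refine (h1.trans_tendsto h2).congr' ?_
    filter_upwards [hne] with z hz
    rw [mul_div_mul_left _ _ (pow_ne_zero 2 hz)]
  · have h1 := isBigO_mul_div_sub_of_asymp (r := 1) hv1 hv0 hω0 hω hω2 hℓ (hr α) (hr β) (hg α) (hg β)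
    have hρ : Tendsto (fun z => (a + b * z) * (z ^ 2)⁻¹) (cobounded ℂ) (𝓝 0) := by
      have := ((hzinv.pow 2).const_mul a).add (hzinv.const_mul b)
      simp only [ne_eq, OfNat.ofNat_ne_zero, not_false_eq_true, zero_pow, mul_zero, add_zero] at this
      refine this.congr' ?_
      filter_upwards [hne] with z hz
      field_simp
    have hmul : ∀ {f : ℂ → ℂ}, f =O[cobounded ℂ] (fun _ => (1 : ℂ)) →
        Tendsto (fun z => ((a + b * z) * (z ^ 2)⁻¹) * f z) (cobounded ℂ) (𝓝 0) := by
      intro f hf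
      have := ((isLittleO_one_iff ℂ).2 hρ).mul_isBigO hf
      simpa [isLittleO_one_iff] using this
    have h2 := hmul h1
    by_cases hα : pole α = none
    · by_cases hβ : pole β = none
      · have h3 := (h2.sub (hmul (hW (k α + k β)))).add
          (hzinv.const_mul (a * if k α + k β = n none then 1 else 0))
        simp only [sub_zero, mul_zero, add_zero] at h3
        refine h3.congr' ?_
        filter_upwards [hne, hne'] with z hz hℓz
        have hℓz' := right_ne_zero_of_mul hℓz
        simp only [hessCoeff, hα, hβ, if_true, hessPart, poleSign]
        generalize (if k α + k β = n none then (1 : ℂ) else 0) = d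
        field_simp
        ring
      · have h3 : ∀ z, hessCoeff Y n pole k a b α β z = 0 := fun z => by
          rw [hessCoeff, if_neg]
          rw [hα]; exact fun h => hβ h.symm
        refine h2.congr' ?_
        filter_upwards [hne, hne'] with z hz hℓz
        have hℓz' := right_ne_zero_of_mul hℓz
        simp only [h3, hβ, if_false]
        field_simp
        ring
    · have h3 : Tendsto (hessCoeff Y n pole k a b α β) (cobounded ℂ) (𝓝 0) := by
        obtain ⟨i, hi⟩ := Option.ne_none_iff_exists'.1 hα
        by_cases hαβ : pole α = pole β
        · have h4 := (hessPolarPoly Y n a b i (k α + k β)).continuous.tendsto 0 |>.comp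
            (tendsto_sub_inv_cobounded (Y (some i) 0))
          rw [← coeff_zero_eq_eval_zero, hessPolarPoly_coeff_zero] at h4
          refine h4.congr' ?_
          filter_upwards [eventually_notMem_germPoles_cobounded (Y := Y)] with z hz
          rw [hessCoeff, if_pos hαβ, hi,
            hY.hessPart_some a b i _ (notMem_germPoles.1 hz.1 i)]
          rfl
        · refine tendsto_const_nhds.congr fun z => ?_
          rw [hessCoeff, if_neg hαβ]
      have h4 := h2.sub h3
      rw [sub_zero] at h4
      refine h4.congr' ?_
      filter_upwards [hne, hne'] with z hz hℓz
      have hℓz' := right_ne_zero_of_mul hℓz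
      simp only [hα, if_false]
      field_simp
      ring

theorem hessError_isBigO (a b : ℂ) (x y : ι → ℂ) (i : I) :
    hessError Y n pole k a b x y =O[𝓝[≠] (Y (some i) 0)] fun _ => (1 : ℂ) := by
  have h := (hY.asymp_finite (pole := pole) (k := k) a b i).2.2.2
  refine IsBigO.congr_left ?_ fun z => (hessError_eq_sum a b x y z).symm
  exact IsBigO.fun_sum fun α _ => IsBigO.fun_sum fun β _ =>
    (h α β).const_mul_left _

theorem hessError_tendsto (hk : IsFlatIndex pole k n) (a b : ℂ) (x y : ι → ℂ) :
    Tendsto (hessError Y n pole k a b x y) (cobounded ℂ) (𝓝 0) := by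
  have h := (hY.asymp_infty hk a b).2.2.2
  refine Tendsto.congr (fun z => (hessError_eq_sum a b x y z).symm) ?_
  have := tendsto_finsetSum (s := Finset.univ) fun α _ =>
    tendsto_finsetSum (s := Finset.univ) fun β _ => (h α β).const_mul (x α * y β)
  simpa using this

theorem flatCombo_div_isBigO (x : ι → ℂ) (i : I) :
    (fun z => flatCombo Y n pole k x z / lamDeriv Y n z) =O[𝓝[≠] (Y (some i) 0)]
      fun _ => (1 : ℂ) := by
  have h := (hY.asymp_finite (pole := pole) (k := k) 0 0 i).2.2.1
  simp only [flatCombo, Finset.sum_div, mul_div_assoc]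
  exact IsBigO.fun_sum fun α _ => (h _ _).const_mul_left _

theorem flatCombo_div_tendsto (hk : IsFlatIndex pole k n) (x : ι → ℂ) :
    Tendsto (fun z => flatCombo Y n pole k x z / lamDeriv Y n z) (cobounded ℂ) (𝓝 0) := by
  have h := (hY.asymp_infty hk 0 0).2.2.1
  simp only [flatCombo, Finset.sum_div, mul_div_assoc]
  have := tendsto_finsetSum (s := Finset.univ) fun α _ => (h α).const_mul (x α)
  simpa using this

/-- A holomorphic function off the poles which is `O (λ')` at the finite poles and `o (λ')` at
infinity becomes a polynomial of bounded degree when multiplied by a fixed polynomial. -/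
theorem exists_polynomial (hk : IsFlatIndex pole k n) {h : ℂ → ℂ}
    (hd : ∀ z ∉ germPoles Y, DifferentiableAt ℂ h z)
    (hfin : ∀ i, (fun z => h z / lamDeriv Y n z) =O[𝓝[≠] (Y (some i) 0)] fun _ => (1 : ℂ))
    (hinf : Tendsto (fun z => h z / lamDeriv Y n z) (cobounded ℂ) (𝓝 0)) :
    ∃ P : ℂ[X], P ∈ degreeLT ℂ (Fintype.card ι) ∧ ∀ z ∉ germPoles Y,
      P.eval z = h z * ∏ i : I, (z - Y (some i) 0) ^ (n (some i) + 1) := by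
  set d : ℂ → ℕ := fun p => ∑ i, if Y (some i) 0 = p then n (some i) + 1 else 0 with hd_def
  have hdi : ∀ i, d (Y (some i) 0) = n (some i) + 1 := by
    intro i
    rw [hd_def]
    dsimp only
    rw [Finset.sum_eq_single i]
    · simp
    · intro j _ hj
      exact if_neg fun h => hj (hY.inj h)
    · simp
  obtain ⟨P, hP, hPz⟩ := exists_polynomial_of_poles (D := n none - 1) hd (d := d) (by
    intro p hp
    obtain ⟨i, -, rfl⟩ := Finset.mem_image.1 hp
    rw [hdi]
    obtain ⟨h1, h2, -⟩ := hY.asymp_finite (pole := pole) (k := k) 0 0 i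
    refine (IsBigO.one_mul (hfin i) h2).congr' ?_ .rfl
    filter_upwards [h1] with z hz
    field_simp) (by
    obtain ⟨h1, h2, -⟩ := hY.asymp_infty hk 0 0
    have h3 := ((isLittleO_one_iff ℂ).2 hinf).mul_isBigO h2
    simp only [one_mul] at h3
    refine h3.tendsto_div_nhds_zero.congr' ?_
    filter_upwards [h1] with z hz
    field_simp)
  refine ⟨P, ?_, fun z hz => ?_⟩
  · rw [mem_degreeLT, hk.card]
    refine hP.trans_eq ?_
    rw [germPoles, Finset.sum_image hY.inj.injOn]
    simp only [hdi]
  · rw [hPz z hz, germPoles, Finset.prod_image hY.inj.injOn]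
    simp only [hdi]

end IsPoleGerms

end

section

open Polynomial Bornology Asymptotics

variable {I ι : Type} [Fintype I] [DecidableEq I] [Fintype ι] [DecidableEq ι]
  {Y : Option I → ℂ → ℂ} {n : Option I → ℕ} {pole : ι → Option I} {k : ι → ℕ}

/-! ### Residues at the critical points and the division identity -/
/-- The Gram matrix of the metric in the flat coordinates. -/
def flatGram (pole : ι → Option I) (k : ι → ℕ) (n : Option I → ℕ) : Matrix ι ι ℂ :=
  Matrix.of fun α β => if pole α = pole β ∧ k α + k β = n (pole α) then 1 else 0

theorem flatGram_symm (α β : ι) : flatGram pole k n α β = flatGram pole k n β α := by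
  simp only [flatGram, Matrix.of_apply]
  congr 1
  refine propext ⟨fun h => ⟨h.1.symm, ?_⟩, fun h => ⟨h.1.symm, ?_⟩⟩
  · rw [add_comm, h.2, h.1]
  · rw [add_comm, h.2, h.1]

theorem flatGram_mul_self (hk : IsFlatIndex pole k n) :
    flatGram pole k n * flatGram pole k n = 1 := by
  ext α γ
  obtain ⟨β, hβ, hβk⟩ := hk.dual α
  have hu : ∀ δ, pole α = pole δ ∧ k α + k δ = n (pole α) ↔ δ = β := by
    intro δ
    constructor
    · rintro ⟨h1, h2⟩
      exact hk.inj δ β (h1.symm.trans hβ.symm) (by omega)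
    · rintro rfl
      exact ⟨hβ.symm, hβk⟩
  rw [Matrix.mul_apply, Finset.sum_eq_single β]
  · simp only [flatGram, Matrix.of_apply, Matrix.one_apply]
    rw [if_pos ((hu β).2 rfl), one_mul]
    congr 1
    refine propext ⟨fun h => ?_, fun h => ?_⟩
    · exact hk.inj _ _ (hβ.symm.trans h.1) (by have := h.2; rw [hβ] at this; omega)
    · subst h
      exact ⟨hβ, by rw [hβ]; omega⟩
  · intro δ _ hδ
    simp only [flatGram, Matrix.of_apply]
    rw [if_neg fun h => hδ ((hu δ).1 h), zero_mul]
  · simp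

theorem flatGram_det_ne_zero (hk : IsFlatIndex pole k n) : (flatGram pole k n).det ≠ 0 := by
  intro h
  have := congrArg Matrix.det (flatGram_mul_self hk)
  rw [Matrix.det_mul, h, zero_mul, Matrix.det_one] at this
  exact zero_ne_one this

/-- The zeros of the derivative of the superpotential. -/
def germCrit (Y : Option I → ℂ → ℂ) (n : Option I → ℕ) : Set ℂ :=
  {z | z ∉ germPoles Y ∧ lamDeriv Y n z = 0}

theorem isOpen_compl_germPoles (Y : Option I → ℂ → ℂ) : IsOpen {z | z ∉ germPoles Y} :=
  (germPoles Y).finite_toSet.isClosed.isOpen_compl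

/-- The polynomial part at infinity of the second derivative of the open potential along `x`, `y`.
-/
def hessInftySum (Y : Option I → ℂ → ℂ) (n : Option I → ℕ) (pole : ι → Option I) (k : ι → ℕ)
    (a b : ℂ) (x y : ι → ℂ) : ℂ[X] :=
  ∑ α, ∑ β, C (x α * y β * if pole α = none ∧ pole β = none then 1 else 0) *
    hessInftyPoly Y n a b (k α + k β)

/-- Its principal part at a finite pole `p`, as a polynomial in `(z - p)⁻¹`. -/
def hessPolarSum (Y : Option I → ℂ → ℂ) (n : Option I → ℕ) (pole : ι → Option I) (k : ι → ℕ)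
    (a b : ℂ) (x y : ι → ℂ) (i : I) : ℂ[X] :=
  ∑ α, ∑ β, C (x α * y β * if pole α = some i ∧ pole β = some i then 1 else 0) *
    hessPolarPoly Y n a b i (k α + k β)

namespace IsPoleGerms

variable (hY : IsPoleGerms Y n)
include hY

theorem exists_polynomial_lamDeriv (hk : IsFlatIndex pole k n) :
    ∃ P : ℂ[X], P ≠ 0 ∧ ∀ z ∉ germPoles Y,
      P.eval z = lamDeriv Y n z * ∏ i : I, (z - Y (some i) 0) ^ (n (some i) + 1) := by
  -- the derivative is `O (λ')` but not `o (λ')` at infinity, so it is divided by `z` there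
  set d : ℂ → ℕ := fun p => ∑ i, if Y (some i) 0 = p then n (some i) + 1 else 0 with hd_def
  have hdi : ∀ i, d (Y (some i) 0) = n (some i) + 1 := by
    intro i
    rw [hd_def]
    dsimp only
    rw [Finset.sum_eq_single i]
    · simp
    · intro j _ hj
      exact if_neg fun h => hj (hY.inj h)
    · simp
  obtain ⟨hne, hO, -⟩ := hY.asymp_infty hk 0 0
  obtain ⟨P, -, hPz⟩ := exists_polynomial_of_poles (D := n none - 1 + 1) (d := d)
    (fun z hz => (hY.analyticAt_lamDeriv hz).differentiableAt) (by
    intro p hp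
    obtain ⟨i, -, rfl⟩ := Finset.mem_image.1 hp
    rw [hdi]
    exact (hY.asymp_finite (pole := pole) (k := k) 0 0 i).2.1) (by
    have hz : (fun z : ℂ => z ^ (n none - 1)) =o[cobounded ℂ]
        fun z => z ^ (n none - 1 + 1) := by
      have h1 : (fun _ : ℂ => (1 : ℂ)) =o[cobounded ℂ] fun z => z :=
        (isLittleO_const_left.2 (Or.inr tendsto_norm_cobounded_atTop))
      simpa [pow_succ] using
        (isBigO_refl (fun z : ℂ => z ^ (n none - 1)) _).mul_isLittleO h1
    exact (hO.trans_isLittleO hz).tendsto_div_nhds_zero)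
  refine ⟨P, ?_, fun z hz => ?_⟩
  · rintro rfl
    obtain ⟨z, hz, hzS⟩ := (hne.and (eventually_notMem_germPoles_cobounded (Y := Y))).exists
    have := hPz z hzS.1
    rw [eval_zero, eq_comm, mul_eq_zero, Finset.prod_eq_zero_iff] at this
    rcases this with h | ⟨p, hp, h⟩
    · exact hz h
    · exact hzS.1 (by rw [sub_eq_zero.1 (pow_eq_zero_iff (by
        obtain ⟨i, -, rfl⟩ := Finset.mem_image.1 hp
        rw [hdi]; omega) |>.1 h)]; exact hp)
  · rw [hPz z hz, germPoles, Finset.prod_image hY.inj.injOn]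
    simp only [hdi]

theorem finite_germCrit (hk : IsFlatIndex pole k n) : (germCrit Y n).Finite := by
  obtain ⟨P, hP, hPz⟩ := hY.exists_polynomial_lamDeriv hk
  refine P.roots.toFinset.finite_toSet.subset fun z hz => ?_
  simp only [Finset.mem_coe, Multiset.mem_toFinset, mem_roots hP, IsRoot]
  rw [hPz z hz.1, hz.2, zero_mul]

/-- Near every point off the poles the derivative of the superpotential vanishes to finite order. -/
theorem exists_lamDeriv_eq (hk : IsFlatIndex pole k n) {p : ℂ} (hp : p ∉ germPoles Y) :
    ∃ (N : ℕ) (g : ℂ → ℂ), AnalyticAt ℂ g p ∧ g p ≠ 0 ∧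
      ∀ᶠ z in 𝓝[≠] p, lamDeriv Y n z = (z - p) ^ N * g z := by
  have ha := hY.analyticAt_lamDeriv hp
  have hfin : ∀ᶠ z in 𝓝[≠] p, lamDeriv Y n z ≠ 0 := by
    have h1 : ∀ᶠ z in 𝓝[≠] p, z ∉ (hY.finite_germCrit hk).toFinset.erase p :=
      nhdsWithin_le_nhds (((hY.finite_germCrit hk).toFinset.erase
        p).finite_toSet.isClosed.isOpen_compl.mem_nhds (by simp))
    filter_upwards [h1, eventually_notMem_germPoles (Y := Y) p, self_mem_nhdsWithin] with
      z hz hz2 hz3 h0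
    exact hz (Finset.mem_erase.2 ⟨hz3, (hY.finite_germCrit hk).mem_toFinset.2 ⟨hz2, h0⟩⟩)
  have htop : analyticOrderAt (lamDeriv Y n) p ≠ ⊤ := by
    intro h
    rw [analyticOrderAt_eq_top] at h
    obtain ⟨z, h1, h2⟩ := (hfin.and (nhdsWithin_le_nhds h)).exists
    exact h1 h2
  obtain ⟨g, hg, hg0, hgz⟩ := (ha.analyticOrderAt_ne_top).1 htop
  exact ⟨analyticOrderNatAt (lamDeriv Y n) p, g, hg, hg0, nhdsWithin_le_nhds hgz⟩

omit hY in
theorem hessPolarSum_coeff_zero (a b : ℂ) (x y : ι → ℂ) (i : I) :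
    (hessPolarSum Y n pole k a b x y i).coeff 0 = 0 := by
  simp only [hessPolarSum, finsetSum_coeff, coeff_C_mul, hessPolarPoly_coeff_zero, mul_zero,
    Finset.sum_const_zero]

/-- The second derivatives of the open potential as a sum of contributions of the poles. -/
theorem sum_hessCoeff_eq (a b : ℂ) (x y : ι → ℂ) {z : ℂ} (hz : z ∉ germPoles Y) :
    ∑ α, ∑ β, x α * y β * hessCoeff Y n pole k a b α β z =
      (hessInftySum Y n pole k a b x y).eval z +
        ∑ i, (hessPolarSum Y n pole k a b x y i).eval (z - Y (some i) 0)⁻¹ := by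
  simp only [hessInftySum, hessPolarSum, eval_finsetSum, eval_mul, eval_C, ← hY.hessPart_none]
  rw [Finset.sum_comm (s := (Finset.univ : Finset I)), ← Finset.sum_add_distrib]
  refine Finset.sum_congr rfl fun α _ => ?_
  rw [Finset.sum_comm (s := (Finset.univ : Finset I)), ← Finset.sum_add_distrib]
  refine Finset.sum_congr rfl fun β _ => ?_
  simp only [← hY.hessPart_some a b _ _ (notMem_germPoles.1 hz _), hessCoeff]
  rcases h : pole α with _ | j
  · by_cases hβ : pole β = none
    · simp [hβ]
    · simp [hβ, eq_comm (a := (none : Option I))]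
  · rw [Finset.sum_eq_single j]
    · by_cases hβ : pole β = some j
      · simp [hβ]
      · have : ¬ some j = pole β := fun h' => hβ h'.symm
        simp [hβ, this]
    · intro i _ hi
      rw [if_neg]
      · ring
      · rintro ⟨h', -⟩
        exact hi (Option.some_injective _ h').symm
    · simp

theorem tendsto_hessError_add (hk : IsFlatIndex pole k n) (a b : ℂ) (x y : ι → ℂ) :
    Tendsto (fun z => hessError Y n pole k a b x y z + ∑ i,
      (hessPolarSum Y n pole k a b x y i).eval (z - Y (some i) 0)⁻¹) (cobounded ℂ) (𝓝 0) := by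
  have h : ∀ i ∈ Finset.univ, Tendsto (fun z => (hessPolarSum Y n pole k a b x y i).eval
      (z - Y (some i) 0)⁻¹) (cobounded ℂ) (𝓝 0) := fun i _ => by
    have := (hessPolarSum Y n pole k a b x y i).continuous.tendsto 0 |>.comp
      (tendsto_sub_inv_cobounded (Y (some i) 0))
    rwa [← coeff_zero_eq_eval_zero, hessPolarSum_coeff_zero] at this
  simpa using (hY.hessError_tendsto hk a b x y).add (tendsto_finsetSum Finset.univ h)

section Quotient

variable {a b : ℂ} {x y : ι → ℂ} {f : ℂ → ℂ} (hf : ∀ z ∉ germPoles Y,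
  f z = (a + b * z) * (flatCombo Y n pole k x z * flatCombo Y n pole k y z / lamDeriv Y n z))
include hf

theorem analyticAt_quotient {z : ℂ} (hz : z ∉ germPoles Y) (h0 : lamDeriv Y n z ≠ 0) :
    AnalyticAt ℂ f z := by
  refine (((analyticAt_const (v := a)).add ((analyticAt_const (v := b)).mul analyticAt_id)).mul
    (((hY.analyticAt_flatCombo (pole := pole) (k := k) x hz).mul
      (hY.analyticAt_flatCombo (pole := pole) (k := k) y hz)).div
        (hY.analyticAt_lamDeriv hz) h0)).congr ?_
  filter_upwards [(isOpen_compl_germPoles Y).mem_nhds hz] with w hw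
  exact (hf w hw).symm

theorem quotient_eq {z : ℂ} (hz : z ∉ germPoles Y) : f z = hessError Y n pole k a b x y z +
    ((hessInftySum Y n pole k a b x y).eval z +
      ∑ i, (hessPolarSum Y n pole k a b x y i).eval (z - Y (some i) 0)⁻¹) := by
  rw [hf z hz, hessError, ← hY.sum_hessCoeff_eq a b x y hz]
  ring

theorem isBigO_quotient_sub (i : I) : (fun z => f z - (hessPolarSum Y n pole k a b x y i).eval
    (z - Y (some i) 0)⁻¹) =O[𝓝[≠] (Y (some i) 0)] fun _ => (1 : ℂ) := by
  have h3 : (fun z => (hessInftySum Y n pole k a b x y).eval z) =O[𝓝[≠] (Y (some i) 0)]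
      fun _ => (1 : ℂ) := ((hessInftySum Y n pole k a b x y).continuous.continuousAt.tendsto.mono_left
    nhdsWithin_le_nhds).isBigO_one ℂ
  have h4 : (fun z => ∑ j ∈ Finset.univ.erase i, (hessPolarSum Y n pole k a b x y j).eval
      (z - Y (some j) 0)⁻¹) =O[𝓝[≠] (Y (some i) 0)] fun _ => (1 : ℂ) := by
    refine IsBigO.fun_sum fun j hj => ?_
    have h5 : ContinuousAt (fun z => (z - Y (some j) 0)⁻¹) (Y (some i) 0) :=
      (continuousAt_id.sub continuousAt_const).inv₀
        (sub_ne_zero.2 fun h => Finset.ne_of_mem_erase hj (hY.inj h).symm)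
    exact (((hessPolarSum Y n pole k a b x y j).continuous.continuousAt.comp h5).tendsto.mono_left
      nhdsWithin_le_nhds).isBigO_one ℂ
  refine (((hY.hessError_isBigO (pole := pole) (k := k) a b x y i).add h3).add h4).congr' ?_
    .rfl
  filter_upwards [eventually_notMem_germPoles (Y := Y) (Y (some i) 0)] with w hw
  rw [hY.quotient_eq hf hw, ← Finset.add_sum_erase _ _ (Finset.mem_univ i)]
  ring

/-- The polynomial part at infinity and the principal parts at the finite poles add up to the second
derivatives of the open potential. -/
theorem sum_principalPart (hk : IsFlatIndex pole k n) {z : ℂ} (hz : z ∉ germPoles Y) :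
    inftyPart f z + ∑ p ∈ germPoles Y, principalPart f p z =
      ∑ α, ∑ β, x α * y β * hessCoeff Y n pole k a b α β z := by
  have h1 : inftyPart f z = (hessInftySum Y n pole k a b x y).eval z := by
    obtain ⟨hne, -⟩ := hY.asymp_infty hk 0 0
    refine inftyPart_eq ?_ ?_ z
    · filter_upwards [hne, eventually_notMem_germPoles_cobounded (Y := Y)] with w hw hw2
      exact (hY.analyticAt_quotient hf hw2.1 hw).continuousAt
    · refine (hY.tendsto_hessError_add hk a b x y).congr' ?_
      filter_upwards [eventually_notMem_germPoles_cobounded (Y := Y)] with w hw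
      rw [hY.quotient_eq hf hw.1]
      ring
  have h2 : ∀ i, principalPart f (Y (some i) 0) z =
      (hessPolarSum Y n pole k a b x y i).eval (z - Y (some i) 0)⁻¹ := fun i => by
    obtain ⟨hne, -⟩ := hY.asymp_finite (pole := pole) (k := k) 0 0 i
    refine principalPart_eq ?_ (hY.isBigO_quotient_sub hf i) (hessPolarSum_coeff_zero a b x y i) z
    filter_upwards [hne, eventually_notMem_germPoles (Y := Y) (Y (some i) 0)] with w hw hw2
    exact (hY.analyticAt_quotient hf hw2 hw).continuousAt
  rw [h1, germPoles, Finset.sum_image hY.inj.injOn, hY.sum_hessCoeff_eq a b x y hz]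
  simp only [h2]

end Quotient

/-- The metric in flat coordinates. By the residue theorem the residues at the critical points are
minus those at the poles and at infinity, which `hessError` is precise enough to compute. -/
theorem sum_residue_crit (hk : IsFlatIndex pole k n) (x y : ι → ℂ) {f : ℂ → ℂ}
    (hf : ∀ z ∉ germPoles Y,
      f z = flatCombo Y n pole k x z * flatCombo Y n pole k y z / lamDeriv Y n z) :
    ∑ᶠ p ∈ germCrit Y n, residue f p = ∑ α, ∑ β, x α * y β * flatGram pole k n α β := by
  have hfin := hY.finite_germCrit hk
  have hf1 : ∀ z ∉ germPoles Y, f z = (1 + 0 * z) *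
      (flatCombo Y n pole k x z * flatCombo Y n pole k y z / lamDeriv Y n z) := fun z hz => by
    rw [hf z hz, zero_mul, add_zero, one_mul]
  set T := hfin.toFinset with hT
  have hTS : Disjoint (germPoles Y) T := Finset.disjoint_left.2 fun z hz hzT =>
    (hfin.mem_toFinset.1 hzT).1 hz
  have hfa : ∀ z ∉ germPoles Y ∪ T, AnalyticAt ℂ f z := fun z hz => by
    rw [Finset.notMem_union] at hz
    exact hY.analyticAt_quotient hf1 hz.1 fun h => hz.2 (hfin.mem_toFinset.2 ⟨hz.1, h⟩)
  have hcont : ∀ p, ∀ᶠ z in 𝓝[≠] p, ContinuousAt f z := fun p => by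
    have h1 : ∀ᶠ z in 𝓝[≠] p, z ∉ (germPoles Y ∪ T).erase p :=
      nhdsWithin_le_nhds (((germPoles Y ∪ T).erase p).finite_toSet.isClosed.isOpen_compl.mem_nhds
        (by simp))
    filter_upwards [h1, self_mem_nhdsWithin] with z hz hz2
    exact (hfa z fun h => hz (Finset.mem_erase.2 ⟨hz2, h⟩)).continuousAt
  set P := hessInftySum Y n pole k 1 0 x y with hP
  have hQcrit : ∀ p ∈ T, ∃ Q : ℂ[X], Q.coeff 0 = 0 ∧
      (fun z => f z - Q.eval (z - p)⁻¹) =O[𝓝[≠] p] fun _ => (1 : ℂ) := by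
    intro p hp
    have hpS := (hfin.mem_toFinset.1 hp).1
    obtain ⟨N, g, hg, hg0, hgz⟩ := hY.exists_lamDeriv_eq hk hpS
    obtain ⟨Q, hQ0, hQ⟩ := exists_polarPart (((hY.analyticAt_flatCombo (pole := pole) (k := k) x
      hpS).mul (hY.analyticAt_flatCombo (pole := pole) (k := k) y hpS)).div hg hg0) N
    refine ⟨Q, hQ0, hQ.congr' ?_ .rfl⟩
    filter_upwards [hgz, eventually_notMem_germPoles (Y := Y) p] with z hz hzS
    rw [hf z hzS, hz]
    simp only [Pi.div_apply, Pi.mul_apply]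
    rw [div_div, mul_comm (g z)]
  have hex : ∀ p ∈ germPoles Y ∪ T, ∃ Q : ℂ[X], Q.coeff 0 = 0 ∧
      (fun z => f z - Q.eval (z - p)⁻¹) =O[𝓝[≠] p] fun _ => (1 : ℂ) := by
    intro p hp
    rcases Finset.mem_union.1 hp with h | h
    · obtain ⟨i, -, rfl⟩ := Finset.mem_image.1 h
      exact ⟨_, hessPolarSum_coeff_zero 1 0 x y i, hY.isBigO_quotient_sub hf1 i⟩
    · exact hQcrit p h
  choose! Q hQ0 hQ using hex
  have hres : ∀ p ∈ germPoles Y ∪ T, residue f p = (Q p).coeff 1 := fun p hp =>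
    residue_eq (hcont p) (hQ p hp)
  set c : ℂ := ∑ α, ∑ β, x α * y β * (if pole α = none ∧ pole β = none then
    (if k α + k β = n none then 1 else 0) else 0) with hc
  -- at infinity the product of `f` with `z` is the quotient for `ρ = z`
  have hP1 : hessInftySum Y n pole k 0 1 x y = X * P + C c := by
    simp only [hP, hc, hessInftySum, hessInftyPoly, Finset.mul_sum, map_sum,
      ← Finset.sum_add_distrib]
    refine Finset.sum_congr rfl fun α _ => Finset.sum_congr rfl fun β _ => ?_
    split_ifs <;> simp <;> ring
  have hinf : Tendsto (fun z => z * (f z - P.eval z)) (cobounded ℂ) (𝓝 c) := by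
    have h3 := (hY.tendsto_hessError_add hk 0 1 x y).add_const c
    rw [zero_add] at h3
    refine h3.congr' ?_
    filter_upwards [eventually_notMem_germPoles_cobounded (Y := Y)] with z hz
    have h4 := hY.quotient_eq (a := 0) (b := 1) (f := fun z => z * f z) (fun z hz => by
      rw [hf z hz, zero_add, one_mul]) hz.1
    rw [mul_sub, h4, hP1]
    simp
    ring
  have hsum := sum_residues (S := germPoles Y ∪ T) (F := fun z => f z - P.eval z)
    (fun z hz => (hfa z hz).differentiableAt.sub P.differentiable.differentiableAt) hQ0
    (fun p hp => by
      have h1 : (fun z => P.eval z) =O[𝓝[≠] p] fun _ => (1 : ℂ) :=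
        (P.continuous.continuousAt.tendsto.mono_left nhdsWithin_le_nhds).isBigO_one ℂ
      refine ((hQ p hp).sub h1).congr_left fun z => ?_
      ring) hinf
  rw [Finset.sum_union hTS, ← Finset.sum_congr rfl fun p hp => hres p (Finset.mem_union_left _ hp),
    ← Finset.sum_congr rfl fun p hp => hres p (Finset.mem_union_right _ hp), germPoles,
    Finset.sum_image hY.inj.injOn] at hsum
  rw [finsum_mem_eq_finite_toFinset_sum _ hfin, ← hT, eq_sub_of_add_eq' hsum,
    Finset.sum_congr rfl fun i _ => residue_eq (hcont _) (hY.isBigO_quotient_sub hf1 i)]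
  simp only [hessPolarSum, finsetSum_coeff, coeff_C_mul, hc]
  rw [Finset.sum_comm (s := (Finset.univ : Finset I)), ← Finset.sum_sub_distrib]
  refine Finset.sum_congr rfl fun α _ => ?_
  rw [Finset.sum_comm (s := (Finset.univ : Finset I)), ← Finset.sum_sub_distrib]
  refine Finset.sum_congr rfl fun β _ => ?_
  have hc : ∀ i, (hessPolarPoly Y n 1 0 i (k α + k β)).coeff 1 =
      -(if k α + k β = n (some i) then 1 else 0) := fun i => by
    simp [hessPolarPoly, polarPoly_coeff_one]
  simp only [hc, flatGram, Matrix.of_apply]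
  rcases h : pole α with _ | j
  · by_cases hβ : pole β = none
    · simp [hβ]
    · simp [hβ, eq_comm (a := (none : Option I))]
  · rw [Finset.sum_eq_single j]
    · by_cases hβ : pole β = some j
      · simp [hβ]
      · have : ¬ some j = pole β := fun h' => hβ h'.symm
        simp [hβ, this]
    · intro i _ hi
      rw [if_neg]
      · ring
      · rintro ⟨h', -⟩
        exact hi (Option.some_injective _ h').symm
    · simp

omit hY in
theorem prod_ne_zero {z : ℂ} (hz : z ∉ germPoles Y) :
    ∏ i : I, (z - Y (some i) 0) ^ (n (some i) + 1) ≠ 0 :=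
  Finset.prod_ne_zero_iff.2 fun i _ => pow_ne_zero _ (sub_ne_zero.2 (notMem_germPoles.1 hz i))

/-- The linear forms `flatCombo x` exhaust the functions that are holomorphic off the poles, `O
(λ')` at the finite poles and `o (λ')` at infinity: both spaces have the same dimension. -/
theorem exists_flatCombo_eq (hk : IsFlatIndex pole k n) {h : ℂ → ℂ}
    (hd : ∀ z ∉ germPoles Y, DifferentiableAt ℂ h z)
    (hfin : ∀ i, (fun z => h z / lamDeriv Y n z) =O[𝓝[≠] (Y (some i) 0)] fun _ => (1 : ℂ))
    (hinf : Tendsto (fun z => h z / lamDeriv Y n z) (cobounded ℂ) (𝓝 0)) :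
    ∃ ζ, ∀ z ∉ germPoles Y, h z = flatCombo Y n pole k ζ z := by
  have hγ : ∀ γ, ∃ P : ℂ[X], P ∈ degreeLT ℂ (Fintype.card ι) ∧ ∀ z ∉ germPoles Y,
      P.eval z = flatCombo Y n pole k (Pi.single γ 1) z *
        ∏ i : I, (z - Y (some i) 0) ^ (n (some i) + 1) := fun γ =>
    hY.exists_polynomial hk
      (fun z hz => (hY.analyticAt_flatCombo (pole := pole) (k := k) _ hz).differentiableAt)
      (hY.flatCombo_div_isBigO (pole := pole) (k := k) _) (hY.flatCombo_div_tendsto hk _)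
  choose P hPdeg hP using hγ
  have hsum : ∀ (ζ : ι → ℂ) z, z ∉ germPoles Y → (∑ γ, ζ γ • P γ).eval z =
      flatCombo Y n pole k ζ z * ∏ i : I, (z - Y (some i) 0) ^ (n (some i) + 1) := by
    intro ζ z hz
    simp only [eval_finsetSum, eval_smul, hP _ z hz, flatCombo, Finset.sum_mul, smul_eq_mul]
    refine Finset.sum_congr rfl fun γ _ => ?_
    rw [Finset.sum_eq_single γ]
    · simp; ring
    · intro δ _ hδ; simp [hδ]
    · simp
  let Φ : (ι → ℂ) →ₗ[ℂ] degreeLT ℂ (Fintype.card ι) :=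
    { toFun := fun ζ => ⟨∑ γ, ζ γ • P γ, Submodule.sum_mem _ fun γ _ =>
        Submodule.smul_mem _ _ (hPdeg γ)⟩
      map_add' := fun x y => by
        ext1
        simp [add_smul, Finset.sum_add_distrib]
      map_smul' := fun c x => by
        ext1
        simp [Finset.smul_sum, smul_smul] }
  have hinj : Function.Injective Φ := by
    refine (injective_iff_map_eq_zero _).2 fun ζ hζ => ?_
    have hζ' : ∑ γ, ζ γ • P γ = 0 := congrArg Subtype.val hζ
    have h0 : ∀ z ∉ germPoles Y, flatCombo Y n pole k ζ z = 0 := by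
      intro z hz
      have := hsum ζ z hz
      rw [hζ', eval_zero, eq_comm, mul_eq_zero] at this
      exact this.resolve_right (prod_ne_zero hz)
    by_contra hne
    refine flatGram_det_ne_zero hk (Matrix.exists_vecMul_eq_zero_iff.1 ⟨ζ, hne, ?_⟩)
    funext β
    have h1 := hY.sum_residue_crit hk ζ (Pi.single β 1) (f := fun _ => 0) fun z hz => by
      rw [h0 z hz, zero_mul, zero_div]
    have h2 : ∀ p, residue (fun _ => 0) p = 0 := fun p => by
      simpa using residue_eq (f := fun _ => 0) (p := p) (Q := 0)
        (Eventually.of_forall fun _ => continuousAt_const)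
        (by simpa using isBigO_zero (E' := ℂ) (fun _ : ℂ => (1 : ℂ)) (𝓝[≠] p))
    simp only [h2, finsum_zero] at h1
    simpa [Matrix.vecMul, dotProduct, Pi.single_apply] using h1.symm
  have hfr : Module.finrank ℂ (ι → ℂ) = Module.finrank ℂ (degreeLT ℂ (Fintype.card ι)) := by
    rw [LinearEquiv.finrank_eq (degreeLTEquiv ℂ (Fintype.card ι))]
    simp
  have : FiniteDimensional ℂ (degreeLT ℂ (Fintype.card ι)) :=
    Module.Finite.equiv (degreeLTEquiv ℂ (Fintype.card ι)).symm
  have hsurj := (LinearMap.injective_iff_surjective_of_finrank_eq_finrank hfr).1 hinj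
  obtain ⟨R, hR, hRz⟩ := hY.exists_polynomial hk hd hfin hinf
  obtain ⟨ζ, hζ⟩ := hsurj ⟨R, hR⟩
  refine ⟨ζ, fun z hz => ?_⟩
  have h1 : ∑ γ, ζ γ • P γ = R := congrArg Subtype.val hζ
  have h2 := hsum ζ z hz
  rw [h1, hRz z hz] at h2
  exact mul_right_cancel₀ (prod_ne_zero hz) h2

/-- The division identity `∂_x λ ∂_y λ = ∂_ζ λ + ρ λ' H (x, y)`, divided by `ρ`: subtracting `λ' H
(x, y)` lowers the pole orders of the product to those of the functions characterised by
`exists_flatCombo_eq`. -/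
theorem exists_division (hk : IsFlatIndex pole k n) (a b : ℂ) (x y : ι → ℂ) :
    ∃ ζ, ∀ z ∉ germPoles Y,
      (a + b * z) * (flatCombo Y n pole k x z * flatCombo Y n pole k y z) =
        flatCombo Y n pole k ζ z +
          lamDeriv Y n z * ∑ α, ∑ β, x α * y β * hessCoeff Y n pole k a b α β z := by
  set h : ℂ → ℂ := fun z => (a + b * z) * (flatCombo Y n pole k x z * flatCombo Y n pole k y z) -
    lamDeriv Y n z * ∑ α, ∑ β, x α * y β * hessCoeff Y n pole k a b α β z with hh
  have hd : ∀ z ∉ germPoles Y, DifferentiableAt ℂ h z := by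
    intro z hz
    have h1 : AnalyticAt ℂ (fun z => a + b * z) z :=
      analyticAt_const.add (analyticAt_const.mul analyticAt_id)
    refine ((h1.mul ((hY.analyticAt_flatCombo (pole := pole) (k := k) x hz).mul
      (hY.analyticAt_flatCombo (pole := pole) (k := k) y hz))).sub
      ((hY.analyticAt_lamDeriv hz).mul (Finset.analyticAt_fun_sum _ fun α _ =>
        Finset.analyticAt_fun_sum _ fun β _ => analyticAt_const.mul
          (hY.analyticAt_hessCoeff a b α β hz)))).differentiableAt
  have hdiv : ∀ z, lamDeriv Y n z ≠ 0 → hessError Y n pole k a b x y z = h z / lamDeriv Y n z := by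
    intro z hz
    rw [hessError, hh]
    field_simp
  obtain ⟨ζ, hζ⟩ := hY.exists_flatCombo_eq hk hd (fun i => by
    refine (hY.hessError_isBigO (pole := pole) (k := k) a b x y i).congr' ?_ .rfl
    exact (hY.asymp_finite (pole := pole) (k := k) 0 0 i).1.mono hdiv) (by
    refine (hY.hessError_tendsto hk a b x y).congr' ?_
    exact (hY.asymp_infty hk 0 0).1.mono hdiv)
  refine ⟨ζ, fun z hz => ?_⟩
  rw [← hζ z hz, hh]
  ring

/-- Uniqueness in the division identity: the quotient of `∂_x λ` by `ρ λ'` is bounded at the finite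
poles and vanishes at infinity, so that it is zero as soon as it is holomorphic off the poles. -/
theorem eq_zero_of_flatCombo_eq_mul (hk : IsFlatIndex pole k n) (x : ι → ℂ) {h : ℂ → ℂ}
    (hd : ∀ z ∉ germPoles Y, DifferentiableAt ℂ h z)
    (hx : ∀ z ∉ germPoles Y, flatCombo Y n pole k x z = lamDeriv Y n z * h z) :
    ∀ z ∉ germPoles Y, h z = 0 := by
  refine eq_zero_of_bounded_of_tendsto hd (fun p hp => ?_) ?_
  · obtain ⟨i, -, rfl⟩ := Finset.mem_image.1 hp
    refine (hY.flatCombo_div_isBigO (pole := pole) (k := k) x i).congr' ?_ .rfl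
    filter_upwards [(hY.asymp_finite (pole := pole) (k := k) 0 0 i).1,
      eventually_notMem_germPoles (Y := Y) (Y (some i) 0)] with z hz hz2
    rw [hx z hz2]
    field_simp
  · refine (hY.flatCombo_div_tendsto hk x).congr' ?_
    filter_upwards [(hY.asymp_infty hk 0 0).1,
      eventually_notMem_germPoles_cobounded (Y := Y)] with z hz hz2
    rw [hx z hz2.1]
    field_simp

end IsPoleGerms

end

section

open Polynomial Asymptotics

/-! ### Roots of a superpotential near a pole -/

/-- `v` is the inverse of the germ `Y` of a local biholomorphism with `Y 0 = p`. -/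
structure IsLocalInverse (Y v : ℂ → ℂ) (p : ℂ) : Prop where
  analytic : AnalyticAt ℂ Y 0
  deriv_ne : deriv Y 0 ≠ 0
  apply_zero : Y 0 = p
  inv_analytic : AnalyticAt ℂ v p
  inv_apply : v p = 0
  right : ∀ᶠ y in 𝓝 p, Y (v y) = y
  left : ∀ᶠ u in 𝓝 0, v (Y u) = u

theorem exists_isLocalInverse {Y : ℂ → ℂ} (hY : AnalyticAt ℂ Y 0) (hY' : deriv Y 0 ≠ 0) :
    ∃ v, IsLocalInverse Y v (Y 0) := by
  obtain ⟨v, h1, h2, h3, h4⟩ := exists_localInverse hY hY'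
  exact ⟨v, hY, hY', rfl, h1, h2, h3, h4⟩

namespace IsLocalInverse

variable {Y v : ℂ → ℂ} {p : ℂ} (h : IsLocalInverse Y v p)
include h

theorem tendsto : Tendsto v (𝓝 p) (𝓝 0) := by
  have := h.inv_analytic.continuousAt.tendsto
  rwa [h.inv_apply] at this

theorem eventually_ne : ∀ᶠ y in 𝓝[≠] p, v y ≠ 0 := by
  filter_upwards [self_mem_nhdsWithin, nhdsWithin_le_nhds h.right] with y hy hy2 h0
  rw [h0, h.apply_zero] at hy2
  exact hy hy2.symm

theorem tendsto_punctured : Tendsto v (𝓝[≠] p) (𝓝[≠] 0) :=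
  tendsto_nhdsWithin_iff.2 ⟨h.tendsto.mono_left nhdsWithin_le_nhds, h.eventually_ne⟩

theorem isBigO : v =O[𝓝 p] fun y => y - p := by
  simpa [h.inv_apply] using h.inv_analytic.differentiableAt.isBigO_sub

theorem isBigO_symm : (fun y => y - p) =O[𝓝 p] v := by
  have h1 : (fun u => Y u - Y 0) =O[𝓝 0] fun u => u := by
    simpa using h.analytic.differentiableAt.isBigO_sub
  refine (h1.comp_tendsto h.tendsto).congr' ?_ .rfl
  filter_upwards [h.right] with y hy
  simp [hy, h.apply_zero]

theorem deriv_mul_deriv : deriv Y 0 * deriv v p = 1 := by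
  have h1 : HasDerivAt Y (deriv Y 0) (v p) := by
    rw [h.inv_apply]; exact h.analytic.differentiableAt.hasDerivAt
  have h2 := h1.comp p h.inv_analytic.differentiableAt.hasDerivAt
  exact (h2.congr_of_eventuallyEq (h.right.mono fun y hy => hy.symm :
    (fun y => y) =ᶠ[𝓝 p] Y ∘ v)).unique (hasDerivAt_id' p)

end IsLocalInverse

/-- `-[u ^ n] log (1 - (Y - Y 0) X)` as a polynomial in `X`: the polar part of the superpotential
that belongs to the germ `Y`. -/
def logPoly (Y : ℂ → ℂ) (n : ℕ) : ℂ[X] :=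
  ∑ j ∈ Finset.range (n + 1), C (taylorCoeff n (fun u => (Y u - Y 0) ^ j) / j) * X ^ j

theorem logPoly_coeff (Y : ℂ → ℂ) {n j : ℕ} (hj : j ≤ n) :
    (logPoly Y n).coeff j = taylorCoeff n (fun u => (Y u - Y 0) ^ j) / j := by
  simp only [logPoly, finsetSum_coeff, coeff_C_mul, coeff_X_pow]
  rw [Finset.sum_eq_single j]
  · simp
  · intro i _ hi
    rw [if_neg (Ne.symm hi), mul_zero]
  · intro h
    exact absurd (Finset.mem_range.2 (by omega)) h

theorem logPoly_coeff_zero (Y : ℂ → ℂ) (n : ℕ) : (logPoly Y n).coeff 0 = 0 := by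
  rw [logPoly_coeff Y (Nat.zero_le n)]; simp

theorem logPoly_natDegree_le (Y : ℂ → ℂ) (n : ℕ) : (logPoly Y n).natDegree ≤ n := by
  refine natDegree_sum_le_of_forall_le _ _ fun j hj => ?_
  exact (natDegree_C_mul_X_pow_le _ _).trans (by have := Finset.mem_range.1 hj; omega)

theorem logPoly_eval {Y : ℂ → ℂ} (hY : AnalyticAt ℂ Y 0) (n : ℕ) (c : ℂ) :
    (logPoly Y n).eval c = -taylorCoeff n (fun u => Complex.log (1 - c * (Y u - Y 0))) := by
  rw [taylorCoeff_log_one_sub (X := fun u => Y u - Y 0) (hY.sub analyticAt_const) (sub_self _),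
    neg_neg, logPoly, eval_finsetSum]
  simp

/-- The Taylor coefficients of a logarithm are those of its derivative. -/
theorem logPoly_eval_inv {Y : ℂ → ℂ} (hY : AnalyticAt ℂ Y 0) {n : ℕ} (hn : 0 < n) {y : ℂ}
    (hy : y ≠ Y 0) :
    (logPoly Y n).eval (y - Y 0)⁻¹ = taylorCoeff (n - 1) (fun u => deriv Y u / (y - Y u)) / n := by
  obtain ⟨m, rfl⟩ : ∃ m, n = m + 1 := ⟨n - 1, by omega⟩
  have hy0 : y - Y 0 ≠ 0 := sub_ne_zero.2 hy
  rw [logPoly_eval hY, taylorCoeff_succ, Nat.add_sub_cancel, ← neg_div, ← taylorCoeff_neg]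
  push_cast
  congr 1
  refine taylorCoeff_congr ?_ _
  have hc : ContinuousAt (fun u => 1 - (y - Y 0)⁻¹ * (Y u - Y 0)) 0 :=
    continuousAt_const.sub (continuousAt_const.mul (hY.continuousAt.sub continuousAt_const))
  filter_upwards [hc.eventually (IsOpen.mem_nhds Complex.isOpen_slitPlane
    (show 1 - (y - Y 0)⁻¹ * (Y 0 - Y 0) ∈ Complex.slitPlane by simp)),
    hY.eventually_analyticAt, hY.continuousAt.eventually_ne hy.symm] with u hu hYu huy
  have h1 := ((((hYu.differentiableAt.hasDerivAt).sub_const (Y 0)).const_mul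
    (y - Y 0)⁻¹).const_sub 1).clog hu
  rw [h1.deriv]
  have h2 : y - Y u ≠ 0 := sub_ne_zero.2 huy.symm
  have h3 : 1 - (y - Y 0)⁻¹ * (Y u - Y 0) = (y - Y 0)⁻¹ * (y - Y u) := by
    field_simp; ring
  rw [h3]
  field_simp

theorem isBigO_of_pow {l : Filter ℂ} {f g : ℂ → ℂ} {n : ℕ} (hn : n ≠ 0)
    (h : (fun z => f z ^ n) =O[l] fun z => g z ^ n) : f =O[l] g :=
  IsBigO.of_pow hn h

theorem IsLocalInverse.isBigO_taylorCoeff {Y v : ℂ → ℂ} {p : ℂ} (h : IsLocalInverse Y v p)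
    {B : ℂ → ℂ} (hB : AnalyticAt ℂ B 0) (m : ℕ) :
    (fun y => taylorCoeff m (fun u => B u / (y - Y u)) - B (v y) / (v y ^ (m + 1) * deriv Y (v y)))
      =O[𝓝[≠] p] fun _ => (1 : ℂ) := by
  refine ((isBigO_taylorCoeff_div_sub h.analytic h.deriv_ne hB m).comp_tendsto
    h.tendsto_punctured).congr' ?_ .rfl
  filter_upwards [nhdsWithin_le_nhds h.right] with y hy
  simp only [Function.comp, hy]

theorem IsLocalInverse.eventually_deriv_ne {Y v : ℂ → ℂ} {p : ℂ} (h : IsLocalInverse Y v p) :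
    ∀ᶠ y in 𝓝 p, deriv Y (v y) ≠ 0 :=
  h.tendsto.eventually (h.analytic.deriv.continuousAt.eventually_ne h.deriv_ne)

/-- The polar part of a germ is `v ^ (-n) / n` up to a bounded function. -/
theorem IsLocalInverse.logPoly_isBigO {Y v : ℂ → ℂ} {p : ℂ} (h : IsLocalInverse Y v p) {n : ℕ}
    (hn : 0 < n) : (fun y => (logPoly Y n).eval (y - p)⁻¹ - (v y ^ n)⁻¹ / n) =O[𝓝[≠] p]
      fun _ => (1 : ℂ) := by
  refine ((h.isBigO_taylorCoeff h.analytic.deriv (n - 1)).const_mul_left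
    (n : ℂ)⁻¹).congr' ?_ .rfl
  filter_upwards [self_mem_nhdsWithin, nhdsWithin_le_nhds h.eventually_deriv_ne] with y hy hd
  have hy' : y ≠ Y 0 := by rw [h.apply_zero]; exact hy
  have h1 := logPoly_eval_inv h.analytic hn hy'
  rw [h.apply_zero] at h1
  rw [h1, Nat.sub_add_cancel hn]
  field_simp

/-- The constant term of the superpotential at a pole of the primary differential. -/
theorem IsLocalInverse.logPoly_isBigO_sharp {Y v ℓ : ℂ → ℂ} (h : IsLocalInverse Y v 0) {n : ℕ}
    (hn : 0 < n) (hℓ : AnalyticAt ℂ ℓ 0) (hYℓ : ∀ᶠ u in 𝓝 0, Y u = u * Complex.exp (ℓ u)) :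
    (fun y => (logPoly Y n).eval y⁻¹ + taylorCoeff n ℓ - (v y ^ n)⁻¹ / n) =O[𝓝[≠] 0]
      fun y => y := by
  obtain ⟨m, rfl⟩ : ∃ m, n = m + 1 := ⟨n - 1, by omega⟩
  have hn0 : ((m + 1 : ℕ) : ℂ) ≠ 0 := Nat.cast_ne_zero.2 (by omega)
  have hp := analyticAt_pow_zero
  -- the logarithmic derivative `u Y' / Y`
  set B : ℂ → ℂ := fun u => 1 + u ^ 1 * deriv ℓ u with hB
  have hBa : AnalyticAt ℂ B 0 := analyticAt_const.add ((hp 1).mul hℓ.deriv)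
  have hYB : ∀ᶠ u in 𝓝 0, u * deriv Y u = B u * Y u := by
    have h1 : deriv Y =ᶠ[𝓝 0] deriv fun u => u * Complex.exp (ℓ u) :=
      EventuallyEq.deriv hYℓ
    filter_upwards [h1, hYℓ, hℓ.eventually_analyticAt] with u hu hu2 hu3
    rw [hu, hu2, ((hasDerivAt_id' u).fun_mul hu3.differentiableAt.hasDerivAt.cexp).deriv]
    simp only [hB]
    ring
  have hcoef : taylorCoeff (m + 1) B = (m + 1) * taylorCoeff (m + 1) ℓ := by
    rw [hB, taylorCoeff_add analyticAt_const ((hp 1).fun_mul hℓ.deriv),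
      taylorCoeff_pow_mul hℓ.deriv, if_pos (by omega), Nat.add_sub_cancel, taylorCoeff_succ m ℓ]
    have : taylorCoeff (m + 1) (fun _ => (1 : ℂ)) = 0 := by
      simpa using taylorCoeff_pow 0 (m + 1)
    rw [this]
    have : (m : ℂ) + 1 ≠ 0 := by exact_mod_cast hn0
    field_simp
    ring
  have h1 := (isBigO_refl (fun y : ℂ => y) (𝓝[≠] 0)).mul
    (((h.isBigO_taylorCoeff hBa (m + 1)).const_mul_left ((m + 1 : ℕ) : ℂ)⁻¹))
  simp only [mul_one] at h1
  refine h1.congr' ?_ .rfl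
  filter_upwards [self_mem_nhdsWithin, nhdsWithin_le_nhds h.eventually_deriv_ne, h.eventually_ne,
    nhdsWithin_le_nhds (h.tendsto.eventually hYB), nhdsWithin_le_nhds h.right] with y hy hd hv hvB hvy
  have hy0 : y ≠ 0 := hy
  have hy' : y ≠ Y 0 := by rw [h.apply_zero]; exact hy
  have h2 := logPoly_eval_inv h.analytic (Nat.succ_pos m) hy'
  rw [h.apply_zero, sub_zero, Nat.succ_sub_one] at h2
  have h3 : taylorCoeff (m + 1) (fun u => B u / (y - Y u)) * y =
      taylorCoeff m (fun u => deriv Y u / (y - Y u)) + (m + 1) * taylorCoeff (m + 1) ℓ := by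
    have hne : ∀ᶠ u in 𝓝 0, y - Y u ≠ 0 :=
      (continuousAt_const.sub h.analytic.continuousAt).eventually_ne (sub_ne_zero.2 hy')
    have ha : AnalyticAt ℂ (fun u => deriv Y u / (y - Y u)) 0 :=
      h.analytic.deriv.div (analyticAt_const.sub h.analytic) (sub_ne_zero.2 hy')
    have h4 : (fun u => y * (B u / (y - Y u))) =ᶠ[𝓝 0]
        fun u => u ^ 1 * (deriv Y u / (y - Y u)) + B u := by
      filter_upwards [hne, hYB] with u hu hu2
      rw [pow_one, ← mul_div_assoc, ← mul_div_assoc, hu2]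
      field_simp
      ring
    rw [mul_comm, ← taylorCoeff_const_mul, taylorCoeff_congr h4,
      taylorCoeff_add ((hp 1).fun_mul ha) hBa, taylorCoeff_pow_mul ha, if_pos (by omega),
      Nat.add_sub_cancel, hcoef]
  rw [h2]
  have h5 : B (v y) / (v y ^ (m + 1 + 1) * deriv Y (v y)) * y = (v y ^ (m + 1))⁻¹ := by
    rw [hvy] at hvB
    rw [div_mul_eq_mul_div, ← hvB]
    field_simp
    ring
  have h6 : ((m.succ : ℕ) : ℂ) = ((m + 1 : ℕ) : ℂ) := rfl
  rw [h6]
  push_cast at hn0 ⊢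
  generalize taylorCoeff (m + 1) (fun u => B u / (y - Y u)) = T at h3 ⊢
  generalize taylorCoeff m (fun u => deriv Y u / (y - Y u)) = T' at h3 ⊢
  rw [mul_sub, mul_sub, mul_left_comm y _ (_ / _), mul_comm y (_ / _), h5]
  field_simp
  linear_combination (v y * v y ^ m) * h3

section Roots

variable {lam ψ : ℂ → ℂ} {p : ℂ} {n : ℕ}

/-- A root of `n λ` has the order of vanishing of `y - p`. -/
theorem isBigO_root (hψ : AnalyticAt ℂ ψ p) (hψ0 : ψ p ≠ 0) (hn : 0 < n)
    (hlam : ∀ᶠ y in 𝓝[≠] p, (y - p) ^ n * (n * lam y) = ψ y) {u : ℂ → ℂ}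
    (hu : ∀ᶠ y in 𝓝[≠] p, u y ^ n * (n * lam y) = 1) :
    u =O[𝓝[≠] p] (fun y => y - p) ∧ (fun y => y - p) =O[𝓝[≠] p] u ∧ ∀ᶠ y in 𝓝[≠] p, u y ≠ 0 := by
  have h1 : ∀ᶠ y in 𝓝[≠] p, u y ^ n * ψ y = (y - p) ^ n := by
    filter_upwards [hlam, hu] with y h1 h2
    rw [← h1]
    linear_combination (y - p) ^ n * h2
  have hψc : Tendsto ψ (𝓝[≠] p) (𝓝 (ψ p)) := hψ.continuousAt.tendsto.mono_left nhdsWithin_le_nhds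
  have hψne : ∀ᶠ y in 𝓝[≠] p, ψ y ≠ 0 := hψc.eventually_ne hψ0
  refine ⟨isBigO_of_pow hn.ne' ?_, isBigO_of_pow hn.ne' ?_, ?_⟩
  · have := (isBigO_refl (fun y => (y - p) ^ n) (𝓝[≠] p)).mul
      ((hψc.inv₀ hψ0).isBigO_one ℂ)
    simp only [mul_one] at this
    refine this.congr' ?_ .rfl
    filter_upwards [h1, hψne] with y hy hy0
    rw [← hy]; field_simp
  · have := (isBigO_refl (fun y => u y ^ n) (𝓝[≠] p)).mul (hψc.isBigO_one ℂ)
    simp only [mul_one] at this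
    exact this.congr' h1 .rfl
  · filter_upwards [hu] with y hy h0
    rw [h0, zero_pow hn.ne', zero_mul] at hy
    exact zero_ne_one hy

/-- A germ `Y` which inverts a root of `n λ` to sufficiently high order determines `λ` to the
corresponding order. -/
theorem of_root (hψ : AnalyticAt ℂ ψ p) (hψ0 : ψ p ≠ 0) (hn : 0 < n)
    (hlam : ∀ᶠ y in 𝓝[≠] p, (y - p) ^ n * (n * lam y) = ψ y) {u Y : ℂ → ℂ}
    (hu : ∀ᶠ y in 𝓝[≠] p, u y ^ n * (n * lam y) = 1) (hY : AnalyticAt ℂ Y 0) {r : ℕ}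
    (hYu : (fun y => y - Y (u y)) =O[𝓝[≠] p] fun y => (y - p) ^ (n + 1 + r)) :
    Y 0 = p ∧ deriv Y 0 ≠ 0 ∧ ∀ v, IsLocalInverse Y v p →
      (fun y => lam y - (v y ^ n)⁻¹ / n) =O[𝓝[≠] p] fun y => (y - p) ^ r := by
  obtain ⟨hu1, hu2, hu0⟩ := isBigO_root hψ hψ0 hn hlam hu
  have hid : Tendsto (fun y : ℂ => y - p) (𝓝[≠] p) (𝓝 0) := by
    have : Tendsto (fun y : ℂ => y - p) (𝓝 p) (𝓝 (p - p)) :=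
      (continuous_id.sub continuous_const).tendsto p
    rw [sub_self] at this
    exact this.mono_left nhdsWithin_le_nhds
  have hut : Tendsto u (𝓝[≠] p) (𝓝 0) := hu1.trans_tendsto hid
  have hpow : ∀ k, (fun y : ℂ => (y - p) ^ k) =O[𝓝[≠] p] fun _ => (1 : ℂ) := fun k =>
    IsBigO.one_pow (hid.isBigO_one ℂ) k
  have hY0 : Y 0 = p := by
    have h1 : Tendsto (fun y => y - Y (u y)) (𝓝[≠] p) (𝓝 (p - Y 0)) :=
      (tendsto_id.mono_left nhdsWithin_le_nhds).sub (hY.continuousAt.tendsto.comp hut)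
    have h2 : Tendsto (fun y => y - Y (u y)) (𝓝[≠] p) (𝓝 0) := by
      refine hYu.trans_tendsto ?_
      simpa using hid.pow (n + 1 + r)
    exact (sub_eq_zero.1 (tendsto_nhds_unique h1 h2)).symm
  have hY' : deriv Y 0 ≠ 0 := by
    intro h0
    have h1 : (fun w => Y w - p) =o[𝓝 0] fun w => w := by
      have := hY.differentiableAt.hasDerivAt.isLittleO
      simpa [h0, hY0] using this
    have h2 : (fun y => Y (u y) - p) =o[𝓝[≠] p] fun y => y - p :=
      (h1.comp_tendsto hut).trans_isBigO hu1
    have h3 : (fun y => y - Y (u y)) =o[𝓝[≠] p] fun y => y - p := by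
      refine hYu.trans_isLittleO ?_
      have : (fun y : ℂ => (y - p) ^ (n + r)) =o[𝓝[≠] p] fun _ => (1 : ℂ) := by
        rw [isLittleO_one_iff]
        simpa [hn.ne'] using hid.pow (n + r)
      have := (isBigO_refl (fun y : ℂ => y - p) (𝓝[≠] p)).mul_isLittleO this
      refine (this.congr_left fun y => ?_).congr_right fun y => mul_one _
      ring
    have h4 := h3.add h2
    have h5 : (fun y => y - p) =o[𝓝[≠] p] fun y => y - p :=
      h4.congr_left fun y => by ring
    have h6 : ∀ᶠ y in 𝓝[≠] p, y - p = 0 := by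
      have := h5.def (c := 1 / 2) (by norm_num)
      filter_upwards [this] with y hy
      rw [← norm_eq_zero]
      linarith [norm_nonneg (y - p)]
    obtain ⟨y, hy, hy2⟩ := (h6.and self_mem_nhdsWithin).exists
    exact hy2 (sub_eq_zero.1 hy)
  refine ⟨hY0, hY', fun v hv => ?_⟩
  have hvu : (fun y => v y - u y) =O[𝓝[≠] p] fun y => (y - p) ^ (n + 1 + r) := by
    have h1 := hv.inv_analytic.hasStrictDerivAt.isBigO_sub
    have h2 : Tendsto (fun y => (y, Y (u y))) (𝓝[≠] p) (𝓝 (p, p)) := by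
      have := hY.continuousAt.tendsto.comp hut
      rw [hY0] at this
      exact (tendsto_id.mono_left nhdsWithin_le_nhds).prodMk_nhds this
    refine ((h1.comp_tendsto h2).trans hYu).congr' ?_ .rfl
    filter_upwards [hut.eventually hv.left] with y hy
    simp [hy]
  -- `v ^ n - u ^ n` is divisible by `v - u`
  have hgeom : (fun y => u y ^ n - v y ^ n) =O[𝓝[≠] p] fun y => (y - p) ^ (2 * n + r) := by
    have h1 : (fun y => ∑ i ∈ Finset.range n, v y ^ i * u y ^ (n - 1 - i)) =O[𝓝[≠] p]
        fun y => (y - p) ^ (n - 1) := by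
      refine IsBigO.fun_sum fun i hi => ?_
      have := ((hv.isBigO.mono nhdsWithin_le_nhds).pow i).mul (hu1.pow (n - 1 - i))
      refine this.congr_right fun y => ?_
      rw [← pow_add]
      congr 1
      have := Finset.mem_range.1 hi
      omega
    refine (h1.mul hvu).neg_left.congr (fun y => ?_) fun y => ?_
    · rw [Commute.geom_sum₂_mul (Commute.all _ _)]
      ring
    · rw [← pow_add]
      congr 1
      omega
  have hinv : (fun y => (y - p) ^ (2 * n) * ((u y ^ n)⁻¹ * (v y ^ n)⁻¹)) =O[𝓝[≠] p]
      fun _ => (1 : ℂ) := by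
    have h1 := ((hu2.pow n).mul ((hv.isBigO_symm.mono nhdsWithin_le_nhds).pow n)).mul
      (isBigO_refl (fun y => (u y ^ n)⁻¹ * (v y ^ n)⁻¹) (𝓝[≠] p))
    refine (h1.congr_left fun y => by ring).trans (IsBigO.of_bound 1 ?_)
    filter_upwards [hu0, hv.eventually_ne] with y h2 h3
    field_simp
    simp
  have h1 := ((hinv.mul (isBigO_refl (fun y => (y - p) ^ r) (𝓝[≠] p))).const_mul_left
    (n : ℂ)⁻¹)
  have hfin : (fun y => (n : ℂ)⁻¹ * ((v y ^ n - u y ^ n) * ((u y ^ n)⁻¹ * (v y ^ n)⁻¹)))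
      =O[𝓝[≠] p] fun y => (y - p) ^ r := by
    have h2 := hgeom.neg_left.mul
      (isBigO_refl (fun y => (u y ^ n)⁻¹ * (v y ^ n)⁻¹) (𝓝[≠] p))
    have h3 : (fun y => (y - p) ^ (2 * n + r) * ((u y ^ n)⁻¹ * (v y ^ n)⁻¹)) =O[𝓝[≠] p]
        fun y => (y - p) ^ r := by
      have := hinv.mul (isBigO_refl (fun y => (y - p) ^ r) (𝓝[≠] p))
      refine this.congr (fun y => ?_) fun y => one_mul _
      rw [pow_add]; ring
    refine ((h2.congr_left fun y => ?_).trans h3).const_mul_left _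
    ring
  refine hfin.congr' ?_ .rfl
  filter_upwards [hu, hu0, hv.eventually_ne] with y h2 h3 h4
  have hn0 : (n : ℂ) ≠ 0 := Nat.cast_ne_zero.2 hn.ne'
  have h5 : lam y = (u y ^ n)⁻¹ / n := by
    have := pow_ne_zero n h3
    field_simp
    linear_combination h2
  rw [h5]
  field_simp

/-- If `λ` is `v ^ (-n) / n` to sufficiently high order, then it has a root close to `v`. -/
theorem exists_root (hψ : AnalyticAt ℂ ψ p) (hn : 0 < n)
    (hlam : ∀ᶠ y in 𝓝[≠] p, (y - p) ^ n * (n * lam y) = ψ y) {v Y : ℂ → ℂ}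
    (hv : IsLocalInverse Y v p) {r : ℕ}
    (hlv : (fun y => lam y - (v y ^ n)⁻¹ / n) =O[𝓝[≠] p] fun y => (y - p) ^ r) :
    ∃ q : ℂ → ℂ, AnalyticAt ℂ q p ∧ q =O[𝓝[≠] p] (fun y => (y - p) ^ (n + r)) ∧
      ∀ᶠ y in 𝓝[≠] p, (v y * Complex.exp (-q y)) ^ n * (n * lam y) = 1 := by
  have hn0 : (n : ℂ) ≠ 0 := Nat.cast_ne_zero.2 hn.ne'
  set θ : ℂ → ℂ := fun y => dslope v p y ^ n * ψ y with hθ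
  have hds : AnalyticAt ℂ (dslope v p) p := by
    obtain ⟨s, hs⟩ := hv.inv_analytic
    exact ⟨_, hs.has_fpower_series_dslope_fslope⟩
  have hθa : AnalyticAt ℂ θ p := (hds.pow n).mul hψ
  have hθv : ∀ᶠ y in 𝓝[≠] p, θ y = v y ^ n * (n * lam y) := by
    filter_upwards [hlam, self_mem_nhdsWithin] with y hy hyp
    have hyp' : y - p ≠ 0 := sub_ne_zero.2 hyp
    rw [hθ]
    dsimp only
    rw [dslope_of_ne _ hyp, slope_def_field, hv.inv_apply, sub_zero, ← hy, div_pow]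
    field_simp
  have hθ1 : (fun y => θ y - 1) =O[𝓝[≠] p] fun y => (y - p) ^ (n + r) := by
    have h1 := (((hv.isBigO.mono nhdsWithin_le_nhds).pow n).mul hlv).const_mul_left (n : ℂ)
    refine h1.congr' ?_ (Eventually.of_forall fun y => (pow_add _ _ _).symm)
    filter_upwards [hθv, hv.eventually_ne] with y hy hy0
    rw [hy]
    field_simp
  have hθp : θ p = 1 := by
    have h1 : Tendsto (fun y => θ y - 1) (𝓝[≠] p) (𝓝 (θ p - 1)) :=
      (hθa.continuousAt.tendsto.mono_left nhdsWithin_le_nhds).sub_const 1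
    have h2 : Tendsto (fun y : ℂ => (y - p) ^ (n + r)) (𝓝[≠] p) (𝓝 0) := by
      have : Tendsto (fun y : ℂ => (y - p) ^ (n + r)) (𝓝 p) (𝓝 ((p - p) ^ (n + r))) :=
        ((continuous_id.sub continuous_const).pow _).tendsto p
      rw [sub_self, zero_pow (by omega)] at this
      exact this.mono_left nhdsWithin_le_nhds
    exact sub_eq_zero.1 (tendsto_nhds_unique h1 (hθ1.trans_tendsto h2))
  have hlog : AnalyticAt ℂ (fun y => Complex.log (θ y)) p :=
    hθa.clog (by rw [hθp]; simp)
  refine ⟨fun y => Complex.log (θ y) / n, hlog.div analyticAt_const hn0, ?_, ?_⟩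
  · have h1 : (fun w => Complex.log w - Complex.log 1) =O[𝓝 1] fun w => w - 1 :=
      (differentiableAt_id.clog (by simp)).isBigO_sub
    have h2 : Tendsto θ (𝓝[≠] p) (𝓝 1) := by
      rw [← hθp]; exact hθa.continuousAt.tendsto.mono_left nhdsWithin_le_nhds
    have h3 := (((h1.comp_tendsto h2).trans hθ1)).const_mul_left (n : ℂ)⁻¹
    refine h3.congr_left fun y => ?_
    simp [div_eq_inv_mul]
  · have hne : ∀ᶠ y in 𝓝[≠] p, θ y ≠ 0 := nhdsWithin_le_nhds
      (hθa.continuousAt.eventually_ne (by rw [hθp]; exact one_ne_zero))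
    filter_upwards [hθv, hne] with y hy hy0
    have h1 : Complex.exp (-(Complex.log (θ y) / n)) ^ n = (θ y)⁻¹ := by
      rw [← Complex.exp_nat_mul, show (n : ℂ) * -(Complex.log (θ y) / n) = -Complex.log (θ y) by
        field_simp, Complex.exp_neg, Complex.exp_log hy0]
    rw [mul_pow, h1, mul_right_comm, ← hy, mul_inv_cancel₀ hy0]

/-- A superpotential has a holomorphic root near its pole, whose inverse is the full germ. -/
theorem exists_uniformizer (hψ : AnalyticAt ℂ ψ p) (hn : 0 < n)
    (hlam : ∀ᶠ y in 𝓝[≠] p, (y - p) ^ n * (n * lam y) = ψ y) {c : ℂ} (hc : c ^ n * ψ p = 1) :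
    ∃ u Z : ℂ → ℂ, AnalyticAt ℂ u p ∧ u p = 0 ∧ deriv u p = c ∧
      (∀ᶠ y in 𝓝[≠] p, u y ^ n * (n * lam y) = 1) ∧ IsLocalInverse Z u p ∧
      u =ᶠ[𝓝 p] fun y => (y - p) * (c * Complex.exp (-(Complex.log (ψ y / ψ p) / n))) := by
  have hn0 : (n : ℂ) ≠ 0 := Nat.cast_ne_zero.2 hn.ne'
  have hψ0 : ψ p ≠ 0 := right_ne_zero_of_mul (hc.trans_ne one_ne_zero)
  have hc0 : c ≠ 0 := by
    rintro rfl
    rw [zero_pow hn.ne', zero_mul] at hc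
    exact zero_ne_one hc
  set E : ℂ → ℂ := fun y => c * Complex.exp (-(Complex.log (ψ y / ψ p) / n)) with hE
  have hEa : AnalyticAt ℂ E p := by
    refine analyticAt_const.mul (AnalyticAt.cexp ?_)
    exact (((hψ.div analyticAt_const hψ0).clog (by simp [div_self hψ0])).div
      analyticAt_const hn0).neg
  have hEp : E p = c := by simp [hE, div_self hψ0]
  set u : ℂ → ℂ := fun y => (y - p) * E y with hu
  have hua : AnalyticAt ℂ u p := (analyticAt_id.sub analyticAt_const).mul hEa
  have hup : u p = 0 := by simp [hu]
  have hud : deriv u p = c := by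
    rw [hu, (((hasDerivAt_id' p).sub_const p).fun_mul hEa.differentiableAt.hasDerivAt).deriv]
    simp [hEp]
  have hroot : ∀ᶠ y in 𝓝[≠] p, u y ^ n * (n * lam y) = 1 := by
    have hne : ∀ᶠ y in 𝓝[≠] p, ψ y ≠ 0 := nhdsWithin_le_nhds (hψ.continuousAt.eventually_ne hψ0)
    filter_upwards [hlam, hne] with y hy hy0
    have h1 : Complex.exp (-(Complex.log (ψ y / ψ p) / n)) ^ n = (ψ y / ψ p)⁻¹ := by
      rw [← Complex.exp_nat_mul, show (n : ℂ) * -(Complex.log (ψ y / ψ p) / n) =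
        -Complex.log (ψ y / ψ p) by field_simp, Complex.exp_neg,
        Complex.exp_log (div_ne_zero hy0 hψ0)]
    simp only [hu, hE, mul_pow, h1]
    rw [mul_right_comm, hy, inv_div]
    field_simp
    linear_combination hc
  have hshift : AnalyticAt ℂ (fun x => u (p + x)) 0 :=
    AnalyticAt.comp (g := u) (f := fun x => p + x) (by simpa using hua)
      (analyticAt_const.add analyticAt_id)
  have hshift' : deriv (fun x => u (p + x)) 0 ≠ 0 := by
    rw [deriv_comp_const_add, add_zero, hud]
    exact hc0
  obtain ⟨v, hv1, hv2, hv3, hv4⟩ := exists_localInverse hshift hshift'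
  simp only [add_zero, hup] at hv1 hv2 hv3
  have hsub : Tendsto (fun y : ℂ => y - p) (𝓝 p) (𝓝 0) := by
    have : Tendsto (fun y : ℂ => y - p) (𝓝 p) (𝓝 (p - p)) :=
      (continuous_id.sub continuous_const).tendsto p
    rwa [sub_self] at this
  have hleft : ∀ᶠ y in 𝓝 p, p + v (u y) = y := by
    filter_upwards [hsub.eventually hv4] with y hy
    simp only [add_sub_cancel] at hy
    rw [hy, add_sub_cancel]
  refine ⟨u, fun w => p + v w, hua, hup, hud, hroot, ⟨analyticAt_const.fun_add hv1, ?_, ?_, hua, hup,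
    hleft, hv3⟩, .rfl⟩
  · intro h0
    have h1 : HasDerivAt (fun w => p + v w) 0 (u p) := by
      rw [← h0, hup]
      exact (analyticAt_const.fun_add hv1).differentiableAt.hasDerivAt
    have h2 := h1.comp p hua.differentiableAt.hasDerivAt
    have h3 := (h2.congr_of_eventuallyEq (hleft.mono fun y hy => hy.symm :
      (fun y => y) =ᶠ[𝓝 p] (fun w => p + v w) ∘ u)).unique (hasDerivAt_id' p)
    rw [zero_mul] at h3
    exact zero_ne_one h3
  · simp [hv2]

end Roots

/-- Polynomials without constant term are determined by their growth. -/
theorem eq_of_isBigO_eval {P Q : ℂ[X]} {p : ℂ} (hP : P.coeff 0 = Q.coeff 0)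
    (h : (fun y => P.eval (y - p)⁻¹ - Q.eval (y - p)⁻¹) =O[𝓝[≠] p] fun _ => (1 : ℂ)) : P = Q := by
  rw [← sub_eq_zero]
  set R := P - Q with hR
  have hinv : Tendsto (fun y : ℂ => ‖(y - p)⁻¹‖) (𝓝[≠] p) atTop := by
    have h1 : Tendsto (fun y : ℂ => y - p) (𝓝[≠] p) (𝓝[≠] 0) := by
      refine tendsto_nhdsWithin_iff.2 ⟨?_, ?_⟩
      · have : Tendsto (fun y : ℂ => y - p) (𝓝 p) (𝓝 (p - p)) :=
          (continuous_id.sub continuous_const).tendsto p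
        rw [sub_self] at this
        exact this.mono_left nhdsWithin_le_nhds
      · filter_upwards [self_mem_nhdsWithin] with y hy using sub_ne_zero.2 hy
    exact tendsto_norm_cobounded_atTop.comp (tendsto_inv₀_nhdsNE_zero.comp h1)
  have hdeg : R.degree ≤ 0 := by
    by_contra hd
    have h1 := Polynomial.tendsto_norm_atTop R (not_le.1 hd) hinv
    obtain ⟨C, hC⟩ := h.bound
    have h2 := h1.eventually_gt_atTop (C * ‖(1 : ℂ)‖)
    obtain ⟨y, hy1, hy2⟩ := (hC.and h2).exists
    rw [hR, eval_sub] at hy2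
    linarith
  rw [eq_C_of_degree_le_zero hdeg, hR, coeff_sub, hP, sub_self, C_0]

/-- A relative change of the root by `1 + O ((y - p) ^ n)` changes a holomorphic function of the
root by `O ((y - p) ^ (n + 1))`. -/
theorem isBigO_comp_sub_comp_mul_exp {F v q : ℂ → ℂ} {p : ℂ} {n : ℕ} (hF : AnalyticAt ℂ F 0)
    (hv : Tendsto v (𝓝[≠] p) (𝓝 0)) (hv1 : v =O[𝓝[≠] p] fun y => y - p) (hq : AnalyticAt ℂ q p)
    (hqn : q =O[𝓝[≠] p] fun y => (y - p) ^ n) (hq0 : q p = 0) :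
    (fun y => F (v y) - F (v y * Complex.exp (-q y))) =O[𝓝[≠] p] fun y => (y - p) ^ (n + 1) := by
  have hqt : Tendsto q (𝓝[≠] p) (𝓝 0) := by
    rw [← hq0]; exact hq.continuousAt.tendsto.mono_left nhdsWithin_le_nhds
  have hexp : Tendsto (fun y => Complex.exp (-q y)) (𝓝[≠] p) (𝓝 1) := by
    have := (Complex.continuous_exp.tendsto (-0)).comp hqt.neg
    simpa [Function.comp_def] using this
  have h1 := hF.hasStrictDerivAt.isBigO_sub
  have h2 : Tendsto (fun y => (v y, v y * Complex.exp (-q y))) (𝓝[≠] p) (𝓝 (0, 0)) := by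
    refine hv.prodMk_nhds ?_
    simpa using hv.mul hexp
  have h3 : (fun w => Complex.exp w - Complex.exp 0) =O[𝓝 0] fun w => w - 0 :=
    (Complex.hasDerivAt_exp 0).differentiableAt.isBigO_sub
  have h4 : (fun y => Complex.exp (-q y) - 1) =O[𝓝[≠] p] fun y => (y - p) ^ n := by
    have h6 : Tendsto (fun y => -q y) (𝓝[≠] p) (𝓝 0) := by simpa using hqt.neg
    have h7 := h3.comp_tendsto h6
    simp only [Function.comp_def, Complex.exp_zero, sub_zero] at h7
    exact h7.trans hqn.neg_left
  have h5 : (fun y => v y - v y * Complex.exp (-q y)) =O[𝓝[≠] p] fun y => (y - p) ^ (n + 1) :=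
    (hv1.mul h4).neg_left.congr (fun y => by ring) fun y => by ring
  exact (h1.comp_tendsto h2).trans h5

end

section

/-! ### Superpotentials parametrised by germs -/
/-- The logarithmic derivative of a family of germs, on the level of Taylor coefficients. -/
theorem fderiv_taylorCoeff_log {E : Type*} [NormedAddCommGroup E] [NormedSpace ℂ E] {f : E → ℂ → ℂ}
    {x : E} (hf : AnalyticAt ℂ (fun q : E × ℂ => f q.1 q.2) (x, 0)) (h0 : f x 0 ≠ 0) {n : ℕ}
    (hn : 0 < n) :
    DifferentiableAt ℂ (fun y => taylorCoeff n fun u => Complex.log (f y u / f y 0)) x ∧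
    ∀ v, fderiv ℂ (fun y => taylorCoeff n fun u => Complex.log (f y u / f y 0)) x v =
      taylorCoeff n fun u => fderiv ℂ (fun y => f y u) x v / f x u := by
  have hslit : f x 0 / f x 0 ∈ Complex.slitPlane := by simp [h0]
  have hF : AnalyticAt ℂ (fun q : E × ℂ => Complex.log (f q.1 q.2 / f q.1 0)) (x, 0) :=
    (hf.div (AnalyticAt.comp (g := fun y => f y 0) (f := Prod.fst) hf.along_fst analyticAt_fst)
      h0).clog hslit
  obtain ⟨h1, h2⟩ := analyticAt_taylorCoeff_and_fderiv
    (F := fun y u => Complex.log (f y u / f y 0)) hF n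
  refine ⟨h1.differentiableAt, fun v => (h2 v).trans ?_⟩
  have hc : Tendsto (fun u : ℂ => (x, u)) (𝓝 0) (𝓝 (x, 0)) := (Continuous.prodMk_right x).tendsto 0
  have hfx : AnalyticAt ℂ (f x) 0 := hf.along_snd
  have hev := hc.eventually hf.eventually_analyticAt
  have h3 : AnalyticAt ℂ (fun u => fderiv ℂ (fun y => f y u) x v) 0 :=
    ((hf.fderiv.clm_apply_apply analyticAt_const).along_snd (p := (x, 0))).congr <| by
      filter_upwards [hev] with u hu using fderiv_apply_fst hu.differentiableAt v
  have h4 : (fun u => fderiv ℂ (fun y => Complex.log (f y u / f y 0)) x v) =ᶠ[𝓝 0] fun u =>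
      fderiv ℂ (fun y => f y u) x v / f x u - fderiv ℂ (fun y => f y 0) x v / f x 0 * u ^ 0 := by
    filter_upwards [hev, (hfx.continuousAt.div_const (f x 0)).eventually_mem
      (Complex.isOpen_slitPlane.mem_nhds hslit), hfx.continuousAt.eventually_ne h0] with u hu hs hu0
    have h5 : HasFDerivAt (fun y => f y u / f y 0) _ x := hu.along_fst.differentiableAt.hasFDerivAt.mul
      ((hasDerivAt_inv h0).comp_hasFDerivAt x hf.along_fst.differentiableAt.hasFDerivAt)
    rw [(h5.clog hs).fderiv]
    simp
    field_simp
    ring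
  rw [taylorCoeff_congr h4, taylorCoeff_sub (h3.fun_div hfx h0)
    (analyticAt_const.fun_mul (analyticAt_pow_zero 0)), taylorCoeff_const_mul, taylorCoeff_pow,
    if_neg hn.ne', mul_zero, sub_zero]

variable {I κ ι : Type} [Fintype I] [DecidableEq I] [Fintype κ] [Fintype ι] [DecidableEq ι]

/-- The derivative of the germ `Y i` along the flat coordinate with exponent `k` at the pole `i` is
`u ^ k` times this function of `Y i`: it expresses that the flat coordinate shifts the primitive of
`dz / ρ`, written in the coordinate `z` at a finite pole and `1 / z` at infinity. -/
def germSpeed (a b : ℂ) : Option I → ℂ → ℂ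
  | none, y => a * y ^ 2 + b * y
  | some _, y => a + b * y

/-- The denominator of the kernel at a pole. -/
def kernDen : Option I → ℂ → ℂ → ℂ
  | none, z, y => 1 - z * y
  | some _, z, y => z - y

/-- The numerator of the kernel at a pole. -/
def kernNum : Option I → ℂ → ℂ
  | none, y => y
  | some _, _ => 1

/-- Minus the derivative of the denominator along the germ. -/
def kernCoeff : Option I → ℂ → ℂ
  | none, z => z
  | some _, _ => 1

/-- The part of the derivative of a logarithm of the denominator that does not depend on `z`. -/
def constSpeed (a b : ℂ) : Option I → ℂ → ℂ
  | none, y => a * y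
  | some _, _ => b

theorem poleKernel_eq (Y : Option I → ℂ → ℂ) (i : Option I) (z u : ℂ) :
    poleKernel Y i z u = kernNum i (Y i u) / kernDen i z (Y i u) := by
  cases i <;> rfl

/-- The derivative of the kernel along the germ, times `germSpeed`. -/
def kernelSpeed (Y : Option I → ℂ → ℂ) (a b : ℂ) (i : Option I) (z u : ℂ) : ℂ :=
  germSpeed a b i (Y i u) / kernDen i z (Y i u) ^ 2

theorem hasDerivAt_kern (i : Option I) {z y : ℂ} (h : kernDen i z y ≠ 0) :
    HasDerivAt (fun y => kernNum i y / kernDen i z y) (1 / kernDen i z y ^ 2) y := by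
  rcases i with _ | i
  · refine ((hasDerivAt_id y).div (((hasDerivAt_id y).const_mul z).const_sub 1) h).congr_deriv ?_
    simp [kernDen]
    ring
  · refine ((hasDerivAt_const y 1).div ((hasDerivAt_id y).const_sub z) h).congr_deriv ?_
    simp [kernDen, kernNum]

/-- The `z`-derivative of the kernel is, up to sign, its square. -/
theorem hasDerivAt_kern_left (i : Option I) {z y : ℂ} (h : kernDen i z y ≠ 0) :
    HasDerivAt (fun z => kernNum i y / kernDen i z y)
      (poleSign i * (kernNum i y / kernDen i z y) ^ 2) z := by
  rcases i with _ | i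
  · refine ((hasDerivAt_const z y).div (((hasDerivAt_id z).mul_const y).const_sub 1) h).congr_deriv ?_
    simp only [kernDen] at h
    simp [kernDen, kernNum, poleSign]
    field_simp
  · refine ((hasDerivAt_const z 1).div ((hasDerivAt_id z).sub_const y) h).congr_deriv ?_
    simp [kernDen, kernNum, poleSign]
    ring

/-- The contribution of a pole to the superpotential. -/
def polarPart (Y : Option I → ℂ → ℂ) (n : Option I → ℕ) (i : Option I) (z : ℂ) : ℂ :=
  -taylorCoeff (n i) fun u => Complex.log (kernDen i z (Y i u) / kernDen i z (Y i 0))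

theorem IsPoleGerms.kernDen_ne {Y : Option I → ℂ → ℂ} {n : Option I → ℕ} (hY : IsPoleGerms Y n)
    {z : ℂ} (hz : z ∉ germPoles Y) (i : Option I) : kernDen i z (Y i 0) ≠ 0 := by
  rcases i with _ | i
  · simp [kernDen, hY.infty]
  · exact sub_ne_zero.2 (notMem_germPoles.1 hz i)

theorem IsPoleGerms.sum_polarPart {Y : Option I → ℂ → ℂ} {n : Option I → ℕ} (hY : IsPoleGerms Y n)
    {z : ℂ} (hz : z ∉ germPoles Y) : ∑ i, polarPart Y n i z = (logPoly (Y none) (n none)).eval z +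
      ∑ i, (logPoly (Y (some i)) (n (some i))).eval (z - Y (some i) 0)⁻¹ := by
  rw [Fintype.sum_option]
  congr 1
  · simp [logPoly_eval (hY.analytic none), polarPart, kernDen, hY.infty]
  · refine Finset.sum_congr rfl fun i _ => ?_
    have h := sub_ne_zero.2 (notMem_germPoles.1 hz i)
    simp only [logPoly_eval (hY.analytic (some i)), polarPart, kernDen]
    congr 2
    funext u
    congr 1
    field_simp
    ring

/-- A space of superpotentials that are parametrised by germs at the poles: the superpotential is
the sum of the polar parts `logPoly` of the germs and of a constant `c t`. -/
structure PoleSystem (L : LGModel κ ι) (A : (ι → ℂ) → κ → ℂ) (G : Set (ι → ℂ))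
    (pole : ι → Option I) (k : ι → ℕ) (n : Option I → ℕ) (Y : (ι → ℂ) → Option I → ℂ → ℂ) (a b : ℂ)
    (c : (ι → ℂ) → ℂ) (e : (ι → ℂ) × ℂ) : Prop extends LGModel.FlatParam L A G where
  index : IsFlatIndex pole k n
  rho_eq : ∀ z, L.rho z = a + b * z
  rho_ne : ∀ t ∈ G, ∀ z ∉ germPoles (Y t), a + b * z ≠ 0
  germs : ∀ t ∈ G, IsPoleGerms (Y t) n
  poles_eq : ∀ t ∈ G, L.poles (A t) = germPoles (Y t)
  germ_analytic : ∀ t ∈ G, ∀ i, AnalyticAt ℂ (fun q : (ι → ℂ) × ℂ => Y q.1 i q.2) (t, 0)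
  germ_deriv : ∀ t ∈ G, ∀ i γ, ∀ᶠ u in 𝓝 0, fderiv ℂ (fun t => Y t i u) t (Pi.single γ 1) =
    if pole γ = i then u ^ k γ * germSpeed a b i (Y t i u) else 0
  const_analytic : ∀ t ∈ G, AnalyticAt ℂ c t
  const_deriv : ∀ t ∈ G, ∀ γ, fderiv ℂ c t (Pi.single γ 1) =
    if pole γ = none then a * taylorCoeff (n none) (fun u => u ^ k γ * Y t none u)
    else b * (if k γ = n (pole γ) then 1 else 0)
  lam_eq : ∀ t ∈ G, ∀ z ∉ germPoles (Y t), L.lam (A t) z = c t +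
    ((logPoly (Y t none) (n none)).eval z +
      ∑ i, (logPoly (Y t (some i)) (n (some i))).eval (z - Y t (some i) 0)⁻¹)
  unit_eq : ∀ t ∈ G, ∀ z ∉ germPoles (Y t),
    (a + b * z) * (flatCombo (Y t) n pole k e.1 z + e.2 * lamDeriv (Y t) n z) = 1

namespace PoleSystem

variable {L : LGModel κ ι} {A : (ι → ℂ) → κ → ℂ} {G : Set (ι → ℂ)}
  {pole : ι → Option I} {k : ι → ℕ} {n : Option I → ℕ} {Y : (ι → ℂ) → Option I → ℂ → ℂ} {a b : ℂ}
  {c : (ι → ℂ) → ℂ} {e : (ι → ℂ) × ℂ} (D : PoleSystem L A G pole k n Y a b c e)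
  {t : ι → ℂ} (ht : t ∈ G) {z : ℂ} (hz : z ∉ germPoles (Y t))
include D ht

theorem eventually_germ (i : Option I) : ∀ᶠ u in 𝓝 (0 : ℂ), AnalyticAt ℂ (fun t => Y t i u) t ∧
    ∀ γ, fderiv ℂ (fun t => Y t i u) t (Pi.single γ 1) =
      if pole γ = i then u ^ k γ * germSpeed a b i (Y t i u) else 0 := by
  have h3 : Tendsto (fun u : ℂ => (t, u)) (𝓝 0) (𝓝 (t, 0)) := (Continuous.prodMk_right t).tendsto 0
  filter_upwards [h3.eventually (D.germ_analytic t ht i).eventually_analyticAt,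
    eventually_all.2 fun γ => D.germ_deriv t ht i γ] with u hu hd using ⟨hu.along_fst, hd⟩

include hz

theorem notMem_poles : z ∉ L.poles (A t) := by rwa [D.poles_eq t ht]

theorem eventually_kernDen_ne (i : Option I) : ∀ᶠ u in 𝓝 (0 : ℂ), kernDen i z (Y t i u) ≠ 0 := by
  have hc := ((D.germs t ht).analytic i).continuousAt
  refine ContinuousAt.eventually_ne ?_ ((D.germs t ht).kernDen_ne hz i)
  cases i
  · exact continuousAt_const.sub (continuousAt_const.mul hc)
  · exact continuousAt_const.sub hc

theorem analyticAt_kernDen (i : Option I) : AnalyticAt ℂ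
    (fun q : ((ι → ℂ) × ℂ) × ℂ => kernDen i q.1.2 (Y q.1.1 i q.2)) ((t, z), 0) ∧
    AnalyticAt ℂ (fun q : ((ι → ℂ) × ℂ) × ℂ => kernNum i (Y q.1.1 i q.2)) ((t, z), 0) := by
  have hYq : AnalyticAt ℂ (fun q : ((ι → ℂ) × ℂ) × ℂ => Y q.1.1 i q.2) ((t, z), 0) :=
    AnalyticAt.comp (g := fun q : (ι → ℂ) × ℂ => Y q.1 i q.2)
      (f := fun q : ((ι → ℂ) × ℂ) × ℂ => (q.1.1, q.2)) (D.germ_analytic t ht i)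
      ((analyticAt_fst.comp analyticAt_fst).prod analyticAt_snd)
  have hzq : AnalyticAt ℂ (fun q : ((ι → ℂ) × ℂ) × ℂ => q.1.2) ((t, z), 0) :=
    analyticAt_snd.comp analyticAt_fst
  rcases i with _ | i
  · exact ⟨analyticAt_const.sub (hzq.mul hYq), hYq⟩
  · exact ⟨hzq.sub hYq, analyticAt_const⟩

theorem analyticAt_kernel (i : Option I) (m : ℕ) : AnalyticAt ℂ
    (fun q : ((ι → ℂ) × ℂ) × ℂ => q.2 ^ m * poleKernel (Y q.1.1) i q.1.2 q.2) ((t, z), 0) := by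
  have h := D.analyticAt_kernDen ht hz i
  simp only [poleKernel_eq]
  exact (analyticAt_snd.pow m).mul (h.2.div h.1 ((D.germs t ht).kernDen_ne hz i))

theorem analyticAt_poleCoeff_joint (i : Option I) (m : ℕ) :
    AnalyticAt ℂ (fun q : (ι → ℂ) × ℂ => poleCoeff (Y q.1) n i m q.2) (t, z) :=
  (analyticAt_taylorCoeff_and_fderiv (F := fun (q : (ι → ℂ) × ℂ) u =>
    u ^ m * poleKernel (Y q.1) i q.2 u) (D.analyticAt_kernel ht hz i m) (n i)).1

/-- Only the germ at the pole of `t_γ` moves, so that `∂_γ` acts on the coefficients of the kernel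
through `kernelSpeed`. -/
theorem fderiv_poleCoeff (i : Option I) (m : ℕ) (γ : ι) :
    fderiv ℂ (fun t => poleCoeff (Y t) n i m z) t (Pi.single γ 1) =
      if pole γ = i then taylorCoeff (n i) (fun u => u ^ (m + k γ) * kernelSpeed (Y t) a b i z u)
      else 0 := by
  have hF : AnalyticAt ℂ (fun q : (ι → ℂ) × ℂ => q.2 ^ m * poleKernel (Y q.1) i z q.2) (t, 0) :=
    AnalyticAt.comp (g := fun q : ((ι → ℂ) × ℂ) × ℂ => q.2 ^ m * poleKernel (Y q.1.1) i q.1.2 q.2)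
      (f := fun q : (ι → ℂ) × ℂ => ((q.1, z), q.2)) (D.analyticAt_kernel ht hz i m)
      ((analyticAt_fst.prod analyticAt_const).prod analyticAt_snd)
  refine ((analyticAt_taylorCoeff_and_fderiv
    (F := fun (t : ι → ℂ) u => u ^ m * poleKernel (Y t) i z u) hF (n i)).2 _).trans ?_
  have h3 : (fun u => fderiv ℂ (fun t => u ^ m * poleKernel (Y t) i z u) t (Pi.single γ 1))
      =ᶠ[𝓝 0] fun u => if pole γ = i then u ^ (m + k γ) * kernelSpeed (Y t) a b i z u else 0 := by
    filter_upwards [D.eventually_kernDen_ne ht hz i, D.eventually_germ ht i] with u hu hd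
    simp only [poleKernel_eq]
    have h4 : HasFDerivAt (fun t => u ^ m * (kernNum i (Y t i u) / kernDen i z (Y t i u))) _ t :=
      ((hasDerivAt_kern i hu).comp_hasFDerivAt t hd.1.differentiableAt.hasFDerivAt).const_mul _
    rw [h4.fderiv]
    simp only [smul_apply, smul_eq_mul, hd.2, kernelSpeed]
    split_ifs <;> ring
  rw [taylorCoeff_congr h3]
  split_ifs
  exacts [rfl, taylorCoeff_fun_zero _]

theorem deriv_poleCoeff (i : Option I) (m : ℕ) :
    HasDerivAt (poleCoeff (Y t) n i m) (taylorCoeff (n i)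
      (fun u => u ^ m * (poleSign i * poleKernel (Y t) i z u ^ 2))) z := by
  have hF : AnalyticAt ℂ (fun q : ℂ × ℂ => q.2 ^ m * poleKernel (Y t) i q.1 q.2) (z, 0) :=
    AnalyticAt.comp (g := fun q : ((ι → ℂ) × ℂ) × ℂ => q.2 ^ m * poleKernel (Y q.1.1) i q.1.2 q.2)
      (f := fun q : ℂ × ℂ => ((t, q.1), q.2)) (D.analyticAt_kernel ht hz i m)
      ((analyticAt_const.prod analyticAt_fst).prod analyticAt_snd)
  obtain ⟨h1, h2⟩ := analyticAt_taylorCoeff_and_fderiv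
    (F := fun (z : ℂ) u => u ^ m * poleKernel (Y t) i z u) hF (n i)
  refine h1.differentiableAt.hasDerivAt.congr_deriv ?_
  rw [← fderiv_apply_one_eq_deriv, h2]
  refine taylorCoeff_congr ?_ _
  filter_upwards [D.eventually_kernDen_ne ht hz i] with u hu
  rw [fderiv_apply_one_eq_deriv]
  simp only [poleKernel_eq]
  exact ((hasDerivAt_kern_left i hu).const_mul _).deriv

/-- The identity `± ∂_z (ρ K) = ∂ K / ∂ t` for the kernels, on the level of Taylor coefficients. -/
theorem hasDerivAt_hessPart (i : Option I) (m : ℕ) :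
    HasDerivAt (hessPart (Y t) n a b i m)
      (taylorCoeff (n i) fun u => u ^ m * kernelSpeed (Y t) a b i z u) z := by
  have h1 : HasDerivAt (fun z : ℂ => a + b * z) b z := by
    simpa using ((hasDerivAt_id z).const_mul b).const_add a
  refine (((h1.mul (D.deriv_poleCoeff ht hz i m)).const_mul (poleSign i)).add_const
    (b * (if m = n i then 1 else 0))).congr_deriv ?_
  have hp := analyticAt_pow_zero m
  have hK := (D.analyticAt_kernel ht hz i 0).along_snd
  simp only [pow_zero, one_mul] at hK
  rw [poleCoeff, ← taylorCoeff_const_mul, ← taylorCoeff_const_mul,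
    ← taylorCoeff_add (analyticAt_const.fun_mul (hp.fun_mul hK))
      (analyticAt_const.fun_mul (hp.fun_mul (analyticAt_const.fun_mul (hK.fun_pow 2)))),
    ← taylorCoeff_const_mul]
  refine taylorCoeff_congr ?_ _
  filter_upwards [D.eventually_kernDen_ne ht hz i] with u hu
  rcases i with _ | i <;>
  · simp only [poleSign, poleKernel_eq, kernelSpeed, kernNum, kernDen, germSpeed] at hu ⊢
    field_simp
    ring

theorem lamFlat_eq : LGModel.lamFlat L A =ᶠ[𝓝 (t, z)]
    fun q => c q.1 + ∑ i, polarPart (Y q.1) n i q.2 := by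
  have h1 : ∀ i : I, ∀ᶠ q : (ι → ℂ) × ℂ in 𝓝 (t, z), q.2 - Y q.1 (some i) 0 ≠ 0 := fun i => by
    have hY : ContinuousAt (fun t => Y t (some i) 0) t :=
      (D.germ_analytic t ht (some i)).along_fst.continuousAt
    have hc : ContinuousAt (fun q : (ι → ℂ) × ℂ => q.2 - Y q.1 (some i) 0) (t, z) :=
      continuousAt_snd.sub (ContinuousAt.comp (f := Prod.fst) (x := (t, z)) hY continuousAt_fst)
    exact hc.eventually_ne (sub_ne_zero.2 (notMem_germPoles.1 hz i))
  filter_upwards [eventually_all.2 h1, continuousAt_fst.eventually_mem (D.isOpen.mem_nhds ht)]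
    with q h2 h3
  have h4 := notMem_germPoles.2 fun i => sub_ne_zero.1 (h2 i)
  rw [(D.germs _ h3).sum_polarPart h4, ← D.lam_eq _ h3 _ h4, LGModel.lamFlat]

/-- The differential of a polar part. -/
theorem fderiv_polarPart (i : Option I) :
    DifferentiableAt ℂ (fun q : (ι → ℂ) × ℂ => polarPart (Y q.1) n i q.2) (t, z) ∧
    (∀ γ, fderiv ℂ (fun q : (ι → ℂ) × ℂ => polarPart (Y q.1) n i q.2) (t, z) (Pi.single γ 1, 0) =
      if pole γ = i then (a + b * z) * poleCoeff (Y t) n i (k γ) z - taylorCoeff (n i) fun u =>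
        u ^ k γ * constSpeed a b i (Y t i u) else 0) ∧
    fderiv ℂ (fun q : (ι → ℂ) × ℂ => polarPart (Y q.1) n i q.2) (t, z) (0, 1) =
      poleSign i * poleCoeff (Y t) n i 0 z := by
  obtain ⟨h1, h2⟩ := fderiv_taylorCoeff_log
    (f := fun (q : (ι → ℂ) × ℂ) u => kernDen i q.2 (Y q.1 i u)) (D.analyticAt_kernDen ht hz i).1
    ((D.germs t ht).kernDen_ne hz i) ((D.germs t ht).n_pos i)
  have hYa := (D.germs t ht).analytic i
  have hp := analyticAt_pow_zero
  have hev : ∀ᶠ u in 𝓝 (0 : ℂ), (∀ γ, fderiv ℂ (fun q : (ι → ℂ) × ℂ => kernDen i q.2 (Y q.1 i u))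
      (t, z) (Pi.single γ 1, 0) = if pole γ = i then -(u ^ k γ * (germSpeed a b i (Y t i u) *
        kernCoeff i z)) else 0) ∧
      fderiv ℂ (fun q : (ι → ℂ) × ℂ => kernDen i q.2 (Y q.1 i u)) (t, z) (0, 1) =
        -(poleSign i * kernNum i (Y t i u)) := by
    filter_upwards [D.eventually_germ ht i] with u hd
    have hY : HasFDerivAt (fun q : (ι → ℂ) × ℂ => Y q.1 i u) _ (t, z) :=
      HasFDerivAt.comp (f := Prod.fst) (t, z) hd.1.differentiableAt.hasFDerivAt hasFDerivAt_fst
    rcases i with _ | i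
    · have h : HasFDerivAt (fun q : (ι → ℂ) × ℂ => kernDen (none : Option I) q.2 (Y q.1 none u)) _
        (t, z) := (hasFDerivAt_snd.mul hY).const_sub 1
      rw [h.fderiv]
      refine ⟨fun γ => ?_, by simp [kernNum, poleSign]⟩
      simp [hd.2, kernCoeff]
      split_ifs <;> ring
    · have h : HasFDerivAt (fun q : (ι → ℂ) × ℂ => kernDen (some i) q.2 (Y q.1 (some i) u)) _
        (t, z) := hasFDerivAt_snd.sub hY
      rw [h.fderiv]
      refine ⟨fun γ => ?_, by simp [kernNum, poleSign]⟩
      simp [hd.2, kernCoeff]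
      split_ifs <;> ring
  refine ⟨h1.neg, fun γ => ?_, ?_⟩ <;> simp only [polarPart] <;>
    rw [fderiv_fun_neg, neg_apply, h2, ← taylorCoeff_neg]
  · split_ifs with hγ
    · rw [poleCoeff, ← taylorCoeff_const_mul, ← taylorCoeff_sub (analyticAt_const.fun_mul
        (D.analyticAt_kernel ht hz i (k γ)).along_snd) ((hp _).fun_mul ?_)]
      · refine taylorCoeff_congr ?_ _
        filter_upwards [hev, D.eventually_kernDen_ne ht hz i] with u hu hne
        rw [hu.1, if_pos hγ, poleKernel_eq]
        rcases i with _ | i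
        · simp only [kernNum, kernDen, germSpeed, kernCoeff, constSpeed] at hne ⊢
          linear_combination (-(u ^ k γ * Y t none u * a)) * mul_inv_cancel₀ hne
        · simp only [kernNum, kernDen, germSpeed, kernCoeff, constSpeed] at hne ⊢
          field_simp
          ring
      · cases i
        exacts [analyticAt_const.mul hYa, analyticAt_const]
    · refine (taylorCoeff_congr (g := fun _ => 0) ?_ _).trans (taylorCoeff_fun_zero _)
      filter_upwards [hev] with u hu
      rw [hu.1, if_neg hγ, zero_div, neg_zero]
  · rw [poleCoeff, ← taylorCoeff_const_mul]
    refine taylorCoeff_congr ?_ _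
    filter_upwards [hev] with u hu
    rw [hu.2, poleKernel_eq]
    ring

/-- The differential of the superpotential: `∂_α λ` is `ρ` times a coefficient of a kernel, and `∂_s
λ` is `ρ λ'`. -/
theorem dlamExt_eq (x : (ι → ℂ) × ℂ) : LGModel.dlamExt L A t z x =
    (a + b * z) * (flatCombo (Y t) n pole k x.1 z + x.2 * lamDeriv (Y t) n z) := by
  have hP := fun i => D.fderiv_polarPart ht hz i
  have h1 : HasFDerivAt (LGModel.lamFlat L A) _ (t, z) :=
    ((HasFDerivAt.comp (f := Prod.fst) (t, z) (D.const_analytic t ht).differentiableAt.hasFDerivAt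
      hasFDerivAt_fst).add (HasFDerivAt.fun_sum fun i (_ : i ∈ Finset.univ) =>
        (hP i).1.hasFDerivAt)).congr_of_eventuallyEq (D.lamFlat_eq ht hz)
  have h2 : ∀ α, LGModel.dlamExt L A t z (LGModel.dt α) =
      (a + b * z) * poleCoeff (Y t) n (pole α) (k α) z := fun α => by
    simp only [LGModel.dlamExt, LGModel.dt, h1.fderiv]
    simp only [ContinuousLinearMap.comp_apply, ContinuousLinearMap.prod_apply, add_apply, sum_apply,
      ContinuousLinearMap.coe_fst', smul_apply, ContinuousLinearMap.coe_snd', smul_zero,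
      fun i => (hP i).2.1 α, Finset.sum_ite_eq, Finset.mem_univ, if_true, D.const_deriv t ht]
    rcases pole α with _ | i
    · rw [if_pos rfl, ← taylorCoeff_const_mul]
      simp only [constSpeed, mul_left_comm a]
      ring
    · rw [if_neg (by simp)]
      simp only [constSpeed, mul_comm _ b, taylorCoeff_const_mul, taylorCoeff_pow, eq_comm]
      ring
  have h3 : LGModel.dlamExt L A t z LGModel.ds = (a + b * z) * lamDeriv (Y t) n z := by
    have h4 : ((0 : ι → ℂ), L.rho z • (1 : ℂ)) = (a + b * z) • (0, 1) := by ext <;> simp [D.rho_eq]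
    simp only [LGModel.dlamExt, LGModel.ds, h1.fderiv, ContinuousLinearMap.comp_apply,
      ContinuousLinearMap.prod_apply, smul_apply, ContinuousLinearMap.coe_fst',
      ContinuousLinearMap.coe_snd', h4, map_smul]
    simp [fun i => (hP i).2.2, Fintype.sum_option, lamDeriv, poleSign, sub_eq_add_neg]
  rw [LGModel.dlamExt_eq_sum, h3, flatCombo, mul_add, Finset.mul_sum]
  simp only [h2]
  congr 1
  · exact Finset.sum_congr rfl fun α _ => by ring
  · ring

omit hz

theorem dlam_eq (x : ι → ℂ) (hz : z ∉ germPoles (Y t)) :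
    L.dlam (A t) (fderiv ℂ A t x) z = (a + b * z) * flatCombo (Y t) n pole k x z := by
  have h := D.dlamExt_apply ht (D.notMem_poles ht hz) (x, 0)
  rw [D.dlamExt_eq ht hz] at h
  simpa using h.symm

theorem deriv_lam (hz : z ∉ germPoles (Y t)) : deriv (L.lam (A t)) z = lamDeriv (Y t) n z := by
  have h := D.dlamExt_apply ht (D.notMem_poles ht hz) (0, 1)
  rw [D.dlamExt_eq ht hz, D.rho_eq] at h
  refine mul_left_cancel₀ (D.rho_ne t ht z hz) ?_
  simpa [LGModel.dlam, flatCombo] using h.symm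

theorem crit_eq : L.crit (A t) = germCrit (Y t) n := by
  ext z
  simp only [LGModel.crit, germCrit, Set.mem_ofPred_eq, D.poles_eq t ht]
  exact and_congr_right fun hz => by rw [D.deriv_lam ht hz]

theorem metric_eq (x y : ι → ℂ) : L.metric (A t) (fderiv ℂ A t x) (fderiv ℂ A t y) =
    bil (fun α β => flatGram pole k n α β) x y := by
  rw [LGModel.metric, D.crit_eq ht, bil_apply]
  refine (D.germs t ht).sum_residue_crit D.index x y fun z hz => ?_
  have h0 := D.rho_ne t ht z hz
  rw [D.dlam_eq ht x hz, D.dlam_eq ht y hz, D.deriv_lam ht hz, D.rho_eq, sq,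
    mul_mul_mul_comm, mul_div_mul_left _ _ (mul_ne_zero h0 h0)]

/-- Dividing the product of two derivatives by `λ'` turns the cubic form into the metric: the
multiple of `λ'` cancels the denominator and has no residues at the critical points. -/
theorem cubic_eq (x y ζ w : ι → ℂ) {h : ℂ → ℂ} (hh : ∀ z ∉ germPoles (Y t), AnalyticAt ℂ h z)
    (hd : ∀ z ∉ germPoles (Y t), LGModel.dlamExt L A t z (x, 0) * LGModel.dlamExt L A t z (y, 0) =
      LGModel.dlamExt L A t z (ζ, h z)) :
    L.cubic (A t) (fderiv ℂ A t x) (fderiv ℂ A t y) (fderiv ℂ A t w) =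
      L.metric (A t) (fderiv ℂ A t ζ) (fderiv ℂ A t w) := by
  rw [LGModel.cubic, LGModel.metric, D.crit_eq ht]
  refine finsum_mem_congr rfl fun p hp => ?_
  have hF := fun x {z} hz => (D.germs t ht).analyticAt_flatCombo (pole := pole) (k := k) x (z := z) hz
  obtain ⟨N, g, hg, hg0, hgz⟩ := (D.germs t ht).exists_lamDeriv_eq D.index hp.1
  have hne : ∀ᶠ z in 𝓝[≠] p, lamDeriv (Y t) n z ≠ 0 ∧ z ∉ germPoles (Y t) := by
    filter_upwards [hgz, self_mem_nhdsWithin, nhdsWithin_le_nhds (hg.continuousAt.eventually_ne hg0),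
      IsPoleGerms.eventually_notMem_germPoles (Y := Y t) p] with z hz hzp hz0 hzS
    rw [hz]
    exact ⟨mul_ne_zero (pow_ne_zero _ (sub_ne_zero.2 hzp)) hz0, hzS⟩
  refine residue_congr_add (g := fun z => h z * flatCombo (Y t) n pole k w z) ?_
    ((hh p hp.1).mul (hF w hp.1)) ?_
  · filter_upwards [hne] with z ⟨hz, hzS⟩
    refine (((hF ζ hzS).mul (hF w hzS)).div
      ((D.germs t ht).analyticAt_lamDeriv hzS) hz).continuousAt.congr ?_
    filter_upwards [(isOpen_compl_germPoles (Y t)).mem_nhds hzS] with v hv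
    have h0 := D.rho_ne t ht v hv
    rw [D.rho_eq, D.deriv_lam ht hv, D.dlam_eq ht ζ hv, D.dlam_eq ht w hv, sq, mul_mul_mul_comm,
      mul_div_mul_left _ _ (mul_ne_zero h0 h0)]
    rfl
  · filter_upwards [hne] with z ⟨hz, hzS⟩
    have hz0 := D.rho_ne t ht z hzS
    have h1 := hd z hzS
    simp only [D.dlamExt_eq ht hzS, zero_mul, add_zero] at h1
    rw [D.dlam_eq ht x hzS, D.dlam_eq ht y hzS, D.dlam_eq ht ζ hzS, D.dlam_eq ht w hzS, D.rho_eq,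
      D.deriv_lam ht hzS, h1]
    field_simp

omit ht

/-- The analytic input for the rank one extension: the constancy of the metric, the formula for `H`,
the division identity and its uniqueness, and the closedness of `H`. The mixed relation
`ρ ∂_z H (∂_α, ∂_β) = ∂_α ∂_β λ` and the symmetry of `∂_γ H (∂_α, ∂_β)` come from the kernels. -/
theorem flatData : L.FlatData A G (fun α β t z => hessCoeff (Y t) n pole k a b α β z)
    (fun α β => flatGram pole k n α β) e where
  toFlatParam := D.toFlatParam
  H_analytic α β t ht z hz := by
    rw [D.poles_eq t ht] at hz
    by_cases h : pole α = pole β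
    · simp only [hessCoeff, if_pos h, hessPart]
      exact (analyticAt_const.mul ((analyticAt_const.add (analyticAt_const.mul analyticAt_snd)).mul
        (D.analyticAt_poleCoeff_joint ht hz _ _))).add analyticAt_const
    · simp only [hessCoeff, if_neg h]
      exact analyticAt_const
  H_symm α β t z := by
    simp only [hessCoeff]
    by_cases h : pole α = pole β
    · rw [if_pos h, if_pos h.symm, h, add_comm]
    · rw [if_neg h, if_neg fun h' => h h'.symm]
  H_closed α β γ t ht z hz := by
    rw [D.poles_eq t ht] at hz
    have key : ∀ α γ, fderiv ℂ (fun t => hessCoeff (Y t) n pole k a b α β z) t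
        (Pi.single γ 1) = if pole α = pole β ∧ pole γ = pole β then
          poleSign (pole β) * ((a + b * z) * taylorCoeff (n (pole β))
            fun u => u ^ (k α + k β + k γ) * kernelSpeed (Y t) a b (pole β) z u) else 0 := by
      intro α γ
      by_cases h : pole α = pole β
      · simp only [hessCoeff, if_pos h, hessPart]
        have h3 := ((((D.analyticAt_poleCoeff_joint ht hz (pole β)
          (k α + k β)).along_fst.differentiableAt.hasFDerivAt.const_mul (a + b * z)).const_mul
            (poleSign (pole β))).add_const (b * (if k α + k β = n (pole β) then 1 else 0)))
        rw [h, h3.fderiv]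
        simp only [smul_apply, smul_eq_mul, D.fderiv_poleCoeff ht hz]
        by_cases h4 : pole γ = pole β <;> simp [h4]
      · simp [hessCoeff, h]
    rw [key, key]
    by_cases h : pole α = pole β ∧ pole γ = pole β
    · rw [if_pos h, if_pos h.symm, show k α + k β + k γ = k γ + k β + k α by ring]
    · rw [if_neg h, if_neg fun h' => h h'.symm]
  H_deriv α β t ht z hz := by
    have h1 : (fun t => LGModel.dlamExt L A t z (Pi.single α 1, 0)) =ᶠ[𝓝 t]
        fun t => (a + b * z) * poleCoeff (Y t) n (pole α) (k α) z := by
      filter_upwards [D.eventually_mem ht hz] with t' h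
      rw [D.dlamExt_eq h.1 (D.poles_eq t' h.1 ▸ h.2)]
      simp [flatCombo, Pi.single_apply]
    rw [D.poles_eq t ht] at hz
    have h2 := (D.analyticAt_poleCoeff_joint ht hz (pole α) (k α)).along_fst.differentiableAt
    rw [h1.fderiv_eq, (h2.hasFDerivAt.const_mul (a + b * z)).fderiv, smul_apply, smul_eq_mul,
      D.fderiv_poleCoeff ht hz, D.rho_eq]
    congr 1
    by_cases h : pole α = pole β
    · rw [if_pos h.symm]
      have : (fun z => hessCoeff (Y t) n pole k a b α β z) =
          hessPart (Y t) n a b (pole α) (k α + k β) := funext fun z => if_pos h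
      rw [this]
      exact (D.hasDerivAt_hessPart ht hz _ _).deriv
    · rw [if_neg fun h' => h h'.symm]
      simp [hessCoeff, h]
  hess_eq t ht x y z hz := by
    rw [D.poles_eq t ht] at hz
    rw [LGModel.hess, D.poles_eq t ht, bil_apply]
    refine (D.germs t ht).sum_principalPart (fun w hw => ?_) D.index hz
    have h0 := D.rho_ne t ht w hw
    rw [D.dlam_eq ht x hw, D.dlam_eq ht y hw, D.deriv_lam ht hw, D.rho_eq]
    rw [mul_assoc, mul_div_mul_left _ _ h0, mul_left_comm, mul_div_assoc]
  metric_eq t ht x y := D.metric_eq ht x y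
  gram_symm := flatGram_symm
  det_ne_zero := flatGram_det_ne_zero D.index
  division t ht x y := by
    obtain ⟨ζ, hζ⟩ := (D.germs t ht).exists_division D.index a b x y
    refine ⟨ζ, fun z hz => ?_⟩
    rw [D.poles_eq t ht] at hz
    simp only [D.dlamExt_eq ht hz, bil_apply]
    linear_combination (a + b * z) * hζ z hz
  division_unique t ht x h hh hx := by
    rw [D.poles_eq t ht] at hh hx ⊢
    intro z hz
    refine neg_eq_zero.1 ((D.germs t ht).eq_zero_of_flatCombo_eq_mul D.index x (h := fun z => -h z)
      (fun z hz => (hh z hz).differentiableAt.neg) (fun z hz => ?_) z hz)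
    have h1 := hx z hz
    rw [D.dlamExt_eq ht hz] at h1
    linear_combination (mul_eq_zero.1 h1).resolve_left (D.rho_ne t ht z hz)
  cubic_eq t ht x y ζ h hh hd w := by
    rw [D.poles_eq t ht] at hh hd
    exact D.cubic_eq ht x y ζ w hh hd
  unit_eq t ht z hz := by
    rw [D.poles_eq t ht] at hz
    rw [D.dlamExt_eq ht hz, D.unit_eq t ht z hz]

end PoleSystem

end

section

open Polynomial Asymptotics

/-- The highest coefficient of the polar part of a germ. -/
theorem taylorCoeff_sub_pow {Y : ℂ → ℂ} (hY : AnalyticAt ℂ Y 0) (n : ℕ) :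
    taylorCoeff n (fun u => (Y u - Y 0) ^ n) = deriv Y 0 ^ n := by
  have hds : AnalyticAt ℂ (dslope Y 0) 0 := by
    obtain ⟨s, hs⟩ := hY
    exact ⟨_, hs.has_fpower_series_dslope_fslope⟩
  have h1 : (fun u => (Y u - Y 0) ^ n) = fun u => u ^ n * dslope Y 0 u ^ n := by
    funext u
    have h2 := sub_smul_dslope Y 0 u
    rw [sub_zero, smul_eq_mul] at h2
    rw [← h2, mul_pow]
  rw [h1, taylorCoeff_pow_mul (hds.fun_pow n), if_pos le_rfl, Nat.sub_self, taylorCoeff_zero,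
    dslope_same]

theorem tendsto_sub_nhdsWithin (p : ℂ) : Tendsto (fun y : ℂ => y - p) (𝓝[≠] p) (𝓝 0) := by
  have : Tendsto (fun y : ℂ => y - p) (𝓝 p) (𝓝 (p - p)) :=
    (continuous_id.sub continuous_const).tendsto p
  rw [sub_self] at this
  exact this.mono_left nhdsWithin_le_nhds

theorem isBigO_sub_pow_of_le {p : ℂ} {j m : ℕ} (h : j ≤ m) :
    (fun y : ℂ => (y - p) ^ m) =O[𝓝[≠] p] fun y => (y - p) ^ j :=
  (isBigO_pow_pow h).comp_tendsto (tendsto_sub_nhdsWithin p)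

theorem isBigO_comp_sub_comp {l : Filter ℂ} {E f g h : ℂ → ℂ} {c : ℂ} (hE : AnalyticAt ℂ E c)
    (hg : Tendsto g l (𝓝 c)) (hfg : (fun z => f z - g z) =O[l] h) (hh : Tendsto h l (𝓝 0)) :
    (fun z => E (f z) - E (g z)) =O[l] h := by
  have hf : Tendsto f l (𝓝 c) := by
    have := (hfg.trans_tendsto hh).add hg
    simpa using this
  exact (hE.hasStrictDerivAt.isBigO_sub.comp_tendsto (hf.prodMk_nhds hg)).trans hfg

theorem eq_of_isBigO_eval_sharp {P Q : ℂ[X]}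
    (h : (fun y => P.eval y⁻¹ - Q.eval y⁻¹) =O[𝓝[≠] 0] fun y : ℂ => y) : P = Q := by
  have h0 : Tendsto (fun y : ℂ => y) (𝓝[≠] 0) (𝓝 0) := tendsto_id.mono_left nhdsWithin_le_nhds
  have h1 : P - C (P.coeff 0 - Q.coeff 0) = Q := by
    refine eq_of_isBigO_eval (p := 0) (by simp) ?_
    have h2 := (h.trans (h0.isBigO_one ℂ)).sub
      (isBigO_const_const (P.coeff 0 - Q.coeff 0) one_ne_zero (𝓝[≠] (0 : ℂ)))
    refine h2.congr_left fun y => ?_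
    simp
    ring
  have h2 : Tendsto (fun y : ℂ => P.eval y⁻¹ - Q.eval y⁻¹) (𝓝[≠] 0)
      (𝓝 (P.coeff 0 - Q.coeff 0)) := by
    refine tendsto_const_nhds.congr fun y => ?_
    conv_rhs => rw [← h1]
    simp
  have h3 := tendsto_nhds_unique h2 (h.trans_tendsto h0)
  rw [← h1, h3]
  simp

/-- `λ` has a pole of order `n` at `p`: it is the sum of a holomorphic function `R` and a polynomial
`Q` in `(y - p)⁻¹`. -/
structure HasPole (lam : ℂ → ℂ) (p : ℂ) (n : ℕ) (Q : ℂ[X]) (R : ℂ → ℂ) : Prop where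
  n_pos : 0 < n
  natDegree_le : Q.natDegree ≤ n
  coeff_ne : Q.coeff n ≠ 0
  analytic : AnalyticAt ℂ R p
  eq : ∀ᶠ y in 𝓝[≠] p, lam y = R y + Q.eval (y - p)⁻¹

namespace HasPole

variable {lam R : ℂ → ℂ} {p : ℂ} {n : ℕ} {Q : ℂ[X]} (h : HasPole lam p n Q R)
include h

theorem exists_numerator : ∃ ψ : ℂ → ℂ, AnalyticAt ℂ ψ p ∧ ψ p = n * Q.coeff n ∧
    ∀ᶠ y in 𝓝[≠] p, (y - p) ^ n * (n * lam y) = ψ y := by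
  refine ⟨fun y => n * ((y - p) ^ n * R y + (reflect n Q).eval (y - p)), ?_, ?_, ?_⟩
  · have h1 : AnalyticAt ℂ (fun y : ℂ => y - p) p := analyticAt_id.sub analyticAt_const
    exact analyticAt_const.mul (((h1.pow n).mul h.analytic).add
      (AnalyticAt.comp (g := fun w => (reflect n Q).eval w)
        ((reflect n Q).differentiable.analyticAt _) h1))
  · simp only [sub_self]
    rw [zero_pow h.n_pos.ne', zero_mul, zero_add, ← coeff_zero_eq_eval_zero, coeff_reflect,
      revAt_zero]
  · filter_upwards [h.eq, self_mem_nhdsWithin] with y hy hyp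
    have hyp' : y - p ≠ 0 := sub_ne_zero.2 hyp
    let _ := invertibleOfNonzero (inv_ne_zero hyp')
    have h1 := eval₂_reflect_mul_pow (RingHom.id ℂ) (y - p)⁻¹ n Q h.natDegree_le
    rw [invOf_eq_inv] at h1
    simp only [inv_inv, eval₂_id] at h1
    rw [hy, ← h1, inv_pow]
    field_simp

theorem numerator_ne {ψ : ℂ → ℂ} (hψ : ψ p = n * Q.coeff n) : ψ p ≠ 0 := by
  rw [hψ]
  exact mul_ne_zero (Nat.cast_ne_zero.2 h.n_pos.ne') h.coeff_ne

theorem isBigO_root {u : ℂ → ℂ} (hu : ∀ᶠ y in 𝓝[≠] p, u y ^ n * (n * lam y) = 1) :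
    u =O[𝓝[≠] p] (fun y => y - p) ∧ (fun y => y - p) =O[𝓝[≠] p] u ∧ ∀ᶠ y in 𝓝[≠] p, u y ≠ 0 := by
  obtain ⟨ψ, h1, h2, h3⟩ := h.exists_numerator
  exact _root_.isBigO_root h1 (h.numerator_ne h2) h.n_pos h3 hu

/-- If `Y` inverts a root of `1 / (n λ)` up to order `n + 1`, then it determines the polar part. -/
theorem of_root (hQ : Q.coeff 0 = 0) {u Y : ℂ → ℂ}
    (hu : ∀ᶠ y in 𝓝[≠] p, u y ^ n * (n * lam y) = 1) (hY : AnalyticAt ℂ Y 0)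
    (hYu : (fun y => y - Y (u y)) =O[𝓝[≠] p] fun y => (y - p) ^ (n + 1)) :
    Y 0 = p ∧ deriv Y 0 ≠ 0 ∧ Q = logPoly Y n := by
  obtain ⟨ψ, h1, h2, h3⟩ := h.exists_numerator
  obtain ⟨h4, h5, h6⟩ := _root_.of_root (r := 0) h1 (h.numerator_ne h2) h.n_pos h3 hu hY hYu
  obtain ⟨v, hv⟩ := exists_isLocalInverse hY h5
  rw [h4] at hv
  refine ⟨h4, h5, eq_of_isBigO_eval (p := p) (by rw [hQ, logPoly_coeff_zero]) ?_⟩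
  have hR : R =O[𝓝[≠] p] fun _ => (1 : ℂ) :=
    (h.analytic.continuousAt.tendsto.mono_left nhdsWithin_le_nhds).isBigO_one ℂ
  have h7 := h6 v hv
  simp only [pow_zero] at h7
  refine ((h7.sub (hv.logPoly_isBigO h.n_pos)).sub hR).congr' ?_ .rfl
  filter_upwards [h.eq] with y hy
  rw [hy]
  ring

/-- Conversely, if the polar part is that of the germ `Y`, then the inverse of `Y` differs from a
root by the factor `1 + O ((y - p) ^ n)`. -/
theorem exists_root {Y : ℂ → ℂ} (hY : AnalyticAt ℂ Y 0) (hY' : deriv Y 0 ≠ 0) (hYp : Y 0 = p)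
    (hQ : Q = logPoly Y n) : ∃ v q : ℂ → ℂ, IsLocalInverse Y v p ∧ AnalyticAt ℂ q p ∧ q p = 0 ∧
      q =O[𝓝[≠] p] (fun y => (y - p) ^ n) ∧
      ∀ᶠ y in 𝓝[≠] p, (v y * Complex.exp (-q y)) ^ n * (n * lam y) = 1 := by
  obtain ⟨v, hv⟩ := exists_isLocalInverse hY hY'
  rw [hYp] at hv
  obtain ⟨ψ, h1, h2, h3⟩ := h.exists_numerator
  have hR : R =O[𝓝[≠] p] fun _ => (1 : ℂ) :=
    (h.analytic.continuousAt.tendsto.mono_left nhdsWithin_le_nhds).isBigO_one ℂ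
  have h4 : (fun y => lam y - (v y ^ n)⁻¹ / n) =O[𝓝[≠] p] fun y => (y - p) ^ 0 := by
    simp only [pow_zero]
    refine ((hv.logPoly_isBigO h.n_pos).add hR).congr' ?_ .rfl
    filter_upwards [h.eq] with y hy
    rw [hy, hQ]
    ring
  obtain ⟨q, h5, h6, h7⟩ := _root_.exists_root h1 h.n_pos h3 hv h4
  refine ⟨v, q, hv, h5, ?_, h6, h7⟩
  have h8 : Tendsto (fun y : ℂ => (y - p) ^ (n + 0)) (𝓝[≠] p) (𝓝 0) := by
    simpa [h.n_pos.ne'] using (tendsto_sub_nhdsWithin p).pow (n + 0)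
  exact tendsto_nhds_unique (h5.continuousAt.tendsto.mono_left nhdsWithin_le_nhds)
    (h6.trans_tendsto h8)

/-- A holomorphic root `u` of `1 / (n λ)`, with inverse `Z`, in the form `c (y - p) exp (- h)`. -/
theorem exists_uniformizer {c : ℂ} (hc : c ^ n * (n * Q.coeff n) = 1) :
    ∃ u Z h : ℂ → ℂ, AnalyticAt ℂ u p ∧ deriv u p = c ∧
      (∀ᶠ y in 𝓝[≠] p, u y ^ n * (n * lam y) = 1) ∧ IsLocalInverse Z u p ∧ AnalyticAt ℂ h p ∧
      h p = 0 ∧ (∀ᶠ y in 𝓝 p, u y = c * (y - p) * Complex.exp (-h y)) ∧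
      ∀ m, (fun y => (y - p) ^ n * (n * lam y) - n * Q.coeff n) =O[𝓝[≠] p] (fun y => (y - p) ^ m) →
        h =O[𝓝[≠] p] fun y => (y - p) ^ m := by
  obtain ⟨ψ, h1, h2, h3⟩ := h.exists_numerator
  have hψ0 := h.numerator_ne h2
  obtain ⟨u, Z, h4, -, h6, h7, h8, h9⟩ := _root_.exists_uniformizer h1 h.n_pos h3 (c := c)
    (by rw [h2]; exact hc)
  refine ⟨u, Z, fun y => Complex.log (ψ y / ψ p) / n, h4, h6, h7, h8, ?_, ?_, ?_, ?_⟩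
  · exact ((h1.div analyticAt_const hψ0).clog (by simp [div_self hψ0])).div analyticAt_const
      (Nat.cast_ne_zero.2 h.n_pos.ne')
  · simp [div_self hψ0]
  · exact h9.mono fun y hy => by rw [hy]; ring
  · intro m hm
    have h10 : (fun w => Complex.log w - Complex.log 1) =O[𝓝 1] fun w => w - 1 :=
      (differentiableAt_id.clog (by simp)).isBigO_sub
    have h11 : Tendsto (fun y => ψ y / ψ p) (𝓝[≠] p) (𝓝 1) := by
      have := (h1.continuousAt.tendsto.mono_left
        (nhdsWithin_le_nhds (s := {p}ᶜ))).div_const (ψ p)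
      rwa [div_self hψ0] at this
    have h12 : (fun y => ψ y / ψ p - 1) =O[𝓝[≠] p] fun y => (y - p) ^ m := by
      refine (hm.const_mul_left (ψ p)⁻¹).congr' ?_ .rfl
      filter_upwards [h3] with y hy
      rw [hy, ← h2]
      field_simp
    have h13 := h10.comp_tendsto h11
    simp only [Function.comp_def, Complex.log_one, sub_zero] at h13
    refine ((h13.trans h12).const_mul_left (n : ℂ)⁻¹).congr_left fun y => ?_
    simp [div_eq_inv_mul]

theorem exists_scale : ∃ c : ℂ, c ≠ 0 ∧ c ^ n * (n * Q.coeff n) = 1 := by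
  have hne : (n : ℂ) * Q.coeff n ≠ 0 :=
    mul_ne_zero (Nat.cast_ne_zero.2 h.n_pos.ne') h.coeff_ne
  obtain ⟨c, hc⟩ := IsAlgClosed.exists_pow_nat_eq ((n : ℂ) * Q.coeff n)⁻¹ h.n_pos
  refine ⟨c, ?_, by rw [hc, inv_mul_cancel₀ hne]⟩
  rintro rfl
  rw [zero_pow h.n_pos.ne'] at hc
  exact inv_ne_zero hne hc.symm

end HasPole

namespace HasPole

variable {lam R : ℂ → ℂ} {n : ℕ} {Q : ℂ[X]} (h : HasPole lam 0 n Q R)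
include h

/-- With one more order of agreement, a germ `Y = u exp (ℓ (u))` determines the constant term too.
-/
theorem of_root_sharp {u Y ℓ : ℂ → ℂ}
    (hu : ∀ᶠ y in 𝓝[≠] 0, u y ^ n * (n * lam y) = 1) (hY : AnalyticAt ℂ Y 0)
    (hℓ : AnalyticAt ℂ ℓ 0) (hYℓ : ∀ᶠ u in 𝓝 0, Y u = u * Complex.exp (ℓ u))
    (hYu : (fun y => y - Y (u y)) =O[𝓝[≠] 0] fun y => y ^ (n + 2)) :
    Q + C (R 0) = logPoly Y n + C (taylorCoeff n ℓ) := by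
  obtain ⟨ψ, h1, h2, h3⟩ := h.exists_numerator
  obtain ⟨h4, h5, h6⟩ := _root_.of_root (r := 1) h1 (h.numerator_ne h2) h.n_pos h3 hu hY
    (by simpa using hYu)
  obtain ⟨v, hv⟩ := exists_isLocalInverse hY h5
  rw [h4] at hv
  refine eq_of_isBigO_eval_sharp ?_
  have hR : (fun y => R y - R 0) =O[𝓝[≠] 0] fun y => y := by
    simpa using (h.analytic.differentiableAt.isBigO_sub).mono (nhdsWithin_le_nhds (s := {0}ᶜ))
  have h7 := h6 v hv
  simp only [sub_zero, pow_one] at h7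
  refine ((h7.sub (hv.logPoly_isBigO_sharp h.n_pos hℓ hYℓ)).sub hR).congr' ?_ .rfl
  filter_upwards [h.eq] with y hy
  rw [hy, sub_zero, eval_add, eval_C, eval_add, eval_C]
  ring

/-- If the germ gives the constant term as well, its inverse is one order closer to a root. -/
theorem exists_root_sharp {Y ℓ : ℂ → ℂ} (hY : AnalyticAt ℂ Y 0) (hY' : deriv Y 0 ≠ 0)
    (hℓ : AnalyticAt ℂ ℓ 0) (hYℓ : ∀ᶠ u in 𝓝 0, Y u = u * Complex.exp (ℓ u))
    (hQ : Q + C (R 0) = logPoly Y n + C (taylorCoeff n ℓ)) :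
    ∃ v q : ℂ → ℂ, IsLocalInverse Y v 0 ∧ AnalyticAt ℂ q 0 ∧ q 0 = 0 ∧
      q =O[𝓝[≠] 0] (fun y => y ^ (n + 1)) ∧
      ∀ᶠ y in 𝓝[≠] 0, (v y * Complex.exp (-q y)) ^ n * (n * lam y) = 1 := by
  have hY0 : Y 0 = 0 := by simpa using hYℓ.self_of_nhds
  obtain ⟨v, hv⟩ := exists_isLocalInverse hY hY'
  rw [hY0] at hv
  obtain ⟨ψ, h1, h2, h3⟩ := h.exists_numerator
  have hR : (fun y => R y - R 0) =O[𝓝[≠] 0] fun y => y := by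
    simpa using (h.analytic.differentiableAt.isBigO_sub).mono (nhdsWithin_le_nhds (s := {0}ᶜ))
  have h4 : (fun y => lam y - (v y ^ n)⁻¹ / n) =O[𝓝[≠] 0] fun y => (y - 0) ^ 1 := by
    simp only [sub_zero, pow_one]
    refine ((hv.logPoly_isBigO_sharp h.n_pos hℓ hYℓ).add hR).congr' ?_ .rfl
    filter_upwards [h.eq] with y hy
    have h5 := congrArg (eval y⁻¹) hQ
    rw [eval_add, eval_C, eval_add, eval_C] at h5
    rw [hy, sub_zero]
    linear_combination -h5
  obtain ⟨q, h5, h6, h7⟩ := _root_.exists_root h1 h.n_pos h3 hv h4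
  refine ⟨v, q, hv, h5, ?_, by simpa using h6, h7⟩
  have h8 : Tendsto (fun y : ℂ => (y - 0) ^ (n + 1)) (𝓝[≠] 0) (𝓝 0) := by
    simpa using (tendsto_sub_nhdsWithin 0).pow (n + 1)
  exact tendsto_nhds_unique (h5.continuousAt.tendsto.mono_left nhdsWithin_le_nhds)
    (h6.trans_tendsto h8)

end HasPole

/-! ### Flat coordinates at the poles of a rational or trigonometric superpotential -/

section Expansions

variable {lam R : ℂ → ℂ} {p : ℂ} {n : ℕ} {Q : ℂ[X]}

theorem isBigO_root_of_inverse {Y v q : ℂ → ℂ} (hv : IsLocalInverse Y v p) (hq : AnalyticAt ℂ q p)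
    {m : ℕ} (hqn : q =O[𝓝[≠] p] fun y => (y - p) ^ m) (hq0 : q p = 0) {F : ℂ → ℂ}
    (hF : AnalyticAt ℂ F 0) :
    (fun y => F (v y) - F (v y * Complex.exp (-q y))) =O[𝓝[≠] p] fun y => (y - p) ^ (m + 1) :=
  isBigO_comp_sub_comp_mul_exp hF (hv.tendsto.mono_left nhdsWithin_le_nhds)
    (hv.isBigO.mono nhdsWithin_le_nhds) hq hqn hq0

/-- The expansion of `z` at a finite pole of a rational superpotential exists. -/
theorem HasPole.exists_expansion (h : HasPole lam p n Q R) {Y : ℂ → ℂ} (hY : AnalyticAt ℂ Y 0)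
    (hY' : deriv Y 0 ≠ 0) (hYp : Y 0 = p) (hQ : Q = logPoly Y n) :
    ∃ u v : ℂ → ℂ, AnalyticAt ℂ u p ∧ (∀ᶠ y in 𝓝[≠] p, u y ^ n * (n * lam y) = 1) ∧
      IsLocalInverse Y v p ∧ ∀ F : ℂ → ℂ, AnalyticAt ℂ F 0 →
        (fun y => F (v y) - F (u y)) =O[𝓝[≠] p] fun y => (y - p) ^ (n + 1) := by
  obtain ⟨v, q, hv, hq, hq0, hqn, hroot⟩ := h.exists_root hY hY' hYp hQ
  exact ⟨fun y => v y * Complex.exp (-q y), v, hv.inv_analytic.mul hq.neg.cexp, hroot, hv,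
    fun F hF => isBigO_root_of_inverse hv hq hqn hq0 hF⟩

theorem IsLocalInverse.isBigO_sub_taylor {Z u : ℂ → ℂ} (hZ : IsLocalInverse Z u p) {F : ℂ → ℂ}
    (hF : AnalyticAt ℂ F 0) (m : ℕ) :
    (fun y => F (u y) - ∑ j : Fin m, taylorCoeff j F * u y ^ (j : ℕ)) =O[𝓝[≠] p]
      fun y => (y - p) ^ m := by
  have h1 := (_root_.isBigO_sub_taylor hF m).comp_tendsto
    (hZ.tendsto.mono_left (nhdsWithin_le_nhds (s := {p}ᶜ)))
  refine (h1.trans ((hZ.isBigO.mono nhdsWithin_le_nhds).pow m)).congr_left fun y => ?_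
  simp only [Function.comp]
  rw [Finset.sum_range]

end Expansions

end

section

open Polynomial Bornology

section Clauses

variable {lam R : ℂ → ℂ} {p : ℂ} {n : ℕ} {Q : ℂ[X]}

theorem HasPole.tendsto_root (h : HasPole lam p n Q R) {u : ℂ → ℂ}
    (hu : ∀ᶠ y in 𝓝[≠] p, u y ^ n * (n * lam y) = 1) : Tendsto u (𝓝[≠] p) (𝓝 0) :=
  (h.isBigO_root hu).1.trans_tendsto (tendsto_sub_nhdsWithin p)

theorem tendsto_sub_pow (p : ℂ) {m : ℕ} (hm : m ≠ 0) :
    Tendsto (fun y : ℂ => (y - p) ^ m) (𝓝[≠] p) (𝓝 0) := by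
  simpa [hm] using (tendsto_sub_nhdsWithin p).pow m

theorem tendsto_exp_neg {q : ℂ → ℂ} (hq : AnalyticAt ℂ q p) (hq0 : q p = 0) :
    Tendsto (fun y => Complex.exp (-q y)) (𝓝[≠] p) (𝓝 1) := by
  have h1 : ContinuousAt (fun y => Complex.exp (-q y)) p := hq.continuousAt.fun_neg.cexp
  have h2 := h1.tendsto.mono_left (nhdsWithin_le_nhds (s := {p}ᶜ))
  rwa [hq0, neg_zero, Complex.exp_zero] at h2

/-- An expansion of a coordinate `φ`, with `z = E φ`, in the local parameter `u` determines the
polar part of the superpotential. -/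
theorem HasPole.of_expansion (h : HasPole lam p n Q R) (hQ : Q.coeff 0 = 0) {E T φ u : ℂ → ℂ}
    (hE : ∀ x, AnalyticAt ℂ E x) (hT : AnalyticAt ℂ T 0)
    (hu : ∀ᶠ y in 𝓝[≠] p, u y ^ n * (n * lam y) = 1) (hEφ : ∀ᶠ y in 𝓝[≠] p, E (φ y) = y)
    (hO : (fun y => φ y - T (u y)) =O[𝓝[≠] p] fun y => (y - p) ^ (n + 1)) :
    E (T 0) = p ∧ deriv (fun u => E (T u)) 0 ≠ 0 ∧ Q = logPoly (fun u => E (T u)) n := by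
  refine h.of_root hQ hu ((hE _).comp hT) ?_
  refine (isBigO_comp_sub_comp (hE (T 0)) (hT.continuousAt.tendsto.comp (h.tendsto_root hu)) hO
    (tendsto_sub_pow p n.succ_ne_zero)).congr' ?_ .rfl
  filter_upwards [hEφ] with y hy
  rw [hy]
  rfl

theorem IsLocalInverse.isBigO_sub_coeff {Z u : ℂ → ℂ} (hZ : IsLocalInverse Z u p) {φ : ℂ → ℂ}
    (hφ : AnalyticAt ℂ φ p) (m : ℕ) :
    (fun y => φ y - ∑ j : Fin m, taylorCoeff j (fun x => φ (Z x)) * u y ^ (j : ℕ)) =O[𝓝[≠] p]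
      fun y => (y - p) ^ m := by
  have hφ' : AnalyticAt ℂ φ (Z 0) := by rwa [hZ.apply_zero]
  refine (hZ.isBigO_sub_taylor (F := fun x => φ (Z x)) (hφ'.comp hZ.analytic) m).congr' ?_
    .rfl
  filter_upwards [nhdsWithin_le_nhds hZ.right] with y hy
  rw [hy]

/-- The coefficients of the expansion of `φ` in powers of a root `u` of `1 / (n λ)`. -/
theorem HasPole.exists_coeff (h : HasPole lam p n Q R) {φ : ℂ → ℂ} (hφ : AnalyticAt ℂ φ p) :
    ∃ u : ℂ → ℂ, ∃ τ : ℕ → ℂ, AnalyticAt ℂ u p ∧ (∀ᶠ y in 𝓝[≠] p, u y ^ n * (n * lam y) = 1) ∧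
      ∀ m, (fun y => φ y - ∑ j : Fin m, τ j * u y ^ (j : ℕ)) =O[𝓝[≠] p] fun y => (y - p) ^ m := by
  obtain ⟨c, -, hc⟩ := h.exists_scale
  obtain ⟨u, Z, -, hu, -, hr, hZ, -⟩ := h.exists_uniformizer hc
  exact ⟨u, fun j => taylorCoeff j fun x => φ (Z x), hu, hr, hZ.isBigO_sub_coeff hφ⟩

/-- If `y = u E (g)` and `g` agrees with `T (u)` to order `m`, then `y` agrees with `u E (T (u))` to
order `m + 1`. -/
theorem HasPole.isBigO_sub_mul (h : HasPole lam 0 n Q R) {E T g u : ℂ → ℂ}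
    (hT : AnalyticAt ℂ T 0) (hE : AnalyticAt ℂ E (T 0))
    (hu : ∀ᶠ y in 𝓝[≠] 0, u y ^ n * (n * lam y) = 1) (hy : ∀ᶠ y in 𝓝[≠] 0, y = u y * E (g y))
    {m : ℕ} (hm : m ≠ 0) (hO : (fun y => g y - T (u y)) =O[𝓝[≠] 0] fun y => y ^ m) :
    (fun y => y - u y * E (T (u y))) =O[𝓝[≠] 0] fun y => y ^ (m + 1) := by
  have h1 := isBigO_comp_sub_comp hE (hT.continuousAt.tendsto.comp (h.tendsto_root hu)) hO
    (by simpa using tendsto_sub_pow 0 hm)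
  have h2 := (h.isBigO_root hu).1
  simp only [sub_zero] at h2
  refine (h2.mul h1).congr' ?_ (Eventually.of_forall fun y => by ring)
  filter_upwards [hy] with y hy
  conv_rhs => lhs; rw [hy]
  simp only [Function.comp]
  ring

end Clauses

theorem IsLocalInverse.tendsto_div {Y v : ℂ → ℂ} (h : IsLocalInverse Y v 0) :
    Tendsto (fun y => v y / y) (𝓝[≠] 0) (𝓝 (deriv Y 0)⁻¹) := by
  have h1 := hasDerivAt_iff_tendsto_slope.1 h.inv_analytic.differentiableAt.hasDerivAt
  rw [eq_inv_of_mul_eq_one_right h.deriv_mul_deriv] at h1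
  refine h1.congr fun y => ?_
  simp [slope_def_field, h.inv_apply]

/-! ### Expansions at infinity -/

theorem map_inv_nhdsWithin_zero : map Inv.inv (𝓝[≠] (0 : ℂ)) = cobounded ℂ := by
  rw [← inv_cobounded₀, ← Filter.map_inv, map_map, inv_involutive.comp_self, map_id]

section Infinity

variable {lam : ℂ → ℂ} {n : ℕ}

/-- At infinity a root `W` of `n λ` with `W ~ z` is the inverse of a root of `1 / (n λ)` in the
local coordinate `y = 1 / z`; `inv_of_root` is the converse. -/
theorem root_of_inv {W : ℂ → ℂ} (hW : Tendsto (fun y => W y / y⁻¹) (𝓝[≠] 0) (𝓝 1))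
    (h : ∀ᶠ y in 𝓝[≠] 0, W y ^ n = n * lam y⁻¹) :
    (∀ᶠ y in 𝓝[≠] 0, W y ≠ 0) ∧ ∀ᶠ y in 𝓝[≠] 0, (W y)⁻¹ ^ n * (n * lam y⁻¹) = 1 := by
  have h1 : ∀ᶠ y in 𝓝[≠] 0, W y ≠ 0 := by
    filter_upwards [hW.eventually_ne one_ne_zero] with y hy h0
    simp [h0] at hy
  refine ⟨h1, ?_⟩
  filter_upwards [h1, h] with y h1 h2
  rw [← h2, inv_pow, inv_mul_cancel₀ (pow_ne_zero _ h1)]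

theorem inv_of_root {u : ℂ → ℂ} (hu : Tendsto (fun y => u y / y) (𝓝[≠] 0) (𝓝 1))
    (h : ∀ᶠ y in 𝓝[≠] 0, u y ^ n * (n * lam y⁻¹) = 1) :
    (∀ᶠ y in 𝓝[≠] 0, (u y)⁻¹ ^ n = n * lam y⁻¹) ∧
      Tendsto (fun y => (u y)⁻¹ / y⁻¹) (𝓝[≠] 0) (𝓝 1) := by
  constructor
  · filter_upwards [h] with y hy
    rw [inv_pow]
    exact (eq_inv_of_mul_eq_one_right hy).symm
  · have := hu.inv₀ one_ne_zero
    rw [inv_one] at this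
    refine this.congr fun y => ?_
    rw [inv_div, inv_div_inv]

end Infinity

/-! ### Partial fractions -/

/-- `λ` is the sum of the polynomial `P` and of polynomials `Q i` in `(z - p i)⁻¹`. -/
structure IsPartialFraction {I : Type} [Fintype I] (lam : ℂ → ℂ) (p : I → ℂ) (n : Option I → ℕ)
    (P : ℂ[X]) (Q : I → ℂ[X]) : Prop where
  inj : Function.Injective p
  n_pos : ∀ i, 0 < n i
  natDegree_le : P.natDegree ≤ n none
  coeff_ne : P.coeff (n none) ≠ 0
  natDegree_le' : ∀ i, (Q i).natDegree ≤ n (some i)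
  coeff_ne' : ∀ i, (Q i).coeff (n (some i)) ≠ 0
  coeff_zero : ∀ i, (Q i).coeff 0 = 0
  eq : ∀ z, (∀ i, z ≠ p i) → lam z = P.eval z + ∑ i, (Q i).eval (z - p i)⁻¹

namespace IsPartialFraction

variable {I : Type} [Fintype I] [DecidableEq I] {lam : ℂ → ℂ} {p : I → ℂ} {n : Option I → ℕ}
  {P : ℂ[X]} {Q : I → ℂ[X]} (h : IsPartialFraction lam p n P Q)
include h

theorem hasPole (i : I) : HasPole lam (p i) (n (some i)) (Q i)
    fun z => P.eval z + ∑ j ∈ Finset.univ.erase i, (Q j).eval (z - p j)⁻¹ where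
  n_pos := h.n_pos _
  natDegree_le := h.natDegree_le' i
  coeff_ne := h.coeff_ne' i
  analytic := by
    refine (P.differentiable.analyticAt _).add (Finset.analyticAt_fun_sum _ fun j hj => ?_)
    have : p i - p j ≠ 0 := sub_ne_zero.2 (h.inj.ne (Finset.ne_of_mem_erase hj).symm)
    exact AnalyticAt.comp (g := fun w => (Q j).eval w) ((Q j).differentiable.analyticAt _)
      ((analyticAt_id.sub analyticAt_const).inv this)
  eq := by
    have h1 : ∀ j, ∀ᶠ z in 𝓝[≠] (p i), z ≠ p j := fun j => by
      by_cases hj : p i = p j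
      · rw [← hj]; exact self_mem_nhdsWithin
      · exact nhdsWithin_le_nhds (continuousAt_id.eventually_ne hj)
    filter_upwards [eventually_all.2 h1] with z hz
    rw [h.eq z hz, ← Finset.add_sum_erase _ _ (Finset.mem_univ i)]
    ring

/-- The expansion at infinity in the coordinate `y = 1 / z`; the remainder `R` vanishes there, which
allows `of_root_sharp` to recover the constant term of `P`. -/
theorem hasPole_infty : ∃ R : ℂ → ℂ, HasPole (fun y => lam y⁻¹) 0 (n none) P R ∧ R 0 = 0 := by
  have h0 : Tendsto (fun y : ℂ => y) (𝓝[≠] 0) (𝓝 0) := tendsto_id.mono_left nhdsWithin_le_nhds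
  refine ⟨fun y => ∑ i, (Q i).eval (y / (1 - p i * y)), ⟨h.n_pos _, h.natDegree_le, h.coeff_ne,
    Finset.analyticAt_fun_sum _ fun i _ => ?_, ?_⟩, ?_⟩
  · refine AnalyticAt.comp (g := fun w => (Q i).eval w) ((Q i).differentiable.analyticAt _)
      (analyticAt_id.div (analyticAt_const.sub (analyticAt_const.mul analyticAt_id)) ?_)
    simp
  · have h1 : ∀ i, ∀ᶠ y : ℂ in 𝓝[≠] 0, 1 - p i * y ≠ 0 := fun i =>
      nhdsWithin_le_nhds (ContinuousAt.eventually_ne (by fun_prop) (by simp))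
    filter_upwards [eventually_all.2 h1, self_mem_nhdsWithin] with y hy hy0
    have hy0 : y ≠ 0 := hy0
    have h2 : ∀ i, y⁻¹ - p i = (1 - p i * y) / y := fun i => by field_simp
    rw [h.eq]
    · simp only [h2, inv_div, sub_zero]
      ring
    · intro i h3
      have := h2 i
      rw [h3, sub_self, eq_comm, div_eq_zero_iff] at this
      exact this.elim (hy i) hy0
  · simp [← coeff_zero_eq_eval_zero, h.coeff_zero]

/-- The same with the constant term of the polynomial moved to the holomorphic part. -/
theorem hasPole_infty' :
    ∃ R : ℂ → ℂ, HasPole (fun y => lam y⁻¹) 0 (n none) (P - C (P.coeff 0)) R := by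
  obtain ⟨R, h1, -⟩ := h.hasPole_infty
  refine ⟨fun y => P.coeff 0 + R y, h1.n_pos, ?_, ?_, analyticAt_const.add h1.analytic, ?_⟩
  · exact natDegree_sub_C.trans_le h1.natDegree_le
  · rw [coeff_sub, coeff_C_of_ne_zero h1.n_pos.ne', sub_zero]
    exact h1.coeff_ne
  · filter_upwards [h1.eq] with y hy
    rw [hy, eval_sub, eval_C]
    ring

end IsPartialFraction

end

section

open Polynomial

/-! ### Families of germs and coefficients -/

section Families

variable {ι I : Type} [Fintype ι] [DecidableEq ι] [Fintype I] [DecidableEq I]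

/-- The polynomial in `u` whose coefficients are the flat coordinates that belong to the pole `i`.
-/
def flatSeries (pole : ι → Option I) (k : ι → ℕ) (i : Option I) (t : ι → ℂ) (u : ℂ) : ℂ :=
  ∑ γ, if pole γ = i then t γ * u ^ k γ else 0

variable {pole : ι → Option I} {k : ι → ℕ}

theorem analyticAt_flatSeries (i : Option I) (q : (ι → ℂ) × ℂ) :
    AnalyticAt ℂ (fun q : (ι → ℂ) × ℂ => flatSeries pole k i q.1 q.2) q := by
  refine Finset.analyticAt_fun_sum _ fun γ _ => ?_
  split_ifs
  · exact (((ContinuousLinearMap.proj (R := ℂ) (φ := fun _ : ι => ℂ) γ).analyticAt q.1).comp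
      (f := fun q : (ι → ℂ) × ℂ => q.1) analyticAt_fst).mul (analyticAt_snd.pow _)
  · exact analyticAt_const

theorem analyticAt_germ {F : (ι → ℂ) → ℂ → ℂ} {t : ι → ℂ} {u : ℂ}
    (hF : AnalyticAt ℂ (fun q : (ι → ℂ) × ℂ => F q.1 q.2) (t, u)) : AnalyticAt ℂ (F t) u :=
  AnalyticAt.comp (g := fun q : (ι → ℂ) × ℂ => F q.1 q.2) (f := fun u => (t, u)) hF
    (analyticAt_const.prod analyticAt_id)

theorem fderiv_comp_flatSeries {E : ℂ → ℂ} (i : Option I) (t : ι → ℂ) (u : ℂ) {d : ℂ}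
    (hE : HasDerivAt E d (flatSeries pole k i t u)) (γ : ι) :
    fderiv ℂ (fun t => E (flatSeries pole k i t u)) t (Pi.single γ 1) =
      if pole γ = i then u ^ k γ * d else 0 := by
  have h1 : HasFDerivAt (fun t : ι → ℂ => flatSeries pole k i t u)
      (∑ γ, if pole γ = i then
        u ^ k γ • ContinuousLinearMap.proj (R := ℂ) (φ := fun _ : ι => ℂ) γ else 0) t := by
    refine HasFDerivAt.fun_sum fun γ _ => ?_
    split_ifs
    · exact (hasFDerivAt_apply γ t).mul_const _
    · exact hasFDerivAt_const _ _
  have h2 := hE.comp_hasFDerivAt t h1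
  have h3 : fderiv ℂ (fun t => E (flatSeries pole k i t u)) t = _ := h2.fderiv
  rw [h3, _root_.smul_apply, _root_.sum_apply,
    Finset.sum_eq_single γ, smul_eq_mul]
  · split_ifs
    · simp [mul_comm]
    · simp
  · intro δ _ hδ
    split_ifs
    · simp [hδ]
    · rfl
  · simp

theorem analyticAt_logPoly_coeff {F : (ι → ℂ) → ℂ → ℂ} {t : ι → ℂ}
    (hF : AnalyticAt ℂ (fun q : (ι → ℂ) × ℂ => F q.1 q.2) (t, 0)) (n j : ℕ) :
    AnalyticAt ℂ (fun t => (logPoly (F t) n).coeff j) t := by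
  rcases le_or_gt j n with hj | hj
  · simp only [logPoly_coeff _ hj]
    have h0 : AnalyticAt ℂ (fun q : (ι → ℂ) × ℂ => F q.1 0) (t, 0) :=
      AnalyticAt.comp (g := fun q : (ι → ℂ) × ℂ => F q.1 q.2)
        (f := fun q : (ι → ℂ) × ℂ => (q.1, (0 : ℂ))) hF (analyticAt_fst.prod analyticAt_const)
    exact (analyticAt_taylorCoeff_and_fderiv (F := fun t u => (F t u - F t 0) ^ j)
      ((hF.sub h0).pow j) n).1.mul analyticAt_const
  · have h1 : ∀ t, (logPoly (F t) n).coeff j = 0 := fun t =>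
      coeff_eq_zero_of_natDegree_lt ((logPoly_natDegree_le _ _).trans_lt hj)
    simp only [h1]
    exact analyticAt_const

theorem eventually_injective {X : Type*} [TopologicalSpace X] {f : X → I → ℂ} {x : X}
    (hf : ∀ i, ContinuousAt (fun x => f x i) x) (h : Function.Injective (f x)) :
    ∀ᶠ x in 𝓝 x, Function.Injective (f x) := by
  have h1 : ∀ᶠ x in 𝓝 x, ∀ i j, i ≠ j → f x i - f x j ≠ 0 := by
    simp only [eventually_all]
    exact fun i j hij => ((hf i).sub (hf j)).eventually_ne (sub_ne_zero.2 (h.ne hij))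
  exact h1.mono fun x hx i j hij => by_contra fun hne => hx i j hne (sub_eq_zero.2 hij)

/-- The parameters for which the poles are distinct and of the right order. -/
def germDomain (Y : (ι → ℂ) → Option I → ℂ → ℂ) : Set (ι → ℂ) :=
  {t | (Function.Injective fun i : I => Y t (some i) 0) ∧ ∀ i, deriv (Y t i) 0 ≠ 0}

theorem isOpen_germDomain {Y : (ι → ℂ) → Option I → ℂ → ℂ}
    (hY : ∀ t i, AnalyticAt ℂ (fun q : (ι → ℂ) × ℂ => Y q.1 i q.2) (t, 0)) :
    IsOpen (germDomain Y) := by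
  refine isOpen_iff_eventually.2 fun t ht => ?_
  have h1 : ∀ i, ContinuousAt (fun t => Y t i 0) t := fun i =>
    (AnalyticAt.comp (g := fun q : (ι → ℂ) × ℂ => Y q.1 i q.2) (f := fun t => (t, (0 : ℂ)))
      (hY t i) (analyticAt_id.prod analyticAt_const)).continuousAt
  have h2 : ∀ i, ContinuousAt (fun t => deriv (Y t i) 0) t := fun i => by
    have := (analyticAt_taylorCoeff_and_fderiv (F := fun t => Y t i) (hY t i) 1).1.continuousAt
    simpa [taylorCoeff] using this
  exact (eventually_injective (fun i => h1 (some i)) ht.1).and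
    (eventually_all.2 fun i => (h2 i).eventually_ne (ht.2 i))

end Families

section Polynomials

/-- The polynomial `∑ α_j X ^ (j + 1)`. -/
def tailPoly {n : ℕ} (α : Fin n → ℂ) : ℂ[X] := ∑ j : Fin n, C (α j) * X ^ ((j : ℕ) + 1)

/-- The polynomial `X ^ n / n + ∑ α_j X ^ j`. -/
def headPoly (n : ℕ) {r : ℕ} (α : Fin r → ℂ) : ℂ[X] :=
  C (n : ℂ)⁻¹ * X ^ n + ∑ j : Fin r, C (α j) * X ^ (j : ℕ)

theorem sum_fin_coeff {r : ℕ} (α : Fin r → ℂ) (s m : ℕ) :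
    (∑ j : Fin r, C (α j) * X ^ ((j : ℕ) + s)).coeff (m + s) =
      if h : m < r then α ⟨m, h⟩ else 0 := by
  simp only [finsetSum_coeff, coeff_C_mul, coeff_X_pow, add_left_inj, mul_ite, mul_one, mul_zero]
  split_ifs with h
  · rw [Finset.sum_eq_single ⟨m, h⟩]
    · simp
    · intro j _ hj
      rw [if_neg fun h => hj (Fin.ext h.symm)]
    · simp
  · exact Finset.sum_eq_zero fun j _ => if_neg (by have := j.2; omega)

theorem tailPoly_coeff_zero {n : ℕ} (α : Fin n → ℂ) : (tailPoly α).coeff 0 = 0 := by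
  simp [tailPoly]

theorem tailPoly_coeff_succ {n : ℕ} (α : Fin n → ℂ) (m : ℕ) :
    (tailPoly α).coeff (m + 1) = if h : m < n then α ⟨m, h⟩ else 0 :=
  sum_fin_coeff α 1 m

theorem tailPoly_coeff_last {n : ℕ} (hn : 0 < n) (α : Fin (n + 1) → ℂ) :
    (tailPoly fun j : Fin n => α j.succ).coeff n = α (Fin.last n) := by
  obtain ⟨r, rfl⟩ : ∃ r, n = r + 1 := ⟨n - 1, by omega⟩
  rw [tailPoly_coeff_succ, dif_pos r.lt_succ_self]
  rfl

theorem tailPoly_natDegree_le {n : ℕ} (α : Fin n → ℂ) : (tailPoly α).natDegree ≤ n := by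
  refine natDegree_sum_le_of_forall_le _ _ fun j _ => ?_
  exact (natDegree_C_mul_X_pow_le _ _).trans j.2

theorem eq_tailPoly {n : ℕ} {P : ℂ[X]} (h0 : P.coeff 0 = 0) (hn : P.natDegree ≤ n) :
    (tailPoly fun j : Fin n => P.coeff ((j : ℕ) + 1)) = P := by
  ext m
  rcases m with _ | m
  · rw [tailPoly_coeff_zero, h0]
  · rw [tailPoly_coeff_succ]
    split_ifs with h
    · rfl
    · rw [coeff_eq_zero_of_natDegree_lt (by omega)]

theorem tailPoly_eval_inv {n : ℕ} (α : Fin n → ℂ) (w : ℂ) :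
    (tailPoly α).eval w⁻¹ = ∑ j : Fin n, α j / w ^ ((j : ℕ) + 1) := by
  simp [tailPoly, eval_finsetSum, div_eq_mul_inv]

theorem headPoly_eval (n : ℕ) {r : ℕ} (α : Fin r → ℂ) (z : ℂ) :
    (headPoly n α).eval z = z ^ n / n + ∑ j : Fin r, α j * z ^ (j : ℕ) := by
  simp [headPoly, eval_finsetSum, inv_mul_eq_div]

theorem headPoly_coeff (n : ℕ) {r : ℕ} (α : Fin r → ℂ) (m : ℕ) :
    (headPoly n α).coeff m = (if m = n then (n : ℂ)⁻¹ else 0) +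
      if h : m < r then α ⟨m, h⟩ else 0 := by
  rw [headPoly, coeff_add, coeff_C_mul, coeff_X_pow, ← sum_fin_coeff α 0 m]
  simp

theorem headPoly_natDegree_le {n r : ℕ} (hr : r ≤ n) (α : Fin r → ℂ) :
    (headPoly n α).natDegree ≤ n :=
  natDegree_le_iff_coeff_eq_zero.2 fun m hm => by
    rw [headPoly_coeff, if_neg (by omega), dif_neg (by omega), add_zero]

theorem eq_headPoly {n r : ℕ} (hr : r ≤ n) {P : ℂ[X]} (hP : P.natDegree ≤ n)
    (hn : P.coeff n = (n : ℂ)⁻¹) (h : ∀ m, r ≤ m → m < n → P.coeff m = 0) :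
    (headPoly n fun j : Fin r => P.coeff (j : ℕ)) = P := by
  ext m
  rw [headPoly_coeff]
  rcases lt_trichotomy m n with h1 | rfl | h1
  · rw [if_neg h1.ne, zero_add]
    split_ifs with h2
    · rfl
    · rw [h m (not_lt.1 h2) h1]
  · rw [if_pos rfl, dif_neg (by omega), hn, add_zero]
  · rw [if_neg h1.ne', dif_neg (by omega), coeff_eq_zero_of_natDegree_lt (by omega), add_zero]

theorem logPoly_coeff_self {Y : ℂ → ℂ} (hY : AnalyticAt ℂ Y 0) (n : ℕ) :
    (logPoly Y n).coeff n = deriv Y 0 ^ n / n := by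
  rw [logPoly_coeff Y le_rfl, taylorCoeff_sub_pow hY]

theorem tailPoly_logPoly (Y : ℂ → ℂ) (n : ℕ) :
    (tailPoly fun j : Fin n => (logPoly Y n).coeff ((j : ℕ) + 1)) = logPoly Y n :=
  eq_tailPoly (logPoly_coeff_zero _ _) (logPoly_natDegree_le _ _)

end Polynomials

end

section

open Polynomial

/-! ### Rational superpotentials in flat coordinates -/

namespace CKP

variable {n₀ m : ℕ} {n : Fin m → ℕ}

/-- The pole to which a flat coordinate belongs. -/
def pole : CKPIdx n₀ n → Option (Fin m)
  | Sum.inl _ => none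
  | Sum.inr x => some x.1

/-- The power of the local parameter at which a flat coordinate appears. -/
def expo : CKPIdx n₀ n → ℕ
  | Sum.inl j => j + 1
  | Sum.inr x => x.2

/-- The order of a pole of the superpotential. -/
def order (n₀ : ℕ) {m : ℕ} (n : Fin m → ℕ) : Option (Fin m) → ℕ
  | none => n₀
  | some i => n i

/-- The expansions of `z` at the finite poles and of `1 / z` at infinity in the local parameter. -/
def germ (t : CKPIdx n₀ n → ℂ) : Option (Fin m) → ℂ → ℂ
  | none, u => u * (1 - u * flatSeries pole expo none t u)⁻¹
  | some i, u => flatSeries pole expo (some i) t u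

/-- The logarithm of the ratio of the germ at infinity and the local parameter. -/
def logGerm (t : CKPIdx n₀ n → ℂ) (u : ℂ) : ℂ :=
  -Complex.log (1 - u * flatSeries pole expo none t u)

/-- The constant term of the superpotential. -/
def const (t : CKPIdx n₀ n → ℂ) : ℂ := taylorCoeff n₀ (logGerm t)

/-- The superpotential, in the coordinates given by the coefficients, with given flat coordinates.
-/
def coeffs (t : CKPIdx n₀ n → ℂ) : CKPIdx n₀ n → ℂ
  | Sum.inl j => (logPoly (germ t none) n₀ + C (const t)).coeff j
  | Sum.inr ⟨i, j⟩ => Fin.cases (germ t (some i) 0)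
      (fun j => (logPoly (germ t (some i)) (n i)).coeff ((j : ℕ) + 1)) j

theorem flatSeries_none (t : CKPIdx n₀ n → ℂ) (u : ℂ) :
    flatSeries pole expo none t u = ∑ j : Fin (n₀ - 1), t (Sum.inl j) * u ^ ((j : ℕ) + 1) := by
  simp [flatSeries, Fintype.sum_sum_type, pole, expo]

theorem flatSeries_some (t : CKPIdx n₀ n → ℂ) (i : Fin m) (u : ℂ) :
    flatSeries pole expo (some i) t u = ∑ j : Fin (n i + 1), t (Sum.inr ⟨i, j⟩) * u ^ (j : ℕ) := by
  simp only [flatSeries, Fintype.sum_sum_type, pole, expo, Fintype.sum_sigma, reduceCtorEq,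
    if_false, Finset.sum_const_zero, zero_add, Option.some.injEq]
  rw [Finset.sum_eq_single i]
  · simp
  · intro j _ hj
    simp [hj]
  · simp

theorem isFlatIndex (hn₀ : 0 < n₀) : IsFlatIndex (pole (n₀ := n₀) (n := n)) expo (order n₀ n) where
  infty := by
    rintro (j | ⟨i, j⟩) h
    · have := j.2
      simp only [expo, order]
      omega
    · cases h
  inj := by
    rintro (j | ⟨i, j⟩) (j' | ⟨i', j'⟩) h1 h2
    · simp only [expo] at h2
      congr 1
      ext
      omega
    · cases h1
    · cases h1
    · simp only [pole, Option.some.injEq] at h1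
      subst h1
      simp only [expo] at h2
      rw [Fin.ext h2]
  dual := by
    rintro (j | ⟨i, j⟩)
    · refine ⟨Sum.inl j.rev, rfl, ?_⟩
      simp only [expo, order, pole, Fin.val_rev]
      omega
    · refine ⟨Sum.inr ⟨i, j.rev⟩, rfl, ?_⟩
      simp only [expo, order, pole, Fin.val_rev]
      omega
  card := by
    simp [order]
    ring

theorem analyticAt_germ (t : CKPIdx n₀ n → ℂ) (i : Option (Fin m)) :
    AnalyticAt ℂ (fun q : (CKPIdx n₀ n → ℂ) × ℂ => germ q.1 i q.2) (t, 0) := by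
  rcases i with _ | i
  · exact analyticAt_snd.mul ((analyticAt_const.sub (analyticAt_snd.mul
      (analyticAt_flatSeries none _))).inv (by simp))
  · exact analyticAt_flatSeries (some i) _

theorem analyticAt_logGerm (t : CKPIdx n₀ n → ℂ) :
    AnalyticAt ℂ (fun q : (CKPIdx n₀ n → ℂ) × ℂ => logGerm q.1 q.2) (t, 0) :=
  ((analyticAt_const.sub (analyticAt_snd.mul (analyticAt_flatSeries none _))).clog (by simp)).neg

theorem analyticAt_denominator (t : CKPIdx n₀ n → ℂ) (u : ℂ) :
    AnalyticAt ℂ (fun u => 1 - u * flatSeries pole expo none t u) u :=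
  analyticAt_const.sub (analyticAt_id.mul
    (_root_.analyticAt_germ (F := flatSeries pole expo none) (analyticAt_flatSeries none (t, u))))

theorem eventually_denominator_ne (t : CKPIdx n₀ n → ℂ) :
    ∀ᶠ u in 𝓝 0, 1 - u * flatSeries pole expo none t u ≠ 0 :=
  (analyticAt_denominator t 0).continuousAt.eventually_ne (by simp)

theorem germ_none_eq (t : CKPIdx n₀ n → ℂ) :
    ∀ᶠ u in 𝓝 0, germ t none u = u * Complex.exp (logGerm t u) := by
  filter_upwards [eventually_denominator_ne t] with u hu
  rw [germ, logGerm, Complex.exp_neg, Complex.exp_log hu]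

theorem deriv_germ_none (t : CKPIdx n₀ n → ℂ) : deriv (germ t none) 0 = 1 := by
  have h1 : HasDerivAt (fun u : ℂ => u) 1 0 := hasDerivAt_id 0
  have h2 := h1.mul ((analyticAt_denominator t 0).inv (by simp)).differentiableAt.hasDerivAt
  have h3 : deriv (germ t none) 0 = _ := h2.deriv
  simp [h3]

theorem deriv_denominator (t : CKPIdx n₀ n → ℂ) :
    deriv (fun u => 1 - u * flatSeries pole expo none t u) 0 = 0 := by
  have h1 : HasDerivAt (fun u : ℂ => u) 1 0 := hasDerivAt_id 0
  have h2 := (h1.mul (_root_.analyticAt_germ (F := flatSeries pole expo none)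
    (analyticAt_flatSeries none (t, 0))).differentiableAt.hasDerivAt).const_sub 1
  have h3 : deriv (fun u => 1 - u * flatSeries pole expo none t u) 0 = _ := h2.deriv
  rw [h3, flatSeries_none]
  simp

/-- For `ρ = 1` a flat coordinate shifts `z`, that is, `Y` at a finite pole and `1 / Y` at infinity.
-/
theorem germ_deriv (t : CKPIdx n₀ n → ℂ) (i : Option (Fin m)) (γ : CKPIdx n₀ n) :
    ∀ᶠ u in 𝓝 0, fderiv ℂ (fun t => germ t i u) t (Pi.single γ 1) =
      if pole γ = i then u ^ expo γ * germSpeed 1 0 i (germ t i u) else 0 := by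
  rcases i with _ | i
  · filter_upwards [eventually_denominator_ne t] with u hu
    have h1 := ((((hasDerivAt_id (flatSeries pole expo none t u)).const_mul u).const_sub 1).fun_inv
      hu).const_mul u
    refine (fderiv_comp_flatSeries none t u h1 γ).trans ?_
    simp only [germSpeed, germ, id]
    congr 1
    field_simp
    ring
  · refine Eventually.of_forall fun u => ?_
    refine (fderiv_comp_flatSeries (some i) t u (hasDerivAt_id _) γ).trans ?_
    simp [germSpeed]

theorem const_deriv (t : CKPIdx n₀ n → ℂ) (γ : CKPIdx n₀ n) :
    fderiv ℂ const t (Pi.single γ 1) = if pole γ = none then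
      1 * taylorCoeff (order n₀ n none) (fun u => u ^ expo γ * germ t none u)
    else 0 * (if expo γ = order n₀ n (pole γ) then 1 else 0) := by
  have h1 : fderiv ℂ const t (Pi.single γ 1) = _ :=
    (analyticAt_taylorCoeff_and_fderiv (analyticAt_logGerm t) n₀).2 (Pi.single γ 1)
  have h2 : ∀ᶠ u in 𝓝 0, fderiv ℂ (fun t => logGerm t u) t (Pi.single γ 1) =
      if pole γ = none then u ^ expo γ * germ t none u else 0 := by
    have h3 : ∀ᶠ u in 𝓝 0, 1 - u * flatSeries pole expo none t u ∈ Complex.slitPlane :=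
      (analyticAt_denominator t 0).continuousAt.eventually_mem
        (Complex.isOpen_slitPlane.mem_nhds (by simp))
    filter_upwards [h3, eventually_denominator_ne t] with u hu hu0
    have h4 := ((((hasDerivAt_id (flatSeries pole expo none t u)).const_mul u).const_sub 1).clog
      hu).neg
    refine (fderiv_comp_flatSeries none t u h4 γ).trans ?_
    simp only [germ, id]
    congr 1
    field_simp
  rw [h1, taylorCoeff_congr h2, zero_mul, one_mul]
  split_ifs
  · rfl
  · exact taylorCoeff_fun_zero _

theorem const_eq_zero (t : CKPIdx 1 n → ℂ) : const t = 0 := by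
  have h1 : logGerm t = fun _ => 0 := by
    funext u
    simp [logGerm, flatSeries_none]
  rw [const, h1, taylorCoeff_fun_zero]

/-- The polynomial part of a superpotential. -/
def poly (a : CKPIdx n₀ n → ℂ) : ℂ[X] := headPoly n₀ fun j => a (Sum.inl j)

/-- The principal part of a superpotential at a finite pole. -/
def polar (a : CKPIdx n₀ n → ℂ) (i : Fin m) : ℂ[X] :=
  tailPoly fun j : Fin (n i) => a (Sum.inr ⟨i, j.succ⟩)

theorem polar_coeffs (t : CKPIdx n₀ n → ℂ) (i : Fin m) :
    polar (coeffs t) i = logPoly (germ t (some i)) (n i) :=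
  tailPoly_logPoly _ _

theorem poly_coeffs (hn₀ : 0 < n₀) (t : CKPIdx n₀ n → ℂ) :
    poly (coeffs t) = logPoly (germ t none) n₀ + C (const t) := by
  have hg := _root_.analyticAt_germ (F := fun t => germ t none) (analyticAt_germ t none)
  refine eq_headPoly (P := logPoly (germ t none) n₀ + C (const t)) (Nat.sub_le _ _) ?_ ?_ ?_
  · exact natDegree_add_C.trans_le (logPoly_natDegree_le _ _)
  · rw [coeff_add, coeff_C_of_ne_zero hn₀.ne', logPoly_coeff_self hg, deriv_germ_none, one_pow]
    simp
  · intro j h1 h2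
    obtain rfl : j = n₀ - 1 := by omega
    rcases eq_or_ne n₀ 1 with rfl | hn1
    · simp [logPoly_coeff_zero, const_eq_zero]
    -- the coefficient of `z ^ (n₀ - 1)` is the linear coefficient of a power of `1 / S`,
    -- where `S` has no linear term
    rw [coeff_add, coeff_C_of_ne_zero (by omega), logPoly_coeff _ (Nat.sub_le _ _)]
    have h3 : (fun u => (germ t none u - germ t none 0) ^ (n₀ - 1)) = fun u =>
        u ^ (n₀ - 1) * (1 - u * flatSeries pole expo none t u)⁻¹ ^ (n₀ - 1) := by
      funext u
      simp [germ, mul_pow]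
    have h4 := (analyticAt_denominator t 0).fun_inv (by simp)
    rw [h3, taylorCoeff_pow_mul (h4.fun_pow _), if_pos (Nat.sub_le _ _), Nat.sub_sub_self hn₀]
    have h5 : HasDerivAt (fun u => (1 - u * flatSeries pole expo none t u)⁻¹ ^ (n₀ - 1)) 0 0 := by
      have h6 := (analyticAt_denominator t 0).differentiableAt.hasDerivAt
      rw [deriv_denominator] at h6
      simpa using (h6.fun_inv (by simp)).fun_pow (n₀ - 1)
    rw [taylorCoeff, iteratedDeriv_one, h5.deriv]
    simp

theorem isPartialFraction (hn₀ : 0 < n₀) (hn : ∀ i, 0 < n i) {a : CKPIdx n₀ n → ℂ}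
    (ha : a ∈ (cKP n₀ n).carrier) : IsPartialFraction (cKPLam n₀ n a)
      (fun i => a (Sum.inr ⟨i, 0⟩)) (order n₀ n) (poly a) (polar a) where
  inj := ha.1
  n_pos := by rintro (_ | i); exacts [hn₀, hn i]
  natDegree_le := headPoly_natDegree_le (Nat.sub_le _ _) _
  coeff_ne := by
    rw [poly, headPoly_coeff, order, if_pos rfl, dif_neg (by omega), add_zero]
    exact inv_ne_zero (Nat.cast_ne_zero.2 hn₀.ne')
  natDegree_le' i := tailPoly_natDegree_le _
  coeff_ne' i := (tailPoly_coeff_last (hn i) fun j => a (Sum.inr ⟨i, j⟩)).trans_ne (ha.2 i)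
  coeff_zero i := tailPoly_coeff_zero _
  eq z _ := by
    simp [poly, polar, headPoly_eval, tailPoly_eval_inv, cKPLam]

theorem coeffs_eq {a t : CKPIdx n₀ n → ℂ} (h1 : poly a = logPoly (germ t none) n₀ + C (const t))
    (h2 : ∀ i, germ t (some i) 0 = a (Sum.inr ⟨i, 0⟩))
    (h3 : ∀ i, polar a i = logPoly (germ t (some i)) (n i)) : coeffs t = a := by
  funext κ
  rcases κ with j | ⟨i, j⟩
  · have hj := j.2
    rw [coeffs, ← h1, poly, headPoly_coeff, if_neg (by omega), dif_pos hj, zero_add]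
  · refine Fin.cases ?_ (fun j => ?_) j
    · exact h2 i
    · rw [coeffs, Fin.cases_succ, ← h3, polar, tailPoly_coeff_succ, dif_pos j.2]

end CKP

end

section

open Polynomial Bornology Asymptotics

namespace CKP

variable {n₀ m : ℕ} {n : Fin m → ℕ}

/-! ### Flat coordinates determine the rational superpotential -/
theorem isBigO_infty_iff {N : ℕ} {T u : ℂ → ℂ} (h1 : u =O[𝓝[≠] 0] fun y : ℂ => y)
    (h2 : (fun y : ℂ => y) =O[𝓝[≠] 0] u) (h3 : ∀ᶠ y in 𝓝[≠] 0, u y ≠ 0) :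
    (fun y => y⁻¹ - ((u y)⁻¹ - T (u y))) =O[𝓝[≠] 0] (fun y : ℂ => y ^ N) ↔
      (fun y => u y * y⁻¹ - (1 - u y * T (u y))) =O[𝓝[≠] 0] fun y : ℂ => y ^ (N + 1) := by
  constructor <;> intro h
  · refine (h1.mul h).congr' ?_ (Eventually.of_forall fun y => (pow_succ' y N).symm)
    filter_upwards [h3] with y hy
    field_simp
  · have h4 := h2.inv_rev (by filter_upwards [self_mem_nhdsWithin] with y hy h0; exact absurd h0 hy)
    refine (h4.mul h).congr' ?_ ?_
    · filter_upwards [h3] with y hy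
      field_simp
    · filter_upwards [self_mem_nhdsWithin] with y hy
      have hy : y ≠ 0 := hy
      rw [pow_succ']
      field_simp

/-- The expansion at infinity in terms of the local coordinate `y = 1 / z`. -/
theorem infty_expansion_iff {lam R : ℂ → ℂ} {Q : ℂ[X]}
    (h : HasPole (fun y => lam y⁻¹) 0 n₀ Q R) (t : CKPIdx n₀ n → ℂ) :
    (∃ w : ℂ → ℂ, (∀ᶠ z in cobounded ℂ, w z ^ n₀ = n₀ * lam z) ∧
      Tendsto (fun z => w z / z) (cobounded ℂ) (𝓝 1) ∧
      (fun z => z - (w z - ∑ j : Fin (n₀ - 1), t (Sum.inl j) / w z ^ ((j : ℕ) + 1)))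
        =O[cobounded ℂ] fun z => (z ^ n₀)⁻¹) ↔
    ∃ u : ℂ → ℂ, (∀ᶠ y in 𝓝[≠] 0, u y ^ n₀ * (n₀ * lam y⁻¹) = 1) ∧
      Tendsto (fun y => u y / y) (𝓝[≠] 0) (𝓝 1) ∧
      (fun y => u y * y⁻¹ - (1 - u y * flatSeries pole expo none t (u y))) =O[𝓝[≠] 0]
        fun y => y ^ (n₀ + 1) := by
  simp only [← map_inv_nhdsWithin_zero, eventually_map, tendsto_map'_iff,
    isBigO_map, Function.comp_def, inv_pow, inv_inv]
  constructor
  · rintro ⟨w, h1, h2, h3⟩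
    obtain ⟨h4, h5⟩ := root_of_inv h2 h1
    obtain ⟨h6, h7, h8⟩ := h.isBigO_root h5
    simp only [sub_zero] at h6 h7
    refine ⟨fun y => (w y⁻¹)⁻¹, h5, ?_, (isBigO_infty_iff h6 h7 h8).1 ?_⟩
    · have := h2.inv₀ one_ne_zero
      rw [inv_one] at this
      exact this.congr fun y => by rw [inv_div, div_eq_mul_inv, div_eq_mul_inv, mul_comm]
    · simpa [flatSeries_none, div_eq_mul_inv] using h3
  · rintro ⟨u, h1, h2, h3⟩
    obtain ⟨h4, h5⟩ := inv_of_root h2 h1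
    obtain ⟨h6, h7, h8⟩ := h.isBigO_root h1
    simp only [sub_zero] at h6 h7
    refine ⟨fun z => (u z⁻¹)⁻¹, by simpa using h4, by simpa using h5, ?_⟩
    simpa [flatSeries_none, div_eq_mul_inv] using (isBigO_infty_iff h6 h7 h8).2 h3

theorem analyticAt_germ' (t : CKPIdx n₀ n → ℂ) (i : Option (Fin m)) :
    AnalyticAt ℂ (germ t i) 0 :=
  _root_.analyticAt_germ (F := fun t => germ t i) (analyticAt_germ t i)

/-- The superpotential is recovered from its flat coordinates: at a finite pole these are the
expansion of `z` to the order that fixes the polar part, and at infinity the absence of a constant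
term in `z - w₀` gives one more order, which fixes the constant term of the polynomial. -/
theorem of_isFlatCoord (hn₀ : 0 < n₀) (hn : ∀ i, 0 < n i) {a : CKPIdx n₀ n → ℂ}
    (ha : a ∈ (cKP n₀ n).carrier) {t : CKPIdx n₀ n → ℂ} (ht : cKPIsFlatCoord n₀ n a t) :
    t ∈ germDomain germ ∧ coeffs t = a := by
  have hpf := isPartialFraction hn₀ hn ha
  have h1 : ∀ i, germ t (some i) 0 = a (Sum.inr ⟨i, 0⟩) ∧ deriv (germ t (some i)) 0 ≠ 0 ∧
      polar a i = logPoly (germ t (some i)) (n i) := fun i => by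
    obtain ⟨u, -, hr, hO⟩ := ht.2 i
    refine (hpf.hasPole i).of_expansion (tailPoly_coeff_zero _) (E := fun x => x)
      (T := germ t (some i)) (φ := fun x => x) (fun _ => analyticAt_id) (analyticAt_germ' t _) hr
      (Eventually.of_forall fun _ => rfl) ?_
    simp only [germ, flatSeries_some]
    exact hO
  refine ⟨⟨?_, ?_⟩, coeffs_eq ?_ (fun i => (h1 i).1) fun i => (h1 i).2.2⟩
  · simpa only [h1] using ha.1
  · rintro (_ | i)
    · simp [deriv_germ_none]
    · exact (h1 i).2.1
  · obtain ⟨R, hR, hR0⟩ : ∃ R, HasPole (fun y => cKPLam n₀ n a y⁻¹) 0 n₀ (poly a) R ∧ R 0 = 0 :=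
    hpf.hasPole_infty
    obtain ⟨u, hr, -, hO⟩ := (infty_expansion_iff hR t).1 ht.1
    have h2 := (hR.isBigO_root hr).2.2
    have h3 := hR.of_root_sharp hr (analyticAt_germ' t none)
      (_root_.analyticAt_germ (F := logGerm) (analyticAt_logGerm t)) (germ_none_eq t)
      (hR.isBigO_sub_mul (E := Inv.inv) (analyticAt_denominator t 0)
        (analyticAt_inv (by simp)) hr (g := fun y => u y * y⁻¹) ?_ n₀.succ_ne_zero hO)
    · rw [hR0, C_0, add_zero] at h3
      exact h3
    · filter_upwards [h2] with y hy
      field_simp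

/-- Every point of the domain of the germs consists of flat coordinates of a superpotential. -/
theorem isFlatCoord_coeffs (hn₀ : 0 < n₀) (hn : ∀ i, 0 < n i) {t : CKPIdx n₀ n → ℂ}
    (ht : t ∈ germDomain germ) :
    coeffs t ∈ (cKP n₀ n).carrier ∧ cKPIsFlatCoord n₀ n (coeffs t) t := by
  have hc : coeffs t ∈ (cKP n₀ n).carrier := by
    refine ⟨ht.1, fun i => ?_⟩
    obtain ⟨j, hj⟩ : ∃ j : Fin (n i), Fin.last (n i) = j.succ :=
      ⟨⟨n i - 1, Nat.sub_lt (hn i) one_pos⟩, Fin.ext (Nat.sub_add_cancel (hn i)).symm⟩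
    have hj' : (j : ℕ) + 1 = n i := by
      have := congrArg Fin.val hj
      simpa using this.symm
    rw [hj]
    simp only [coeffs, Fin.cases_succ]
    rw [hj', logPoly_coeff_self (analyticAt_germ' t _)]
    exact div_ne_zero (pow_ne_zero _ (ht.2 _)) (Nat.cast_ne_zero.2 (hn i).ne')
  have hpf := isPartialFraction hn₀ hn hc
  refine ⟨hc, ?_, fun i => ?_⟩
  · obtain ⟨R, hR, hR0⟩ : ∃ R, HasPole (fun y => cKPLam n₀ n (coeffs t) y⁻¹) 0 n₀
      (poly (coeffs t)) R ∧ R 0 = 0 := hpf.hasPole_infty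
    refine (infty_expansion_iff hR t).2 ?_
    obtain ⟨v, q, hv, hq, hq0, hqO, hr⟩ := hR.exists_root_sharp (analyticAt_germ' t none)
      (ht.2 none) (_root_.analyticAt_germ (F := logGerm) (analyticAt_logGerm t)) (germ_none_eq t)
      (by rw [hR0, C_0, add_zero]; exact poly_coeffs hn₀ t)
    refine ⟨_, hr, ?_, ?_⟩
    · have h1 := hv.tendsto_div.mul (tendsto_exp_neg hq hq0)
      rw [deriv_germ_none, inv_one, one_mul] at h1
      exact h1.congr fun y => by ring
    · have hS := analyticAt_denominator t 0
      have h1 := isBigO_root_of_inverse hv hq (by simpa using hqO) hq0 hS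
      have h2 : (fun y => Complex.exp (-q y) - Complex.exp 0) =O[𝓝[≠] 0] fun y => y ^ (n₀ + 1) :=
        isBigO_comp_sub_comp (g := fun _ => 0) (c := 0) analyticAt_cexp tendsto_const_nhds
          (by simpa using hqO.neg_left) (by simpa using tendsto_sub_pow 0 n₀.succ_ne_zero)
      have h3 := ((hS.continuousAt.tendsto.comp (hv.tendsto.mono_left
        (nhdsWithin_le_nhds (s := {0}ᶜ)))).isBigO_one ℂ).mul h2
      simp only [sub_zero, one_mul, Complex.exp_zero] at h1 h3
      have h5 := isBigO_sub_pow_of_le (p := 0) (n₀ + 1).le_succ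
      simp only [sub_zero] at h5
      refine (h3.add (h1.trans h5)).congr' ?_ .rfl
      filter_upwards [nhdsWithin_le_nhds hv.right, self_mem_nhdsWithin,
        nhdsWithin_le_nhds (hv.tendsto.eventually (eventually_denominator_ne t))] with y hy hy0 hne
      have hy0 : y ≠ 0 := hy0
      have h4 : v y * y⁻¹ = 1 - v y * flatSeries pole expo none t (v y) := by
        rw [germ, ← div_eq_mul_inv, div_eq_iff hne] at hy
        rw [mul_inv_eq_iff_eq_mul₀ hy0]
        linear_combination hy
      simp only [Function.comp]
      linear_combination (-Complex.exp (-q y)) * h4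
  · obtain ⟨u, v, hu, hr, hv, hO⟩ := (hpf.hasPole i).exists_expansion (analyticAt_germ' t (some i))
      (ht.2 (some i)) rfl (polar_coeffs t i)
    refine ⟨u, hu, hr, (hO _ (analyticAt_germ' t (some i))).congr' ?_ .rfl⟩
    filter_upwards [nhdsWithin_le_nhds hv.right] with y hy
    rw [hy, germ, flatSeries_some]

/-- The polynomial part has no term of degree `n₀ - 1`, so that the root at infinity agrees with `1
/ z` to second order. -/
theorem poly_isBigO {lam R : ℂ → ℂ} {a : CKPIdx n₀ n → ℂ} (hn₀ : 0 < n₀)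
    (h : HasPole (fun y => lam y⁻¹) 0 n₀ (poly a) R) (hR : R 0 = 0) :
    (fun y => (y - 0) ^ n₀ * (n₀ * lam y⁻¹) - n₀ * (poly a).coeff n₀) =O[𝓝[≠] 0]
      fun y => (y - 0) ^ 2 := by
  have hn0 : (n₀ : ℂ) ≠ 0 := Nat.cast_ne_zero.2 hn₀.ne'
  have h1 : R =O[𝓝[≠] 0] fun y => y := by
    simpa [hR] using (h.analytic.differentiableAt.isBigO_sub).mono (nhdsWithin_le_nhds (s := {0}ᶜ))
  have h2 : (fun y => y ^ n₀ * R y) =O[𝓝[≠] 0] fun y => (y - 0) ^ 2 := by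
    refine (((isBigO_refl (fun y : ℂ => y ^ n₀) _).mul h1).congr_right
      fun y => ?_).trans (isBigO_sub_pow_of_le (p := 0) (show 2 ≤ n₀ + 1 by omega))
    rw [sub_zero, pow_succ]
  have h3 : ∀ j : Fin (n₀ - 1), (fun y : ℂ => a (Sum.inl j) * y ^ (n₀ - j)) =O[𝓝[≠] 0]
      fun y => (y - 0) ^ 2 := fun j => by
    have := (isBigO_sub_pow_of_le (p := 0) (show 2 ≤ n₀ - j by omega)).const_mul_left (a (Sum.inl j))
    simpa using this
  refine ((h2.add (IsBigO.fun_sum fun j (_ : j ∈ Finset.univ) => h3 j)).const_mul_left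
    (n₀ : ℂ)).congr' ?_ .rfl
  filter_upwards [h.eq, self_mem_nhdsWithin] with y hy hy0
  have hy0 : y ≠ 0 := hy0
  have h4 : ∀ j : Fin (n₀ - 1), y ^ n₀ * y⁻¹ ^ (j : ℕ) = y ^ (n₀ - j) := fun j => by
    rw [pow_sub₀ _ hy0 (by omega), inv_pow]
  simp only [hy, poly, headPoly_eval, headPoly_coeff, sub_zero, if_true, ← h4]
  rw [dif_neg (by omega), add_zero, mul_inv_cancel₀ hn0]
  have h5 : y ^ n₀ * y⁻¹ ^ n₀ = 1 := by rw [← mul_pow, mul_inv_cancel₀ hy0, one_pow]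
  have h6 : ∑ j : Fin (n₀ - 1), a (Sum.inl j) * (y ^ n₀ * y⁻¹ ^ (j : ℕ)) =
      y ^ n₀ * ∑ j : Fin (n₀ - 1), a (Sum.inl j) * y⁻¹ ^ (j : ℕ) := by
    rw [Finset.mul_sum]
    exact Finset.sum_congr rfl fun j _ => by ring
  rw [h6]
  field_simp
  linear_combination -h5

/-- Every superpotential has flat coordinates, the coefficients of the expansions of `z` in powers
of roots of `1 / (n λ)`. -/
theorem exists_isFlatCoord (hn₀ : 0 < n₀) (hn : ∀ i, 0 < n i) {a : CKPIdx n₀ n → ℂ}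
    (ha : a ∈ (cKP n₀ n).carrier) : ∃ t, cKPIsFlatCoord n₀ n a t := by
  have hpf := isPartialFraction hn₀ hn ha
  choose u τ hu hr hO using fun i => (hpf.hasPole i).exists_coeff analyticAt_id
  obtain ⟨R, hR, hR0⟩ : ∃ R, HasPole (fun y => cKPLam n₀ n a y⁻¹) 0 n₀ (poly a) R ∧ R 0 = 0 :=
    hpf.hasPole_infty
  obtain ⟨x, Z, h, -, -, hxr, hZ, hh, hh0, hxh, hm⟩ := hR.exists_uniformizer (c := 1) (by
    simp only [poly, headPoly_coeff, if_true]
    rw [dif_neg (by omega), add_zero, mul_inv_cancel₀ (Nat.cast_ne_zero.2 hn₀.ne')]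
    simp)
  have hh2 := hm 2 (poly_isBigO hn₀ hR hR0)
  -- the first two coefficients of the expansion of `x / y` in powers of `x`
  have hF0 : taylorCoeff 0 (fun v => Complex.exp (-h (Z v))) = 1 := by
    simp [taylorCoeff_zero, hZ.apply_zero, hh0]
  have hF1 : taylorCoeff 1 (fun v => Complex.exp (-h (Z v))) = 0 := by
    have h1 : h =O[𝓝 0] fun y => y ^ (1 + 1) := by
      rw [← nhdsNE_sup_pure]
      refine IsBigO.sup (by simpa using hh2) ?_
      rw [isBigO_pure]
      exact fun _ => hh0
    have h2 : deriv h 0 = 0 := by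
      simpa [taylorCoeff] using taylorCoeff_eq_zero_of_isBigO hh h1
    have h3 : HasDerivAt h 0 (Z 0) := by
      rw [hZ.apply_zero]
      simpa [h2] using hh.differentiableAt.hasDerivAt
    have h4 := (h3.comp 0 hZ.analytic.differentiableAt.hasDerivAt).neg.cexp
    have h5 : deriv (fun v => Complex.exp (-h (Z v))) 0 = _ := h4.deriv
    simp [taylorCoeff, h5]
  refine ⟨Sum.elim (fun j => -taylorCoeff (j + 2) fun v => Complex.exp (-h (Z v))) fun s => τ s.1 s.2,
    (infty_expansion_iff hR _).2 ⟨x, hxr, ?_, ?_⟩, fun i => ⟨u i, hu i, hr i, hO i _⟩⟩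
  · refine (tendsto_exp_neg hh hh0).congr' ?_
    filter_upwards [nhdsWithin_le_nhds hxh, self_mem_nhdsWithin] with y hy hy0
    have hy0 : y ≠ 0 := hy0
    rw [hy]
    field_simp
    simp
  · refine (hZ.isBigO_sub_coeff (φ := fun y => Complex.exp (-h y)) hh.fun_neg.cexp
      (n₀ + 1)).congr' ?_ (Eventually.of_forall fun y => by simp)
    obtain ⟨r, rfl⟩ : ∃ r, n₀ = r + 1 := ⟨n₀ - 1, by omega⟩
    filter_upwards [nhdsWithin_le_nhds hxh, self_mem_nhdsWithin] with y hy hy0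
    have hy0 : y ≠ 0 := hy0
    have h1 : Complex.exp (-h y) = x y * y⁻¹ := by
      conv_rhs => rw [hy]
      field_simp
      simp
    rw [h1, Fin.sum_univ_succ, Fin.sum_univ_succ, flatSeries_none]
    simp only [Fin.val_zero, Fin.val_succ, hF0, hF1, Sum.elim_inl, Finset.mul_sum, neg_mul,
      mul_neg, Finset.sum_neg_distrib, pow_zero, zero_add, zero_mul, mul_one, sub_neg_eq_add]
    congr 2
    exact Finset.sum_congr rfl fun j _ => by ring

end CKP

end

section

open Polynomial

namespace CKP

variable {n₀ m : ℕ} {n : Fin m → ℕ}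

/-! ### The space of rational superpotentials -/
theorem analyticAt_coeffs (t : CKPIdx n₀ n → ℂ) : AnalyticAt ℂ coeffs t := by
  suffices h : ∀ κ, AnalyticAt ℂ (fun t => coeffs t κ) t from AnalyticAt.pi h
  intro κ
  rcases κ with j | ⟨i, j⟩
  · have h1 : AnalyticAt ℂ (fun t : CKPIdx n₀ n → ℂ => if (j : ℕ) = 0 then const t else 0) t := by
      split_ifs
      · exact (analyticAt_taylorCoeff_and_fderiv (analyticAt_logGerm t) n₀).1
      · exact analyticAt_const
    simpa only [coeffs, coeff_add, coeff_C] using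
      (analyticAt_logPoly_coeff (F := fun t => germ t none) (analyticAt_germ t none) n₀ j).fun_add h1
  · refine Fin.cases ?_ (fun j => ?_) j
    · exact AnalyticAt.comp (g := fun q : (CKPIdx n₀ n → ℂ) × ℂ => germ q.1 (some i) q.2)
        (f := fun t => (t, (0 : ℂ))) (analyticAt_germ t (some i))
        (analyticAt_id.prod analyticAt_const)
    · exact analyticAt_logPoly_coeff (F := fun t => germ t (some i)) (analyticAt_germ t (some i))
        (n i) (j + 1)

theorem isOpen_extDomain : IsOpen (cKP n₀ n).extDomain := by
  refine isOpen_iff_eventually.2 fun q hq => ?_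
  have h0 : ∀ κ, Continuous fun q : (CKPIdx n₀ n → ℂ) × ℂ => q.1 κ := fun κ => by fun_prop
  have h1 := eventually_injective (f := fun (q' : (CKPIdx n₀ n → ℂ) × ℂ) (i : Fin m) =>
    q'.1 (Sum.inr ⟨i, 0⟩))
    (fun i => (h0 (Sum.inr ⟨i, 0⟩)).continuousAt) hq.1.1
  have h2 : ∀ᶠ q' in 𝓝 q, ∀ i : Fin m, q'.1 (Sum.inr ⟨i, Fin.last (n i)⟩) ≠ 0 :=
    eventually_all.2 fun i => (h0 _).continuousAt.eventually_ne (hq.1.2 i)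
  have h3 : ∀ᶠ q' in 𝓝 q, ∀ i : Fin m, q'.2 - q'.1 (Sum.inr ⟨i, 0⟩) ≠ 0 := by
    refine eventually_all.2 fun i => (continuous_snd.sub (h0 _)).continuousAt.eventually_ne ?_
    refine sub_ne_zero.2 fun h => hq.2 ?_
    exact Finset.mem_image.2 ⟨i, Finset.mem_univ _, h.symm⟩
  filter_upwards [h1, h2, h3] with q' h1 h2 h3
  refine ⟨⟨h1, h2⟩, fun h => ?_⟩
  obtain ⟨i, -, hi⟩ := Finset.mem_image.1 h
  exact h3 i (sub_eq_zero.2 hi.symm)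

theorem lam_analytic {a : CKPIdx n₀ n → ℂ} {z : ℂ} (hz : z ∉ (cKP n₀ n).poles a) :
    AnalyticAt ℂ (fun q : (CKPIdx n₀ n → ℂ) × ℂ => cKPLam n₀ n q.1 q.2) (a, z) := by
  have h0 : ∀ κ, AnalyticAt ℂ (fun q : (CKPIdx n₀ n → ℂ) × ℂ => q.1 κ) (a, z) := fun κ =>
    ((ContinuousLinearMap.proj (R := ℂ) (φ := fun _ => ℂ) κ).comp
      (ContinuousLinearMap.fst ℂ (CKPIdx n₀ n → ℂ) ℂ)).analyticAt _
  refine (((analyticAt_snd.pow _).div_const).add (Finset.analyticAt_fun_sum _ fun j _ =>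
    (h0 _).mul (analyticAt_snd.pow _))).add (Finset.analyticAt_fun_sum _ fun i _ =>
      Finset.analyticAt_fun_sum _ fun j _ => (h0 _).div ((analyticAt_snd.sub (h0 _)).pow _) ?_)
  refine pow_ne_zero _ (sub_ne_zero.2 fun h => hz ?_)
  exact Finset.mem_image.2 ⟨i, Finset.mem_univ _, h.symm⟩

theorem isPoleGerms (hn₀ : 0 < n₀) (hn : ∀ i, 0 < n i) {t : CKPIdx n₀ n → ℂ}
    (ht : t ∈ germDomain germ) : IsPoleGerms (germ t) (order n₀ n) where
  analytic := analyticAt_germ' t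
  deriv_ne := ht.2
  infty := by simp [germ]
  inj := ht.1
  n_pos := by rintro (_ | i); exacts [hn₀, hn i]

/-- The unit field: `∂ / ∂ t_{0, n₀ - 1}` if `n₀ ≥ 2`, and the field of the common translations of
`z` if `n₀ = 1`. -/
def unitField (n₀ : ℕ) {m : ℕ} (n : Fin m → ℕ) : (CKPIdx n₀ n → ℂ) × ℂ :=
  (fun α => if n₀ = 1 then (if expo α = 0 then 1 else 0) else
    (if pole α = none ∧ expo α + 1 = n₀ then 1 else 0), if n₀ = 1 then 1 else 0)

/-- The function `1` is the derivative of `λ` along the unit field. For `n₀ = 1` it is the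
coefficient at infinity in `λ'`, whose other terms are cancelled by the shifts of the finite poles.
-/
theorem unit_eq (hn₀ : 0 < n₀) (hn : ∀ i, 0 < n i) {t : CKPIdx n₀ n → ℂ}
    (ht : t ∈ germDomain germ) (z : ℂ) :
    flatCombo (germ t) (order n₀ n) pole expo (unitField n₀ n).1 z +
      (unitField n₀ n).2 * lamDeriv (germ t) (order n₀ n) z = 1 := by
  have hg := isPoleGerms hn₀ hn ht
  -- the coefficient of `u` in `Y / (1 - z Y)`
  have h1 : ∀ N r : ℕ, N = r + 1 → taylorCoeff N (fun u => u ^ r * poleKernel (germ t) none z u) = 1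
  := by
    rintro N r rfl
    have h2 : AnalyticAt ℂ (fun u => 1 - z * germ t none u) 0 :=
      analyticAt_const.sub (analyticAt_const.mul (hg.analytic none))
    have h3 : (1 : ℂ) - z * germ t none 0 ≠ 0 := by simp [hg.infty]
    have h4 : AnalyticAt ℂ (poleKernel (germ t) none z) 0 := (hg.analytic none).div h2 h3
    have h5 : HasDerivAt (poleKernel (germ t) none z) _ 0 :=
      (hg.analytic none).differentiableAt.hasDerivAt.div h2.differentiableAt.hasDerivAt h3
    rw [taylorCoeff_pow_mul h4, if_pos (Nat.le_succ r), Nat.add_sub_cancel_left, taylorCoeff,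
      iteratedDeriv_one, h5.deriv, hg.infty, deriv_germ_none]
    simp
  rcases eq_or_ne n₀ 1 with rfl | hn1
  · have h2 := h1 1 0 rfl
    simp only [flatCombo, unitField, if_true, lamDeriv, one_mul, Fintype.sum_sum_type,
      Fintype.sum_sigma, expo, Fin.val_eq_zero_iff, ite_mul, zero_mul,
      Nat.add_eq_zero_iff, one_ne_zero, and_false, if_false, Finset.sum_const_zero, zero_add, pole]
    have h3 : ∀ i, (∑ j : Fin (n i + 1), if j = 0 then
        poleCoeff (germ t) (order 1 n) (some i) j z else 0) =
          poleCoeff (germ t) (order 1 n) (some i) 0 z := fun i => by simp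
    rw [Finset.sum_congr rfl fun i _ => h3 i, add_sub_cancel]
    exact h2
  · simp only [flatCombo, unitField, if_neg hn1, zero_mul, add_zero]
    rw [Finset.sum_eq_single (Sum.inl ⟨n₀ - 2, by omega⟩)]
    · rw [if_pos ⟨rfl, show n₀ - 2 + 1 + 1 = n₀ by omega⟩, one_mul]
      exact h1 n₀ _ (show n₀ = n₀ - 2 + 1 + 1 by omega)
    · rintro (j | x) - hne
      · rw [if_neg, zero_mul]
        rintro ⟨-, h⟩
        simp only [expo] at h
        exact hne (congrArg Sum.inl (Fin.ext (by simp only; omega)))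
      · rw [if_neg (by simp [pole]), zero_mul]
    · simp

theorem poleSystem (hn₀ : 0 < n₀) (hn : ∀ i, 0 < n i) : PoleSystem (cKP n₀ n) coeffs
    (germDomain germ) pole expo (order n₀ n) germ 1 0 const (unitField n₀ n) where
  isOpen := isOpen_germDomain analyticAt_germ
  analytic t _ := analyticAt_coeffs t
  of_flatCoord _ ha _ h := of_isFlatCoord hn₀ hn ha h
  flatCoord _ ht := isFlatCoord_coeffs hn₀ hn ht
  surj a ha := by
    obtain ⟨t, ht⟩ := exists_isFlatCoord hn₀ hn ha
    exact ⟨t, of_isFlatCoord hn₀ hn ha ht⟩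
  card_eq := rfl
  isOpen_extDomain := isOpen_extDomain
  zOf_analytic _ := analyticAt_id
  zOf_deriv s := hasDerivAt_id s
  zOf_surj _ _ z _ := ⟨z, rfl⟩
  lam_analytic _ _ _ hz := lam_analytic hz
  index := isFlatIndex hn₀
  rho_eq _ := by simp [cKP]
  rho_ne _ _ _ _ := by simp
  germs _ ht := isPoleGerms hn₀ hn ht
  poles_eq _ _ := rfl
  germ_analytic t _ := analyticAt_germ t
  germ_deriv t _ := germ_deriv t
  rho_analytic _ := analyticAt_const
  const_analytic t _ := (analyticAt_taylorCoeff_and_fderiv (analyticAt_logGerm t) n₀).1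
  const_deriv t _ := const_deriv t
  lam_eq t ht z hz := by
    have h1 := (isPartialFraction hn₀ hn (isFlatCoord_coeffs hn₀ hn ht).1).eq z
      (notMem_germPoles.1 hz)
    rw [poly_coeffs hn₀, eval_add, eval_C] at h1
    simp only [polar_coeffs] at h1
    refine h1.trans ?_
    rw [add_comm (eval z _), add_assoc]
    rfl
  unit_eq t ht z _ := by
    rw [zero_mul, add_zero, one_mul]
    exact unit_eq hn₀ hn ht z

end CKP

end

section

open Polynomial

/-! ### Trigonometric superpotentials in flat coordinates -/

namespace Toda

variable {n₀ n₁ k : ℕ} {n : Fin k → ℕ}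

/-- The pole to which a flat coordinate belongs; `some none` is the pole `z = 0`. -/
def pole : TodaFlatIdx n₀ n₁ n → Option (Option (Fin k))
  | Sum.inl _ => none
  | Sum.inr (Sum.inl _) => some none
  | Sum.inr (Sum.inr x) => some (some x.1)

/-- The power of the local parameter at which a flat coordinate appears. -/
def expo : TodaFlatIdx n₀ n₁ n → ℕ
  | Sum.inl j => j + 1
  | Sum.inr (Sum.inl j) => j
  | Sum.inr (Sum.inr x) => x.2

/-- The order of a pole of the superpotential. -/
def order (n₀ n₁ : ℕ) {k : ℕ} (n : Fin k → ℕ) : Option (Option (Fin k)) → ℕ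
  | none => n₀
  | some none => n₁
  | some (some i) => n i

/-- The expansion of `log z`, or of `log (1 / z)`, at a pole, without its logarithmic term. -/
abbrev series (t : TodaFlatIdx n₀ n₁ n → ℂ) (i : Option (Option (Fin k))) : ℂ → ℂ :=
  flatSeries pole expo i t

/-- The factor `u` at the two poles `0` and `∞` of `dz / z`. -/
def base : Option (Option (Fin k)) → ℂ → ℂ
  | some (some _), _ => 1
  | _, u => u

/-- The expansions of `z` at the finite poles and of `1 / z` at infinity in the local parameter. -/
def germ (t : TodaFlatIdx n₀ n₁ n → ℂ) (i : Option (Option (Fin k))) (u : ℂ) : ℂ :=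
  base i u * Complex.exp (series t i u)

/-- The constant term of the superpotential. -/
def const (t : TodaFlatIdx n₀ n₁ n → ℂ) : ℂ :=
  ∑ i, taylorCoeff (order n₀ n₁ n (some i)) (series t (some i))

/-- The superpotential, in the coordinates given by the coefficients, with given flat coordinates.
-/
def coeffs (t : TodaFlatIdx n₀ n₁ n → ℂ) : TodaIdx n₀ n₁ n → ℂ
  | Sum.inl j => (logPoly (germ t none) n₀ + C (const t)).coeff j
  | Sum.inr (Sum.inl j) => (logPoly (germ t (some none)) n₁).coeff ((j : ℕ) + 1)
  | Sum.inr (Sum.inr ⟨i, j⟩) => Fin.cases (germ t (some (some i)) 0)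
      (fun j => (logPoly (germ t (some (some i))) (n i)).coeff ((j : ℕ) + 1)) j

theorem series_infty (t : TodaFlatIdx n₀ n₁ n → ℂ) (u : ℂ) :
    series t none u = ∑ j : Fin (n₀ - 1), t (Sum.inl j) * u ^ ((j : ℕ) + 1) := by
  simp [series, flatSeries, Fintype.sum_sum_type, pole, expo]

theorem series_zero (t : TodaFlatIdx n₀ n₁ n → ℂ) (u : ℂ) :
    series t (some none) u = ∑ j : Fin (n₁ + 1), t (Sum.inr (Sum.inl j)) * u ^ (j : ℕ) := by
  simp [series, flatSeries, Fintype.sum_sum_type, pole, expo]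

theorem series_some (t : TodaFlatIdx n₀ n₁ n → ℂ) (i : Fin k) (u : ℂ) :
    series t (some (some i)) u =
      ∑ j : Fin (n i + 1), t (Sum.inr (Sum.inr ⟨i, j⟩)) * u ^ (j : ℕ) := by
  simp only [series, flatSeries, Fintype.sum_sum_type, pole, expo, Fintype.sum_sigma, reduceCtorEq,
    if_false, Finset.sum_const_zero, zero_add, Option.some.injEq]
  rw [Finset.sum_eq_single i]
  · simp
  · intro j _ hj
    simp [hj]
  · simp

theorem isFlatIndex (hn₀ : 0 < n₀) :
    IsFlatIndex (pole (n₀ := n₀) (n₁ := n₁) (n := n)) expo (order n₀ n₁ n) where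
  infty := by
    rintro (j | j | x) h
    · have := j.2
      simp only [expo, order]
      omega
    · cases h
    · cases h
  inj := by
    rintro (j | j | ⟨i, j⟩) (j' | j' | ⟨i', j'⟩) h1 h2 <;>
      simp only [pole, Option.some.injEq, reduceCtorEq] at h1 <;> simp only [expo] at h2
    · rw [Fin.ext (Nat.succ_injective h2)]
    · rw [Fin.ext h2]
    · subst h1
      rw [Fin.ext h2]
  dual := by
    rintro (j | j | ⟨i, j⟩)
    · refine ⟨Sum.inl j.rev, rfl, ?_⟩
      simp only [expo, order, pole, Fin.val_rev]
      omega
    · refine ⟨Sum.inr (Sum.inl j.rev), rfl, ?_⟩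
      simp only [expo, order, pole, Fin.val_rev]
      omega
    · refine ⟨Sum.inr (Sum.inr ⟨i, j.rev⟩), rfl, ?_⟩
      simp only [expo, order, pole, Fin.val_rev]
      omega
  card := by
    simp [order, Fintype.sum_option]
    ring

theorem base_analytic (i : Option (Option (Fin k))) (u : ℂ) : AnalyticAt ℂ (base i) u := by
  rcases i with _ | _ | i
  exacts [analyticAt_id, analyticAt_id, analyticAt_const]

theorem analyticAt_germ (t : TodaFlatIdx n₀ n₁ n → ℂ) (i : Option (Option (Fin k))) :
    AnalyticAt ℂ (fun q : (TodaFlatIdx n₀ n₁ n → ℂ) × ℂ => germ q.1 i q.2) (t, 0) :=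
  (AnalyticAt.comp (g := base i) (base_analytic i _) analyticAt_snd).mul (analyticAt_flatSeries i _).cexp

theorem analyticAt_germ' (t : TodaFlatIdx n₀ n₁ n → ℂ) (i : Option (Option (Fin k))) :
    AnalyticAt ℂ (germ t i) 0 :=
  _root_.analyticAt_germ (F := fun t => germ t i) (analyticAt_germ t i)

theorem analyticAt_series (t : TodaFlatIdx n₀ n₁ n → ℂ) (i : Option (Option (Fin k))) (u : ℂ) :
    AnalyticAt ℂ (series t i) u :=
  _root_.analyticAt_germ (F := fun t => series t i) (analyticAt_flatSeries i (t, u))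

theorem deriv_germ (t : TodaFlatIdx n₀ n₁ n → ℂ) {i : Option (Option (Fin k))}
    (hi : base i = fun u => u) : deriv (germ t i) 0 = Complex.exp (series t i 0) := by
  have h1 := (hasDerivAt_id (0 : ℂ)).mul
    (analyticAt_series t i 0).cexp.differentiableAt.hasDerivAt
  rw [show germ t i = fun u => u * Complex.exp (series t i u) by funext u; rw [germ, hi]]
  exact h1.deriv.trans (by simp)

theorem deriv_germ_none (t : TodaFlatIdx n₀ n₁ n → ℂ) : deriv (germ t none) 0 = 1 := by
  rw [deriv_germ t rfl, series_infty]
  simp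

/-- For `ρ = z` a flat coordinate shifts `log z`, so that it scales the germ. -/
theorem germ_deriv (t : TodaFlatIdx n₀ n₁ n → ℂ) (i : Option (Option (Fin k)))
    (γ : TodaFlatIdx n₀ n₁ n) (u : ℂ) :
    fderiv ℂ (fun t => germ t i u) t (Pi.single γ 1) =
      if pole γ = i then u ^ expo γ * germSpeed 0 1 i (germ t i u) else 0 := by
  refine (fderiv_comp_flatSeries i t u
    ((Complex.hasDerivAt_exp _).const_mul (base i u)) γ).trans ?_
  rcases i with _ | i <;> simp [germSpeed, germ]

/-- The constant term is the sum of the flat coordinates `t_{i, n_i}` of the finite poles. -/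
theorem const_analytic_and_deriv (t : TodaFlatIdx n₀ n₁ n → ℂ) :
    AnalyticAt ℂ const t ∧ ∀ γ, fderiv ℂ const t (Pi.single γ 1) = if pole γ = none then
      0 * taylorCoeff (order n₀ n₁ n none) (fun u => u ^ expo γ * germ t none u)
    else 1 * (if expo γ = order n₀ n₁ n (pole γ) then 1 else 0) := by
  have h1 := fun i : Option (Fin k) => analyticAt_taylorCoeff_and_fderiv
    (F := fun t : TodaFlatIdx n₀ n₁ n → ℂ => series t (some i)) (x := t)
    (analyticAt_flatSeries (some i) (t, 0)) (order n₀ n₁ n (some i))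
  refine ⟨Finset.analyticAt_fun_sum _ fun i _ => (h1 i).1, fun γ => ?_⟩
  have h2 : fderiv ℂ const t = _ := fderiv_fun_sum fun i _ => (h1 i).1.differentiableAt
  have h3 : ∀ (i : Option (Fin k)) u, fderiv ℂ (fun t => series t (some i) u) t (Pi.single γ 1) =
      if pole γ = some i then u ^ expo γ else 0 := fun i u =>
    (fderiv_comp_flatSeries (some i) t u (hasDerivAt_id _) γ).trans (by simp)
  rw [h2, _root_.sum_apply]
  simp only [(h1 _).2, h3]
  rcases hγ : pole γ with _ | i
  · simp [taylorCoeff_fun_zero]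
  · rw [Finset.sum_eq_single i]
    · simp [taylorCoeff_pow, eq_comm]
    · intro j _ hj
      simp [hj.symm, taylorCoeff_fun_zero]
    · simp

/-- The polynomial part of a superpotential. -/
def poly (a : TodaIdx n₀ n₁ n → ℂ) : ℂ[X] := headPoly n₀ fun j => a (Sum.inl j)

/-- The finite poles of a superpotential. -/
def position (a : TodaIdx n₀ n₁ n → ℂ) : Option (Fin k) → ℂ
  | none => 0
  | some i => a (Sum.inr (Sum.inr ⟨i, 0⟩))

/-- The principal part of a superpotential at a finite pole. -/
def polar (a : TodaIdx n₀ n₁ n → ℂ) : Option (Fin k) → ℂ[X]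
  | none => tailPoly fun j => a (Sum.inr (Sum.inl j))
  | some i => tailPoly fun j : Fin (n i) => a (Sum.inr (Sum.inr ⟨i, j.succ⟩))

theorem polar_coeffs (t : TodaFlatIdx n₀ n₁ n → ℂ) (i : Option (Fin k)) :
    polar (coeffs t) i = logPoly (germ t (some i)) (order n₀ n₁ n (some i)) := by
  rcases i with _ | i <;> exact tailPoly_logPoly _ _

theorem position_coeffs (t : TodaFlatIdx n₀ n₁ n → ℂ) (i : Option (Fin k)) :
    position (coeffs t) i = germ t (some i) 0 := by
  rcases i with _ | i
  · simp [position, germ, base]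
  · rfl

theorem poly_coeffs (hn₀ : 0 < n₀) (t : TodaFlatIdx n₀ n₁ n → ℂ) :
    poly (coeffs t) = logPoly (germ t none) n₀ + C (const t) := by
  refine eq_headPoly (P := logPoly (germ t none) n₀ + C (const t)) le_rfl ?_ ?_ (by omega)
  · exact natDegree_add_C.trans_le (logPoly_natDegree_le _ _)
  · rw [coeff_add, coeff_C_of_ne_zero hn₀.ne', logPoly_coeff_self (analyticAt_germ' t none),
      deriv_germ_none, one_pow]
    simp

theorem polar_natDegree_le (a : TodaIdx n₀ n₁ n → ℂ) (i : Option (Fin k)) :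
    (polar a i).natDegree ≤ order n₀ n₁ n (some i) := by
  rcases i with _ | i <;> exact tailPoly_natDegree_le _

theorem polar_coeff_zero (a : TodaIdx n₀ n₁ n → ℂ) (i : Option (Fin k)) :
    (polar a i).coeff 0 = 0 := by
  rcases i with _ | i <;> exact tailPoly_coeff_zero _

theorem mem_carrier_iff (hn₁ : 0 < n₁) (hn : ∀ i, 0 < n i) {a : TodaIdx n₀ n₁ n → ℂ} :
    a ∈ (toda n₀ n₁ n).carrier ↔ Function.Injective (position a) ∧
      ∀ i, (polar a i).coeff (order n₀ n₁ n (some i)) ≠ 0 := by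
  have h1 : ∀ i, (polar a (some i)).coeff (n i) = a (Sum.inr (Sum.inr ⟨i, Fin.last (n i)⟩)) := by
    intro i
    have h := tailPoly_coeff_last (hn i) fun j => a (Sum.inr (Sum.inr ⟨i, j⟩))
    exact h
  have h2 : (polar a none).coeff n₁ = a (Sum.inr (Sum.inl ⟨n₁ - 1, by omega⟩)) := by
    obtain ⟨r, rfl⟩ : ∃ r, n₁ = r + 1 := ⟨n₁ - 1, by omega⟩
    simp [polar, tailPoly_coeff_succ]
  rw [Option.forall, Option.injective_iff]
  simp only [order, h1, h2]
  constructor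
  · rintro ⟨h3, h4, h5, h6⟩
    exact ⟨⟨h3, by rintro ⟨i, hi⟩; exact h4 i hi⟩, h5 _ (Nat.sub_add_cancel hn₁), h6⟩
  · rintro ⟨⟨h3, h4⟩, h5, h6⟩
    refine ⟨h3, fun i hi => h4 ⟨i, hi⟩, fun j hj => ?_, h6⟩
    rwa [show j = ⟨n₁ - 1, by omega⟩ from Fin.ext (by simp only; omega)]

theorem isPartialFraction (hn₀ : 0 < n₀) (hn₁ : 0 < n₁) (hn : ∀ i, 0 < n i)
    {a : TodaIdx n₀ n₁ n → ℂ} (ha : a ∈ (toda n₀ n₁ n).carrier) :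
    IsPartialFraction (todaLam n₀ n₁ n a) (position a) (order n₀ n₁ n) (poly a) (polar a) where
  inj := ((mem_carrier_iff hn₁ hn).1 ha).1
  n_pos := by rintro (_ | _ | i); exacts [hn₀, hn₁, hn i]
  natDegree_le := headPoly_natDegree_le le_rfl _
  coeff_ne := by
    rw [poly, headPoly_coeff, order, if_pos rfl, dif_neg (by omega), add_zero]
    exact inv_ne_zero (Nat.cast_ne_zero.2 hn₀.ne')
  natDegree_le' := polar_natDegree_le a
  coeff_ne' := ((mem_carrier_iff hn₁ hn).1 ha).2
  coeff_zero := polar_coeff_zero a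
  eq z _ := by
    simp [poly, polar, position, headPoly_eval, tailPoly_eval_inv, todaLam, Fintype.sum_option]
    ring

theorem coeffs_eq {a : TodaIdx n₀ n₁ n → ℂ} {t : TodaFlatIdx n₀ n₁ n → ℂ}
    (h1 : poly a = logPoly (germ t none) n₀ + C (const t))
    (h2 : ∀ i, germ t (some i) 0 = position a i)
    (h3 : ∀ i, polar a i = logPoly (germ t (some i)) (order n₀ n₁ n (some i))) : coeffs t = a := by
  funext κ
  rcases κ with j | j | ⟨i, j⟩
  · rw [coeffs, ← h1, poly, headPoly_coeff, if_neg (by omega), dif_pos j.2, zero_add]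
  · have := h3 none
    rw [order] at this
    rw [coeffs, ← this, polar, tailPoly_coeff_succ, dif_pos j.2]
  · refine Fin.cases (h2 (some i)) (fun j => ?_) j
    have := h3 (some i)
    rw [order] at this
    rw [coeffs, Fin.cases_succ, ← this, polar, tailPoly_coeff_succ, dif_pos j.2]

end Toda

end

section

open Polynomial Bornology Asymptotics

namespace Toda

variable {n₀ n₁ k : ℕ} {n : Fin k → ℕ}

/-! ### Flat coordinates determine the trigonometric superpotential -/
/-- The expansion at infinity in terms of the local coordinate `y = 1 / z`. -/
theorem infty_expansion_iff (lam : ℂ → ℂ) (t : TodaFlatIdx n₀ n₁ n → ℂ) :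
    (∃ w g : ℂ → ℂ, (∀ᶠ z in cobounded ℂ, w z ^ n₀ = n₀ * lam z) ∧
      Tendsto (fun z => w z / z) (cobounded ℂ) (𝓝 1) ∧
      (∀ᶠ z in cobounded ℂ, z = w z * Complex.exp (g z)) ∧
      (fun z => g z + ∑ j : Fin (n₀ - 1), t (Sum.inl j) / w z ^ ((j : ℕ) + 1))
        =O[cobounded ℂ] fun z => (z ^ n₀)⁻¹) ↔
    ∃ u g : ℂ → ℂ, (∀ᶠ y in 𝓝[≠] 0, u y ^ n₀ * (n₀ * lam y⁻¹) = 1) ∧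
      Tendsto (fun y => u y / y) (𝓝[≠] 0) (𝓝 1) ∧
      (∀ᶠ y in 𝓝[≠] 0, y = u y * Complex.exp (g y)) ∧
      (fun y => g y - series t none (u y)) =O[𝓝[≠] 0] fun y => y ^ n₀ := by
  simp only [← map_inv_nhdsWithin_zero, eventually_map, tendsto_map'_iff,
    isBigO_map, Function.comp_def, inv_pow, inv_inv]
  constructor
  · rintro ⟨w, g, h1, h2, h3, h4⟩
    obtain ⟨-, h5⟩ := root_of_inv h2 h1
    refine ⟨fun y => (w y⁻¹)⁻¹, fun y => -g y⁻¹, h5, ?_, ?_, ?_⟩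
    · have := h2.inv₀ one_ne_zero
      rw [inv_one] at this
      exact this.congr fun y => by rw [inv_div, div_eq_mul_inv, div_eq_mul_inv, mul_comm]
    · filter_upwards [h3] with y hy
      rw [Complex.exp_neg, ← mul_inv, ← hy, inv_inv]
    · refine h4.neg_left.congr_left fun y => ?_
      simp only [series_infty, div_eq_mul_inv, inv_pow]
      ring
  · rintro ⟨u, g, h1, h2, h3, h4⟩
    obtain ⟨h5, h6⟩ := inv_of_root h2 h1
    refine ⟨fun z => (u z⁻¹)⁻¹, fun z => -g z⁻¹, by simpa using h5, by simpa using h6, ?_, ?_⟩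
    · filter_upwards [h3] with y hy
      simp only [inv_inv]
      rw [Complex.exp_neg, ← mul_inv, ← hy]
    · refine h4.neg_left.congr_left fun y => ?_
      simp only [inv_inv, series_infty, div_eq_mul_inv, inv_pow]
      ring

/-- The value at `z = 0` of the holomorphic part of the superpotential: the pole `i` contributes `-
t_{i, n_i}`, because `1 - (0 - Y 0)⁻¹ (Y - Y 0)` is the exponential of an increment of `log Y`. -/
theorem regular_part {a : TodaIdx n₀ n₁ n → ℂ} {t : TodaFlatIdx n₀ n₁ n → ℂ} (hn : ∀ i, 0 < n i)
    (h2 : ∀ i : Fin k, germ t (some (some i)) 0 = position a (some i))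
    (h3 : ∀ i : Fin k, polar a (some i) = logPoly (germ t (some (some i))) (n i)) :
    (poly a).eval 0 + ∑ j ∈ Finset.univ.erase none, (polar a j).eval (0 - position a j)⁻¹ =
      (poly a).coeff 0 - (const t - taylorCoeff n₁ (series t (some none))) := by
  have h4 : (polar a none).eval (0 - position a none)⁻¹ = 0 := by
    simp [position, ← coeff_zero_eq_eval_zero, polar_coeff_zero]
  rw [Finset.sum_erase (f := fun j => (polar a j).eval (0 - position a j)⁻¹) _ h4,
    Fintype.sum_option, h4, const, Fintype.sum_option,
    coeff_zero_eq_eval_zero, zero_add, order, add_sub_cancel_left, sub_eq_add_neg,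
    ← Finset.sum_neg_distrib]
  congr 1
  refine Finset.sum_congr rfl fun i _ => ?_
  rw [h3, ← h2, logPoly_eval (analyticAt_germ' t _)]
  congr 1
  have h5 : (fun u => Complex.log (1 - (0 - germ t (some (some i)) 0)⁻¹ *
      (germ t (some (some i)) u - germ t (some (some i)) 0))) =ᶠ[𝓝 0]
        fun u => series t (some (some i)) u - series t (some (some i)) 0 := by
    have h6 : Tendsto (fun u => (series t (some (some i)) u - series t (some (some i)) 0).im) (𝓝 0)
        (𝓝 0) := by
      have h7 : ContinuousAt
          (fun u => (series t (some (some i)) u - series t (some (some i)) 0).im) 0 :=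
        Complex.continuous_im.continuousAt.comp
          ((analyticAt_series t _ 0).continuousAt.sub continuousAt_const)
      simpa using h7.tendsto
    filter_upwards [h6.eventually (Ioo_mem_nhds (neg_lt_zero.2 Real.pi_pos) Real.pi_pos)] with u hu
    rw [← Complex.log_exp hu.1 hu.2.le, Complex.exp_sub]
    congr 1
    simp only [germ, base, one_mul]
    field_simp [Complex.exp_ne_zero]
    ring
  obtain ⟨r, hr⟩ : ∃ r, n i = r + 1 := ⟨n i - 1, by have := hn i; omega⟩
  rw [taylorCoeff_congr h5, order, hr, taylorCoeff_succ, taylorCoeff_succ, deriv_sub_const_fun]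

/-- The superpotential is recovered from its flat coordinates: the expansions of `log z` fix the
polar parts, and the last coordinate at `z = 0`, where one more order is known, fixes the constant
term. -/
theorem of_isFlatCoord (hn₀ : 0 < n₀) (hn₁ : 0 < n₁) (hn : ∀ i, 0 < n i)
    {a : TodaIdx n₀ n₁ n → ℂ} (ha : a ∈ (toda n₀ n₁ n).carrier) {t : TodaFlatIdx n₀ n₁ n → ℂ}
    (ht : todaIsFlatCoord n₀ n₁ n a t) : t ∈ germDomain germ ∧ coeffs t = a := by
  have hpf := isPartialFraction hn₀ hn₁ hn ha
  have h1 : ∀ i : Fin k, germ t (some (some i)) 0 = position a (some i) ∧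
      deriv (germ t (some (some i))) 0 ≠ 0 ∧
      polar a (some i) = logPoly (germ t (some (some i))) (n i) := fun i => by
    obtain ⟨u, φ, -, -, hr, hφ, hO⟩ := ht.2.2 i
    have h2 : germ t (some (some i)) = fun u => Complex.exp (series t (some (some i)) u) := by
      funext u
      simp [germ, base]
    rw [h2]
    refine (hpf.hasPole (some i)).of_expansion (polar_coeff_zero a _)
      (fun _ => analyticAt_cexp) (analyticAt_series t _ 0) hr hφ ?_
    simp only [series_some]
    exact hO
  -- the pole `z = 0`, with the value of the holomorphic part
  obtain ⟨u, g, -, -, hr, hg, hO⟩ := ht.2.1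
  have hp : HasPole (todaLam n₀ n₁ n a) 0 n₁ (polar a none) (fun z => (poly a).eval z +
    ∑ j ∈ Finset.univ.erase none, (polar a j).eval (z - position a j)⁻¹) := hpf.hasPole none
  simp only [← series_zero] at hO
  have h2 := hp.of_root_sharp hr (analyticAt_germ' t (some none))
    (analyticAt_series t (some none) 0) (Eventually.of_forall fun _ => rfl)
    (hp.isBigO_sub_mul (analyticAt_series t (some none) 0) analyticAt_cexp hr hg
      n₁.succ_ne_zero hO)
  have h3 := congrArg (fun P : ℂ[X] => P.coeff 0) h2
  have h4 := regular_part hn (fun i => (h1 i).1) fun i => (h1 i).2.2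
  simp only [coeff_add, coeff_C_zero, polar_coeff_zero, logPoly_coeff_zero, zero_add] at h3
  rw [h4] at h2 h3
  rw [h3, add_left_inj] at h2
  have h5 : (poly a).coeff 0 = const t := by
    linear_combination h3
  -- infinity
  obtain ⟨R, hR⟩ : ∃ R, HasPole (fun y => todaLam n₀ n₁ n a y⁻¹) 0 n₀
    (poly a - C ((poly a).coeff 0)) R := hpf.hasPole_infty'
  obtain ⟨u', g', hr', -, hg', hO'⟩ := (infty_expansion_iff _ t).1 ht.1
  have h6 := hR.isBigO_sub_mul (analyticAt_series t none 0) analyticAt_cexp hr' hg' hn₀.ne' hO'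
  obtain ⟨-, -, h7⟩ := hR.of_root (by simp) hr' (analyticAt_germ' t none)
    (by simp only [sub_zero]; exact h6)
  rw [sub_eq_iff_eq_add, h5] at h7
  have h8 : ∀ i, germ t (some i) 0 = position a i := by
    rintro (_ | i)
    · simp [germ, base, position]
    · exact (h1 i).1
  refine ⟨⟨by simpa only [h8] using hpf.inj, ?_⟩, coeffs_eq h7 h8 ?_⟩
  · rintro (_ | _ | i)
    · simp [deriv_germ_none]
    · simp [deriv_germ t (i := some none) rfl]
    · exact (h1 i).2.1
  · rintro (_ | i)
    · exact h2
    · exact (h1 i).2.2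

/-- A root `u` that agrees with the inverse of `Y = u exp T` to high order gives an expansion of the
logarithm. -/
theorem exp_expansion {T v q : ℂ → ℂ} (hT : AnalyticAt ℂ T 0)
    (hv : IsLocalInverse (fun u => u * Complex.exp (T u)) v 0) (hq : AnalyticAt ℂ q 0)
    (hq0 : q 0 = 0) {N : ℕ} (hqO : q =O[𝓝[≠] 0] fun y => y ^ N) :
    (∀ᶠ y in 𝓝[≠] 0, y = v y * Complex.exp (-q y) * Complex.exp (q y + T (v y))) ∧
      (fun y => q y + T (v y) - T (v y * Complex.exp (-q y))) =O[𝓝[≠] 0] fun y => y ^ N := by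
  constructor
  · filter_upwards [nhdsWithin_le_nhds hv.right] with y hy
    rw [mul_assoc, ← Complex.exp_add, neg_add_cancel_left, hy]
  · have h1 := (isBigO_root_of_inverse hv hq (by simpa using hqO) hq0 hT).trans
      (isBigO_sub_pow_of_le N.le_succ)
    simp only [sub_zero] at h1
    exact (hqO.add h1).congr_left fun y => by ring

/-- Every point of the domain of the germs consists of flat coordinates of a superpotential. -/
theorem isFlatCoord_coeffs (hn₀ : 0 < n₀) (hn₁ : 0 < n₁) (hn : ∀ i, 0 < n i)
    {t : TodaFlatIdx n₀ n₁ n → ℂ} (ht : t ∈ germDomain germ) :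
    coeffs t ∈ (toda n₀ n₁ n).carrier ∧ todaIsFlatCoord n₀ n₁ n (coeffs t) t := by
  have hpos : ∀ i, 0 < order n₀ n₁ n i := by rintro (_ | _ | i); exacts [hn₀, hn₁, hn i]
  have hc : coeffs t ∈ (toda n₀ n₁ n).carrier := by
    refine (mem_carrier_iff hn₁ hn).2 ⟨?_, fun i => ?_⟩
    · rw [show position (coeffs t) = fun i => germ t (some i) 0 from funext (position_coeffs t)]
      exact ht.1
    · rw [polar_coeffs, logPoly_coeff_self (analyticAt_germ' t _)]
      exact div_ne_zero (pow_ne_zero _ (ht.2 _)) (Nat.cast_ne_zero.2 (hpos _).ne')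
  have hpf := isPartialFraction hn₀ hn₁ hn hc
  refine ⟨hc, ?_, ?_, fun i => ?_⟩
  · obtain ⟨R, hR⟩ : ∃ R, HasPole (fun y => todaLam n₀ n₁ n (coeffs t) y⁻¹) 0 n₀
      (poly (coeffs t) - C ((poly (coeffs t)).coeff 0)) R := hpf.hasPole_infty'
    obtain ⟨v, q, hv, hq, hq0, hqO, hr⟩ := hR.exists_root (analyticAt_germ' t none) (ht.2 none)
      (by simp [germ, base]) (by simp [poly_coeffs hn₀, logPoly_coeff_zero])
    simp only [sub_zero] at hqO
    obtain ⟨h1, h2⟩ := exp_expansion (analyticAt_series t none 0) hv hq hq0 hqO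
    refine (infty_expansion_iff _ t).2 ⟨_, _, hr, ?_, h1, h2⟩
    have h3 := hv.tendsto_div.mul (tendsto_exp_neg hq hq0)
    rw [deriv_germ_none, inv_one, one_mul] at h3
    exact h3.congr fun y => by ring
  · have h0 := regular_part (t := t) hn (fun i => (position_coeffs t (some i)).symm)
      fun i => polar_coeffs t (some i)
    have hp : HasPole (todaLam n₀ n₁ n (coeffs t)) 0 n₁ (polar (coeffs t) none)
      (fun z => (poly (coeffs t)).eval z + ∑ j ∈ Finset.univ.erase none,
        (polar (coeffs t) j).eval (z - position (coeffs t) j)⁻¹) := hpf.hasPole none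
    obtain ⟨v, q, hv, hq, hq0, hqO, hr⟩ := hp.exists_root_sharp
      (analyticAt_germ' t (some none)) (ht.2 (some none)) (analyticAt_series t (some none) 0)
      (Eventually.of_forall fun _ => rfl) (by
        rw [h0, polar_coeffs, poly_coeffs hn₀]
        simp [logPoly_coeff_zero, order])
    obtain ⟨h1, h2⟩ := exp_expansion (analyticAt_series t (some none) 0) hv hq hq0 hqO
    simp only [series_zero t (_ * _)] at h2
    exact ⟨fun y => v y * Complex.exp (-q y), fun y => q y + series t (some none) (v y),
      hv.inv_analytic.mul hq.fun_neg.cexp, hq.add (AnalyticAt.comp (g := series t (some none))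
        (analyticAt_series t (some none) _) hv.inv_analytic), hr, h1, h2⟩
  · obtain ⟨u, v, hu, hr, hv, hO⟩ := (hpf.hasPole (some i)).exists_expansion
      (analyticAt_germ' t _) (ht.2 (some (some i))) rfl (polar_coeffs t (some i))
    refine ⟨u, fun y => series t (some (some i)) (v y), hu, AnalyticAt.comp
      (g := series t (some (some i))) (analyticAt_series t _ _) hv.inv_analytic, hr, ?_, ?_⟩
    · filter_upwards [nhdsWithin_le_nhds hv.right] with y hy
      simpa [germ, base] using hy
    · have h2 := hO _ (analyticAt_series t (some (some i)) 0)
      simp only [series_some t i (u _)] at h2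
      exact h2

/-- Every superpotential has flat coordinates, the coefficients of the expansions of a branch of
`log z` in powers of roots of `1 / (n λ)`. -/
theorem exists_isFlatCoord (hn₀ : 0 < n₀) (hn₁ : 0 < n₁) (hn : ∀ i, 0 < n i)
    {a : TodaIdx n₀ n₁ n → ℂ} (ha : a ∈ (toda n₀ n₁ n).carrier) :
    ∃ t, todaIsFlatCoord n₀ n₁ n a t := by
  have hpf := isPartialFraction hn₀ hn₁ hn ha
  -- a branch of `log z` at each finite pole other than `0`
  have h1 : ∀ i : Fin k, ∃ φ : ℂ → ℂ, AnalyticAt ℂ φ (position a (some i)) ∧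
      ∀ᶠ z in 𝓝[≠] (position a (some i)), Complex.exp (φ z) = z := fun i => by
    have hp : position a (some i) ≠ 0 := ha.2.1 i
    refine ⟨fun z => Complex.log (z / position a (some i)) + Complex.log (position a (some i)),
      ((analyticAt_id.div analyticAt_const hp).clog (by simp [div_self hp])).add analyticAt_const,
      ?_⟩
    filter_upwards [nhdsWithin_le_nhds (continuousAt_id.eventually_ne hp)] with z hz
    have hz : z ≠ 0 := hz
    rw [Complex.exp_add, Complex.exp_log (div_ne_zero hz hp), Complex.exp_log hp,
      div_mul_cancel₀ _ hp]
  choose φ hφ hφe using h1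
  choose u τ hu hr hO using fun i => (hpf.hasPole (some i)).exists_coeff (hφ i)
  obtain ⟨R, hR⟩ : ∃ R, HasPole (fun y => todaLam n₀ n₁ n a y⁻¹) 0 n₀
    (poly a - C ((poly a).coeff 0)) R := hpf.hasPole_infty'
  obtain ⟨x, Z, h, -, -, hxr, hZ, hh, hh0, hxh, -⟩ := hR.exists_uniformizer (c := 1) (by
    rw [coeff_sub, coeff_C_of_ne_zero hn₀.ne', poly, headPoly_coeff, if_pos rfl,
      dif_neg (by omega), add_zero, sub_zero, mul_inv_cancel₀ (Nat.cast_ne_zero.2 hn₀.ne'),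
      one_pow, one_mul])
  have hp : HasPole (todaLam n₀ n₁ n a) 0 n₁ (polar a none) _ := hpf.hasPole none
  obtain ⟨c, hc0, hc⟩ := hp.exists_scale
  obtain ⟨x', Z', h', hx', -, hxr', hZ', hh', -, hxh', -⟩ := hp.exists_uniformizer hc
  have hh'' : AnalyticAt ℂ (fun y => h' y - Complex.log c) 0 := hh'.sub analyticAt_const
  refine ⟨Sum.elim (fun j => taylorCoeff (j + 1) fun v => h (Z v)) (Sum.elim
    (fun j => taylorCoeff j fun v => h' (Z' v) - Complex.log c) fun s => τ s.1 s.2),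
    (infty_expansion_iff _ _).2 ⟨x, h, hxr, ?_, ?_, ?_⟩,
    ⟨x', _, hx', hh'', hxr', ?_, by simpa using hZ'.isBigO_sub_coeff hh'' (n₁ + 1)⟩,
    fun i => ⟨u i, φ i, hu i, hφ i, hr i, hφe i, hO i _⟩⟩
  · refine (tendsto_exp_neg hh hh0).congr' ?_
    filter_upwards [nhdsWithin_le_nhds hxh, self_mem_nhdsWithin] with y hy hy0
    have hy0 : y ≠ 0 := hy0
    rw [hy]
    field_simp
    simp
  · filter_upwards [nhdsWithin_le_nhds hxh] with y hy
    rw [hy, mul_assoc, ← Complex.exp_add, neg_add_cancel, Complex.exp_zero]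
    ring
  · refine (hZ.isBigO_sub_coeff hh n₀).congr (fun y => ?_) fun y => by simp
    obtain ⟨r, rfl⟩ : ∃ r, n₀ = r + 1 := ⟨n₀ - 1, by omega⟩
    rw [Fin.sum_univ_succ, series_infty, Fin.val_zero, taylorCoeff_zero, hZ.apply_zero, hh0,
      zero_mul, zero_add]
    rfl
  · filter_upwards [nhdsWithin_le_nhds hxh'] with y hy
    rw [hy, Complex.exp_sub, Complex.exp_log hc0, Complex.exp_neg]
    field_simp [Complex.exp_ne_zero]
    simp

end Toda

end

section

open Polynomial

namespace Toda

variable {n₀ n₁ k : ℕ} {n : Fin k → ℕ}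

/-! ### The space of trigonometric superpotentials -/
theorem analyticAt_coeffs (t : TodaFlatIdx n₀ n₁ n → ℂ) : AnalyticAt ℂ coeffs t := by
  have h1 : ∀ i m j, AnalyticAt ℂ (fun t : TodaFlatIdx n₀ n₁ n → ℂ =>
    (logPoly (germ t i) m).coeff j) t := fun i m j =>
      analyticAt_logPoly_coeff (F := fun t => germ t i) (analyticAt_germ t i) m j
  suffices h : ∀ κ, AnalyticAt ℂ (fun t => coeffs t κ) t from AnalyticAt.pi h
  intro κ
  rcases κ with j | j | ⟨i, j⟩
  · have h2 : AnalyticAt ℂ (fun t : TodaFlatIdx n₀ n₁ n → ℂ => if (j : ℕ) = 0 then const t else 0)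
        t := by
      split_ifs
      · exact (const_analytic_and_deriv t).1
      · exact analyticAt_const
    simpa only [coeffs, coeff_add, coeff_C] using (h1 none n₀ j).fun_add h2
  · exact h1 _ _ _
  · refine Fin.cases ?_ (fun j => h1 _ _ _) j
    exact AnalyticAt.comp (g := fun q : (TodaFlatIdx n₀ n₁ n → ℂ) × ℂ => germ q.1 (some (some i)) q.2)
      (f := fun t => (t, (0 : ℂ))) (analyticAt_germ t _) (analyticAt_id.prod analyticAt_const)

theorem isOpen_extDomain : IsOpen (toda n₀ n₁ n).extDomain := by
  refine isOpen_iff_eventually.2 fun q hq => ?_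
  have h0 : ∀ κ, Continuous fun q : (TodaIdx n₀ n₁ n → ℂ) × ℂ => q.1 κ := fun κ => by fun_prop
  obtain ⟨⟨h1, h2, h3, h4⟩, h5⟩ := hq
  have h6 : ∀ᶠ q' in 𝓝 q, ∀ j : Fin n₁, (j : ℕ) + 1 = n₁ → q'.1 (Sum.inr (Sum.inl j)) ≠ 0 := by
    simp only [eventually_all]
    exact fun j hj => (h0 _).continuousAt.eventually_ne (h3 j hj)
  have h7 : ∀ᶠ q' in 𝓝 q, ∀ i : Fin k,
      Complex.exp q'.2 - q'.1 (Sum.inr (Sum.inr ⟨i, 0⟩)) ≠ 0 := by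
    refine eventually_all.2 fun i => ((Complex.continuous_exp.comp continuous_snd).sub
      (h0 _)).continuousAt.eventually_ne (sub_ne_zero.2 fun h => h5 ?_)
    exact Finset.mem_insert_of_mem (Finset.mem_image.2 ⟨i, Finset.mem_univ _, h.symm⟩)
  filter_upwards [eventually_injective (f := fun (q' : (TodaIdx n₀ n₁ n → ℂ) × ℂ) (i : Fin k) =>
      q'.1 (Sum.inr (Sum.inr ⟨i, 0⟩))) (fun i => (h0 _).continuousAt) h1,
    eventually_all.2 fun i => (h0 _).continuousAt.eventually_ne (h2 i), h6,
    eventually_all.2 fun i => (h0 _).continuousAt.eventually_ne (h4 i), h7] with q' h1 h2 h3 h4 h5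
  refine ⟨⟨h1, h2, h3, h4⟩, fun h => ?_⟩
  rcases Finset.mem_insert.1 h with h | h
  · exact Complex.exp_ne_zero _ h
  · obtain ⟨i, -, hi⟩ := Finset.mem_image.1 h
    exact h5 i (sub_eq_zero.2 hi.symm)

theorem lam_analytic {a : TodaIdx n₀ n₁ n → ℂ} {z : ℂ} (hz : z ∉ (toda n₀ n₁ n).poles a) :
    AnalyticAt ℂ (fun q : (TodaIdx n₀ n₁ n → ℂ) × ℂ => todaLam n₀ n₁ n q.1 q.2) (a, z) := by
  have h0 : ∀ κ, AnalyticAt ℂ (fun q : (TodaIdx n₀ n₁ n → ℂ) × ℂ => q.1 κ) (a, z) := fun κ =>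
    ((ContinuousLinearMap.proj (R := ℂ) (φ := fun _ => ℂ) κ).comp
      (ContinuousLinearMap.fst ℂ (TodaIdx n₀ n₁ n → ℂ) ℂ)).analyticAt _
  refine ((((analyticAt_snd.pow _).div_const).add (Finset.analyticAt_fun_sum _ fun j _ =>
    (h0 _).mul (analyticAt_snd.pow _))).add (Finset.analyticAt_fun_sum _ fun j _ =>
      (h0 _).div (analyticAt_snd.pow _) (pow_ne_zero _ fun h => hz ?_))).add
        (Finset.analyticAt_fun_sum _ fun i _ => Finset.analyticAt_fun_sum _ fun j _ =>
          (h0 _).div ((analyticAt_snd.sub (h0 _)).pow _)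
            (pow_ne_zero _ (sub_ne_zero.2 fun h => hz ?_)))
  · exact Finset.mem_insert.2 (Or.inl h)
  · exact Finset.mem_insert_of_mem (Finset.mem_image.2 ⟨i, Finset.mem_univ _, h.symm⟩)

theorem ne_zero {t : TodaFlatIdx n₀ n₁ n → ℂ} {z : ℂ} (hz : z ∉ germPoles (germ t)) : z ≠ 0 := by
  have := notMem_germPoles.1 hz none
  rwa [germ, base.eq_def, zero_mul] at this

/-- The unit field `∂ / ∂ t_{1, n₁}`. -/
def unitField (n₀ n₁ : ℕ) {k : ℕ} (n : Fin k → ℕ) : TodaFlatIdx n₀ n₁ n → ℂ :=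
  Pi.single (Sum.inr (Sum.inl (Fin.last n₁))) 1

/-- The coordinate `t_{1, n₁}` is an additive constant of `λ`. -/
theorem unit_eq (t : TodaFlatIdx n₀ n₁ n → ℂ) {z : ℂ} (hz : z ∉ germPoles (germ t)) :
    z * flatCombo (germ t) (order n₀ n₁ n) pole expo (unitField n₀ n₁ n) z = 1 := by
  have hz0 := ne_zero hz
  have h1 : germ t (some none) 0 = 0 := by simp [germ, base]
  have h2 : AnalyticAt ℂ (poleKernel (germ t) (some none) z) 0 :=
    analyticAt_const.div (analyticAt_const.sub (analyticAt_germ' t (some none)))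
      (by rw [h1]; simpa using hz0)
  rw [flatCombo, unitField, Finset.sum_eq_single (Sum.inr (Sum.inl (Fin.last n₁)))]
  · simp only [Pi.single_eq_same, one_mul, poleCoeff, pole, expo, order, Fin.val_last]
    rw [taylorCoeff_pow_mul h2, if_pos le_rfl, Nat.sub_self, taylorCoeff_zero, poleKernel, h1]
    field_simp
    simp
  · intro α _ hα
    rw [Pi.single_eq_of_ne hα, zero_mul]
  · simp

theorem poleSystem (hn₀ : 0 < n₀) (hn₁ : 0 < n₁) (hn : ∀ i, 0 < n i) :
    PoleSystem (toda n₀ n₁ n) coeffs (germDomain germ) pole expo (order n₀ n₁ n) germ 0 1 const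
      (unitField n₀ n₁ n, 0) where
  isOpen := isOpen_germDomain analyticAt_germ
  analytic t _ := analyticAt_coeffs t
  of_flatCoord _ ha _ h := of_isFlatCoord hn₀ hn₁ hn ha h
  flatCoord _ ht := isFlatCoord_coeffs hn₀ hn₁ hn ht
  surj a ha := by
    obtain ⟨t, ht⟩ := exists_isFlatCoord hn₀ hn₁ hn ha
    exact ⟨t, of_isFlatCoord hn₀ hn₁ hn ha ht⟩
  card_eq := by
    simp
    omega
  isOpen_extDomain := isOpen_extDomain
  zOf_analytic _ := analyticAt_cexp
  zOf_deriv s := Complex.hasDerivAt_exp s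
  zOf_surj _ _ z hz := ⟨Complex.log z, Complex.exp_log fun h => hz (Finset.mem_insert.2 (Or.inl h))⟩
  lam_analytic _ _ _ hz := lam_analytic hz
  index := isFlatIndex hn₀
  rho_eq _ := by simp [toda]
  rho_ne _ _ _ hz := by simpa using ne_zero hz
  germs t ht :=
    { analytic := analyticAt_germ' t
      deriv_ne := ht.2
      infty := by simp [germ, base]
      inj := ht.1
      n_pos := by rintro (_ | _ | i); exacts [hn₀, hn₁, hn i] }
  poles_eq t _ := by
    ext z
    simp only [germPoles, ← position_coeffs]
    simp [toda, position, Option.exists, eq_comm]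
  germ_analytic t _ := analyticAt_germ t
  germ_deriv t _ i γ := Eventually.of_forall (germ_deriv t i γ)
  rho_analytic _ := analyticAt_id
  const_analytic t _ := (const_analytic_and_deriv t).1
  const_deriv t _ := (const_analytic_and_deriv t).2
  lam_eq t ht z hz := by
    have h1 := (isPartialFraction hn₀ hn₁ hn (isFlatCoord_coeffs hn₀ hn₁ hn ht).1).eq z fun i => by
      rw [position_coeffs]
      exact notMem_germPoles.1 hz i
    rw [poly_coeffs hn₀, eval_add, eval_C] at h1
    simp only [polar_coeffs, position_coeffs] at h1
    refine h1.trans ?_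
    rw [add_comm (eval z _), add_assoc]
    rfl
  unit_eq t _ z hz := by
    rw [zero_mul, add_zero, zero_add, one_mul]
    exact unit_eq t hz

end Toda

end

end

theorem mainTheorem7 :
    (∀ (n₀ m : ℕ) (n : Fin m → ℕ), 0 < n₀ → (∀ i, 0 < n i) →
      (cKP n₀ n).HasRankOneExtension) ∧
    (∀ (n₀ n₁ k : ℕ) (n : Fin k → ℕ), 0 < n₀ → 0 < n₁ → (∀ i, 0 < n i) →
      (toda n₀ n₁ n).HasRankOneExtension) :=
  ⟨fun _ _ _ hn₀ hn => (CKP.poleSystem hn₀ hn).flatData.hasRankOneExtension,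
    fun _ _ _ _ hn₀ hn₁ hn => (Toda.poleSystem hn₀ hn₁ hn).flatData.hasRankOneExtension⟩
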